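/- Let $B$ be a branched surface (compact, without boundary, locally modelled on two transverse branch arcs at a double point) with fibred regular neighbourhood $N(B)$, and let $\pi:N(B)\to B$ be the projection that collapses each interval fibre to a point. Let $\partial_vN(B)$ be the vertical boundary, and let the pared locus $p(B)\subset\partial_vN(B)$ be a family of core curves of $\partial_vN(B)$ transverse to the fibres. Fix a (two-dimensional) CW structure $\tau$ on $B$ whose 1-skeleton contains the branch locus. A *splitting surface* of $B$ is an injectively immersed surface $S\subset N(B)$, transverse to the interval fibres, with $\partial S=p(B)$, complete (in the path metric coming from $B$ by the transverse projection $\pi$; equivalently, a path $[0,1)\to S$ whose projection to $B$ converges in $B$ at $1$ converges in $S$), meeting each fibre in a discrete set, and having an open neighbourhood $\mathcal N(S)$ in $N(B)$ which fibres over $S$ with fibres open subintervals of the fibres of $N(B)$, such that $\mathcal N(S)\cap\partial_vN(B)=\mathrm{int}(\partial_vN(B))$ and the endpoints of the fibres of $\mathcal N(S)$ trace out surfaces transverse to the fibres of $N(B)$. A *splitting complex* of $B$ is a finite complex $c$ embedded in $N(B)$, each of whose open cells is mapped by $\pi$ homeomorphically onto an open cell of $\tau$, which is locally contained in a surface transverse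 to the fibres (with boundary, if any, on $p(B)$), such that $\partial c\cap\partial_vN(B)=p(B)$ and $p(B)\subset\overline{\mathrm{int}(c)}$. Here $\mathrm{int}(c)$ is the set of points near which $c$ contains an open surface transverse to the fibres, and $\partial c=c-\mathrm{int}(c)$. Put $B_0(p(B),c)=p(B)$, let $B_{k+1}(p(B),c)$ be obtained from $B_k(p(B),c)$ by adjoining all closed cells of $c$ that meet it, and let the radius of $c$ be $R(c)=\sup\{k : B_k(p(B),c)\cap\partial c=p(B)\}\in\mathbb N\cup\{\infty\}$. **Theorem.** There is a sequence of splitting complexes $c_k$ of $B$ with $R(c_k)\to\infty$ as $k\to\infty$ if and only if there is a splitting surface $S$ of $B$. -/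

import Mathlib

open Set Filter Topology

namespace BranchedSurface

/-- The standard fibred block, in coordinates `((x, y), z)`: the slab `|z| ≤ 3` slit open along
`{x > 0, 1 < z < 2}` and `{y > 0, -2 < z < -1}`. Its vertical fibres are intervals; collapsing them
gives the local model of a branched surface at a double point of the branch locus, and over open
subsets of it the models at a simple branch point and at a smooth point. -/
def modelN : Set ((ℝ × ℝ) × ℝ) :=
  {t | |t.2| ≤ 3 ∧ ¬ (0 < t.1.1 ∧ 1 < t.2 ∧ t.2 < 2) ∧ ¬ (0 < t.1.2 ∧ -2 < t.2 ∧ t.2 < -1)}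

/-- Two points of the block lie on the same interval fibre. -/
def SameModelFiber (t u : (ℝ × ℝ) × ℝ) : Prop :=
  t.1 = u.1 ∧ ∀ z ∈ uIcc t.2 u.2, (t.1, z) ∈ modelN

/-- The vertical boundary of the block. -/
def modelVert : Set ((ℝ × ℝ) × ℝ) :=
  {t | (t.1.1 = 0 ∧ 1 ≤ t.2 ∧ t.2 ≤ 2) ∨ (t.1.2 = 0 ∧ -2 ≤ t.2 ∧ t.2 ≤ -1)}

/-- The interior (as a surface) of the vertical boundary of the block. -/
def modelVertInt : Set ((ℝ × ℝ) × ℝ) :=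
  {t | (t.1.1 = 0 ∧ 1 < t.2 ∧ t.2 < 2) ∨ (t.1.2 = 0 ∧ -2 < t.2 ∧ t.2 < -1)}

/-- The cores of the vertical boundary of the block. -/
def modelCore : Set ((ℝ × ℝ) × ℝ) :=
  {t | (t.1.1 = 0 ∧ t.2 = 3 / 2) ∨ (t.1.2 = 0 ∧ t.2 = -3 / 2)}

variable {N B : Type*} [TopologicalSpace N] [TopologicalSpace B]

/-- A flow box: a homeomorphism from an open union of whole fibres of `π : N → B` onto an open
union of whole fibres of the standard block, matching fibres, the vertical boundary `V` and its
core curves `P`. -/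
structure IsFlowBoxFor (π : N → B) (V P : Set N) (φ : OpenPartialHomeomorph N modelN) :
    Prop where
  source_saturated : ∀ m ∈ φ.source, ∀ n, π n = π m → n ∈ φ.source
  target_saturated : ∀ t ∈ φ.target, ∀ u : modelN, SameModelFiber t u → u ∈ φ.target
  fiber_iff : ∀ m ∈ φ.source, ∀ n ∈ φ.source, π m = π n ↔ SameModelFiber (φ m) (φ n)
  vert_iff : ∀ n ∈ φ.source, n ∈ V ↔ (φ n : (ℝ × ℝ) × ℝ) ∈ modelVert
  core_iff : ∀ n ∈ φ.source, n ∈ P ↔ (φ n : (ℝ × ℝ) × ℝ) ∈ modelCore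

variable (N B) in
/-- A branched surface `B` together with its fibred regular neighbourhood `N = N(B)`: the
projection `π : N → B` collapsing each interval fibre to a point, the vertical boundary `∂ᵥN`, and
the pared locus `p(B)`, a collection of cores of `∂ᵥN`. Everything is locally standard.
(Used with `N` compact and `N`, `B` Hausdorff, so that `B` is the quotient of `N` by its fibres.) -/
structure FibredNbhd where
  /-- the projection collapsing the fibres -/
  π : N → B
  /-- the vertical boundary -/
  vert : Set N
  /-- the pared locus -/
  core : Set N
  continuous_π : Continuous π
  surjective_π : Function.Surjective π
  exists_flowBox : ∀ n, ∃ φ, IsFlowBoxFor π vert core φ ∧ n ∈ φ.source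

namespace FibredNbhd

variable (F : FibredNbhd N B)

/-- Flow boxes of the fibration `π : N(B) → B`. -/
def IsFlowBox (φ : OpenPartialHomeomorph N modelN) : Prop :=
  IsFlowBoxFor F.π F.vert F.core φ

/-- The interior of the surface `∂ᵥN`. -/
def vertInterior : Set N :=
  {n | ∃ φ, F.IsFlowBox φ ∧ n ∈ φ.source ∧ (φ n : (ℝ × ℝ) × ℝ) ∈ modelVertInt}

/-- In the flow box `φ`, the set `D` is the graph of the continuous function `g` over `E`. -/
def IsGraph (φ : OpenPartialHomeomorph N modelN) (E : Set (ℝ × ℝ)) (g : ℝ × ℝ → ℝ)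
    (D : Set N) : Prop :=
  ContinuousOn g E ∧ (∀ q ∈ E, ∃ h : (q, g q) ∈ modelN, (⟨(q, g q), h⟩ : modelN) ∈ φ.target) ∧
    D = {n | n ∈ φ.source ∧ (φ n).1.1 ∈ E ∧ (φ n).1.2 = g (φ n).1.1}

/-- A small open surface in `N(B)` transverse to the fibres. -/
def IsPlaque (D : Set N) : Prop :=
  ∃ φ, F.IsFlowBox φ ∧ ∃ (R : Set (ℝ × ℝ)) (g : ℝ × ℝ → ℝ), IsOpen R ∧ IsGraph φ R g D

/-- A small surface with boundary in `N(B)`, transverse to the fibres, whose boundary is on the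
pared locus. (The two slits of the block are exchanged by the symmetry
`((x, y), z) ↦ ((y, x), -z)`, so it suffices to use the first one.) -/
def IsHalfPlaque (D : Set N) : Prop :=
  ∃ φ, F.IsFlowBox φ ∧ ∃ (R : Set (ℝ × ℝ)) (g : ℝ × ℝ → ℝ), IsOpen R ∧
    IsGraph φ (R ∩ {q | q.1 ≤ 0}) g D ∧ ∀ q ∈ R, q.1 = 0 → g q = 3 / 2

/-! ### Splitting surfaces -/

/-- For a neighbourhood `W` of `S`, the fibre of `W` through `s`: the component of `s` in the
intersection of `W` with the interval fibre of `N(B)` through `s`. -/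
def nbhdFiber (W : Set N) (s : N) : Set N :=
  connectedComponentIn (W ∩ F.π ⁻¹' {F.π s}) s

/-- `W` is a regular open neighbourhood of `S` in `N(B)` which fibres over `S`, with fibres open
subintervals of the fibres of `N(B)`, which meets `∂ᵥN` exactly in its interior, and whose boundary
(the endpoints of its fibres) is a surface transverse to the fibres of `N(B)`: in flow boxes the
two endpoints of the fibre through `s` depend continuously on `s`. -/
structure IsFibredNbhdOf (W S : Set N) : Prop where
  isOpen : IsOpen W
  subset : S ⊆ W
  inter_vert : W ∩ F.vert = F.vertInterior
  fibres : ∀ w ∈ W, ∃! s, s ∈ S ∧ w ∈ F.nbhdFiber W s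
  boundary : ∀ s ∈ S, ∃ φ, F.IsFlowBox φ ∧ s ∈ φ.source ∧ ∃ V ∈ 𝓝 s, V ⊆ φ.source ∧
    ∃ a b : N → ℝ, ContinuousOn a (S ∩ V) ∧ ContinuousOn b (S ∩ V) ∧
      ∀ n ∈ S ∩ V, a n < b n ∧
        (fun m => (φ m : (ℝ × ℝ) × ℝ)) '' F.nbhdFiber W n =
          {(φ n).1.1} ×ˢ Ioo (a n) (b n)

/-- A splitting surface. The surface is a possibly non-closed, possibly non-compact subset of
`N(B)`; since it has a neighbourhood fibring over it, its surface topology is the subspace topology.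
Completeness refers to the path metric that `S` inherits, by transversality, from the compact space
`B`, and is expressed without a choice of metric: a path in `S` whose projection to `B` converges
must converge in `S`. -/
structure IsSplittingSurface (S : Set N) : Prop where
  core_subset : F.core ⊆ S
  /-- away from `p(B)`, a surface transverse to the fibres -/
  plaque : ∀ s ∈ S, s ∉ F.core → ∃ D, F.IsPlaque D ∧ s ∈ D ∧ D ⊆ S ∧ ∃ V ∈ 𝓝 s, S ∩ V ⊆ D
  /-- near `p(B)`, a transverse surface with boundary `p(B)` -/
  halfPlaque : ∀ s ∈ F.core, ∃ D, F.IsHalfPlaque D ∧ s ∈ D ∧ D ⊆ S ∧ ∃ V ∈ 𝓝 s, S ∩ V ⊆ D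
  complete : ∀ γ : ℝ → N, ContinuousOn γ (Ico 0 1) → MapsTo γ (Ico 0 1) S →
    (∃ x, Tendsto (fun t => F.π (γ t)) (𝓝[<] 1) (𝓝 x)) → ∃ s ∈ S, Tendsto γ (𝓝[<] 1) (𝓝 s)
  discrete : ∀ x : B, DiscreteTopology ↥(S ∩ F.π ⁻¹' {x})
  exists_nbhd : ∃ W, F.IsFibredNbhdOf W S

/-! ### Splitting complexes -/

/-- The points near which `c` is a surface transverse to the fibres. -/
def surfaceInterior (c : Set N) : Set N :=
  {s | ∃ D, F.IsPlaque D ∧ s ∈ D ∧ D ⊆ c}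

/-- `∂c = c - int(c)`. -/
def bdry (c : Set N) : Set N := c \ F.surfaceInterior c

/-- The cell structure `τ` of the branched surface `B` is two-dimensional, with the branch locus
`π(∂ᵥN)` in its 1-skeleton. -/
structure IsAdapted [CWComplex (univ : Set B)] : Prop where
  dim_le : ∀ n, 2 < n → IsEmpty (RelCWComplex.cell (univ : Set B) n)
  locus : ∀ v ∈ F.vert, ∃ n ≤ 1, ∃ i : RelCWComplex.cell (univ : Set B) n,
    F.π v ∈ RelCWComplex.openCell n i

/-- `K` is an (open) cell of the cell structure `τ_c` induced on `c` by pulling back the cell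
structure of `B`: a lift to `c` of an open cell of `B` by a continuous section of `π`. -/
def IsCellOf [CWComplex (univ : Set B)] (c K : Set N) : Prop :=
  ∃ (n : ℕ) (i : RelCWComplex.cell (univ : Set B) n) (σ : B → N),
    ContinuousOn σ (RelCWComplex.openCell n i) ∧
    (∀ x ∈ RelCWComplex.openCell n i, F.π (σ x) = x ∧ σ x ∈ c) ∧
    K = σ '' RelCWComplex.openCell n i

/-- A splitting complex: a (finite) complex embedded in `N(B)`, with cells transverse to the fibres
and pulled back from the cells of `B`, locally contained in a surface transverse to the fibres, with
`∂c ∩ ∂ᵥN = p(B)`, and such that the surface `int(c)` abuts on `p(B)`. -/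
structure IsSplittingComplex [CWComplex (univ : Set B)] (c : Set N) : Prop where
  isCompact : IsCompact c
  cells : ∀ s ∈ c, ∃ K, F.IsCellOf c K ∧ s ∈ K
  locally_in_surface : ∀ s ∈ c, ∃ D, (F.IsPlaque D ∨ F.IsHalfPlaque D) ∧ s ∈ D ∧
    ∃ V ∈ 𝓝 s, c ∩ V ⊆ D
  bdry_inter_vert : F.bdry c ∩ F.vert = F.core
  core_subset : F.core ⊆ closure (F.surfaceInterior c)

/-- `B₁(b, c)`: adjoin to `b` all closed cells of `c` incident with `b`. -/
def adjoin [CWComplex (univ : Set B)] (b c : Set N) : Set N :=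
  b ∪ ⋃ (K) (_ : F.IsCellOf c K) (_ : (closure K ∩ b).Nonempty), closure K

/-- `B_k(p(B), c)`: the combinatorial ball of radius `k` about `p(B)` in `c`. -/
def ball [CWComplex (univ : Set B)] (c : Set N) : ℕ → Set N
  | 0 => F.core
  | k + 1 => F.adjoin (ball c k) c

/-- The radius `R(c) = max {k | B_k(p(B), c) ∩ ∂c = p(B)}`, equal to `∞` if every `k` qualifies. -/
noncomputable def radius [CWComplex (univ : Set B)] (c : Set N) : ℕ∞ :=
  ⨆ (k : ℕ) (_ : F.ball c k ∩ F.bdry c = F.core), (k : ℕ∞)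

end FibredNbhd

end BranchedSurface

set_option linter.unusedSectionVars false
open Set Filter Topology Metric

/-! From a surface to complexes. A splitting surface `S` is locally a section of `π` (`LocInj`) and
locally meets every nearby fibre (`FullAt`), so over a closed cell of `B` it behaves like a
covering, and completeness supplies the missing end points of lifted paths. Fibres jump when the
frontier of a cell is reached, so the covering argument is run over `limFib`, the closure of the
fibration over the open cell; the result is `exists_lift_of_complete`: a closed cell lifts into `S`
through every point of `S` in its limit fibres. Only finitely many such lifts meet a compact set
(`finite_lifts`). The iterated stars of the pared locus in `S` are therefore compact, and after
adjoining incident edges they are splitting complexes whose radius tends to infinity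
(`exists_splittingComplexes`).

From complexes to a surface. The positions of the complexes `c k` in `N` need not converge to
anything useful, since sheets may collapse onto each other; only their combinatorics passes to the
limit. Fix a free ultrafilter on the indices and let `leaf c x` be the set of germs of sequences of
points of `c k` over `x` which stay in combinatorial balls of bounded radius. Large radius means
that `c k` is full at such points (`fullAt_core` treats the pared locus), so cells lift through them
and germs can be continued. Around each fibre there is a `Chart` whose size does not depend on the
complex (`exists_coherent`). In it each germ lies on exactly one sheet, named by a germ over the
centre, and sheets never cross (`Chart.z_lt`). Two cells that meet near a given place must meet at
that place, so finitely many places control all incidences (`exists_finite_pairs`); hence only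
finitely many germs of cells occur at each combinatorial distance, and leaves are countable. The
outcome is a `Leaves` structure: countable ordered sets over the points of `B`, with locally
constant transition maps and with the germs of the pared locus marked (`exists_leaves`).

It remains to realise this structure. In each chart the sheets receive disjoint intervals in the
right order, which is possible because they are countably many (`exists_placement`). The choices in
different charts are averaged with a partition of unity: `E` is the averaged signed distance to the
middle of a germ, and `η` its averaged half width. Order and disjointness are linear inequalities
and survive averaging (`E_sep`). The surface `surf` is given by `E = 0` and its neighbourhood `nbd`
by `|E| < η`. A germ of the pared locus is alone in its slit and is given all of it, so `nbd` meets
the vertical boundary exactly in the interior (`nbd_inter_vert`). A path in `surf` whose projection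
converges is eventually on one sheet, and the domain of a sheet is relatively closed in the chart;
this gives completeness (`surf_complete`). -/

namespace BranchedSurface

/-! ### Cells of a finite CW complex -/

section Cells

variable (B : Type*) [TopologicalSpace B] [CWComplex (univ : Set B)]

/-- The cells, of all dimensions, of a CW structure on `B`. -/
abbrev BCell := Σ n, RelCWComplex.cell (univ : Set B) n

variable {B}

/-- The parameter space of a cell. -/
abbrev BCell.Par (e : BCell B) := Fin e.1 → ℝ

/-- The closed parameter cube of a cell. -/
abbrev BCell.cube (e : BCell B) : Set e.Par := closedBall 0 1

/-- The open parameter cube of a cell. -/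
abbrev BCell.int (e : BCell B) : Set e.Par := Metric.ball 0 1

/-- The characteristic map of a cell. -/
def BCell.chr (e : BCell B) : e.Par → B := RelCWComplex.map e.1 e.2

/-- The open cell. -/
def BCell.op (e : BCell B) : Set B := RelCWComplex.openCell e.1 e.2

/-- The inverse of the characteristic map on the open cell. -/
def BCell.inv (e : BCell B) : B → e.Par := (RelCWComplex.map e.1 e.2).symm

lemma BCell.continuousOn_chr (e : BCell B) : ContinuousOn e.chr e.cube :=
  RelCWComplex.continuousOn e.1 e.2

lemma BCell.op_eq (e : BCell B) : e.op = e.chr '' e.int := rfl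

lemma BCell.chr_mem_op (e : BCell B) {v : e.Par} (hv : v ∈ e.int) : e.chr v ∈ e.op :=
  mem_image_of_mem _ hv

lemma BCell.inv_chr (e : BCell B) {v : e.Par} (hv : v ∈ e.int) : e.inv (e.chr v) = v :=
  (RelCWComplex.map e.1 e.2).left_inv (by rw [RelCWComplex.source_eq]; exact hv)

lemma BCell.op_eq_target (e : BCell B) : e.op = (RelCWComplex.map e.1 e.2).target := by
  rw [e.op_eq, ← (RelCWComplex.map e.1 e.2).image_source_eq_target, RelCWComplex.source_eq]; rfl

lemma BCell.inv_mem (e : BCell B) {x : B} (hx : x ∈ e.op) : e.inv x ∈ e.int := by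
  obtain ⟨v, hv, rfl⟩ := hx
  have := e.inv_chr hv
  rw [BCell.chr] at this
  rwa [this]

lemma BCell.chr_inv (e : BCell B) {x : B} (hx : x ∈ e.op) : e.chr (e.inv x) = x := by
  rw [e.op_eq_target] at hx
  exact (RelCWComplex.map e.1 e.2).right_inv hx

lemma BCell.continuousOn_inv (e : BCell B) : ContinuousOn e.inv e.op := by
  rw [e.op_eq_target]; exact RelCWComplex.continuousOn_symm e.1 e.2

lemma BCell.injOn_chr (e : BCell B) : InjOn e.chr e.int := fun v hv w hw h => by
  rw [← e.inv_chr hv, h, e.inv_chr hw]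

lemma BCell.exists_mem_op (x : B) : ∃ e : BCell B, x ∈ e.op := by
  have := (CWComplex.iUnion_openCell_eq_complex (C := (univ : Set B)))
  have hx : x ∈ (univ : Set B) := mem_univ x
  rw [← this] at hx
  simp only [mem_iUnion] at hx
  obtain ⟨n, j, h⟩ := hx
  exact ⟨⟨n, j⟩, h⟩

lemma BCell.eq_of_mem_op {e e' : BCell B} {x : B} (h : x ∈ e.op) (h' : x ∈ e'.op) : e = e' :=
  RelCWComplex.eq_of_not_disjoint_openCell (not_disjoint_iff.2 ⟨x, h, h'⟩)

/-- The points in cells of dimension less than `n`. -/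
def skel (B : Type*) [TopologicalSpace B] [CWComplex (univ : Set B)] (n : ℕ) : Set B :=
  {x | ∃ e : BCell B, e.1 < n ∧ x ∈ e.op}

lemma skel_mono {m n : ℕ} (h : m ≤ n) : skel B m ⊆ skel B n := fun _ ⟨e, he, hx⟩ =>
  ⟨e, he.trans_le h, hx⟩

lemma BCell.not_mem_op_of_mem_skel {e : BCell B} {x : B} (h : x ∈ skel B e.1) : x ∉ e.op := by
  rintro hx
  obtain ⟨e', he', hx'⟩ := h
  rw [BCell.eq_of_mem_op hx hx'] at he'
  exact lt_irrefl _ he'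

lemma BCell.mem_ball_or_sphere {e : BCell B} {v : e.Par} (hv : v ∈ e.cube) :
    v ∈ e.int ∨ v ∈ sphere (0 : e.Par) 1 := by
  simp only [mem_closedBall, mem_ball, mem_sphere] at *; exact hv.lt_or_eq

variable [T2Space B]

lemma skel_eq (n : ℕ) : skel B n = (CWComplex.skeletonLT (univ : Set B) (n : ℕ∞) : Set B) := by
  rw [← CWComplex.iUnion_openCell_eq_skeletonLT]
  ext x
  simp only [skel, mem_ofPred_eq, mem_iUnion]
  constructor
  · rintro ⟨⟨m, j⟩, hm, hx⟩; exact ⟨m, by exact_mod_cast hm, j, hx⟩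
  · rintro ⟨m, hm, j, hx⟩; exact ⟨⟨m, j⟩, by exact_mod_cast hm, hx⟩

lemma BCell.chr_sphere (e : BCell B) {v : e.Par} (hv : v ∈ sphere (0 : e.Par) 1) :
    e.chr v ∈ skel B e.1 := by
  rw [skel_eq]
  exact RelCWComplex.cellFrontier_subset_skeletonLT e.1 e.2 (mem_image_of_mem _ hv)

lemma BCell.mem_ball_of_chr_mem_op {e : BCell B} {v : e.Par} (hv : v ∈ e.cube)
    (h : e.chr v ∈ e.op) : v ∈ e.int :=
  (BCell.mem_ball_or_sphere hv).resolve_right fun hs =>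
    BCell.not_mem_op_of_mem_skel (e.chr_sphere hs) h

lemma isClosed_skel (n : ℕ) : IsClosed (skel B n) := by
  rw [skel_eq]; exact (CWComplex.skeletonLT (univ : Set B) (n : ℕ∞)).closed

/-- The frontier of a cell lies in finitely many open cells, so a closed cell contains only finitely
many centres of cells. Hence every set of centres is closed, the centres form a closed discrete set,
and compactness makes it finite. -/
lemma BCell.finite [CompactSpace B] : Finite (BCell B) := by
  classical
  let f : BCell B → B := fun e => e.chr 0
  have hf0 : ∀ e, f e ∈ e.op := fun e => e.chr_mem_op (mem_ball_self one_pos)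
  have hf : Function.Injective f := fun e e' h => BCell.eq_of_mem_op (hf0 e) (h ▸ hf0 e')
  have key : ∀ A : Set B, A ⊆ range f → IsClosed A := by
    intro A hA
    refine CWComplex.closed (univ : Set B) A (subset_univ _) |>.2 fun n j => ?_
    apply Set.Finite.isClosed
    obtain ⟨I, hI⟩ := CWComplex.cellFrontier_subset_finite_openCell (C := (univ : Set B)) n j
    have : A ∩ RelCWComplex.closedCell n j ⊆
        insert (f ⟨n, j⟩) (⋃ m ∈ Finset.range n, ⋃ k ∈ I m, {f ⟨m, k⟩}) := by
      rintro x ⟨hxA, hx⟩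
      obtain ⟨e, rfl⟩ := hA hxA
      rw [← RelCWComplex.cellFrontier_union_openCell_eq_closedCell] at hx
      rcases hx with hx | hx
      · right
        have := hI hx
        simp only [mem_iUnion] at this ⊢
        obtain ⟨m, hm, k, hk, h⟩ := this
        have : e = ⟨m, k⟩ := BCell.eq_of_mem_op (hf0 e) h
        exact ⟨m, Finset.mem_range.2 hm, k, hk, by rw [this]; rfl⟩
      · left
        have : e = ⟨n, j⟩ := BCell.eq_of_mem_op (hf0 e) hx
        rw [this]
    refine Set.Finite.subset ?_ this
    refine Set.Finite.insert _ ?_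
    exact (Finset.finite_toSet _).biUnion fun m _ =>
      (Finset.finite_toSet _).biUnion fun k _ => finite_singleton _
  have hd : IsClosed (range f) := key _ subset_rfl
  have : DiscreteTopology (range f) := by
    rw [discreteTopology_iff_forall_isClosed]
    intro s
    have := key (Subtype.val '' s) (by rintro _ ⟨x, -, rfl⟩; exact x.2)
    rw [← preimage_image_eq s Subtype.val_injective]
    exact this.preimage continuous_subtype_val
  have : CompactSpace (range f) := isCompact_iff_compactSpace.1 hd.isCompact
  have : Finite (range f) := finite_of_compact_of_discrete
  exact Finite.of_injective _ (fun e e' h => hf (by simpa [Subtype.ext_iff] using h) :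
    Function.Injective (fun e => (⟨f e, mem_range_self e⟩ : range f)))

end Cells

/-! ### Unique lifting into locally injective sets, and lifts of closed cells -/

namespace FibredNbhd

variable {N B : Type*} [TopologicalSpace N] [TopologicalSpace B] (F : FibredNbhd N B)

/-- The projection is locally injective on `c`. -/
def LocInj (c : Set N) : Prop := ∀ s ∈ c, ∃ V ∈ 𝓝 s, InjOn F.π (c ∩ V)

/-- Near `p`, the set `c` meets all fibres in points depending continuously on the fibre. -/
def FullAt (c : Set N) (p : N) : Prop :=
  ∃ V ∈ 𝓝 p, ∃ r : N → N, ContinuousOn r V ∧ r p = p ∧ ∀ m ∈ V, r m ∈ c ∧ F.π (r m) = F.π m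

variable {F}

lemma FullAt.mono {c c' : Set N} {p : N} (h : F.FullAt c p) (hc : c ⊆ c') : F.FullAt c' p := by
  obtain ⟨V, hV, r, h1, hr, h⟩ := h
  exact ⟨V, hV, r, h1, hr, fun m hm => ⟨hc (h m hm).1, (h m hm).2⟩⟩

/-- Uniqueness of lifts to a locally injective set. -/
lemma LocInj.eqOn [T2Space N] {c : Set N} (hc : F.LocInj c) {A : Type*} [TopologicalSpace A]
    {s : Set A} (hs : IsPreconnected s) {f g : A → N} (hf : ContinuousOn f s)
    (hg : ContinuousOn g s) (hfc : MapsTo f s c) (hgc : MapsTo g s c)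
    (h : ∀ a ∈ s, F.π (f a) = F.π (g a)) {a : A} (ha : a ∈ s) (hfg : f a = g a) : EqOn f g s := by
  have : PreconnectedSpace s := isPreconnected_iff_preconnectedSpace.1 hs
  let p : c → B := fun m => F.π m
  have sep : IsSeparatedMap p := T2Space.isSeparatedMap _
  have inj : IsLocallyInjective p := by
    rw [isLocallyInjective_iff_nhds]
    rintro ⟨m, hm⟩
    obtain ⟨V, hV, h⟩ := hc m hm
    refine ⟨Subtype.val ⁻¹' V, continuous_subtype_val.continuousAt.preimage_mem_nhds hV, ?_⟩
    rintro ⟨a, ha⟩ ha' ⟨b, hb⟩ hb' hab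
    exact Subtype.ext (h ⟨ha, ha'⟩ ⟨hb, hb'⟩ hab)
  have := sep.eq_of_comp_eq inj (g₁ := fun t : s => (⟨f t, hfc t.2⟩ : c))
    (g₂ := fun t : s => (⟨g t, hgc t.2⟩ : c))
    ((continuousOn_iff_continuous_domRestrict.1 hf).subtype_mk _)
    ((continuousOn_iff_continuous_domRestrict.1 hg).subtype_mk _)
    (funext fun t => h t t.2) ⟨a, ha⟩ (Subtype.ext hfg)
  intro t ht
  exact congrArg Subtype.val (congrFun this ⟨t, ht⟩)

variable (F)

lemma compactSpace_base (F : FibredNbhd N B) [CompactSpace N] : CompactSpace B :=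
  ⟨by rw [← F.surjective_π.range_eq]; exact isCompact_range F.continuous_π⟩

lemma isQuotientMap_π [CompactSpace N] [T2Space B] : IsQuotientMap F.π :=
  F.continuous_π.isClosedMap.isQuotientMap F.continuous_π F.surjective_π

variable [CWComplex (univ : Set B)]

/-- A lift to `c` of the characteristic map of a closed cell of `B`. -/
structure IsLift (c : Set N) (e : BCell B) (l : e.Par → N) : Prop where
  continuousOn : ContinuousOn l e.cube
  mem : ∀ v ∈ e.cube, l v ∈ c
  π_eq : ∀ v ∈ e.cube, F.π (l v) = e.chr v

variable {F}

lemma IsLift.eqOn [T2Space N] {c : Set N} (hc : F.LocInj c) {e : BCell B} {l l' : e.Par → N}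
    (hl : F.IsLift c e l) (hl' : F.IsLift c e l') {v : e.Par} (hv : v ∈ e.cube)
    (h : l v = l' v) : EqOn l l' e.cube :=
  hc.eqOn (convex_closedBall _ _).isPreconnected hl.continuousOn hl'.continuousOn hl.mem hl'.mem
    (fun a ha => by rw [hl.π_eq a ha, hl'.π_eq a ha]) hv h

/-- The open cell covered by a lift is a cell of `c`. -/
lemma IsLift.isCellOf {c : Set N} {e : BCell B} {l : e.Par → N}
    (hl : F.IsLift c e l) : F.IsCellOf c (l '' e.int) := by
  refine ⟨e.1, e.2, fun x => l (e.inv x), ?_, ?_, ?_⟩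
  · exact (hl.continuousOn.mono ball_subset_closedBall).comp e.continuousOn_inv
      fun x hx => e.inv_mem hx
  · intro x hx
    have := ball_subset_closedBall (e.inv_mem hx)
    exact ⟨by rw [hl.π_eq _ this]; exact e.chr_inv hx, hl.mem _ this⟩
  · ext m
    constructor
    · rintro ⟨v, hv, rfl⟩
      exact ⟨e.chr v, e.chr_mem_op hv, by simp only [e.inv_chr hv]⟩
    · rintro ⟨x, hx, rfl⟩
      exact ⟨_, e.inv_mem hx, rfl⟩

lemma IsLift.closure_image [T2Space N] {c : Set N} {e : BCell B} {l : e.Par → N}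
    (hl : F.IsLift c e l) : closure (l '' e.int) = l '' e.cube := by
  apply Subset.antisymm
  · exact closure_minimal (image_mono ball_subset_closedBall)
      ((isCompact_closedBall _ _).image_of_continuousOn hl.continuousOn).isClosed
  · rintro _ ⟨v, hv, rfl⟩
    have hv' : v ∈ closure e.int := by rwa [closure_ball _ one_ne_zero]
    exact (hl.continuousOn v hv).mono ball_subset_closedBall |>.mem_closure_image hv'

end FibredNbhd
end BranchedSurface

namespace BranchedSurface

/-! ### Fibres of the standard block -/

lemma mem_modelN {q : ℝ × ℝ} {z : ℝ} : (q, z) ∈ modelN ↔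
    |z| ≤ 3 ∧ ¬ (0 < q.1 ∧ 1 < z ∧ z < 2) ∧ ¬ (0 < q.2 ∧ -2 < z ∧ z < -1) := Iff.rfl

/-- The open slits have height exactly 1, so two points of the block over the same base point at
distance less than 1 cannot be on different sides of a slit. This makes fibres recognisable from
heights. -/
lemma sameModelFiber_of_near {q : ℝ × ℝ} {z z' : ℝ} (h : (q, z) ∈ modelN) (h' : (q, z') ∈ modelN)
    (hz : |z - z'| < 1) : SameModelFiber (q, z) (q, z') := by
  refine ⟨rfl, fun w hw => ?_⟩
  rw [mem_modelN] at h h' ⊢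
  simp only at hw
  rw [abs_lt] at hz
  obtain ⟨h1, h2, h3⟩ := h
  obtain ⟨h1', h2', h3'⟩ := h'
  rw [abs_le] at *
  rw [mem_uIcc] at hw
  refine ⟨by constructor <;> rcases hw with hw | hw <;> linarith, ?_, ?_⟩
  · rintro ⟨ha, hb, hc⟩
    have e1 : z ≤ 1 ∨ 2 ≤ z := by
      by_contra hh; push Not at hh; exact h2 ⟨ha, hh.1, hh.2⟩
    have e2 : z' ≤ 1 ∨ 2 ≤ z' := by
      by_contra hh; push Not at hh; exact h2' ⟨ha, hh.1, hh.2⟩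
    rcases hw with hw | hw <;> rcases e1 with e1 | e1 <;> rcases e2 with e2 | e2 <;> linarith
  · rintro ⟨ha, hb, hc⟩
    have e1 : z ≤ -2 ∨ -1 ≤ z := by
      by_contra hh; push Not at hh; exact h3 ⟨ha, hh.1, hh.2⟩
    have e2 : z' ≤ -2 ∨ -1 ≤ z' := by
      by_contra hh; push Not at hh; exact h3' ⟨ha, hh.1, hh.2⟩
    rcases hw with hw | hw <;> rcases e1 with e1 | e1 <;> rcases e2 with e2 | e2 <;> linarith

lemma SameModelFiber.refl {t : (ℝ × ℝ) × ℝ} (h : t ∈ modelN) : SameModelFiber t t :=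
  ⟨rfl, fun z hz => by rw [uIcc_self, mem_singleton_iff] at hz; rw [hz]; exact h⟩

lemma SameModelFiber.symm {t u : (ℝ × ℝ) × ℝ} (h : SameModelFiber t u) : SameModelFiber u t :=
  ⟨h.1.symm, fun z hz => by rw [← h.1]; exact h.2 z (by rwa [uIcc_comm])⟩

lemma SameModelFiber.trans {t u v : (ℝ × ℝ) × ℝ} (h : SameModelFiber t u)
    (h' : SameModelFiber u v) : SameModelFiber t v :=
  ⟨h.1.trans h'.1, fun z hz => by
    rcases uIcc_subset_uIcc_union_uIcc (b := u.2) hz with hz | hz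
    · exact h.2 z hz
    · rw [h.1]; exact h'.2 z hz⟩

lemma modelN_fiber_isClosed (q : ℝ × ℝ) : IsClosed {z : ℝ | (q, z) ∈ modelN} := by
  have : {z : ℝ | (q, z) ∈ modelN} = {z | |z| ≤ 3} ∩ ({z | 0 < q.1} ∩ Ioo 1 2)ᶜ ∩
      ({z | 0 < q.2} ∩ Ioo (-2) (-1))ᶜ := by
    ext z
    simp only [mem_modelN, mem_ofPred_eq, mem_inter_iff, mem_compl_iff, mem_Ioo, and_assoc]
  rw [this]
  refine ((isClosed_le continuous_abs continuous_const).inter ?_).inter ?_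
  · exact (isOpen_const.inter isOpen_Ioo).isClosed_compl
  · exact (isOpen_const.inter isOpen_Ioo).isClosed_compl

/-- A slit opens where a coordinate is positive, an open condition. So the vertical slices of the
block are upper semicontinuous: moving to a nearby base point may remove heights but never adds any.
-/
lemma modelN_subset_of_near (q0 : ℝ × ℝ) : ∃ ε > 0, ∀ q z, dist q q0 < ε → (q, z) ∈ modelN →
    (q0, z) ∈ modelN := by
  obtain ⟨a, ha, ha'⟩ : ∃ a > 0, ∀ t : ℝ, 0 < q0.1 → |t - q0.1| < a → 0 < t := by
    by_cases h : 0 < q0.1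
    · exact ⟨q0.1, h, fun t _ ht => by rw [abs_lt] at ht; linarith⟩
    · exact ⟨1, one_pos, fun t h' => absurd h' h⟩
  obtain ⟨b, hb, hb'⟩ : ∃ a > 0, ∀ t : ℝ, 0 < q0.2 → |t - q0.2| < a → 0 < t := by
    by_cases h : 0 < q0.2
    · exact ⟨q0.2, h, fun t _ ht => by rw [abs_lt] at ht; linarith⟩
    · exact ⟨1, one_pos, fun t h' => absurd h' h⟩
  refine ⟨min a b, lt_min ha hb, fun q z hq h => ?_⟩
  rw [Prod.dist_eq, max_lt_iff, Real.dist_eq, Real.dist_eq] at hq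
  rw [mem_modelN] at *
  refine ⟨h.1, fun hh => h.2.1 ⟨ha' _ hh.1 (hq.1.trans_le (min_le_left _ _)), hh.2⟩,
    fun hh => h.2.2 ⟨hb' _ hh.1 (hq.2.trans_le (min_le_right _ _)), hh.2⟩⟩

/-! ### Flow boxes of product shape around a whole fibre -/

namespace FibredNbhd

variable {N B : Type*} [TopologicalSpace N] [TopologicalSpace B]

/-- A flow box whose image consists of the points of the standard block over a square about `q₀`,
with third coordinate in the range `[zl, zu]` of the fibre through a point over `q₀`. -/
structure Box (F : FibredNbhd N B) where
  φ : OpenPartialHomeomorph N modelN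
  isFlowBox : F.IsFlowBox φ
  q₀ : ℝ × ℝ
  ε : ℝ
  zl : ℝ
  zu : ℝ
  ε_pos : 0 < ε
  mem_target : ∀ t : modelN, t ∈ φ.target ↔ dist t.1.1 q₀ < ε ∧ t.1.2 ∈ Icc zl zu
  center : ∀ z ∈ Icc zl zu, (q₀, z) ∈ modelN

variable {F : FibredNbhd N B}

/-- The horizontal coordinates in a box. -/
def Box.q (b : F.Box) (m : N) : ℝ × ℝ := (b.φ m).1.1

/-- The vertical coordinate in a box. -/
def Box.z (b : F.Box) (m : N) : ℝ := (b.φ m).1.2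

/-- The domain of a box. -/
abbrev Box.src (b : F.Box) : Set N := b.φ.source

/-- The range of coordinates of a box. -/
def Box.rng (b : F.Box) : Set ((ℝ × ℝ) × ℝ) :=
  {t | t ∈ modelN ∧ dist t.1 b.q₀ < b.ε ∧ t.2 ∈ Icc b.zl b.zu}

open Classical in
/-- The point with given coordinates in a box. -/
noncomputable def Box.pt [Nonempty N] (b : F.Box) (t : (ℝ × ℝ) × ℝ) : N :=
  if h : t ∈ modelN then b.φ.symm ⟨t, h⟩ else Classical.arbitrary N

/-- The fibre over `x` is a compact interval `Z` of heights in some flow box. By the tube lemma the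
part of the block with heights in `Z` over a small square is in the target. This part is open,
because a point of the block near `Z` over a nearby base point has its height in `Z` already. -/
lemma exists_box (F : FibredNbhd N B) (x : B) :
    ∃ b : F.Box, ∀ m, F.π m = x → m ∈ b.src ∧ b.q m = b.q₀ := by
  obtain ⟨n, rfl⟩ := F.surjective_π x
  obtain ⟨φ, hφ, hn⟩ := F.exists_flowBox n
  set q0 := (φ n).1.1 with hq0
  set z0 := (φ n).1.2 with hz0
  have hmem : (q0, z0) ∈ modelN := (φ n).2
  set Z : Set ℝ := {z | SameModelFiber (q0, z0) (q0, z)} with hZ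
  have hz0Z : z0 ∈ Z := SameModelFiber.refl hmem
  have hZm : ∀ z ∈ Z, (q0, z) ∈ modelN := fun z hz => hz.2 z right_mem_uIcc
  have hZc : IsClosed Z := by
    rw [← isSeqClosed_iff_isClosed]
    intro u z hu hz
    have h1 : (q0, z) ∈ modelN :=
      (modelN_fiber_isClosed q0).mem_of_tendsto hz (Eventually.of_forall fun n => hZm _ (hu n))
    have h2 : ∀ᶠ n in atTop, |u n - z| < 1 := by
      have := (Metric.tendsto_nhds.1 hz) 1 one_pos
      simpa [Real.dist_eq] using this
    obtain ⟨k, hk⟩ := h2.exists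
    exact (hu k).trans (sameModelFiber_of_near (hZm _ (hu k)) h1 hk)
  have hZb : Z ⊆ Icc (-3) 3 := fun z hz => abs_le.1 (hZm z hz).1
  have hZo : OrdConnected Z := by
    refine ⟨fun a ha b hb c hc => ⟨rfl, fun w hw => ?_⟩⟩
    have ha' := ha.2; have hb' := hb.2
    simp only [mem_uIcc] at *
    rcases hw with hw | hw
    · rcases le_total z0 b with h | h
      · exact hb' w (Or.inl ⟨hw.1, hw.2.trans hc.2⟩)
      · have := hc.2
        exact hb' w (Or.inr ⟨by linarith [hc.1], by linarith [hc.1]⟩)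
    · rcases le_total a z0 with h | h
      · exact ha' w (Or.inr ⟨by linarith [hc.1], hw.2⟩)
      · exact ha' w (Or.inl ⟨by linarith [hc.1], by linarith [hc.1]⟩)
  have hZk : IsCompact Z := isCompact_Icc.of_isClosed_subset hZc hZb
  have hZI : Z = Icc (sInf Z) (sSup Z) := by
    have h1 := hZk.sInf_mem ⟨z0, hz0Z⟩
    have h2 := hZk.sSup_mem ⟨z0, hz0Z⟩
    apply Subset.antisymm
    · exact fun z hz => ⟨csInf_le hZk.bddBelow hz, le_csSup hZk.bddAbove hz⟩
    · exact hZo.out h1 h2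
  obtain ⟨ε₁, hε₁, hsub⟩ := modelN_subset_of_near q0
  obtain ⟨U, hU, hUt⟩ := isOpen_induced_iff.1 φ.open_target
  have hK : ({q0} : Set (ℝ × ℝ)) ×ˢ Z ⊆ U := by
    rintro ⟨q, z⟩ ⟨hq, hz⟩
    simp only [mem_singleton_iff] at hq hz
    subst hq
    have : (⟨(q0, z), hZm z hz⟩ : modelN) ∈ φ.target :=
      hφ.target_saturated (φ n) (φ.map_source hn) _ hz
    rw [← hUt] at this
    exact this
  obtain ⟨u, v, hu, hv, hqu, hZv, huv⟩ := generalized_tube_lemma isCompact_singleton hZk hU hK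
  obtain ⟨ε₂, hε₂, hball⟩ := Metric.isOpen_iff.1 hu q0 (hqu rfl)
  set ε := min ε₁ ε₂ with hε
  have hεpos : 0 < ε := lt_min hε₁ hε₂
  set T : Set modelN := {t | dist t.1.1 q0 < ε ∧ t.1.2 ∈ Z} with hT
  have hZnear : ∀ t : modelN, dist t.1.1 q0 < ε → (∃ z ∈ Z, |z - t.1.2| < 1) → t.1.2 ∈ Z := by
    rintro ⟨⟨q, w⟩, ht⟩ hd ⟨z, hz, hzw⟩
    exact hz.trans (sameModelFiber_of_near (hZm z hz)
      (hsub _ _ (hd.trans_le (min_le_left _ _)) ht) hzw)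
  have hTopen : IsOpen T := by
    have : T = {t : modelN | dist t.1.1 q0 < ε} ∩ ⋃ z ∈ Z, {t : modelN | |z - t.1.2| < 1} := by
      ext t
      simp only [hT, mem_ofPred_eq, mem_inter_iff, mem_iUnion, exists_prop]
      exact ⟨fun h => ⟨h.1, _, h.2, by simp⟩, fun h => ⟨h.1, hZnear t h.1 h.2⟩⟩
    rw [this]
    refine (isOpen_lt (by fun_prop) continuous_const).inter (isOpen_biUnion fun z _ => ?_)
    exact isOpen_lt (by fun_prop) continuous_const
  have hTt : T ⊆ φ.target := by
    rintro t ⟨hd, hz⟩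
    rw [← hUt]
    exact huv ⟨hball (hd.trans_le (min_le_right _ _)), hZv hz⟩
  have hTsat : ∀ t ∈ T, ∀ w : modelN, SameModelFiber t w → w ∈ T := by
    rintro ⟨⟨q, z⟩, ht⟩ ⟨hd, hz⟩ ⟨⟨q', z'⟩, hw⟩ h
    obtain ⟨h1, h2⟩ := h
    simp only at h1 h2 hd hz
    subst h1
    exact ⟨hd, hz.trans ⟨rfl, fun w hw => hsub q w (hd.trans_le (min_le_left _ _)) (h2 w hw)⟩⟩
  set ψ := φ.restrOpen (φ.source ∩ φ ⁻¹' T) (φ.isOpen_inter_preimage hTopen) with hψ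
  have hψs : ∀ m, m ∈ ψ.source ↔ m ∈ φ.source ∧ φ m ∈ T := by
    intro m; rw [hψ, OpenPartialHomeomorph.restrOpen_source]; simp
  have hψc : ∀ m, ψ m = φ m := fun m => rfl
  have hψt : ∀ t, t ∈ ψ.target ↔ t ∈ T := by
    intro t
    constructor
    · intro h
      have := ψ.map_target h
      have h2 := ψ.right_inv h
      rw [hψs] at this
      rw [← h2]; exact this.2
    · intro h
      have h1 := φ.map_target (hTt h)
      have h2 := φ.right_inv (hTt h)
      have : φ.symm t ∈ ψ.source := by rw [hψs]; exact ⟨h1, by rw [h2]; exact h⟩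
      have := ψ.map_source this
      rwa [hψc, h2] at this
  have hflow : F.IsFlowBox ψ := by
    constructor
    · intro m hm k hk
      rw [hψs] at hm ⊢
      have hk' := hφ.source_saturated m hm.1 k hk
      exact ⟨hk', hTsat _ hm.2 _ ((hφ.fiber_iff m hm.1 k hk').1 hk.symm)⟩
    · intro t ht w hw
      rw [hψt] at *
      exact hTsat t ht w hw
    · intro m hm k hk
      rw [hψs] at hm hk
      exact hφ.fiber_iff m hm.1 k hk.1
    · intro m hm
      rw [hψs] at hm
      exact hφ.vert_iff m hm.1
    · intro m hm
      rw [hψs] at hm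
      exact hφ.core_iff m hm.1
  refine ⟨⟨ψ, hflow, q0, ε, sInf Z, sSup Z, hεpos, ?_, ?_⟩, ?_⟩
  · intro t; rw [hψt, hT, ← hZI]; rfl
  · intro z hz; rw [← hZI] at hz; exact hZm z hz
  · intro m hm
    have hm' := hφ.source_saturated n hn m hm
    have hs := (hφ.fiber_iff n hn m hm').1 hm.symm
    refine ⟨?_, hs.1.symm⟩
    change m ∈ ψ.source
    rw [hψs]
    refine ⟨hm', hTsat (φ n) ⟨show dist q0 q0 < ε by rwa [dist_self], hz0Z⟩ _ hs⟩

namespace Box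

variable (b : F.Box)

lemma isOpen_src : IsOpen b.src := b.φ.open_source

lemma continuousOn_q : ContinuousOn b.q b.src :=
  continuous_fst.comp_continuousOn (continuous_subtype_val.comp_continuousOn b.φ.continuousOn)

lemma continuousOn_z : ContinuousOn b.z b.src :=
  continuous_snd.comp_continuousOn (continuous_subtype_val.comp_continuousOn b.φ.continuousOn)

lemma mem_modelN (m : N) : (b.q m, b.z m) ∈ modelN := (b.φ m).2

lemma mem_src {m n : N} (hm : m ∈ b.src) (h : F.π n = F.π m) : n ∈ b.src :=
  b.isFlowBox.source_saturated m hm n h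

lemma π_eq_iff {m n : N} (hm : m ∈ b.src) (hn : n ∈ b.src) :
    F.π m = F.π n ↔ SameModelFiber (b.q m, b.z m) (b.q n, b.z n) :=
  b.isFlowBox.fiber_iff m hm n hn

lemma q_eq {m n : N} (hm : m ∈ b.src) (h : F.π m = F.π n) : b.q m = b.q n :=
  ((b.π_eq_iff hm (b.mem_src hm h.symm)).1 h).1

lemma mem_rng {m : N} (hm : m ∈ b.src) : (b.q m, b.z m) ∈ b.rng :=
  ⟨b.mem_modelN m, (b.mem_target _).1 (b.φ.map_source hm)⟩

lemma dist_q_lt {m : N} (hm : m ∈ b.src) : dist (b.q m) b.q₀ < b.ε := (b.mem_rng hm).2.1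

variable [Nonempty N]

lemma pt_eq {t : (ℝ × ℝ) × ℝ} (ht : t ∈ modelN) : b.pt t = b.φ.symm ⟨t, ht⟩ := dif_pos ht

lemma pt_mem {t : (ℝ × ℝ) × ℝ} (ht : t ∈ b.rng) : b.pt t ∈ b.src := by
  rw [b.pt_eq ht.1]
  exact b.φ.map_target ((b.mem_target ⟨t, ht.1⟩).2 ht.2)

lemma φ_pt {t : (ℝ × ℝ) × ℝ} (ht : t ∈ b.rng) : b.φ (b.pt t) = ⟨t, ht.1⟩ := by
  rw [b.pt_eq ht.1]
  exact b.φ.right_inv ((b.mem_target ⟨t, ht.1⟩).2 ht.2)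

lemma q_pt {t : (ℝ × ℝ) × ℝ} (ht : t ∈ b.rng) : b.q (b.pt t) = t.1 := by
  rw [Box.q, b.φ_pt ht]

lemma z_pt {t : (ℝ × ℝ) × ℝ} (ht : t ∈ b.rng) : b.z (b.pt t) = t.2 := by
  rw [Box.z, b.φ_pt ht]

lemma pt_qz {m : N} (hm : m ∈ b.src) : b.pt (b.q m, b.z m) = m := by
  rw [b.pt_eq (b.mem_modelN m)]
  exact b.φ.left_inv hm

lemma continuousOn_pt : ContinuousOn b.pt b.rng := by
  rw [continuousOn_iff_continuous_domRestrict]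
  have h : Continuous (fun t : b.rng => (⟨t.1, t.2.1⟩ : modelN)) :=
    Continuous.subtype_mk continuous_subtype_val _
  have := b.φ.symm.continuousOn.comp_continuous h
    (fun t => (b.mem_target ⟨t.1, t.2.1⟩).2 t.2.2)
  convert! this using 1
  ext t
  exact b.pt_eq t.2.1

lemma π_pt_eq_iff {t u : (ℝ × ℝ) × ℝ} (ht : t ∈ b.rng) (hu : u ∈ b.rng) :
    F.π (b.pt t) = F.π (b.pt u) ↔ SameModelFiber t u := by
  rw [b.π_eq_iff (b.pt_mem ht) (b.pt_mem hu), b.q_pt ht, b.q_pt hu, b.z_pt ht, b.z_pt hu]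

omit [Nonempty N] in
lemma rng_of_same {t u : (ℝ × ℝ) × ℝ} (ht : t ∈ b.rng) (h : SameModelFiber t u) : u ∈ b.rng := by
  have hu : u ∈ modelN := by have := h.2 u.2 right_mem_uIcc; rwa [h.1] at this
  exact ⟨hu, (b.mem_target ⟨u, hu⟩).1 (b.isFlowBox.target_saturated ⟨t, ht.1⟩
    ((b.mem_target ⟨t, ht.1⟩).2 ht.2) ⟨u, hu⟩ h)⟩

omit [Nonempty N] in
lemma injOn {m n : N} (hm : m ∈ b.src) (hn : n ∈ b.src) (hq : b.q m = b.q n) (hz : b.z m = b.z n) :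
    m = n := b.φ.injOn hm hn (Subtype.ext (Prod.ext hq hz))

end Box

end FibredNbhd
end BranchedSurface

/-! ### Boxes seen from the base: vertical ranges of fibres and their variation -/

namespace BranchedSurface
namespace FibredNbhd

variable {N B : Type*} [TopologicalSpace N] [TopologicalSpace B] {F : FibredNbhd N B}

/-- A point over `x`. -/
noncomputable def sec (F : FibredNbhd N B) (x : B) : N := (F.surjective_π x).choose

@[simp] lemma π_sec (x : B) : F.π (F.sec x) = x := (F.surjective_π x).choose_spec

namespace Box

variable (b : F.Box)

/-- The open subset of `B` covered by a box. -/
def base : Set B := F.π '' b.src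

lemma mem_base_iff {m : N} : F.π m ∈ b.base ↔ m ∈ b.src :=
  ⟨fun ⟨_, hn, h⟩ => b.mem_src hn h.symm, fun h => ⟨m, h, rfl⟩⟩

/-- The horizontal coordinates of a box, as functions on `B`. -/
noncomputable def qB (x : B) : ℝ × ℝ := b.q (F.sec x)

lemma qB_π {m : N} (hm : m ∈ b.src) : b.qB (F.π m) = b.q m :=
  (b.q_eq hm (by simp)).symm

lemma dist_qB_lt {x : B} (hx : x ∈ b.base) : dist (b.qB x) b.q₀ < b.ε := by
  obtain ⟨m, hm, rfl⟩ := hx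
  rw [b.qB_π hm]; exact b.dist_q_lt hm

/-- The range of the vertical coordinate of a box on the fibre over `x`. -/
def J (x : B) : Set ℝ := {z | ∃ m ∈ b.src, F.π m = x ∧ b.z m = z}

lemma z_mem_J {m : N} (hm : m ∈ b.src) : b.z m ∈ b.J (F.π m) := ⟨m, hm, rfl, rfl⟩

lemma J_nonempty {x : B} (hx : x ∈ b.base) : (b.J x).Nonempty := by
  obtain ⟨m, hm, rfl⟩ := hx
  exact ⟨_, b.z_mem_J hm⟩

lemma mem_base_of_J {x : B} {z : ℝ} (h : z ∈ b.J x) : x ∈ b.base := by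
  obtain ⟨m, hm, rfl, -⟩ := h
  exact ⟨m, hm, rfl⟩

lemma rng_of_J {x : B} {z : ℝ} (h : z ∈ b.J x) : (b.qB x, z) ∈ b.rng := by
  obtain ⟨m, hm, rfl, rfl⟩ := h
  rw [b.qB_π hm]; exact b.mem_rng hm

lemma same_of_J {x : B} {z z' : ℝ} (h : z ∈ b.J x) (h' : z' ∈ b.J x) :
    SameModelFiber (b.qB x, z) (b.qB x, z') := by
  obtain ⟨m, hm, rfl, rfl⟩ := h
  obtain ⟨n, hn, hmn, rfl⟩ := h'
  have := (b.π_eq_iff hm hn).1 hmn.symm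
  rw [b.qB_π hm]
  have h2 := this.1
  simp only at h2
  rwa [← h2] at this

lemma π_pt_of_J [Nonempty N] {x : B} {z : ℝ} (h : z ∈ b.J x) : F.π (b.pt (b.qB x, z)) = x := by
  obtain ⟨m, hm, rfl, rfl⟩ := h
  rw [b.qB_π hm, b.pt_qz hm]

lemma J_of_same {x : B} {z z' : ℝ} (h : z ∈ b.J x)
    (h' : SameModelFiber (b.qB x, z) (b.qB x, z')) : z' ∈ b.J x := by
  have : Nonempty N := ⟨h.choose⟩
  have h1 := b.rng_of_J h
  have h2 := b.rng_of_same h1 h'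
  refine ⟨b.pt (b.qB x, z'), b.pt_mem h2, ?_, b.z_pt h2⟩
  rw [← (b.π_pt_eq_iff h1 h2).2 h', b.π_pt_of_J h]

lemma J_of_near {x : B} {z z' : ℝ} (h : z ∈ b.J x) (h' : (b.qB x, z') ∈ modelN)
    (hz : |z - z'| < 1) : z' ∈ b.J x :=
  b.J_of_same h (sameModelFiber_of_near (b.rng_of_J h).1 h' hz)

lemma isOpen_base [CompactSpace N] [T2Space B] : IsOpen b.base := by
  rw [← F.isQuotientMap_π.isOpen_preimage]
  convert! b.isOpen_src using 1
  ext m; exact b.mem_base_iff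

lemma continuousOn_qB [CompactSpace N] [T2Space B] : ContinuousOn b.qB b.base := by
  rw [_root_.continuousOn_iff']
  intro t ht
  obtain ⟨u, hu, h⟩ := _root_.continuousOn_iff'.1 b.continuousOn_q t ht
  refine ⟨b.qB ⁻¹' t ∩ b.base, ?_, by rw [inter_assoc, inter_self]⟩
  rw [← F.isQuotientMap_π.isOpen_preimage]
  convert! hu.inter b.isOpen_src using 1
  rw [← h]
  ext m
  simp only [mem_preimage, mem_inter_iff, b.mem_base_iff]
  refine and_congr_left fun hm => ?_
  rw [b.qB_π hm]

section compact
variable [CompactSpace N] [T2Space B]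

/-- Upper semicontinuity holds because `π` is a closed map: nearby fibres have heights within 1 of
`J x`. A nearby fibre can be strictly smaller only if a slit meeting `J x` has opened, which the two
sign conditions exclude. -/
lemma J_stable {x : B} (hx : x ∈ b.base) : ∀ᶠ x' in 𝓝 x, x' ∈ b.base ∧ b.J x' ⊆ b.J x ∧
    (((b.J x ∩ Ioo 1 2).Nonempty → (b.qB x').1 ≤ 0) →
      ((b.J x ∩ Ioo (-2) (-1)).Nonempty → (b.qB x').2 ≤ 0) → b.J x' = b.J x) := by
  obtain ⟨ε, hε, hsub⟩ := modelN_subset_of_near (b.qB x)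
  have h1 : ∀ᶠ x' in 𝓝 x, x' ∈ b.base := b.isOpen_base.mem_nhds hx
  have h2 : ∀ᶠ x' in 𝓝 x, dist (b.qB x') (b.qB x) < ε :=
    (b.continuousOn_qB.continuousAt (b.isOpen_base.mem_nhds hx)).eventually (ball_mem_nhds _ hε)
  have h3 : ∀ᶠ x' in 𝓝 x, ∀ m ∈ F.π ⁻¹' {x'}, m ∈ b.src ∧ ∃ z ∈ b.J x, |z - b.z m| < 1 := by
    refine F.continuous_π.isClosedMap.eventually_nhds_fiber x fun m hm => ?_
    have hm' : F.π m = x := hm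
    have hms : m ∈ b.src := by rw [← b.mem_base_iff, hm']; exact hx
    have hms' := b.isOpen_src.mem_nhds hms
    have : ∀ᶠ n in 𝓝 m, dist (b.z n) (b.z m) < 1 :=
      (b.continuousOn_z.continuousAt hms').eventually (ball_mem_nhds _ one_pos)
    filter_upwards [this, hms'] with n hn hn'
    refine ⟨hn', b.z m, ⟨m, hms, hm', rfl⟩, ?_⟩
    rw [← Real.dist_eq, dist_comm]; exact hn
  filter_upwards [h1, h2, h3] with x' h1 h2 h3
  have hJ : b.J x' ⊆ b.J x := by
    rintro _ ⟨m, hm, rfl, rfl⟩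
    obtain ⟨-, z, hz, hz'⟩ := h3 m rfl
    refine b.J_of_near hz (hsub _ _ h2 ?_) hz'
    rw [b.qB_π hm]; exact b.mem_modelN m
  refine ⟨h1, hJ, fun ha hb => Subset.antisymm hJ fun z hz => ?_⟩
  obtain ⟨w, hw⟩ := b.J_nonempty h1
  refine b.J_of_same hw ⟨rfl, fun t ht => ?_⟩
  have := b.J_of_same hz (z' := t) ⟨rfl, fun t' ht' => (b.same_of_J hz (hJ hw)).2 _ ?_⟩
  · have h4 := (b.rng_of_J this).1
    refine ⟨h4.1, ?_, ?_⟩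
    · rintro ⟨h5, h6⟩
      exact absurd h5 (not_lt.2 (ha ⟨t, this, h6⟩))
    · rintro ⟨h5, h6⟩
      exact absurd h5 (not_lt.2 (hb ⟨t, this, h6⟩))
  · rw [uIcc_comm] at ht
    exact uIcc_subset_uIcc left_mem_uIcc ht ht'

end compact
end Box

/-! ### Sets over which the fibres do not jump -/

/-- Over `X`, the projection is open: points of fibres are limits of points of nearby fibres. -/
def IsUnif (F : FibredNbhd N B) (X : Set B) : Prop :=
  ∀ x ∈ X, ∀ m, F.π m = x → ∀ V ∈ 𝓝 m, ∀ᶠ x' in 𝓝[X] x, ∃ m' ∈ V, F.π m' = x'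

lemma IsUnif.mono {X Y : Set B} (h : F.IsUnif X) (hY : Y ⊆ X) : F.IsUnif Y :=
  fun x hx m hm V hV => nhdsWithin_mono x hY (h x (hY hx) m hm V hV)

section compact
variable [CompactSpace N] [T2Space B]

/-- A height of `J x` inside a slit is approximated, by uniformity, by points at heights inside the
same slit over nearby points of `X`. Such points show that the slit is not open there, so `J_stable`
gives equality. -/
lemma Box.J_eventuallyEq (b : F.Box) {X : Set B} (hX : F.IsUnif X) {x : B} (hx : x ∈ X)
    (hb : x ∈ b.base) : ∀ᶠ x' in 𝓝[X] x, b.J x' = b.J x := by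
  have key : ∀ (u v : ℝ) (P : ℝ × ℝ → Prop), (∀ q z, (q, z) ∈ modelN → z ∈ Ioo u v → P q) →
      ∀ᶠ x' in 𝓝[X] x, (b.J x ∩ Ioo u v).Nonempty → P (b.qB x') := by
    intro u v P hP
    by_cases h : (b.J x ∩ Ioo u v).Nonempty
    · obtain ⟨_, ⟨m, hm, hmx, rfl⟩, hz⟩ := h
      have hV : b.src ∩ b.z ⁻¹' Ioo u v ∈ 𝓝 m :=
        (b.continuousOn_z.isOpen_inter_preimage b.isOpen_src isOpen_Ioo).mem_nhds ⟨hm, hz⟩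
      filter_upwards [hX x hx m hmx _ hV] with x' ⟨m', ⟨hm's, hm'z⟩, hm'⟩ _
      rw [← hm', b.qB_π hm's]
      exact hP _ _ (b.mem_modelN m') hm'z
    · exact Eventually.of_forall fun x' h' => absurd h' h
  filter_upwards [nhdsWithin_le_nhds (b.J_stable hb),
    key 1 2 (fun q => q.1 ≤ 0) (fun q z h hz => not_lt.1 fun h' => h.2.1 ⟨h', hz⟩),
    key (-2) (-1) (fun q => q.2 ≤ 0) (fun q z h hz => not_lt.1 fun h' => h.2.2 ⟨h', hz⟩)]
    with x' h1 h2 h3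
  exact h1.2.2 h2 h3

/-- A function which is locally constant on a preconnected set is constant on it. -/
lemma eq_of_eventuallyEq_of_isPreconnected {A Y : Type*} [TopologicalSpace A] {s : Set A}
    (hs : IsPreconnected s) {f : A → Y} (hf : ∀ a ∈ s, ∀ᶠ a' in 𝓝[s] a, f a' = f a) {a a' : A}
    (ha : a ∈ s) (ha' : a' ∈ s) : f a = f a' := by
  let : TopologicalSpace Y := ⊥
  have : DiscreteTopology Y := ⟨rfl⟩
  refine hs.constant ?_ ha ha'
  intro a ha
  exact (continuousWithinAt_const (b := f a)).congr_of_eventuallyEq (hf a ha) rfl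

lemma Box.J_eq (b : F.Box) {X : Set B} (hX : F.IsUnif X) (hc : IsPreconnected X)
    (hb : X ⊆ b.base) {x x' : B} (hx : x ∈ X) (hx' : x' ∈ X) : b.J x = b.J x' :=
  eq_of_eventuallyEq_of_isPreconnected hc (fun _ ha => b.J_eventuallyEq hX ha (hb ha)) hx hx'

/-- The required points are found by keeping the height of `m` and moving the base point only. -/
lemma Box.unifAt_of_J (b : F.Box) {X : Set B} {x : B} (hx : x ∈ b.base)
    (h : ∀ᶠ x' in 𝓝[X] x, b.J x ⊆ b.J x') {m : N} (hm : F.π m = x) {V : Set N} (hV : V ∈ 𝓝 m) :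
    ∀ᶠ x' in 𝓝[X] x, ∃ m' ∈ V, F.π m' = x' := by
  subst hm
  have : Nonempty N := ⟨m⟩
  have hm : m ∈ b.src := b.mem_base_iff.1 hx
  have hq : ContinuousWithinAt b.qB X (F.π m) :=
    (b.continuousOn_qB.continuousAt (b.isOpen_base.mem_nhds hx)).continuousWithinAt
  have hr : ∀ᶠ x' in 𝓝[X] (F.π m), (b.qB x', b.z m) ∈ b.rng := by
    filter_upwards [h] with x' hx'
    exact b.rng_of_J (hx' (b.z_mem_J hm))
  have ht : Tendsto (fun x' => b.pt (b.qB x', b.z m)) (𝓝[X] (F.π m)) (𝓝 m) := by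
    have h1 : Tendsto (fun x' => (b.qB x', b.z m)) (𝓝[X] (F.π m))
        (𝓝[b.rng] (b.q m, b.z m)) := by
      refine tendsto_nhdsWithin_iff.2 ⟨?_, hr⟩
      rw [← b.qB_π hm]
      exact hq.tendsto.prodMk_nhds tendsto_const_nhds
    have h2 := (b.continuousOn_pt _ (b.mem_rng hm)).tendsto.comp h1
    rwa [b.pt_qz hm] at h2
  filter_upwards [ht hV, h] with x' h1 h2
  exact ⟨_, h1, b.π_pt_of_J (h2 (b.z_mem_J hm))⟩

end compact

/-! ### Plaques -/

lemma IsGraph.injOn {φ : OpenPartialHomeomorph N modelN} (hφ : F.IsFlowBox φ) {E : Set (ℝ × ℝ)}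
    {g : ℝ × ℝ → ℝ} {D : Set N} (h : IsGraph φ E g D) : InjOn F.π D := by
  obtain ⟨-, -, rfl⟩ := h
  rintro m ⟨hm, hmE, hmg⟩ n ⟨hn, hnE, hng⟩ hmn
  have := ((hφ.fiber_iff m hm n hn).1 hmn).1
  refine φ.injOn hm hn (Subtype.ext (Prod.ext this ?_))
  rw [hmg, hng, this]

/-- The map `r` slides a point along its fibre to the graph. Near `s` the slide covers a height less
than 1, so it does not cross a slit. -/
lemma IsGraph.fullAt {φ : OpenPartialHomeomorph N modelN} (hφ : F.IsFlowBox φ) {E : Set (ℝ × ℝ)}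
    {g : ℝ × ℝ → ℝ} {D : Set N} (h : IsGraph φ E g D) {s : N} (hs : s ∈ D)
    (hE : ∀ᶠ m in 𝓝 s, (φ m).1.1 ∈ E) : F.FullAt D s := by
  classical
  obtain ⟨hg, hgt, rfl⟩ := h
  obtain ⟨hs1, hs2, hs3⟩ := hs
  have hsrc : φ.source ∈ 𝓝 s := φ.open_source.mem_nhds hs1
  have hcφ : ContinuousAt (fun m => (φ m : (ℝ × ℝ) × ℝ)) s :=
    continuous_subtype_val.continuousAt.comp (φ.continuousAt hs1)
  have hqt : Tendsto (fun m => (φ m).1.1) (𝓝 s) (𝓝[E] (φ s).1.1) :=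
    tendsto_nhdsWithin_iff.2 ⟨(continuous_fst.continuousAt.comp hcφ), hE⟩
  have hgt' : Tendsto (fun m => g (φ m).1.1) (𝓝 s) (𝓝 (φ s).1.2) := by
    rw [hs3]; exact (hg _ hs2).tendsto.comp hqt
  have hzt : Tendsto (fun m => (φ m).1.2) (𝓝 s) (𝓝 (φ s).1.2) :=
    continuous_snd.continuousAt.comp hcφ
  have hd : ∀ᶠ m in 𝓝 s, |(φ m).1.2 - g (φ m).1.1| < 1 := by
    have := (hzt.sub hgt').abs
    rw [sub_self, abs_zero] at this
    exact this.eventually_lt_const one_pos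
  let V : Set N := {m | m ∈ φ.source ∧ (φ m).1.1 ∈ E ∧ |(φ m).1.2 - g (φ m).1.1| < 1}
  let r : N → N := fun m => if h : ((φ m).1.1, g (φ m).1.1) ∈ modelN then φ.symm ⟨_, h⟩ else m
  have hr : ∀ m, (φ m).1.1 ∈ E → ∃ h : ((φ m).1.1, g (φ m).1.1) ∈ modelN,
      r m = φ.symm ⟨_, h⟩ ∧ (⟨_, h⟩ : modelN) ∈ φ.target := by
    intro m hm
    obtain ⟨h1, h2⟩ := hgt _ hm
    exact ⟨h1, dif_pos h1, h2⟩
  have hrs : ∀ m, (φ m).1.1 ∈ E → r m ∈ φ.source ∧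
      (φ (r m) : (ℝ × ℝ) × ℝ) = ((φ m).1.1, g (φ m).1.1) := by
    intro m hm
    obtain ⟨h1, h2, h3⟩ := hr m hm
    rw [h2]
    exact ⟨φ.map_target h3, by rw [φ.right_inv h3]⟩
  refine ⟨V, ?_, r, ?_, ?_, ?_⟩
  · filter_upwards [hsrc, hE, hd] with m h1 h2 h3 using ⟨h1, h2, h3⟩
  · rw [continuousOn_iff_continuous_domRestrict]
    have hm1 : ∀ m : V, ((φ m).1.1, g (φ m).1.1) ∈ modelN := fun m => (hr m m.2.2.1).choose
    have hc : Continuous (fun m : V => (φ m : (ℝ × ℝ) × ℝ)) := by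
      refine continuous_subtype_val.comp ?_
      exact φ.continuousOn.comp_continuous continuous_subtype_val fun m => m.2.1
    have hcg : Continuous (fun m : V => g (φ m).1.1) :=
      hg.comp_continuous (continuous_fst.comp hc) fun m => m.2.2.1
    have hc2 : Continuous (fun m : V => (⟨((φ m).1.1, g (φ m).1.1), hm1 m⟩ : modelN)) :=
      Continuous.subtype_mk ((continuous_fst.comp hc).prodMk hcg) _
    have := φ.symm.continuousOn.comp_continuous hc2 (fun m => (hr m m.2.2.1).choose_spec.2)
    convert! this using 1
    ext m
    exact (hr m m.2.2.1).choose_spec.1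
  · refine φ.injOn (hrs s hs2).1 hs1 (Subtype.ext ?_)
    rw [(hrs s hs2).2, ← hs3]
  · rintro m ⟨h1, h2, h3⟩
    obtain ⟨h4, h5⟩ := hrs m h2
    refine ⟨⟨h4, by rw [h5]; exact h2, by rw [h5]⟩, ?_⟩
    rw [hφ.fiber_iff _ h4 _ h1, h5]
    have h6 : ((φ m).1.1, g (φ m).1.1) ∈ modelN := (hr m h2).choose
    refine sameModelFiber_of_near h6 (φ m).2 ?_
    rw [abs_sub_comm]; exact h3

lemma IsPlaque.injOn {D : Set N} (h : F.IsPlaque D) : InjOn F.π D := by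
  obtain ⟨φ, hφ, R, g, hR, hg⟩ := h
  exact hg.injOn hφ

lemma IsHalfPlaque.injOn {D : Set N} (h : F.IsHalfPlaque D) : InjOn F.π D := by
  obtain ⟨φ, hφ, R, g, hR, hg, -⟩ := h
  exact hg.injOn hφ

lemma IsGraph.mem {φ : OpenPartialHomeomorph N modelN} {E : Set (ℝ × ℝ)}
    {g : ℝ × ℝ → ℝ} {D : Set N} (h : IsGraph φ E g D) {s : N} (hs : s ∈ D) :
    s ∈ φ.source ∧ (φ s).1.1 ∈ E ∧ (φ s).1.2 = g (φ s).1.1 := by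
  obtain ⟨-, -, rfl⟩ := h
  exact hs

lemma continuousAt_flowBox {φ : OpenPartialHomeomorph N modelN} {s : N} (hs : s ∈ φ.source) :
    ContinuousAt (fun m => (φ m : (ℝ × ℝ) × ℝ)) s :=
  continuous_subtype_val.continuousAt.comp (φ.continuousAt hs)

lemma IsPlaque.fullAt {D : Set N} (h : F.IsPlaque D) {s : N} (hs : s ∈ D) : F.FullAt D s := by
  obtain ⟨φ, hφ, R, g, hR, hg⟩ := h
  refine hg.fullAt hφ hs ?_
  have := hg.mem hs
  exact (continuous_fst.continuousAt.comp (continuousAt_flowBox this.1)).eventually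
    (hR.mem_nhds this.2.1)

/-- A half plaque meets all nearby fibres although it lives only over `q.1 ≤ 0`: on its edge it has
height `3 / 2`, in the middle of the slit, where the block has no nearby points with `0 < q.1`. -/
lemma IsHalfPlaque.fullAt {D : Set N} (h : F.IsHalfPlaque D) {s : N} (hs : s ∈ D) :
    F.FullAt D s := by
  obtain ⟨φ, hφ, R, g, hR, hg, hg0⟩ := h
  refine hg.fullAt hφ hs ?_
  obtain ⟨h1, ⟨h2, h3⟩, h4⟩ := hg.mem hs
  have hc := continuousAt_flowBox h1
  have hq : ContinuousAt (fun m => (φ m).1.1) s := continuous_fst.continuousAt.comp hc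
  have hq1 : ContinuousAt (fun m => (φ m).1.1.1) s := continuous_fst.continuousAt.comp hq
  have hz : ContinuousAt (fun m => (φ m).1.2) s := continuous_snd.continuousAt.comp hc
  have hR' := hq.eventually (hR.mem_nhds h2)
  suffices ∀ᶠ m in 𝓝 s, (φ m).1.1.1 ≤ 0 by
    filter_upwards [hR', this] with m ha hb using ⟨ha, hb⟩
  rcases (show (φ s).1.1.1 ≤ 0 from h3).lt_or_eq with h5 | h5
  · filter_upwards [hq1.eventually_lt_const h5] with m hm using hm.le
  · have h6 := hg0 _ h2 h5
    rw [h6] at h4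
    have h7 : Ioo (1 : ℝ) 2 ∈ 𝓝 (φ s).1.2 := by rw [h4]; exact Ioo_mem_nhds (by norm_num) (by norm_num)
    filter_upwards [hz h7] with m hm
    exact not_lt.1 fun h' => (φ m).2.2.1 ⟨h', hm⟩

/-! ### The vertical boundary -/

/-- Independence of the flow box follows from an intrinsic property: for an interior point of the
vertical boundary, all nearby points of its fibre are in `F.vert`. At an end of a slit, height `±1`
or `±2`, the fibre continues outside `modelVert` and the property fails. -/
lemma mem_vertInterior_iff {φ : OpenPartialHomeomorph N modelN} (hφ : F.IsFlowBox φ) {n : N}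
    (hn : n ∈ φ.source) : n ∈ F.vertInterior ↔ (φ n : (ℝ × ℝ) × ℝ) ∈ modelVertInt := by
  refine ⟨?_, fun h => ⟨φ, hφ, hn, h⟩⟩
  rintro ⟨ψ, hψ, hnψ, h⟩
  have hV : ∃ V ∈ 𝓝 n, ∀ m ∈ V, F.π m = F.π n → m ∈ F.vert := by
    have hc := continuousAt_flowBox hnψ
    have hz : ContinuousAt (fun m => (ψ m).1.2) n := continuous_snd.continuousAt.comp hc
    have hsrc := ψ.open_source.mem_nhds hnψ
    rcases h with ⟨h0, h1, h2⟩ | ⟨h0, h1, h2⟩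
    · refine ⟨_, inter_mem hsrc (hz (Ioo_mem_nhds h1 h2)), ?_⟩
      rintro m ⟨hm, hm'⟩ hmn
      have := ((hψ.fiber_iff m hm n hnψ).1 hmn).1
      rw [hψ.vert_iff m hm]
      exact Or.inl ⟨by rw [this]; exact h0, hm'.1.le, hm'.2.le⟩
    · refine ⟨_, inter_mem hsrc (hz (Ioo_mem_nhds h1 h2)), ?_⟩
      rintro m ⟨hm, hm'⟩ hmn
      have := ((hψ.fiber_iff m hm n hnψ).1 hmn).1
      rw [hψ.vert_iff m hm]
      exact Or.inr ⟨by rw [this]; exact h0, hm'.1.le, hm'.2.le⟩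
  obtain ⟨V, hV, hV'⟩ := hV
  rcases hqz : (φ n : (ℝ × ℝ) × ℝ) with ⟨q, z⟩
  have hmod : (q, z) ∈ modelN := by rw [← hqz]; exact (φ n).2
  -- nearby points of the same fibre are in `vert`
  have key : ∀ (T : Set ℝ), z ∈ closure T → (∀ w ∈ T, |z - w| < 1 ∧ (q, w) ∈ modelN) →
      ∃ w ∈ T, (q, w) ∈ modelVert := by
    intro T hzT hT
    have hT' : ∀ w : T, (q, w.1) ∈ modelN := fun w => (hT w w.2).2
    obtain ⟨u, huT, hu⟩ := mem_closure_iff_seq_limit.1 hzT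
    have hsame : ∀ k, SameModelFiber (q, z) (q, u k) := fun k =>
      sameModelFiber_of_near hmod (hT _ (huT k)).2 (hT _ (huT k)).1
    have htar : ∀ k, (⟨(q, u k), (hT _ (huT k)).2⟩ : modelN) ∈ φ.target := fun k =>
      hφ.target_saturated (φ n) (φ.map_source hn) _ (by rw [hqz]; exact hsame k)
    have h1 : Tendsto (fun k => (⟨(q, u k), (hT _ (huT k)).2⟩ : modelN)) atTop (𝓝 (φ n)) := by
      rw [tendsto_subtype_rng, hqz]
      exact tendsto_const_nhds.prodMk_nhds hu
    have h2 := (φ.symm.continuousAt (φ.map_source hn)).tendsto.comp h1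
    rw [φ.left_inv hn] at h2
    obtain ⟨k, hk⟩ := (h2.eventually hV).exists
    have h3 : φ.symm ⟨(q, u k), (hT _ (huT k)).2⟩ ∈ φ.source := φ.map_target (htar k)
    have h4 := hV' _ hk (by
      symm
      have := (hφ.fiber_iff n hn (φ.symm ⟨(q, u k), (hT _ (huT k)).2⟩) h3).2 (by
        rw [φ.right_inv (htar k), hqz]; exact hsame k)
      exact this)
    change φ.symm ⟨(q, u k), (hT _ (huT k)).2⟩ ∈ F.vert at h4
    rw [hφ.vert_iff _ h3, φ.right_inv (htar k)] at h4
    exact ⟨u k, huT k, h4⟩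
  have hv : (q, z) ∈ modelVert := by
    rw [← hqz, ← hφ.vert_iff n hn]; exact hV' n (mem_of_mem_nhds hV) rfl
  have hm3 : ∀ w : ℝ, (w ∈ Ioo (-1 : ℝ) 1 ∨ w ∈ Ioo 2 3 ∨ w ∈ Ioo (-3) (-2)) → (q, w) ∈ modelN := by
    intro w hw
    rw [mem_modelN, abs_le]
    simp only [mem_Ioo] at hw
    refine ⟨?_, ?_, ?_⟩
    · rcases hw with hw | hw | hw <;> constructor <;> linarith [hw.1, hw.2]
    · rintro ⟨-, h1, h2⟩; rcases hw with hw | hw | hw <;> linarith [hw.1, hw.2]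
    · rintro ⟨-, h1, h2⟩; rcases hw with hw | hw | hw <;> linarith [hw.1, hw.2]
  have hno : ∀ w : ℝ, (w ∈ Ioo (-1 : ℝ) 1 ∨ w ∈ Ioo 2 3 ∨ w ∈ Ioo (-3) (-2)) →
      (q, w) ∉ modelVert := by
    intro w hw h
    simp only [mem_Ioo] at hw
    rcases h with ⟨-, h1, h2⟩ | ⟨-, h1, h2⟩ <;> simp only at h1 h2 <;>
      rcases hw with hw | hw | hw <;> linarith [hw.1, hw.2]
  -- Here `Ioo u v` is a range of heights free of vertical boundary, adjacent to the end `z` of a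
  -- slit.
  have kill : ∀ u v : ℝ, u < v → v - u ≤ 1 → (z = u ∨ z = v) →
      (Ioo u v ⊆ Ioo (-1) 1 ∨ Ioo u v ⊆ Ioo 2 3 ∨ Ioo u v ⊆ Ioo (-3) (-2)) → False := by
    intro u v huv h1 hz hs
    have hw : ∀ w ∈ Ioo u v, (w ∈ Ioo (-1 : ℝ) 1 ∨ w ∈ Ioo 2 3 ∨ w ∈ Ioo (-3) (-2)) :=
      fun w hw => hs.imp (fun h => h hw) (fun h => h.imp (fun h => h hw) (fun h => h hw))
    obtain ⟨w, hwT, hwv⟩ := key (Ioo u v)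
      (by rw [closure_Ioo huv.ne]; rcases hz with rfl | rfl
          · exact left_mem_Icc.2 huv.le
          · exact right_mem_Icc.2 huv.le)
      (fun w hwT => ⟨by rw [abs_lt]; rcases hz with rfl | rfl <;> constructor <;>
        linarith [hwT.1, hwT.2], hm3 w (hw w hwT)⟩)
    exact hno w (hw w hwT) hwv
  rcases hv with ⟨h0, h1, h2⟩ | ⟨h0, h1, h2⟩ <;> simp only at h0 h1 h2
  · left
    refine ⟨h0, lt_of_le_of_ne h1 fun h => ?_, lt_of_le_of_ne h2 fun h => ?_⟩
    · exact kill 0 1 (by norm_num) (by norm_num) (Or.inr h.symm)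
        (Or.inl (Ioo_subset_Ioo (by norm_num) (by norm_num)))
    · exact kill 2 3 (by norm_num) (by norm_num) (Or.inl h) (Or.inr (Or.inl subset_rfl))
  · right
    refine ⟨h0, lt_of_le_of_ne h1 fun h => ?_, lt_of_le_of_ne h2 fun h => ?_⟩
    · exact kill (-3) (-2) (by norm_num) (by norm_num) (Or.inr h.symm) (Or.inr (Or.inr subset_rfl))
    · exact kill (-1) 0 (by norm_num) (by norm_num) (Or.inl h)
        (Or.inl (Ioo_subset_Ioo (by norm_num) (by norm_num)))

lemma modelCore_subset : modelCore ⊆ modelVertInt := by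
  rintro t (⟨h1, h2⟩ | ⟨h1, h2⟩)
  · left; refine ⟨h1, ?_, ?_⟩ <;> rw [h2] <;> norm_num
  · right; refine ⟨h1, ?_, ?_⟩ <;> rw [h2] <;> norm_num

lemma modelVertInt_subset : modelVertInt ⊆ modelVert := by
  rintro t (⟨h1, h2, h3⟩ | ⟨h1, h2, h3⟩)
  · left; exact ⟨h1, h2.le, h3.le⟩
  · right; exact ⟨h1, h2.le, h3.le⟩

lemma core_subset_vertInterior : F.core ⊆ F.vertInterior := fun n hn => by
  obtain ⟨φ, hφ, h⟩ := F.exists_flowBox n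
  exact ⟨φ, hφ, h, modelCore_subset ((hφ.core_iff n h).1 hn)⟩

lemma vertInterior_subset_vert : F.vertInterior ⊆ F.vert := fun n ⟨_, hφ, h, h'⟩ =>
  (hφ.vert_iff n h).2 (modelVertInt_subset h')

/-- An open graph through such a point would continue over base points with a positive coordinate at
heights inside the open slit, where the block is empty. In particular plaques avoid the pared locus.
-/
lemma IsPlaque.not_mem_vertInterior {D : Set N} (h : F.IsPlaque D) {s : N} (hs : s ∈ D) :
    s ∉ F.vertInterior := by
  obtain ⟨φ, hφ, R, g, hR, hg⟩ := h
  obtain ⟨h1, h2, h3⟩ := hg.mem hs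
  intro hv
  rw [mem_vertInterior_iff hφ h1] at hv
  obtain ⟨hgc, hgm, -⟩ := hg
  have hgc' : ContinuousAt g (φ s).1.1 := hgc.continuousAt (hR.mem_nhds h2)
  rcases hv with ⟨h0, hv⟩ | ⟨h0, hv⟩
  · have ha : ContinuousAt (fun t : ℝ => ((t, (φ s).1.1.2) : ℝ × ℝ)) 0 := by fun_prop
    have hs0 : (φ s).1.1 = (0, (φ s).1.1.2) := Prod.ext h0 rfl
    have hb : ∀ᶠ t in 𝓝 (0 : ℝ), (t, (φ s).1.1.2) ∈ R :=
      ha.eventually (hR.mem_nhds (by simp only; rw [← hs0]; exact h2))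
    have hc : ∀ᶠ t in 𝓝 (0 : ℝ), g (t, (φ s).1.1.2) ∈ Ioo (1 : ℝ) 2 := by
      rw [hs0] at hgc'
      refine (ContinuousAt.comp (f := fun t : ℝ => ((t, (φ s).1.1.2) : ℝ × ℝ)) hgc' ha).eventually
        (Ioo_mem_nhds ?_ ?_) <;> simp only [Function.comp_apply] <;> rw [← hs0, ← h3]
      · exact hv.1
      · exact hv.2
    obtain ⟨t, ⟨ht1, ht2⟩, ht⟩ := (((hb.and hc).filter_mono nhdsWithin_le_nhds).and
      (self_mem_nhdsWithin (s := Ioi (0 : ℝ)))).exists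
    exact (hgm _ ht1).choose.2.1 ⟨ht, ht2⟩
  · have ha : ContinuousAt (fun t : ℝ => (((φ s).1.1.1, t) : ℝ × ℝ)) 0 := by fun_prop
    have hs0 : (φ s).1.1 = ((φ s).1.1.1, 0) := Prod.ext rfl h0
    have hb : ∀ᶠ t in 𝓝 (0 : ℝ), ((φ s).1.1.1, t) ∈ R :=
      ha.eventually (hR.mem_nhds (by simp only; rw [← hs0]; exact h2))
    have hc : ∀ᶠ t in 𝓝 (0 : ℝ), g ((φ s).1.1.1, t) ∈ Ioo (-2 : ℝ) (-1) := by
      rw [hs0] at hgc'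
      refine (ContinuousAt.comp (f := fun t : ℝ => (((φ s).1.1.1, t) : ℝ × ℝ)) hgc' ha).eventually
        (Ioo_mem_nhds ?_ ?_) <;> simp only [Function.comp_apply] <;> rw [← hs0, ← h3]
      · exact hv.1
      · exact hv.2
    obtain ⟨t, ⟨ht1, ht2⟩, ht⟩ := (((hb.and hc).filter_mono nhdsWithin_le_nhds).and
      (self_mem_nhdsWithin (s := Ioi (0 : ℝ)))).exists
    exact (hgm _ ht1).choose.2.2 ⟨ht, ht2⟩

end FibredNbhd
end BranchedSurface

/-! ### Openness of the projection over open cells -/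

namespace BranchedSurface

lemma isClosed_modelN : IsClosed modelN := by
  have : modelN = {t : (ℝ × ℝ) × ℝ | |t.2| ≤ 3} ∩
      ({t : (ℝ × ℝ) × ℝ | 0 < t.1.1} ∩ ({t | 1 < t.2} ∩ {t | t.2 < 2}))ᶜ ∩
      ({t : (ℝ × ℝ) × ℝ | 0 < t.1.2} ∩ ({t | -2 < t.2} ∩ {t | t.2 < -1}))ᶜ := by
    ext t
    simp only [modelN, mem_ofPred_eq, mem_inter_iff, mem_compl_iff, and_assoc]
  rw [this]
  refine ((isClosed_le (by fun_prop) continuous_const).inter ?_).inter ?_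
  · exact ((isOpen_lt continuous_const (by fun_prop)).inter ((isOpen_lt continuous_const
      (by fun_prop)).inter (isOpen_lt (by fun_prop) continuous_const))).isClosed_compl
  · exact ((isOpen_lt continuous_const (by fun_prop)).inter ((isOpen_lt continuous_const
      (by fun_prop)).inter (isOpen_lt (by fun_prop) continuous_const))).isClosed_compl

/-- A continuous injective real function on an interval is open at interior points. -/
lemma image_Icc_mem_nhds {f : ℝ → ℝ} {a b c : ℝ} (hac : a < c) (hcb : c < b)
    (hf : ContinuousOn f (Icc a b)) (hi : InjOn f (Icc a b)) : f '' Icc a b ∈ 𝓝 (f c) := by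
  have hab := hac.trans hcb
  have ha : a ∈ Icc a b := left_mem_Icc.2 hab.le
  have hb : b ∈ Icc a b := right_mem_Icc.2 hab.le
  have hc : c ∈ Icc a b := ⟨hac.le, hcb.le⟩
  rcases hf.strictMonoOn_of_injOn_Icc' hab.le hi with h | h
  · exact mem_of_superset (Icc_mem_nhds (h ha hc hac) (h hc hb hcb))
      (intermediate_value_Icc hab.le hf)
  · exact mem_of_superset (Icc_mem_nhds (h hc hb hcb) (h ha hc hac))
      (intermediate_value_Icc' hab.le hf)

section Cells
variable {B : Type*} [TopologicalSpace B] [CWComplex (univ : Set B)] [T2Space B] [CompactSpace B]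

/-- An open cell is open in its skeleton. -/
lemma BCell.eventually_mem_op {e : BCell B} {x : B} (hx : x ∈ e.op) :
    ∀ᶠ x' in 𝓝 x, x' ∈ skel B (e.1 + 1) → x' ∈ e.op := by
  have : Finite (BCell B) := BCell.finite
  -- This set contains all other cells of dimension at most `e.1` and misses `x`; it is closed
  -- because there are finitely many cells.
  have hc : IsClosed (skel B e.1 ∪ ⋃ e' ∈ {e' : BCell B | e' ≠ e ∧ e'.1 ≤ e.1},
      e'.chr '' e'.cube) := by
    refine (isClosed_skel _).union (Set.Finite.isClosed_biUnion (Set.toFinite _) fun e' _ => ?_)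
    exact ((isCompact_closedBall _ _).image_of_continuousOn e'.continuousOn_chr).isClosed
  have hx' : x ∉ skel B e.1 ∪ ⋃ e' ∈ {e' : BCell B | e' ≠ e ∧ e'.1 ≤ e.1}, e'.chr '' e'.cube := by
    rintro (h | h)
    · exact BCell.not_mem_op_of_mem_skel h hx
    · simp only [mem_iUnion] at h
      obtain ⟨e', ⟨hne, hle⟩, v, hv, rfl⟩ := h
      rcases BCell.mem_ball_or_sphere hv with hv | hv
      · exact hne (BCell.eq_of_mem_op (e'.chr_mem_op hv) hx)
      · exact BCell.not_mem_op_of_mem_skel (skel_mono hle (e'.chr_sphere hv)) hx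
  filter_upwards [hc.isOpen_compl.mem_nhds hx'] with x' h1 ⟨e', he', hxe'⟩
  by_contra h
  refine h1 (Or.inr ?_)
  simp only [mem_iUnion]
  refine ⟨e', ⟨fun hh => h (hh ▸ hxe'), Nat.lt_succ_iff.1 he'⟩, ?_⟩
  exact image_mono ball_subset_closedBall hxe'

/-- An injective arc in the 1-skeleton through a point of a 1-cell covers a neighbourhood. -/
lemma BCell.arc_nhds {e : BCell B} (he : e.1 = 1) {α : ℝ → B} {t₀ δ : ℝ} (hδ : 0 < δ)
    (hα : ContinuousOn α (Metric.ball t₀ δ)) (hi : InjOn α (Metric.ball t₀ δ))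
    (hs : ∀ t ∈ Metric.ball t₀ δ, α t ∈ skel B 2) (h₀ : α t₀ ∈ e.op) :
    ∀ᶠ x in 𝓝[e.op] (α t₀), ∃ t ∈ Metric.ball t₀ δ, α t = x := by
  obtain ⟨n, i⟩ := e
  simp only at he
  subst he
  set e : BCell B := ⟨1, i⟩
  have h1 : ∀ᶠ t in 𝓝 t₀, α t ∈ e.op := by
    have := (hα.continuousAt (ball_mem_nhds _ hδ)).eventually (BCell.eventually_mem_op h₀)
    filter_upwards [this, ball_mem_nhds _ hδ] with t h1 h2 using h1 (hs t h2)
  obtain ⟨δ', hδ', h1⟩ := Metric.eventually_nhds_iff_ball.1 h1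
  set η := min δ δ' / 2 with hη
  have hη0 : 0 < η := by positivity
  have hsub : Icc (t₀ - η) (t₀ + η) ⊆ Metric.ball t₀ δ ∩ Metric.ball t₀ δ' := by
    intro t ht
    have h2 : min δ δ' ≤ δ := min_le_left _ _
    have h3 : min δ δ' ≤ δ' := min_le_right _ _
    constructor <;> rw [Metric.mem_ball, Real.dist_eq, abs_lt] <;> constructor <;>
      linarith [ht.1, ht.2]
  -- In the single coordinate of the 1-cell the arc becomes a continuous injective real function,
  -- which is open at interior points.
  let f : ℝ → ℝ := fun t => e.inv (α t) 0
  have hf : ContinuousOn f (Icc (t₀ - η) (t₀ + η)) := by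
    have : ContinuousOn (fun t => e.inv (α t)) (Icc (t₀ - η) (t₀ + η)) :=
      e.continuousOn_inv.comp (hα.mono fun t ht => (hsub ht).1) fun t ht => h1 t (hsub ht).2
    exact (continuous_apply (0 : Fin 1)).comp_continuousOn this
  have hext : ∀ v w : e.Par, v 0 = w 0 → v = w := fun v w h => by
    funext k
    have : k = 0 := Subsingleton.elim (α := Fin 1) _ _
    rw [this]; exact h
  have hfi : InjOn f (Icc (t₀ - η) (t₀ + η)) := by
    intro t ht s hs' hts
    refine hi (hsub ht).1 (hsub hs').1 ?_
    rw [← e.chr_inv (h1 t (hsub ht).2), ← e.chr_inv (h1 s (hsub hs').2)]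
    exact congrArg e.chr (hext _ _ hts)
  have hn := image_Icc_mem_nhds (c := t₀) (by linarith) (by linarith) hf hfi
  have hc : ContinuousWithinAt (fun x => e.inv x 0) e.op (α t₀) :=
    ((continuous_apply (0 : Fin 1)).comp_continuousOn e.continuousOn_inv) _ h₀
  filter_upwards [hc hn, self_mem_nhdsWithin] with x ⟨t, ht, hxt⟩ hx
  refine ⟨t, (hsub ht).1, ?_⟩
  rw [← e.chr_inv (h1 t (hsub ht).2), ← e.chr_inv hx]
  exact congrArg e.chr (hext _ _ hxt)

end Cells

namespace FibredNbhd

variable {N B : Type*} [TopologicalSpace N] [TopologicalSpace B] {F : FibredNbhd N B}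

lemma Box.J_isClosed [CompactSpace N] [T2Space B] (b : F.Box) {x : B} (hx : x ∈ b.base) :
    IsClosed (b.J x) := by
  have h1 : b.J x = b.z '' (F.π ⁻¹' {x}) := by
    ext z
    constructor
    · rintro ⟨m, -, hm, rfl⟩; exact ⟨m, hm, rfl⟩
    · rintro ⟨m, hm, rfl⟩
      have hm : F.π m = x := hm
      exact ⟨m, b.mem_base_iff.1 (hm ▸ hx), hm, rfl⟩
  rw [h1]
  refine (IsCompact.image_of_continuousOn ?_ ?_).isClosed
  · exact (isClosed_singleton.preimage F.continuous_π).isCompact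
  · refine b.continuousOn_z.mono fun m hm => ?_
    have hm : F.π m = x := hm
    exact b.mem_base_iff.1 (hm ▸ hx)

variable [CWComplex (univ : Set B)]

lemma IsAdapted.mem_skel (hτ : F.IsAdapted) {m : N} (hm : m ∈ F.vert) : F.π m ∈ skel B 2 := by
  obtain ⟨n, hn, i, hi⟩ := hτ.locus m hm
  exact ⟨⟨n, i⟩, Nat.lt_succ_of_le hn, hi⟩

variable [CompactSpace N] [T2Space B]

/-- The curve `β` runs in the vertical boundary, so by adaptedness it projects to an injective arc
in the 1-skeleton through `x`. A 0-cell is a point; in a 1-cell the arc covers a neighbourhood of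
`x`; a cell of higher dimension is disjoint from the 1-skeleton. -/
lemma Box.slit_aux (hτ : F.IsAdapted) (b : F.Box) {e : BCell B} {x : B} (hx : x ∈ e.op)
    (hxb : x ∈ b.base) {β : ℝ → (ℝ × ℝ) × ℝ} (hβ : Continuous β) {t₀ : ℝ}
    (hi : Function.Injective fun t => (β t).1) (h₀ : (β t₀).1 = b.qB x) (h₁ : (β t₀).2 ∈ b.J x)
    (hm : ∀ t, β t ∈ modelN) (hz : ∀ t, (β t).2 = (β t₀).2) (hv : ∀ t, β t ∈ modelVert) :
    ∀ᶠ x' in 𝓝[e.op] x, ∃ t, b.qB x' = (β t).1 := by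
  have : Nonempty N := ⟨h₁.choose⟩
  have : CompactSpace B := F.compactSpace_base
  have hr₀ := b.rng_of_J h₁
  have hd : ∀ᶠ t in 𝓝 t₀, dist (β t).1 b.q₀ < b.ε := by
    have : ContinuousAt (fun t => dist (β t).1 b.q₀) t₀ := by fun_prop
    refine this.eventually_lt_const ?_
    simp only; rw [h₀]; exact b.dist_qB_lt hxb
  obtain ⟨δ, hδ, hd⟩ := Metric.eventually_nhds_iff_ball.1 hd
  have hr : ∀ t ∈ Metric.ball t₀ δ, β t ∈ b.rng := fun t ht =>
    ⟨hm t, hd t ht, by rw [hz]; exact hr₀.2.2⟩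
  let α : ℝ → B := fun t => F.π (b.pt (β t))
  have hq : ∀ t ∈ Metric.ball t₀ δ, b.qB (α t) = (β t).1 := fun t ht => by
    rw [b.qB_π (b.pt_mem (hr t ht)), b.q_pt (hr t ht)]
  have hα₀ : α t₀ = x := by
    have : β t₀ = (b.qB x, (β t₀).2) := Prod.ext h₀ rfl
    simp only [α]
    rw [this, b.π_pt_of_J h₁]
  have hsk : ∀ t ∈ Metric.ball t₀ δ, α t ∈ skel B 2 := fun t ht => by
    refine hτ.mem_skel ?_
    rw [b.isFlowBox.vert_iff _ (b.pt_mem (hr t ht)), b.φ_pt (hr t ht)]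
    exact hv t
  rcases Nat.lt_trichotomy e.1 1 with h | h | h
  · have he : e.1 = 0 := by omega
    have : e.op.Subsingleton := by
      rw [e.op_eq]
      have : Subsingleton e.Par := by
        show Subsingleton (Fin e.1 → ℝ)
        rw [he]; infer_instance
      exact (subsingleton_of_subsingleton).image _
    filter_upwards [self_mem_nhdsWithin] with x' hx'
    exact ⟨t₀, by rw [h₀, this hx' hx]⟩
  · have := BCell.arc_nhds (B := B) h hδ (α := α) (t₀ := t₀)
      (F.continuous_π.comp_continuousOn (b.continuousOn_pt.comp hβ.continuousOn hr)) ?_ hsk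
      (by rw [hα₀]; exact hx)
    · rw [hα₀] at this
      filter_upwards [this] with x' ⟨t, ht, htx⟩
      exact ⟨t, by rw [← htx, hq t ht]⟩
    · intro s hs t ht hst
      apply hi
      simp only
      rw [← hq s hs, ← hq t ht, hst]
  · exact absurd hx (BCell.not_mem_op_of_mem_skel
      (skel_mono (by omega) (hα₀ ▸ hsk t₀ (Metric.mem_ball_self hδ))))

/-- The projection is open over each open cell. -/
lemma isUnif_op (hτ : F.IsAdapted) (e : BCell B) : F.IsUnif e.op := by
  intro x hx m hm V hV
  obtain ⟨b, hb⟩ := exists_box F x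
  have hxb : x ∈ b.base := ⟨m, (hb m hm).1, hm⟩
  refine b.unifAt_of_J hxb ?_ hm hV
  have hq : ContinuousAt b.qB x := b.continuousOn_qB.continuousAt (b.isOpen_base.mem_nhds hxb)
  have k1 : ∀ᶠ x' in 𝓝[e.op] x, (b.J x ∩ Ioo 1 2).Nonempty → (b.qB x').1 ≤ 0 := by
    by_cases hne : (b.J x ∩ Ioo 1 2).Nonempty
    swap
    · exact Eventually.of_forall fun _ h => absurd h hne
    obtain ⟨z, hz, hz'⟩ := hne
    have h0 : (b.qB x).1 ≤ 0 := not_lt.1 fun h => (b.rng_of_J hz).1.2.1 ⟨h, hz'⟩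
    rcases h0.lt_or_eq with h0 | h0
    · have : ContinuousAt (fun x => (b.qB x).1) x := continuous_fst.continuousAt.comp hq
      filter_upwards [nhdsWithin_le_nhds (this.eventually_lt_const h0)] with x' h _ using h.le
    -- Here `x` lies under the edge of the slit. By `slit_aux` nearby points of the open cell stay
    -- on the line `q.1 = 0`, so the slit does not open within the cell.
    · have hmod : ∀ y : ℝ, (((0, y), 3 / 2) : (ℝ × ℝ) × ℝ) ∈ modelN := fun y => by
        rw [mem_modelN]; norm_num [abs_le]
      have hq0 : b.qB x = (0, (b.qB x).2) := Prod.ext h0 rfl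
      have hJ : (3 / 2 : ℝ) ∈ b.J x := by
        refine b.J_of_near hz (by rw [hq0]; exact hmod _) ?_
        rw [abs_lt]; constructor <;> linarith [hz'.1, hz'.2]
      have := b.slit_aux hτ hx hxb (β := fun y => ((0, y), 3 / 2)) (t₀ := (b.qB x).2)
        (by fun_prop) (fun s t h => by simpa using h) hq0.symm hJ hmod (fun _ => rfl)
        (fun t => Or.inl ⟨rfl, by norm_num⟩)
      filter_upwards [this] with x' ⟨t, ht⟩ _
      rw [ht]
  have k2 : ∀ᶠ x' in 𝓝[e.op] x, (b.J x ∩ Ioo (-2) (-1)).Nonempty → (b.qB x').2 ≤ 0 := by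
    by_cases hne : (b.J x ∩ Ioo (-2) (-1)).Nonempty
    swap
    · exact Eventually.of_forall fun _ h => absurd h hne
    obtain ⟨z, hz, hz'⟩ := hne
    have h0 : (b.qB x).2 ≤ 0 := not_lt.1 fun h => (b.rng_of_J hz).1.2.2 ⟨h, hz'⟩
    rcases h0.lt_or_eq with h0 | h0
    · have : ContinuousAt (fun x => (b.qB x).2) x := continuous_snd.continuousAt.comp hq
      filter_upwards [nhdsWithin_le_nhds (this.eventually_lt_const h0)] with x' h _ using h.le
    · have hmod : ∀ y : ℝ, (((y, 0), -3 / 2) : (ℝ × ℝ) × ℝ) ∈ modelN := fun y => by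
        rw [mem_modelN]; norm_num [abs_le]
      have hq0 : b.qB x = ((b.qB x).1, 0) := Prod.ext rfl h0
      have hJ : (-3 / 2 : ℝ) ∈ b.J x := by
        refine b.J_of_near hz (by rw [hq0]; exact hmod _) ?_
        rw [abs_lt]; constructor <;> linarith [hz'.1, hz'.2]
      have := b.slit_aux hτ hx hxb (β := fun y => ((y, 0), -3 / 2)) (t₀ := (b.qB x).1)
        (by fun_prop) (fun s t h => by simpa using h) hq0.symm hJ hmod (fun _ => rfl)
        (fun t => Or.inr ⟨rfl, by norm_num⟩)
      filter_upwards [this] with x' ⟨t, ht⟩ _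
      rw [ht]
  filter_upwards [nhdsWithin_le_nhds (b.J_stable hxb), k1, k2] with x' h1 h2 h3
  exact (h1.2.2 h2 h3).ge

/-! ### Limits of fibres over open cells -/

omit [CompactSpace N] [T2Space B] in
variable (F) in
/-- The closure of the pull-back to the open parameter cube of the fibration `π`. -/
def limFib (e : BCell B) : Set (e.Par × N) := closure {p | p.1 ∈ e.int ∧ F.π p.2 = e.chr p.1}

omit [CompactSpace N] [T2Space B] in
lemma mem_limFib_of_int {e : BCell B} {v : e.Par} {m : N} (hv : v ∈ e.int)
    (h : F.π m = e.chr v) : (v, m) ∈ F.limFib e := subset_closure ⟨hv, h⟩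

omit [CompactSpace N] in
lemma limFib_subset {e : BCell B} {p : e.Par × N} (hp : p ∈ F.limFib e) :
    p.1 ∈ e.cube ∧ F.π p.2 = e.chr p.1 := by
  have h1 : IsClosed {p : e.Par × N | p.1 ∈ e.cube} := isClosed_closedBall.preimage continuous_fst
  have hc : IsClosed {p : e.Par × N | p.1 ∈ e.cube ∧ F.π p.2 = e.chr p.1} :=
    h1.isClosed_eq (F.continuous_π.comp continuous_snd).continuousOn
      (e.continuousOn_chr.comp continuousOn_fst fun p hp => hp)
  exact hc.closure_subset_iff.2 (fun p hp => ⟨ball_subset_closedBall hp.1, hp.2⟩) hp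

omit [CompactSpace N] [T2Space B] in
lemma isClosed_limFib (e : BCell B) : IsClosed (F.limFib e) := isClosed_closure

lemma isCompact_limFib (e : BCell B) : IsCompact (F.limFib e) :=
  ((isCompact_closedBall (0 : e.Par) 1).prod isCompact_univ).of_isClosed_subset
    isClosed_closure fun _ hp => ⟨(limFib_subset hp).1, mem_univ _⟩

omit [CompactSpace N] [T2Space B] in
lemma exists_seq_of_mem_limFib {e : BCell B} {v : e.Par} {m : N} (h : (v, m) ∈ F.limFib e) :
    ∃ f : Filter (e.Par × N), f.NeBot ∧ f ≤ 𝓝 (v, m) ∧ ∀ᶠ p in f, p.1 ∈ e.int ∧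
      F.π p.2 = e.chr p.1 := by
  rw [limFib, mem_closure_iff_nhdsWithin_neBot] at h
  exact ⟨_, h, nhdsWithin_le_nhds, self_mem_nhdsWithin⟩

/-- The convex set `U ∩ e.int` is connected and maps into an open cell, over which fibres do not
jump. -/
lemma Box.J_eq_of_convex (hτ : F.IsAdapted) (b : F.Box) {e : BCell B} {U : Set e.Par}
    (hU : Convex ℝ U) (hUc : U ⊆ e.cube) (hUb : MapsTo e.chr U b.base) {v w : e.Par}
    (hv : v ∈ U ∩ e.int) (hw : w ∈ U ∩ e.int) : b.J (e.chr v) = b.J (e.chr w) := by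
  refine b.J_eq (X := e.chr '' (U ∩ e.int)) ((isUnif_op hτ e).mono ?_) ?_ ?_
    (mem_image_of_mem _ hv) (mem_image_of_mem _ hw)
  · rintro _ ⟨v, hv, rfl⟩; exact e.chr_mem_op hv.2
  · exact (hU.inter (convex_ball _ _)).isPreconnected.image _
      (e.continuousOn_chr.mono fun v hv => hUc hv.1)
  · rintro _ ⟨v, hv, rfl⟩; exact hUb hv.1

omit [CompactSpace N] [T2Space B] in
lemma segment_mem_int {e : BCell B} {U : Set e.Par} (hU : Convex ℝ U) (hUc : U ⊆ e.cube)
    {v w : e.Par} (hv : v ∈ U) (hw : w ∈ U ∩ e.int) {t : ℝ} (ht : t ∈ Ioc (0 : ℝ) 1) :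
    v + t • (w - v) ∈ U ∩ e.int := by
  have h1 : v + t • (w - v) = (1 - t) • v + t • w := by
    rw [smul_sub, sub_smul, one_smul]; abel
  refine ⟨?_, ?_⟩
  · rw [h1]; exact hU hv hw.1 (by linarith [ht.2]) ht.1.le (by ring)
  · have hv1 := hUc hv
    have hw1 := hw.2
    rw [mem_closedBall_zero_iff] at hv1
    rw [mem_ball_zero_iff] at hw1 ⊢
    rw [h1]
    calc ‖(1 - t) • v + t • w‖ ≤ ‖(1 - t) • v‖ + ‖t • w‖ := norm_add_le _ _
      _ = (1 - t) * ‖v‖ + t * ‖w‖ := by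
        rw [norm_smul, norm_smul, Real.norm_of_nonneg ht.1.le, Real.norm_of_nonneg (by linarith [ht.2])]
      _ < 1 := by nlinarith [ht.1, ht.2]

/-- The height of a limit is a limit of heights in one fixed closed set, the common range over `U ∩
e.int`. -/
lemma Box.z_mem_J_of_limFib (hτ : F.IsAdapted) (b : F.Box) {e : BCell B} {U : Set e.Par}
    (hU : Convex ℝ U) (hUc : U ⊆ e.cube) (hUb : MapsTo e.chr U b.base) {v w : e.Par}
    (hv : U ∈ 𝓝[e.cube] v) (hw : w ∈ U ∩ e.int) {m : N} (h : (v, m) ∈ F.limFib e) :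
    b.z m ∈ b.J (e.chr w) := by
  obtain ⟨f, hf, hfv, hfe⟩ := exists_seq_of_mem_limFib h
  have hvm := limFib_subset h
  have hvU : v ∈ U := mem_of_mem_nhdsWithin hvm.1 hv
  have hm : m ∈ b.src := b.mem_base_iff.1 (by rw [hvm.2]; exact hUb hvU)
  have h1 : Tendsto (fun p : e.Par × N => p.1) f (𝓝[e.cube] v) :=
    tendsto_nhdsWithin_iff.2 ⟨(continuous_fst.tendsto (v, m)).mono_left hfv,
      hfe.mono fun p hp => ball_subset_closedBall hp.1⟩
  have h2 : Tendsto (fun p : e.Par × N => b.z p.2) f (𝓝 (b.z m)) :=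
    ((b.continuousOn_z.continuousAt (b.isOpen_src.mem_nhds hm)).tendsto.comp
      (continuous_snd.tendsto (v, m))).mono_left hfv
  refine (b.J_isClosed (hUb hw.1)).mem_of_tendsto h2 ?_
  filter_upwards [h1 hv, hfe] with p hp hp'
  rw [b.J_eq_of_convex hτ hU hUc hUb hw ⟨hp, hp'.1⟩, ← hp'.2]
  exact b.z_mem_J (b.mem_base_iff.1 (by rw [hp'.2]; exact hUb hp))

/-- Approach `v` along the segment from `w`, on which the vertical range is constant, at the fixed
height `z`. With `z_mem_J_of_limFib` this identifies the limit fibre over `v` with the vertical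
range over any interior point of `U`. -/
lemma Box.limFib_pt [Nonempty N] (hτ : F.IsAdapted) (b : F.Box) {e : BCell B} {U : Set e.Par}
    (hU : Convex ℝ U) (hUc : U ⊆ e.cube) (hUb : MapsTo e.chr U b.base) {v w : e.Par}
    (hv : v ∈ U) (hw : w ∈ U ∩ e.int) {z : ℝ} (hz : z ∈ b.J (e.chr w)) :
    (b.qB (e.chr v), z) ∈ b.rng ∧ (v, b.pt (b.qB (e.chr v), z)) ∈ F.limFib e := by
  let c : ℝ → e.Par := fun t => v + t • (w - v)
  have hc : Continuous c := by fun_prop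
  have hcU : ∀ t ∈ Ioc (0 : ℝ) 1, c t ∈ U ∩ e.int := fun t ht => segment_mem_int hU hUc hv hw ht
  have hc0 : c 0 = v := by simp [c]
  have hq : ContinuousOn (fun v => b.qB (e.chr v)) U :=
    b.continuousOn_qB.comp (e.continuousOn_chr.mono hUc) hUb
  have hct : Tendsto c (𝓝[Ioc 0 1] 0) (𝓝[U] v) := by
    refine tendsto_nhdsWithin_iff.2 ⟨?_, ?_⟩
    · rw [← hc0]; exact hc.continuousWithinAt
    · filter_upwards [self_mem_nhdsWithin] with t ht using (hcU t ht).1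
  have hqt : Tendsto (fun t => (b.qB (e.chr (c t)), z)) (𝓝[Ioc (0 : ℝ) 1] 0)
      (𝓝 (b.qB (e.chr v), z)) :=
    ((hq v hv).tendsto.comp hct).prodMk_nhds tendsto_const_nhds
  have hJ : ∀ t ∈ Ioc (0 : ℝ) 1, z ∈ b.J (e.chr (c t)) := fun t ht => by
    rwa [b.J_eq_of_convex hτ hU hUc hUb (hcU t ht) hw]
  have hne : (𝓝[Ioc (0 : ℝ) 1] 0).NeBot := by
    rw [← mem_closure_iff_nhdsWithin_neBot, closure_Ioc one_ne_zero.symm]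
    exact ⟨le_rfl, zero_le_one⟩
  have hr : (b.qB (e.chr v), z) ∈ b.rng := by
    refine ⟨?_, b.dist_qB_lt (hUb hv), (b.rng_of_J hz).2.2⟩
    refine isClosed_modelN.mem_of_tendsto hqt ?_
    filter_upwards [self_mem_nhdsWithin] with t ht
    exact (b.rng_of_J (hJ t ht)).1
  refine ⟨hr, ?_⟩
  have h2 : Tendsto (fun t => b.pt (b.qB (e.chr (c t)), z)) (𝓝[Ioc (0 : ℝ) 1] 0)
      (𝓝 (b.pt (b.qB (e.chr v), z))) := by
    refine (b.continuousOn_pt _ hr).tendsto.comp (tendsto_nhdsWithin_iff.2 ⟨hqt, ?_⟩)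
    filter_upwards [self_mem_nhdsWithin] with t ht using b.rng_of_J (hJ t ht)
  refine (isClosed_limFib e).mem_of_tendsto
    ((hct.mono_right nhdsWithin_le_nhds).prodMk_nhds h2) ?_
  filter_upwards [self_mem_nhdsWithin] with t ht
  exact mem_limFib_of_int (hcU t ht).2 (b.π_pt_of_J (hJ t ht))

lemma exists_convex_nhd {b : F.Box} {e : BCell B} {v : e.Par}
    (hv : v ∈ e.cube) (hb : e.chr v ∈ b.base) :
    ∃ U, Convex ℝ U ∧ U ⊆ e.cube ∧ MapsTo e.chr U b.base ∧ U ∈ 𝓝[e.cube] v ∧ v ∈ U ∧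
      (U ∩ e.int).Nonempty := by
  have h1 : ∀ᶠ w in 𝓝[e.cube] v, e.chr w ∈ b.base :=
    (e.continuousOn_chr v hv).eventually (b.isOpen_base.mem_nhds hb)
  rw [eventually_nhdsWithin_iff] at h1
  obtain ⟨δ, hδ, h1⟩ := Metric.eventually_nhds_iff_ball.1 h1
  have hvc : v ∈ closure e.int := by rwa [closure_ball _ one_ne_zero]
  refine ⟨Metric.ball v δ ∩ e.cube, (convex_ball _ _).inter (convex_closedBall _ _),
    inter_subset_right, fun w hw => h1 w hw.1 hw.2,
    inter_mem (nhdsWithin_le_nhds (ball_mem_nhds _ hδ)) self_mem_nhdsWithin,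
    ⟨Metric.mem_ball_self hδ, hv⟩, ?_⟩
  obtain ⟨w, hw, hw'⟩ := mem_closure_iff_nhds.1 hvc _ (ball_mem_nhds v hδ)
  exact ⟨w, ⟨hw, ball_subset_closedBall hw'⟩, hw'⟩

/-- The limit of fibres over a cell is open over the closed parameter cube. -/
lemma limFib_open (hτ : F.IsAdapted) {e : BCell B} {v : e.Par} {m : N}
    (h : (v, m) ∈ F.limFib e) {V : Set N} (hV : V ∈ 𝓝 m) :
    ∀ᶠ w in 𝓝[e.cube] v, ∃ m' ∈ V, (w, m') ∈ F.limFib e := by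
  have : Nonempty N := ⟨m⟩
  have hvm := limFib_subset h
  obtain ⟨b, hb⟩ := exists_box F (e.chr v)
  have hm := (hb m hvm.2).1
  have hvb : e.chr v ∈ b.base := ⟨m, hm, hvm.2⟩
  obtain ⟨U, hU, hUc, hUb, hUv, hvU, w, hw⟩ := exists_convex_nhd hvm.1 hvb
  have hz := b.z_mem_J_of_limFib hτ hU hUc hUb hUv hw h
  have hq : ContinuousWithinAt (fun v => b.qB (e.chr v)) U v :=
    (b.continuousOn_qB.comp (e.continuousOn_chr.mono hUc) hUb) v hvU
  have h1 : Tendsto (fun v' => b.pt (b.qB (e.chr v'), b.z m)) (𝓝[U] v) (𝓝 m) := by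
    have hr := b.limFib_pt hτ hU hUc hUb hvU hw hz
    have h2 : Tendsto (fun v' => (b.qB (e.chr v'), b.z m)) (𝓝[U] v)
        (𝓝[b.rng] (b.qB (e.chr v), b.z m)) := by
      refine tendsto_nhdsWithin_iff.2 ⟨hq.tendsto.prodMk_nhds tendsto_const_nhds, ?_⟩
      filter_upwards [self_mem_nhdsWithin] with v' hv'
      exact (b.limFib_pt hτ hU hUc hUb hv' hw hz).1
    have h3 := (b.continuousOn_pt _ hr.1).tendsto.comp h2
    have h4 : b.pt (b.qB (e.chr v), b.z m) = m := by
      rw [← hvm.2, b.qB_π hm, b.pt_qz hm]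
    rwa [h4] at h3
  have hle : 𝓝[e.cube] v ≤ 𝓝[U] v := le_inf nhdsWithin_le_nhds (le_principal_iff.2 hUv)
  filter_upwards [hle (h1 hV), hUv] with v' h2 h3
  exact ⟨_, h2, (b.limFib_pt hτ hU hUc hUb h3 hw hz).2⟩

omit [CompactSpace N] in
/-- Sliding along fibres preserves limits of fibres. -/
lemma limFib_slide {e : BCell B} {v : e.Par} {m : N} (h : (v, m) ∈ F.limFib e) {V : Set N}
    (hV : V ∈ 𝓝 m) {r : N → N} (hr : ContinuousAt r m) (hπ : ∀ n ∈ V, F.π (r n) = F.π n) :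
    (v, r m) ∈ F.limFib e := by
  obtain ⟨f, hf, hfv, hfe⟩ := exists_seq_of_mem_limFib h
  have h1 : Tendsto (fun p : e.Par × N => p.2) f (𝓝 m) := (continuous_snd.tendsto (v, m)).mono_left hfv
  have h2 : Tendsto (fun p : e.Par × N => p.1) f (𝓝 v) := (continuous_fst.tendsto (v, m)).mono_left hfv
  refine mem_closure_of_tendsto (h2.prodMk_nhds (hr.tendsto.comp h1)) ?_
  filter_upwards [hfe, h1 hV] with p hp hp'
  exact ⟨hp.1, by simp only [Function.comp_apply]; rw [hπ _ hp', hp.2]⟩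

end FibredNbhd
end BranchedSurface

/-! ### Path lifting, and lifts of closed cells into complete surfaces -/

namespace BranchedSurface

/-- Lifting of paths through a local homeomorphism, when partial lifts have end points. -/
lemma exists_path_lift {E X : Type*} [TopologicalSpace E] [TopologicalSpace X] [T2Space E]
    [T2Space X] {p : E → X} (hp : IsLocalHomeomorph p) {c : ℝ → X} (hc : ContinuousOn c (Icc 0 1))
    (hcomp : ∀ t ∈ Ioc (0 : ℝ) 1, ∀ g : ℝ → E, ContinuousOn g (Ico 0 t) →
      (∀ s ∈ Ico 0 t, p (g s) = c s) → ∃ y, Tendsto g (𝓝[<] t) (𝓝 y))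
    {y₀ : E} (h₀ : p y₀ = c 0) :
    ∃ g : ℝ → E, ContinuousOn g (Icc 0 1) ∧ (∀ s ∈ Icc (0 : ℝ) 1, p (g s) = c s) ∧ g 0 = y₀ := by
  classical
  have sep : IsSeparatedMap p := T2Space.isSeparatedMap p
  have inj := hp.isLocallyInjective
  let P : ℝ → (ℝ → E) → Prop := fun t g =>
    ContinuousOn g (Icc 0 t) ∧ (∀ s ∈ Icc 0 t, p (g s) = c s) ∧ g 0 = y₀
  let A : Set ℝ := {t | t ∈ Icc (0 : ℝ) 1 ∧ ∃ g, P t g}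
  have hPmono : ∀ {s t g}, s ≤ t → P t g → P s g := fun hst h =>
    ⟨h.1.mono (Icc_subset_Icc_right hst), fun u hu => h.2.1 u ⟨hu.1, hu.2.trans hst⟩, h.2.2⟩
  have huniq : ∀ {t g g'}, 0 ≤ t → P t g → P t g' → EqOn g g' (Icc 0 t) := by
    intro t g g' ht h h'
    refine sep.eqOn_of_comp_eqOn inj isPreconnected_Icc h.1 h'.1 (fun s hs => ?_)
      (left_mem_Icc.2 ht) (h.2.2.trans h'.2.2.symm)
    simp only [Function.comp_apply]
    rw [h.2.1 s hs, h'.2.1 s hs]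
  have h0A : (0 : ℝ) ∈ A := by
    refine ⟨⟨le_rfl, zero_le_one⟩, fun _ => y₀, continuousOn_const, fun s hs => ?_, rfl⟩
    rw [Icc_self, mem_singleton_iff] at hs; rw [hs, h₀]
  have hbdd : BddAbove A := ⟨1, fun t ht => ht.1.2⟩
  set T := sSup A with hT
  have hT0 : 0 ≤ T := le_csSup hbdd h0A
  have hT1 : T ≤ 1 := csSup_le ⟨0, h0A⟩ fun t ht => ht.1.2
  have hlt : ∀ t, 0 ≤ t → t < T → ∃ g, P t g := by
    intro t ht htT
    obtain ⟨s, hs, hts⟩ := exists_lt_of_lt_csSup ⟨0, h0A⟩ htT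
    exact ⟨hs.2.choose, hPmono hts.le hs.2.choose_spec⟩
  -- the lift exists on `[0, T]`
  have hTA : ∃ g, P T g := by
    rcases hT0.eq_or_lt with h | h
    · rw [← h]; exact h0A.2
    have : Nonempty (ℝ → E) := ⟨fun _ => y₀⟩
    choose! g hg using hlt
    -- By uniqueness the partial lifts glue to a lift on `[0, T)`; the hypothesis `hcomp` then
    -- provides its value at `T`.
    let G : ℝ → E := fun t => g t t
    have hG : ∀ t, 0 ≤ t → t < T → EqOn G (g t) (Icc 0 t) := fun t ht htT s hs =>
      huniq hs.1 (hg s hs.1 (hs.2.trans_lt htT)) (hPmono hs.2 (hg t ht htT)) ⟨hs.1, le_rfl⟩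
    have hGc : ContinuousOn G (Ico 0 T) := by
      intro s hs
      obtain ⟨t, hst, htT⟩ := exists_between hs.2
      have ht0 := hs.1.trans hst.le
      have h1 : ContinuousWithinAt G (Icc 0 t) s :=
        ((hg t ht0 htT).1.congr (hG t ht0 htT)) s ⟨hs.1, hst.le⟩
      refine h1.mono_of_mem_nhdsWithin ?_
      filter_upwards [self_mem_nhdsWithin, nhdsWithin_le_nhds (Iio_mem_nhds hst)] with u hu hu'
      exact ⟨hu.1, le_of_lt hu'⟩
    have hGp : ∀ s ∈ Ico 0 T, p (G s) = c s := fun s hs =>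
      (hg s hs.1 hs.2).2.1 s ⟨hs.1, le_rfl⟩
    obtain ⟨y, hy⟩ := hcomp T ⟨h, hT1⟩ G hGc hGp
    have hcT : Tendsto c (𝓝[<] T) (𝓝 (c T)) := by
      have h1 : ContinuousWithinAt c (Icc 0 1) T := hc T ⟨hT0, hT1⟩
      refine h1.mono_of_mem_nhdsWithin ?_
      filter_upwards [self_mem_nhdsWithin, nhdsWithin_le_nhds (Ioi_mem_nhds h)] with u hu hu'
      exact ⟨le_of_lt hu', (le_of_lt hu).trans hT1⟩
    have hpy : p y = c T := by
      refine tendsto_nhds_unique ((hp.continuous.tendsto y).comp hy) (hcT.congr' ?_)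
      filter_upwards [self_mem_nhdsWithin, nhdsWithin_le_nhds (Ioi_mem_nhds h)] with u hu hu'
      exact (hGp u ⟨le_of_lt hu', hu⟩).symm
    refine ⟨Function.update G T y, ?_, ?_, ?_⟩
    · have h1 : Icc 0 T \ {T} = Ico 0 T := Icc_sdiff_right
      rw [continuousOn_update_iff, h1]
      refine ⟨hGc, fun _ => ?_⟩
      exact hy.mono_left (nhdsWithin_mono _ fun u hu => hu.2)
    · intro s hs
      rcases hs.2.eq_or_lt with h2 | h2
      · rw [h2, Function.update_self, hpy]
      · rw [Function.update_of_ne h2.ne, hGp s ⟨hs.1, h2⟩]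
    · rw [Function.update_of_ne h.ne]
      exact (hg 0 le_rfl h).2.2
  obtain ⟨g, hg⟩ := hTA
  -- A local inverse of `p` at `g T` would continue the lift beyond `T < 1`.
  have hT1' : T = 1 := by
    by_contra hne
    have hlt1 : T < 1 := lt_of_le_of_ne hT1 hne
    obtain ⟨q, hq, hqp⟩ := hp (g T)
    have h1 : ContinuousWithinAt c (Icc 0 1) T := hc T ⟨hT0, hT1⟩
    have h2 : q.target ∈ 𝓝 (c T) := by
      rw [← hg.2.1 T ⟨hT0, le_rfl⟩, hqp]
      exact q.open_target.mem_nhds (q.map_source hq)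
    obtain ⟨δ, hδ, hδ'⟩ := Metric.mem_nhdsWithin_iff.1 (h1 h2)
    obtain ⟨u, hTu, hu⟩ := exists_between (lt_min hlt1 (lt_add_of_pos_right T hδ))
    have hu1 : u < 1 := hu.trans_le (min_le_left _ _)
    have hsub : Icc T u ⊆ c ⁻¹' q.target := fun s hs => hδ' ⟨by
      rw [Metric.mem_ball, Real.dist_eq, abs_lt]
      have := hu.trans_le (min_le_right 1 (T + δ))
      constructor <;> linarith [hs.1, hs.2], ⟨hT0.trans hs.1, hs.2.trans hu1.le⟩⟩
    have hcq : q.symm (c T) = g T := by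
      rw [← hg.2.1 T ⟨hT0, le_rfl⟩, hqp]; exact q.left_inv hq
    have huA : u ∈ A := by
      refine ⟨⟨hT0.trans hTu.le, hu1.le⟩, fun s => if s ≤ T then g s else q.symm (c s), ?_, ?_, ?_⟩
      · refine ContinuousOn.if ?_ ?_ ?_
        · rintro s ⟨hs, hs'⟩
          have : s = T := by
            have h3 := frontier_le_subset_eq continuous_id continuous_const hs'
            exact h3
          rw [this, hcq]
        · refine hg.1.mono ?_
          rintro s ⟨hs, hs'⟩
          have h3 : s ≤ T := closure_minimal (fun _ h => h) isClosed_Iic hs'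
          exact ⟨hs.1, h3⟩
        · have hcc : ContinuousOn (fun s => q.symm (c s)) (Icc T u) :=
            q.symm.continuousOn.comp (hc.mono fun s hs =>
              ⟨hT0.trans hs.1, hs.2.trans hu1.le⟩) hsub
          refine hcc.mono ?_
          rintro s ⟨hs, hs'⟩
          refine ⟨?_, hs.2⟩
          have : closure {s : ℝ | ¬ s ≤ T} ⊆ Ici T := by
            refine closure_minimal (fun s hs => ?_) isClosed_Ici
            exact le_of_lt (not_le.1 hs)
          exact this hs'
      · intro s hs
        by_cases h3 : s ≤ T
        · simp only [if_pos h3]; exact hg.2.1 s ⟨hs.1, h3⟩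
        · simp only [if_neg h3]
          have h4 := hsub ⟨(not_le.1 h3).le, hs.2⟩
          rw [hqp]; exact q.right_inv h4
      · simp only [if_pos hT0]; exact hg.2.2
    exact absurd (le_csSup hbdd huA) (not_le.2 hTu)
  rw [hT1'] at hg
  exact ⟨g, hg⟩

namespace FibredNbhd

variable {N B : Type*} [TopologicalSpace N] [TopologicalSpace B] {F : FibredNbhd N B}

/-! ### First properties of splitting surfaces -/

lemma IsSplittingSurface.locInj {S : Set N} (hS : F.IsSplittingSurface S) : F.LocInj S := by
  intro s hs
  by_cases h : s ∈ F.core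
  · obtain ⟨D, hD, -, -, V, hV, hDV⟩ := hS.halfPlaque s h
    exact ⟨V, hV, hD.injOn.mono hDV⟩
  · obtain ⟨D, hD, -, -, V, hV, hDV⟩ := hS.plaque s hs h
    exact ⟨V, hV, hD.injOn.mono hDV⟩

lemma IsSplittingSurface.fullAt {S : Set N} (hS : F.IsSplittingSurface S) {s : N} (hs : s ∈ S) :
    F.FullAt S s := by
  by_cases h : s ∈ F.core
  · obtain ⟨D, hD, hsD, hDS, -⟩ := hS.halfPlaque s h
    exact (hD.fullAt hsD).mono hDS
  · obtain ⟨D, hD, hsD, hDS, -⟩ := hS.plaque s hs h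
    exact (hD.fullAt hsD).mono hDS

/-- The fibred neighbourhood meets `∂ᵥN` only in its interior, and plaques never reach that
interior. So only points of the pared locus remain. -/
lemma IsSplittingSurface.inter_vert {S : Set N} (hS : F.IsSplittingSurface S) :
    S ∩ F.vert = F.core := by
  obtain ⟨W, hW⟩ := hS.exists_nbhd
  apply Subset.antisymm
  · rintro s ⟨hs, hv⟩
    have : s ∈ F.vertInterior := by rw [← hW.inter_vert]; exact ⟨hW.subset hs, hv⟩
    by_contra h
    obtain ⟨D, hD, hsD, -⟩ := hS.plaque s hs h
    exact hD.not_mem_vertInterior hsD this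
  · exact fun s hs => ⟨hS.core_subset hs, vertInterior_subset_vert (core_subset_vertInterior hs)⟩

variable [CWComplex (univ : Set B)] [T2Space B]

lemma IsLift.mem_limFib {c : Set N} {e : BCell B} {l : e.Par → N} (hl : F.IsLift c e l)
    {v : e.Par} (hv : v ∈ e.cube) : (v, l v) ∈ F.limFib e := by
  have hv' : v ∈ closure e.int := by rwa [closure_ball _ one_ne_zero]
  have h1 : ContinuousWithinAt (fun w => (w, l w)) e.int v :=
    continuousWithinAt_id.prodMk ((hl.continuousOn v hv).mono ball_subset_closedBall)
  have h2 : MapsTo (fun w => (w, l w)) e.int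
      {p : e.Par × N | p.1 ∈ e.int ∧ F.π p.2 = e.chr p.1} :=
    fun w hw => ⟨hw, hl.π_eq w (ball_subset_closedBall hw)⟩
  exact h1.mem_closure hv' h2

variable [CompactSpace N] [T2Space N]

set_option maxHeartbeats 1000000 in
/-- Lifts of closed cells to a complete transverse surface. -/
lemma exists_lift_of_complete (hτ : F.IsAdapted) {S : Set N} (hi : F.LocInj S)
    (hf : ∀ s ∈ S, F.FullAt S s)
    (hcomp : ∀ γ : ℝ → N, ContinuousOn γ (Ico 0 1) → MapsTo γ (Ico 0 1) S →
      (∃ x, Tendsto (fun t => F.π (γ t)) (𝓝[<] 1) (𝓝 x)) → ∃ s ∈ S, Tendsto γ (𝓝[<] 1) (𝓝 s))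
    {e : BCell B} {v₀ : e.Par} {s₀ : N} (h : (v₀, s₀) ∈ F.limFib e) (hs₀ : s₀ ∈ S) :
    ∃ l, F.IsLift S e l ∧ l v₀ = s₀ := by
  -- This is the pull-back of `S` to the parameter cube, restricted to limits of fibres over the
  -- open cell. Without the restriction `pr` could fail to be open over the frontier, at points of
  -- `S` from which no fibre continues into the cell.
  let E := {p : e.Par × N // p ∈ F.limFib e ∧ p.2 ∈ S}
  let pr : E → e.cube := fun p => ⟨p.1.1, (limFib_subset p.2.1).1⟩
  have hprc : Continuous pr := (continuous_fst.comp continuous_subtype_val).subtype_mk _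
  -- `limFib_open` finds a nearby point in the limit fibre, and the slide `r` moves it into `S`
  -- without leaving the limit fibre.
  have hopen : IsOpenMap pr := by
    rw [isOpenMap_iff_nhds_le]
    rintro ⟨⟨v, s⟩, hvs, hs⟩ O hO
    rw [Filter.mem_map, nhds_subtype_eq_comap, mem_comap] at hO
    obtain ⟨O', hO', hsub⟩ := hO
    rw [nhds_prod_eq, Filter.mem_prod_iff] at hO'
    obtain ⟨A, hA, C, hC, hAC⟩ := hO'
    obtain ⟨V, hV, r, hr, hrs, hrV⟩ := hf s hs
    have hrc : ContinuousAt r s := hr.continuousAt hV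
    have hC' : interior V ∩ r ⁻¹' C ∈ 𝓝 s :=
      inter_mem (interior_mem_nhds.2 hV) (hrc (by rw [hrs]; exact hC))
    have := limFib_open hτ hvs hC'
    rw [nhds_subtype_eq_comap, mem_comap]
    rw [eventually_nhdsWithin_iff] at this
    refine ⟨A ∩ {w | w ∈ e.cube → ∃ m' ∈ interior V ∩ r ⁻¹' C, (w, m') ∈ F.limFib e},
      inter_mem hA this, ?_⟩
    rintro ⟨w, hw⟩ ⟨hwA, hw'⟩
    obtain ⟨m, ⟨hmV, hmC⟩, hm⟩ := hw' hw
    have hVm : V ∈ 𝓝 m := mem_interior_iff_mem_nhds.1 hmV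
    have h1 := limFib_slide hm hVm (hr.continuousAt hVm) fun n hn => (hrV n hn).2
    exact hsub (show (⟨(w, r m), h1, (hrV m (interior_subset hmV)).1⟩ : E) ∈ _ from
      hAC ⟨hwA, hmC⟩)
  have hloc : IsLocalHomeomorph pr := by
    rw [isLocalHomeomorph_iff_isOpenEmbedding_restrict]
    rintro ⟨⟨v, s⟩, hvs, hs⟩
    obtain ⟨V, hV, hVi⟩ := hi s hs
    let U : Set E := {p | p.1.2 ∈ interior V}
    have hU : IsOpen U := isOpen_interior.preimage (continuous_snd.comp continuous_subtype_val)
    refine ⟨U, hU.mem_nhds (mem_interior_iff_mem_nhds.2 hV), ?_⟩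
    refine IsOpenEmbedding.of_continuous_injective_isOpenMap
      (hprc.comp continuous_subtype_val) ?_ (hopen.domRestrict hU)
    rintro ⟨⟨⟨v1, s1⟩, h1, h1'⟩, hU1⟩ ⟨⟨⟨v2, s2⟩, h2, h2'⟩, hU2⟩ h12
    have hv : v1 = v2 := congrArg Subtype.val h12
    subst hv
    have : s1 = s2 := hVi ⟨h1', interior_subset hU1⟩ ⟨h2', interior_subset hU2⟩
      ((limFib_subset h1).2.trans (limFib_subset h2).2.symm)
    subst this
    rfl
  have hv₀ := (limFib_subset h).1
  let y₀ : E := ⟨(v₀, s₀), h, hs₀⟩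
  have hseg : ∀ w ∈ e.cube, ∀ t ∈ Icc (0 : ℝ) 1, v₀ + t • (w - v₀) ∈ e.cube := by
    intro w hw t ht
    have := (convex_closedBall (0 : e.Par) 1).add_smul_sub_mem hv₀ hw ht
    exact this
  have hlift : ∀ w : e.cube, ∃ g : ℝ → E, ContinuousOn g (Icc 0 1) ∧
      (∀ t ∈ Icc (0 : ℝ) 1, (g t).1.1 = v₀ + t • (w.1 - v₀)) ∧ g 0 = y₀ := by
    intro w
    let c : ℝ → e.cube := fun t => ⟨v₀ + (projIcc (0 : ℝ) 1 zero_le_one t : ℝ) • (w.1 - v₀),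
      hseg w w.2 _ (projIcc (0 : ℝ) 1 zero_le_one t).2⟩
    have hc : Continuous c := by
      refine Continuous.subtype_mk ?_ _
      exact continuous_const.add ((continuous_subtype_val.comp continuous_projIcc).smul
        continuous_const)
    have hc1 : ∀ t ∈ Icc (0 : ℝ) 1, (c t).1 = v₀ + t • (w.1 - v₀) := fun t ht => by
      simp only [c, projIcc_of_mem zero_le_one ht]
    suffices H : ∀ t ∈ Ioc (0 : ℝ) 1, ∀ g : ℝ → E, ContinuousOn g (Ico 0 t) →
        (∀ s ∈ Ico 0 t, pr (g s) = c s) → ∃ y, Tendsto g (𝓝[<] t) (𝓝 y) by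
      obtain ⟨g, hg1, hg2, hg3⟩ := exists_path_lift hloc hc.continuousOn H (y₀ := y₀)
        (Subtype.ext (by rw [hc1 0 ⟨le_rfl, zero_le_one⟩, zero_smul, add_zero]))
      exact ⟨g, hg1, fun t ht => by rw [← hc1 t ht, ← hg2 t ht], hg3⟩
    · intro t ht g hg hgl
      -- Completeness is formulated for paths on `[0, 1)`, so the partial lift on `[0, t)` is
      -- rescaled.
      have htend : Tendsto (fun u : ℝ => t * u) (𝓝[<] 1) (𝓝[<] t) := by
        refine tendsto_nhdsWithin_iff.2 ⟨?_, ?_⟩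
        · have : Tendsto (fun u : ℝ => t * u) (𝓝 1) (𝓝 (t * 1)) := by
            exact (continuous_const.mul continuous_id).tendsto 1
          rw [mul_one] at this
          exact this.mono_left nhdsWithin_le_nhds
        · filter_upwards [self_mem_nhdsWithin] with u hu
          have : u < 1 := hu
          show t * u < t
          nlinarith [ht.1]
      have hmaps : MapsTo (fun u : ℝ => t * u) (Ico 0 1) (Ico 0 t) := fun u hu =>
        ⟨mul_nonneg ht.1.le hu.1, by nlinarith [ht.1, hu.2]⟩
      suffices H : ∃ s ∈ S, Tendsto (fun u => (g (t * u)).1.2) (𝓝[<] 1) (𝓝 s) by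
        obtain ⟨s, hs, hs'⟩ := H
        have hrev : Tendsto (fun u : ℝ => u / t) (𝓝[<] t) (𝓝[<] 1) := by
          refine tendsto_nhdsWithin_iff.2 ⟨?_, ?_⟩
          · have : Tendsto (fun u : ℝ => u / t) (𝓝 t) (𝓝 (t / t)) :=
              (continuous_id.div_const t).tendsto t
            rw [div_self ht.1.ne'] at this
            exact this.mono_left nhdsWithin_le_nhds
          · filter_upwards [self_mem_nhdsWithin] with u hu
            exact (div_lt_one ht.1).2 hu
        have h2 : Tendsto (fun u => (g u).1.2) (𝓝[<] t) (𝓝 s) := by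
          refine (hs'.comp hrev).congr fun u => ?_
          simp only [Function.comp_apply]
          rw [mul_div_cancel₀ _ ht.1.ne']
        have h1 : Tendsto (fun u => (g u).1.1) (𝓝[<] t) (𝓝 (c t).1) := by
          have : Tendsto (fun u => (c u).1) (𝓝[<] t) (𝓝 (c t).1) :=
            ((continuous_subtype_val.comp hc).tendsto t).mono_left nhdsWithin_le_nhds
          refine this.congr' ?_
          filter_upwards [self_mem_nhdsWithin, nhdsWithin_le_nhds (Ioi_mem_nhds ht.1)] with u hu hu'
          rw [← hgl u ⟨le_of_lt hu', hu⟩]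
        have h3 : Tendsto (fun u => (g u).1) (𝓝[<] t) (𝓝 ((c t).1, s)) := h1.prodMk_nhds h2
        have h4 : ((c t).1, s) ∈ F.limFib e :=
          (isClosed_limFib e).mem_of_tendsto h3 (Eventually.of_forall fun u => (g u).2.1)
        exact ⟨⟨_, h4, hs⟩, tendsto_subtype_rng.2 h3⟩
      refine hcomp (fun u => (g (t * u)).1.2) ?_ ?_ ⟨e.chr (c t), ?_⟩
      · exact (continuous_snd.comp continuous_subtype_val).comp_continuousOn
          (hg.comp (continuous_const.mul continuous_id).continuousOn hmaps)
      · exact fun u hu => (g (t * u)).2.2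
      · have h1 : Tendsto (fun u : ℝ => e.chr (c (t * u)).1) (𝓝[<] 1) (𝓝 (e.chr (c t).1)) := by
          have h2 : Continuous fun u => e.chr (c u).1 :=
            e.continuousOn_chr.comp_continuous (continuous_subtype_val.comp hc) fun u => (c u).2
          exact ((h2.tendsto t).mono_left nhdsWithin_le_nhds).comp htend
        refine h1.congr' ?_
        have h0 : ∀ᶠ u : ℝ in 𝓝[<] 1, 0 ≤ u := nhdsWithin_le_nhds (Ici_mem_nhds one_pos)
        filter_upwards [self_mem_nhdsWithin, h0] with u hu hu'
        rw [(limFib_subset (g (t * u)).2.1).2, ← hgl _ (hmaps ⟨hu', hu⟩)]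
  choose g hg1 hg2 hg3 using hlift
  -- The lifts of the radial paths from `v₀` depend continuously on the end point, because `pr` is a
  -- separated local homeomorphism; their values at time 1 form the lift of the cell.
  let f : C(unitInterval × e.cube, e.cube) := ⟨fun p => ⟨v₀ + (p.1 : ℝ) • (p.2.1 - v₀),
    hseg _ p.2.2 _ p.1.2⟩, by
      refine Continuous.subtype_mk ?_ _
      fun_prop⟩
  have hcont := hloc.continuous_lift (T2Space.isSeparatedMap pr) f
    (g := fun p => g p.2 p.1) (by
      funext p
      refine Subtype.ext ?_
      exact hg2 p.2 p.1 p.1.2) (by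
      have : (fun w : e.cube => g w ((0 : unitInterval) : ℝ)) = fun _ => y₀ := by
        funext w; exact hg3 w
      simpa using (continuous_const : Continuous fun _ : e.cube => y₀).congr fun w => (hg3 w).symm)
    (fun w => (hg1 w).comp_continuous continuous_subtype_val fun t => t.2)
  let l : e.cube → E := fun w => g w 1
  have hlc : Continuous l := hcont.comp ((continuous_const (y := (1 : unitInterval))).prodMk continuous_id)
  have hl1 : ∀ w : e.cube, (l w).1.1 = w := fun w => by
    have := hg2 w 1 ⟨zero_le_one, le_rfl⟩
    rw [one_smul, add_sub_cancel] at this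
    exact this
  classical
  refine ⟨fun w => if hw : w ∈ e.cube then (l ⟨w, hw⟩).1.2 else s₀, ⟨?_, ?_, ?_⟩, ?_⟩
  · rw [continuousOn_iff_continuous_domRestrict]
    have := (continuous_snd.comp continuous_subtype_val).comp hlc
    convert! this using 1
    ext w
    exact dif_pos w.2
  · intro w hw
    simp only [dif_pos hw]; exact (l ⟨w, hw⟩).2.2
  · intro w hw
    simp only [dif_pos hw]
    rw [(limFib_subset (l ⟨w, hw⟩).2.1).2, hl1]
  · simp only [dif_pos hv₀]
    have hconst : EqOn (g ⟨v₀, hv₀⟩) (fun _ => y₀) (Icc 0 1) := by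
      refine (T2Space.isSeparatedMap pr).eqOn_of_comp_eqOn hloc.isLocallyInjective
        isPreconnected_Icc (hg1 _) continuousOn_const (fun t ht => Subtype.ext ?_)
        (left_mem_Icc.2 zero_le_one) (hg3 _)
      have := hg2 ⟨v₀, hv₀⟩ t ht
      rw [sub_self, smul_zero, add_zero] at this
      exact this
    show (g ⟨v₀, hv₀⟩ 1).1.2 = s₀
    rw [hconst ⟨zero_le_one, le_rfl⟩]

end FibredNbhd
end BranchedSurface

namespace BranchedSurface
namespace FibredNbhd

variable {N B : Type*} [TopologicalSpace N] [TopologicalSpace B] {F : FibredNbhd N B}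

/-! ### Further properties of plaques, the vertical boundary and the pared locus -/

lemma IsPlaque.exists_subset {D O : Set N} (hD : F.IsPlaque D) {s : N} (hs : s ∈ D)
    (hO : O ∈ 𝓝 s) : ∃ D', F.IsPlaque D' ∧ s ∈ D' ∧ D' ⊆ D ∧ D' ⊆ O := by
  obtain ⟨φ, hφ, R, g, hR, hg, hgm, rfl⟩ := hD
  obtain ⟨hs1, hs2, hs3⟩ := hs
  have h1 : φ.symm ⁻¹' O ∈ 𝓝 (φ s) :=
    φ.symm.continuousAt (φ.map_source hs1) (by rwa [φ.left_inv hs1])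
  rw [nhds_subtype_eq_comap, mem_comap] at h1
  obtain ⟨W, hW, hWO⟩ := h1
  have hR' := (continuousOn_id.prodMk hg).isOpen_inter_preimage hR (isOpen_interior (s := W))
  refine ⟨_, ⟨φ, hφ, _, g, hR', hg.mono inter_subset_left, fun q hq => hgm q hq.1, rfl⟩,
    ⟨hs1, ⟨hs2, ?_⟩, hs3⟩, fun n hn => ⟨hn.1, hn.2.1.1, hn.2.2⟩, ?_⟩
  · show ((φ s).1.1, g (φ s).1.1) ∈ interior W
    rw [← hs3]; exact mem_interior_iff_mem_nhds.2 hW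
  · rintro n ⟨hn1, ⟨-, hn2⟩, hn3⟩
    have h2 : ((φ n).1.1, g (φ n).1.1) ∈ interior W := hn2
    rw [← hn3] at h2
    have h4 := interior_subset h2
    have h3 : φ n ∈ φ.symm ⁻¹' O := hWO h4
    rwa [mem_preimage, φ.left_inv hn1] at h3

lemma isClosed_modelCore : IsClosed modelCore := by
  have h1 : Continuous fun t : (ℝ × ℝ) × ℝ => t.1.1 := by fun_prop
  have h2 : Continuous fun t : (ℝ × ℝ) × ℝ => t.1.2 := by fun_prop
  have h3 : Continuous fun t : (ℝ × ℝ) × ℝ => t.2 := by fun_prop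
  exact ((isClosed_eq h1 continuous_const).inter (isClosed_eq h3 continuous_const)).union
    ((isClosed_eq h2 continuous_const).inter (isClosed_eq h3 continuous_const))

lemma isClosed_core : IsClosed F.core := by
  rw [← isOpen_compl_iff, isOpen_iff_mem_nhds]
  intro n hn
  obtain ⟨φ, hφ, h⟩ := F.exists_flowBox n
  have h1 : (φ n : (ℝ × ℝ) × ℝ) ∈ modelCoreᶜ := fun h' => hn ((hφ.core_iff n h).2 h')
  filter_upwards [φ.open_source.mem_nhds h,
    continuousAt_flowBox h (isClosed_modelCore.isOpen_compl.mem_nhds h1)] with m hm hm'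
  exact fun h' => hm' ((hφ.core_iff m hm).1 h')

/-- Decreasing both horizontal coordinates never enters a slit, and it leaves both lines over which
the vertical boundary lies. Sliding the resulting points along their fibres into `S` keeps them off
these lines. -/
lemma FullAt.mem_closure_diff_vert {S : Set N} {p : N} (h : F.FullAt S p) :
    p ∈ closure (S \ F.vert) := by
  obtain ⟨V, hV, r, hr, hrp, hrV⟩ := h
  obtain ⟨φ, hφ, hp⟩ := F.exists_flowBox p
  have hmem : ∀ t : ℝ, ((((φ p).1.1.1 - |t|, (φ p).1.1.2 - |t|) : ℝ × ℝ), (φ p).1.2) ∈ modelN := by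
    intro t
    obtain ⟨h1, h2, h3⟩ := (φ p).2
    have := abs_nonneg t
    exact ⟨h1, fun h => h2 ⟨by linarith [h.1], h.2⟩, fun h => h3 ⟨by linarith [h.1], h.2⟩⟩
  let μ : ℝ → modelN := fun t => ⟨_, hmem t⟩
  have hμ : Continuous μ := by
    refine Continuous.subtype_mk ?_ _
    fun_prop
  have hμ0 : μ 0 = φ p := Subtype.ext (by simp [μ])
  have h1 : Tendsto (fun t => φ.symm (μ t)) (𝓝[>] 0) (𝓝 p) := by
    have h2 : Tendsto μ (𝓝[>] 0) (𝓝 (φ p)) := by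
      rw [← hμ0]; exact hμ.continuousAt.tendsto.mono_left nhdsWithin_le_nhds
    have h3 := (φ.symm.continuousAt (φ.map_source hp)).tendsto
    change Tendsto φ.symm _ (𝓝 (φ.symm (φ p))) at h3
    rw [φ.left_inv hp] at h3
    exact h3.comp h2
  have h2 : Tendsto (fun t => r (φ.symm (μ t))) (𝓝[>] 0) (𝓝 p) := by
    have h3 : Tendsto r (𝓝 p) (𝓝 p) := by
      have h4 : Tendsto r (𝓝 p) (𝓝 (r p)) := hr.continuousAt hV
      rwa [hrp] at h4
    exact h3.comp h1
  refine mem_closure_of_tendsto h2 ?_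
  have hne : ∀ a : ℝ, ∀ᶠ t in 𝓝[>] (0 : ℝ), a - t ≠ 0 := by
    intro a
    have h4 : ∀ᶠ t in 𝓝[≠] (0 : ℝ), t ≠ a := by
      by_cases h : a = 0
      · rw [h]; exact self_mem_nhdsWithin
      · exact nhdsWithin_le_nhds (isOpen_ne.mem_nhds (Ne.symm h))
    filter_upwards [nhdsWithin_mono _ (fun t (ht : 0 < t) => ne_of_gt ht) h4] with t ht h
    exact ht (by linarith)
  have htar : ∀ᶠ t in 𝓝[>] (0 : ℝ), μ t ∈ φ.target := by
    refine nhdsWithin_le_nhds (hμ.continuousAt ?_)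
    rw [hμ0]; exact φ.open_target.mem_nhds (φ.map_source hp)
  filter_upwards [h1 hV, hne (φ p).1.1.1, hne (φ p).1.1.2, self_mem_nhdsWithin, htar]
    with t ht ha hb ht0 ht'
  have ht0' : |t| = t := abs_of_pos ht0
  refine ⟨(hrV _ ht).1, fun hv => ?_⟩
  have hsrc := φ.map_target ht'
  have hsrc' : r (φ.symm (μ t)) ∈ φ.source := hφ.source_saturated _ hsrc _ (hrV _ ht).2
  have hq := ((hφ.fiber_iff _ hsrc' _ hsrc).1 (hrV _ ht).2).1
  rw [φ.right_inv ht'] at hq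
  have hq' : (φ (r (φ.symm (μ t)))).1.1 = ((φ p).1.1.1 - t, (φ p).1.1.2 - t) := by
    rw [hq]; simp only [μ, ht0']
  rcases (hφ.vert_iff _ hsrc').1 hv with h | h
  · exact ha (by rw [hq'] at h; exact h.1)
  · exact hb (by rw [hq'] at h; exact h.1)

variable [CWComplex (univ : Set B)] [T2Space B]

/-! ### Stars -/

/-- The union of `A` and of the closed cells of kind `P` of `S` meeting `A`. -/
def star (F : FibredNbhd N B) (S : Set N) (P : BCell B → Prop) (A : Set N) : Set N :=
  A ∪ {s | ∃ e l, F.IsLift S e l ∧ P e ∧ (∃ v ∈ e.cube, l v ∈ A) ∧ s ∈ l '' e.cube}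

lemma star_subset {S : Set N} {P : BCell B → Prop} {A : Set N} (h : A ⊆ S) : F.star S P A ⊆ S := by
  rintro s (hs | ⟨e, l, hl, -, -, v, hv, rfl⟩)
  · exact h hs
  · exact hl.mem v hv

lemma IsLift.image_subset_star {S : Set N} {P : BCell B → Prop} {A : Set N} {e : BCell B}
    {l : e.Par → N} (hl : F.IsLift S e l) (hP : P e) {v : e.Par} (hv : v ∈ e.cube) (h : l v ∈ A) :
    l '' e.cube ⊆ F.star S P A := fun _ hs => Or.inr ⟨e, l, hl, hP, ⟨v, hv, h⟩, hs⟩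

variable [T2Space N]

/-- If the common point is interior to `e'` as well, the cells coincide and uniqueness of lifts
applies. Otherwise it is on the frontier of `e'`, which lies in cells of lower dimension. -/
lemma IsLift.image_eq_or_lt {S : Set N} (hi : F.LocInj S) {e e' : BCell B} {l : e.Par → N}
    {l' : e'.Par → N} (hl : F.IsLift S e l) (hl' : F.IsLift S e' l') {v : e.Par} {v' : e'.Par}
    (hv : v ∈ e.int) (hv' : v' ∈ e'.cube) (h : l v = l' v') :
    l '' e.cube = l' '' e'.cube ∨ e.1 < e'.1 := by
  have hx : e.chr v = e'.chr v' := by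
    rw [← hl.π_eq v (ball_subset_closedBall hv), h, hl'.π_eq v' hv']
  rcases BCell.mem_ball_or_sphere hv' with h1 | h1
  · left
    have := BCell.eq_of_mem_op (e.chr_mem_op hv) (hx ▸ e'.chr_mem_op h1)
    subst this
    have := e.injOn_chr hv h1 hx
    subst this
    exact (hl.eqOn hi hl' hv' h).image_eq
  · right
    obtain ⟨e'', h2, h3⟩ := e'.chr_sphere h1
    have h4 : e'.chr v' ∈ e.op := by rw [← hx]; exact e.chr_mem_op hv
    rwa [BCell.eq_of_mem_op h4 h3]

variable [CompactSpace N]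

/-- A lift of `e` passes through every point of `A` over `e`, also for points of `A` over the
boundary of `e`. -/
def HasLifts (F : FibredNbhd N B) (S A : Set N) : Prop :=
  ∀ (e : BCell B) (v : e.Par) (s : N), (v, s) ∈ F.limFib e → s ∈ A → ∃ l, F.IsLift S e l ∧ l v = s

lemma IsLift.eventually_eq {S : Set N} (hi : F.LocInj S) {e : BCell B} {l : e.Par → N}
    (hl : F.IsLift S e l) {v : e.Par} (hv : v ∈ e.cube) :
    ∀ᶠ p in 𝓝 (v, l v), p ∈ F.limFib e → p.2 ∈ S → l p.1 = p.2 := by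
  obtain ⟨V, hV, hVi⟩ := hi _ (hl.mem v hv)
  have h1 := hl.continuousOn v hv hV
  rw [mem_map, mem_nhdsWithin_iff_eventually] at h1
  have h2 : ∀ᶠ p in 𝓝 (v, l v), p.1 ∈ e.cube → l p.1 ∈ V :=
    (continuous_fst.tendsto (v, l v)).eventually h1
  have h3 : ∀ᶠ p in 𝓝 (v, l v), p.2 ∈ V := (continuous_snd.tendsto (v, l v)).eventually hV
  filter_upwards [h2, h3] with p hp hp' hpl hpS
  have h4 := limFib_subset hpl
  exact hVi ⟨hl.mem _ h4.1, hp h4.1⟩ ⟨hpS, hp'⟩ ((hl.π_eq _ h4.1).trans h4.2.symm)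

/-- The part `Θ` of the limit fibration over `A` is compact. Near a point `(v, s)` of `Θ`, any lift
passing through `Θ` shares a point with the lift through `(v, s)`, and so equals it. -/
lemma finite_lifts {S A : Set N} (hi : F.LocInj S) (hA : IsCompact A) (hAS : A ⊆ S)
    (hL : F.HasLifts S A) (e : BCell B) :
    {K | ∃ l, F.IsLift S e l ∧ (∃ v ∈ e.cube, l v ∈ A) ∧ K = l '' e.cube}.Finite := by
  let Θ : Set (e.Par × N) := F.limFib e ∩ {p | p.2 ∈ A}
  have hΘ : IsCompact Θ :=
    (isCompact_limFib e).inter_right (hA.isClosed.preimage continuous_snd)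
  have key : {K | ∃ l, F.IsLift S e l ∧ (∃ v ∈ e.cube, (v, l v) ∈ Θ) ∧ K = l '' e.cube}.Finite := by
    refine hΘ.induction_on (p := fun T =>
      {K | ∃ l, F.IsLift S e l ∧ (∃ v ∈ e.cube, (v, l v) ∈ T) ∧ K = l '' e.cube}.Finite) ?_ ?_ ?_ ?_
    · simp
    · intro T T' hT h
      refine h.subset ?_
      rintro K ⟨l, hl, ⟨v, hv, hvT⟩, rfl⟩
      exact ⟨l, hl, ⟨v, hv, hT hvT⟩, rfl⟩
    · intro T T' h h'
      refine (h.union h').subset ?_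
      rintro K ⟨l, hl, ⟨v, hv, hvT | hvT⟩, rfl⟩
      · exact Or.inl ⟨l, hl, ⟨v, hv, hvT⟩, rfl⟩
      · exact Or.inr ⟨l, hl, ⟨v, hv, hvT⟩, rfl⟩
    · rintro ⟨v, s⟩ ⟨h, hs⟩
      obtain ⟨l, hl, rfl⟩ := hL e v s h hs
      have hv := (limFib_subset h).1
      refine ⟨_, inter_mem self_mem_nhdsWithin (mem_nhdsWithin_of_mem_nhds
        (hl.eventually_eq hi hv)), ?_⟩
      refine (finite_singleton (l '' e.cube)).subset ?_
      rintro K ⟨l', hl', ⟨v', hv', ⟨h1, h2⟩, h3⟩, rfl⟩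
      exact ((hl.eqOn hi hl' hv' (h3 h1 (hAS h2))).image_eq).symm
  refine key.subset ?_
  rintro K ⟨l, hl, ⟨v, hv, hvA⟩, rfl⟩
  exact ⟨l, hl, ⟨v, hv, hl.mem_limFib hv, hvA⟩, rfl⟩

lemma isCompact_star {S A : Set N} (hi : F.LocInj S) (hA : IsCompact A) (hAS : A ⊆ S)
    (hL : F.HasLifts S A) (P : BCell B → Prop) : IsCompact (F.star S P A) := by
  have := F.compactSpace_base
  have := BCell.finite (B := B)
  have h : F.star S P A = A ∪ ⋃ e : BCell B, ⋃ K ∈ {K | ∃ l, F.IsLift S e l ∧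
      (∃ v ∈ e.cube, l v ∈ A) ∧ K = l '' e.cube} ∩ {K | P e}, K := by
    ext s
    simp only [star, mem_union, mem_ofPred_eq, mem_iUnion, mem_inter_iff, exists_prop]
    refine or_congr_right ⟨?_, ?_⟩
    · rintro ⟨e, l, hl, hP, hv, hs⟩
      exact ⟨e, _, ⟨⟨l, hl, hv, rfl⟩, hP⟩, hs⟩
    · rintro ⟨e, _, ⟨⟨l, hl, hv, rfl⟩, hP⟩, hs⟩
      exact ⟨e, l, hl, hP, hv, hs⟩
  rw [h]
  refine hA.union (isCompact_iUnion fun e => ?_)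
  refine ((finite_lifts hi hA hAS hL e).inter_of_left _).isCompact_biUnion ?_
  rintro K ⟨⟨l, hl, -, rfl⟩, -⟩
  exact (isCompact_closedBall _ _).image_of_continuousOn hl.continuousOn

/-- Take an ultrafilter of points of `S` tending to `p`. As there are finitely many cells, its
points lie over one open cell, and their parameters converge. The lift of this cell through the
limit point contains the points near the limit. -/
lemma star_mem_nhdsWithin {S A : Set N} (hi : F.LocInj S)
    (hL : F.HasLifts S A) {p : N} (hp : p ∈ A) :
    F.star S (fun _ => True) A ∈ 𝓝[S] p := by
  have := F.compactSpace_base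
  have := BCell.finite (B := B)
  rw [mem_iff_ultrafilter]
  intro U hU
  have hUS : S ∈ U := hU self_mem_nhdsWithin
  have hUp : Tendsto id (U : Filter N) (𝓝 p) := hU.trans nhdsWithin_le_nhds
  have h1 : ⋃ e : BCell B, F.π ⁻¹' e.op ∈ U := by
    convert! (univ_mem : univ ∈ (U : Filter N))
    exact eq_univ_of_forall fun s => mem_iUnion.2 (BCell.exists_mem_op (F.π s))
  rw [← Ultrafilter.mem_coe, ← biUnion_univ, Ultrafilter.mem_coe,
    Ultrafilter.finite_biUnion_mem_iff finite_univ] at h1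
  obtain ⟨e, -, he⟩ := h1
  let v : N → e.Par := fun s => e.inv (F.π s)
  have hv : ∀ s ∈ F.π ⁻¹' e.op, v s ∈ e.int ∧ e.chr (v s) = F.π s := fun s hs =>
    ⟨e.inv_mem hs, e.chr_inv hs⟩
  obtain ⟨v₀, hv₀, hvU⟩ := (isCompact_closedBall (0 : e.Par) 1).ultrafilter_le_nhds (U.map v) (by
    rw [le_principal_iff, Ultrafilter.coe_map]
    exact Filter.mem_map.2 <| mem_of_superset he fun s hs => ball_subset_closedBall (hv s hs).1)
  have hvU' : Tendsto v (U : Filter N) (𝓝 v₀) := hvU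
  have hlim : Tendsto (fun s => (v s, s)) (U : Filter N) (𝓝 (v₀, p)) := hvU'.prodMk_nhds hUp
  have hmem : ∀ᶠ s in (U : Filter N), (v s, s) ∈ F.limFib e := by
    filter_upwards [he] with s hs
    exact mem_limFib_of_int (hv s hs).1 (hv s hs).2.symm
  have h2 : (v₀, p) ∈ F.limFib e := (isClosed_limFib e).mem_of_tendsto hlim hmem
  obtain ⟨l, hl, hlp⟩ := hL e v₀ p h2 hp
  have h3 := hlim.eventually (hlp ▸ hl.eventually_eq hi hv₀)
  filter_upwards [h3, hmem, hUS] with s hs1 hs2 hs3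
  refine hl.image_subset_star trivial hv₀ (hlp ▸ hp) ⟨v s, (limFib_subset hs2).1, hs1 hs2 hs3⟩

end FibredNbhd
end BranchedSurface

namespace BranchedSurface
namespace FibredNbhd

variable {N B : Type*} [TopologicalSpace N] [TopologicalSpace B] {F : FibredNbhd N B}
variable [CWComplex (univ : Set B)] [T2Space B] [T2Space N] [CompactSpace N]

/-! ### Splitting complexes from a splitting surface -/

lemma IsSplittingSurface.hasLifts (hτ : F.IsAdapted) {S : Set N} (hS : F.IsSplittingSurface S) :
    F.HasLifts S S := fun _ _ _ h hs =>
  exists_lift_of_complete hτ hS.locInj (fun _ => hS.fullAt) hS.complete h hs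

lemma HasLifts.mono {S A A' : Set N} (h : F.HasLifts S A) (hA : A' ⊆ A) : F.HasLifts S A' :=
  fun e v s hvs hs => h e v s hvs (hA hs)

lemma IsCellOf.exists_isLift {S c K : Set N} (hi : F.LocInj S) (hL : F.HasLifts S S) (hc : c ⊆ S)
    (h : F.IsCellOf c K) : ∃ e l, F.IsLift S e l ∧ K = l '' e.int := by
  obtain ⟨n, i, σ, hσ, hσc, rfl⟩ := h
  let e : BCell B := ⟨n, i⟩
  have h0 : (0 : e.Par) ∈ e.int := mem_ball_self one_pos
  obtain ⟨l, hl, hl0⟩ := hL e 0 (σ (e.chr 0))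
    (mem_limFib_of_int h0 (hσc _ (e.chr_mem_op h0)).1) (hc (hσc _ (e.chr_mem_op h0)).2)
  refine ⟨e, l, hl, ?_⟩
  have h1 : EqOn l (fun v => σ (e.chr v)) e.int := by
    refine hi.eqOn (convex_ball _ _).isPreconnected (hl.continuousOn.mono ball_subset_closedBall)
      (hσ.comp (e.continuousOn_chr.mono ball_subset_closedBall) fun v hv => e.chr_mem_op hv)
      (fun v hv => hl.mem v (ball_subset_closedBall hv))
      (fun v hv => hc (hσc _ (e.chr_mem_op hv)).2) (fun v hv => ?_) h0 hl0
    rw [hl.π_eq v (ball_subset_closedBall hv), (hσc _ (e.chr_mem_op hv)).1]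
  rw [h1.image_eq, ← image_image σ e.chr]
  rfl

variable (F) in
/-- The combinatorial ball about the pared locus in a splitting surface. -/
def surfBall (S : Set N) : ℕ → Set N
  | 0 => F.core
  | k + 1 => F.star S (fun _ => True) (surfBall S k)

variable (F) in
/-- The combinatorial ball about the pared locus in a splitting surface, together with the incident
edges. -/
def surfComplex (S : Set N) (k : ℕ) : Set N := F.star S (fun e => e.1 ≤ 1) (F.surfBall S (k + 1))

namespace IsSplittingSurface

variable {S : Set N} (hτ : F.IsAdapted) (hS : F.IsSplittingSurface S)
include hτ hS

omit hτ [CompactSpace N] in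
lemma surfBall_subset : ∀ k, F.surfBall S k ⊆ S
  | 0 => hS.core_subset
  | k + 1 => star_subset (surfBall_subset k)

omit hτ [CompactSpace N] in
lemma surfComplex_subset (k : ℕ) : F.surfComplex S k ⊆ S :=
  star_subset (hS.surfBall_subset (k + 1))

omit hτ hS [CompactSpace N] in
lemma surfBall_mono : Monotone (F.surfBall S) := monotone_nat_of_le_succ fun _ => subset_union_left

lemma isCompact_surfBall : ∀ k, IsCompact (F.surfBall S k)
  | 0 => isClosed_core.isCompact
  | k + 1 => isCompact_star hS.locInj (isCompact_surfBall k) (hS.surfBall_subset k)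
      ((hS.hasLifts hτ).mono (hS.surfBall_subset k)) _

lemma isCompact_surfComplex (k : ℕ) : IsCompact (F.surfComplex S k) :=
  isCompact_star hS.locInj (hS.isCompact_surfBall hτ _) (hS.surfBall_subset _)
    ((hS.hasLifts hτ).mono (hS.surfBall_subset _)) _

/-- For 2-cells the balls are saturated from the start: the pared locus lies over the 1-skeleton,
and an open 2-cell meets no other closed cell, there being no cells of higher dimension. -/
lemma image_subset_surfBall {e : BCell B} (he : 2 ≤ e.1) {l : e.Par → N} (hl : F.IsLift S e l)
    {v : e.Par} (hv : v ∈ e.int) : ∀ k, l v ∈ F.surfBall S k → l '' e.cube ⊆ F.surfBall S k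
  | 0, h => by
    have h1 := hτ.mem_skel (vertInterior_subset_vert (core_subset_vertInterior h))
    rw [hl.π_eq v (ball_subset_closedBall hv)] at h1
    exact absurd (e.chr_mem_op hv) (BCell.not_mem_op_of_mem_skel (skel_mono he h1))
  | k + 1, h => by
    rcases h with h | ⟨e', l', hl', -, ⟨w, hw, hw'⟩, v', hv', hvv⟩
    · exact (image_subset_surfBall he hl hv k h).trans (surfBall_mono k.le_succ)
    · rcases hl.image_eq_or_lt hS.locInj hl' hv hv' hvv.symm with h1 | h1
      · rw [h1]; exact hl'.image_subset_star trivial hw hw'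
      · exact absurd he.not_gt fun h => h ((h1.trans_le (by
          by_contra h2
          exact (hτ.dim_le e'.1 (not_le.1 h2)).false e'.2)))

/-- A closed cell of a CW complex need not be a union of open cells: the frontier of a 2-cell may
cover only part of an edge. This is why cells of dimension at most 1 are adjoined in `surfComplex`.
A frontier point of an adjoined cell lies in a 0-cell, so nothing more is needed. -/
lemma image_subset_surfComplex {e : BCell B} {l : e.Par → N} (hl : F.IsLift S e l)
    {v : e.Par} (hv : v ∈ e.int) {k : ℕ} (h : l v ∈ F.surfComplex S k) :
    l '' e.cube ⊆ F.surfComplex S k := by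
  rcases h with h | ⟨e', l', hl', he', ⟨w, hw, hw'⟩, v', hv', hvv⟩
  · by_cases he : e.1 ≤ 1
    · exact hl.image_subset_star he (ball_subset_closedBall hv) h
    · exact (hS.image_subset_surfBall hτ (by lia) hl hv _ h).trans subset_union_left
  · rcases hl.image_eq_or_lt hS.locInj hl' hv hv' hvv.symm with h1 | h1
    · rw [h1]; exact hl'.image_subset_star he' hw hw'
    · have he : e.1 = 0 := by lia
      have : Subsingleton e.Par := by
        have : IsEmpty (Fin e.1) := by rw [he]; infer_instance
        infer_instance
      rintro _ ⟨u, hu, rfl⟩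
      rw [Subsingleton.elim u v]
      exact Or.inr ⟨e', l', hl', he', ⟨w, hw, hw'⟩, v', hv', hvv⟩

/-- One further star contains a neighbourhood in `S` of each point of the ball, hence a plaque about
it. -/
lemma mem_surfaceInterior {k : ℕ} {s : N} (hs : s ∈ F.surfBall S (k + 1)) (hc : s ∉ F.core) :
    s ∈ F.surfaceInterior (F.surfBall S (k + 2)) := by
  have hsS := hS.surfBall_subset _ hs
  obtain ⟨D, hD, hsD, hDS, -⟩ := hS.plaque s hsS hc
  have h1 := star_mem_nhdsWithin hS.locInj
    ((hS.hasLifts hτ).mono (hS.surfBall_subset (k + 1))) hs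
  rw [mem_nhdsWithin_iff_exists_mem_nhds_inter] at h1
  obtain ⟨O, hO, hOS⟩ := h1
  obtain ⟨D', hD', hsD', hDD', hDO⟩ := hD.exists_subset hsD hO
  exact ⟨D', hD', hsD', fun n hn => hOS ⟨hDO hn, hDS (hDD' hn)⟩⟩

omit [CWComplex (univ : Set B)] [T2Space B] [T2Space N] [CompactSpace N] hτ hS in
lemma _root_.BranchedSurface.FibredNbhd.surfaceInterior_mono {c c' : Set N} (h : c ⊆ c') :
    F.surfaceInterior c ⊆ F.surfaceInterior c' := fun _ ⟨D, hD, hs, hc⟩ => ⟨D, hD, hs, hc.trans h⟩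

end IsSplittingSurface
end FibredNbhd
end BranchedSurface

namespace BranchedSurface
namespace FibredNbhd

variable {N B : Type*} [TopologicalSpace N] [TopologicalSpace B] {F : FibredNbhd N B}

lemma core_disjoint_surfaceInterior {c : Set N} {s : N} (hs : s ∈ F.core) :
    s ∉ F.surfaceInterior c := fun ⟨_, hD, hsD, _⟩ =>
  hD.not_mem_vertInterior hsD (core_subset_vertInterior hs)

variable [CWComplex (univ : Set B)] [T2Space B] [T2Space N] [CompactSpace N]

lemma core_subset_ball {c : Set N} : ∀ k, F.core ⊆ F.ball c k
  | 0 => Subset.rfl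
  | k + 1 => (core_subset_ball k).trans subset_union_left

namespace IsSplittingSurface

variable {S : Set N} (hτ : F.IsAdapted) (hS : F.IsSplittingSurface S)
include hτ hS

/-- The index is shifted by one because the condition at `p(B)` uses two stars: the first contains
the points of `S` near the pared locus, the second makes them interior points. -/
lemma isSplittingComplex (k : ℕ) : F.IsSplittingComplex (F.surfComplex S (k + 1)) where
  isCompact := hS.isCompact_surfComplex hτ _
  cells s hs := by
    obtain ⟨e, he⟩ := BCell.exists_mem_op (F.π s)
    obtain ⟨l, hl, hls⟩ := hS.hasLifts hτ e (e.inv (F.π s)) s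
      (mem_limFib_of_int (e.inv_mem he) (e.chr_inv he).symm) (hS.surfComplex_subset _ hs)
    have h1 := hS.image_subset_surfComplex hτ hl (e.inv_mem he) (hls ▸ hs)
    exact ⟨_, IsLift.isCellOf ⟨hl.continuousOn, fun v hv => h1 ⟨v, hv, rfl⟩, hl.π_eq⟩,
      _, e.inv_mem he, hls⟩
  locally_in_surface s hs := by
    by_cases h : s ∈ F.core
    · obtain ⟨D, hD, hsD, -, V, hV, hDV⟩ := hS.halfPlaque s h
      exact ⟨D, Or.inr hD, hsD, V, hV,
        (inter_subset_inter_left _ (hS.surfComplex_subset _)).trans hDV⟩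
    · obtain ⟨D, hD, hsD, -, V, hV, hDV⟩ := hS.plaque s (hS.surfComplex_subset _ hs) h
      exact ⟨D, Or.inl hD, hsD, V, hV,
        (inter_subset_inter_left _ (hS.surfComplex_subset _)).trans hDV⟩
  bdry_inter_vert := by
    apply Subset.antisymm
    · rintro s ⟨⟨hs, -⟩, hv⟩
      rw [← hS.inter_vert]
      exact ⟨hS.surfComplex_subset _ hs, hv⟩
    · exact fun s hs => ⟨⟨subset_union_left (surfBall_mono (Nat.zero_le _) hs),
        core_disjoint_surfaceInterior hs⟩, vertInterior_subset_vert (core_subset_vertInterior hs)⟩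
  core_subset p hp := by
    have h1 := (hS.fullAt (hS.core_subset hp)).mem_closure_diff_vert
    have h2 : F.surfBall S 1 ∈ 𝓝[S] p :=
      star_mem_nhdsWithin hS.locInj ((hS.hasLifts hτ).mono hS.core_subset) hp
    rw [mem_nhdsWithin_iff_exists_mem_nhds_inter] at h2
    obtain ⟨O, hO, hOS⟩ := h2
    rw [mem_closure_iff_nhds] at h1 ⊢
    intro V hV
    obtain ⟨s, ⟨hsV, hsO⟩, hsS, hsv⟩ := h1 _ (inter_mem hV hO)
    refine ⟨s, hsV, ?_⟩
    have h3 := hS.mem_surfaceInterior hτ (k := 0) (hOS ⟨hsO, hsS⟩) fun h =>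
      hsv (vertInterior_subset_vert (core_subset_vertInterior h))
    exact surfaceInterior_mono ((surfBall_mono (by lia)).trans subset_union_left) h3

lemma ball_subset_surfBall (k : ℕ) : ∀ j, F.ball (F.surfComplex S k) j ⊆ F.surfBall S j
  | 0 => Subset.rfl
  | j + 1 => by
    rintro s (hs | hs)
    · exact surfBall_mono j.le_succ (ball_subset_surfBall k j hs)
    · simp only [mem_iUnion] at hs
      obtain ⟨K, hK, ⟨t, htK, ht⟩, hs⟩ := hs
      obtain ⟨e, l, hl, rfl⟩ :=
        hK.exists_isLift hS.locInj (hS.hasLifts hτ) (hS.surfComplex_subset k)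
      rw [hl.closure_image] at htK hs
      obtain ⟨v, hv, rfl⟩ := htK
      exact hl.image_subset_star trivial hv (ball_subset_surfBall k j ht) hs

lemma le_radius (k : ℕ) : (k : ℕ∞) ≤ F.radius (F.surfComplex S k) := by
  refine le_iSup₂_of_le (f := fun (k : ℕ) _ => (k : ℕ∞)) k ?_ le_rfl
  apply Subset.antisymm
  · rintro s ⟨hs, hs', hs''⟩
    by_contra hc
    have h1 := hS.ball_subset_surfBall hτ k k hs
    cases k with
    | zero => exact hc h1
    | succ k =>
      exact hs'' (surfaceInterior_mono subset_union_left (hS.mem_surfaceInterior hτ h1 hc))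
  · exact fun s hs => ⟨core_subset_ball _ hs, subset_union_left (surfBall_mono (Nat.zero_le _) hs),
      core_disjoint_surfaceInterior hs⟩

/-- A splitting surface carries splitting complexes of arbitrarily large radius. -/
theorem exists_splittingComplexes : ∃ c : ℕ → Set N, (∀ k, F.IsSplittingComplex (c k)) ∧
    Tendsto (fun k => F.radius (c k)) atTop (𝓝 ⊤) := by
  refine ⟨fun k => F.surfComplex S (k + 1), fun k => hS.isSplittingComplex hτ k, ?_⟩
  refine tendsto_nhds_top_mono' (f := fun k : ℕ => (k : ℕ∞)) ENat.tendsto_natCast_nhds_top fun k => ?_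
  exact le_trans (Nat.cast_le.2 k.le_succ) (hS.le_radius hτ (k + 1))

end IsSplittingSurface
end FibredNbhd
end BranchedSurface

namespace BranchedSurface
namespace FibredNbhd

variable {N B : Type*} [TopologicalSpace N] [TopologicalSpace B] {F : FibredNbhd N B}

/-! ### Lifts of cells to a splitting complex -/

lemma LocInj.finite_fibre {c : Set N} [T1Space B] (hi : F.LocInj c) (hc : IsCompact c) (x : B) :
    (c ∩ F.π ⁻¹' {x}).Finite := by
  have hk : IsCompact (c ∩ F.π ⁻¹' {x}) :=
    hc.inter_right (isClosed_singleton.preimage F.continuous_π)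
  refine hk.induction_on (p := fun T => (c ∩ F.π ⁻¹' {x} ∩ T).Finite) (by simp)
    (fun T T' h h' => h'.subset (by gcongr)) (fun T T' h h' => by
      rw [inter_union_distrib_left]; exact h.union h') ?_ |>.subset (subset_inter Subset.rfl Subset.rfl)
  rintro s ⟨hs, hsx⟩
  obtain ⟨V, hV, hVi⟩ := hi s hs
  refine ⟨V, mem_nhdsWithin_of_mem_nhds hV, (finite_singleton s).subset ?_⟩
  rintro t ⟨⟨ht, htx⟩, htV⟩
  exact hVi ⟨ht, htV⟩ ⟨hs, mem_of_mem_nhds hV⟩ (by rw [mem_preimage] at *; exact htx.trans hsx.symm)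

lemma _root_.Ultrafilter.exists_eventually_eq_of_finite {A Y : Type*} (U : Ultrafilter A)
    {f : A → Y} {T : Set Y} (hT : T.Finite) (h : ∀ᶠ a in (U : Filter A), f a ∈ T) :
    ∃ y ∈ T, ∀ᶠ a in (U : Filter A), f a = y := by
  have h1 : (⋃ y ∈ T, f ⁻¹' {y}) ∈ U := by
    refine mem_of_superset h fun a ha => ?_
    simp only [mem_iUnion]
    exact ⟨f a, ha, rfl⟩
  rw [Ultrafilter.finite_biUnion_mem_iff hT] at h1
  exact h1

variable [CWComplex (univ : Set B)] [T2Space B] [T2Space N] [CompactSpace N]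

/-- A continuous lift of an open cell to a compact locally injective set extends to the closed
cell. -/
lemma LocInj.exists_extension {c : Set N} (hi : F.LocInj c) (hc : IsCompact c) {e : BCell B}
    {f : e.Par → N} (hf : ContinuousOn f e.int) (hfc : MapsTo f e.int c)
    (hπ : ∀ v ∈ e.int, F.π (f v) = e.chr v) : ∃ l, F.IsLift c e l ∧ EqOn l f e.int := by
  have hcl : e.cube ⊆ closure e.int := by rw [closure_ball _ one_ne_zero]
  have hlim : ∀ v ∈ e.cube, ∃ y, Tendsto f (𝓝[e.int] v) (𝓝 y) := by
    intro v hv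
    have hne : (𝓝[e.int] v).NeBot := mem_closure_iff_nhdsWithin_neBot.1 (hcl hv)
    have hfc' : ∀ᶠ w in 𝓝[e.int] v, f w ∈ c := by
      filter_upwards [self_mem_nhdsWithin] with w hw using hfc hw
    obtain ⟨p, hpc, hp⟩ := hc.exists_mapClusterPt_of_frequently hfc'.frequently
    have hpπ : F.π p = e.chr v := by
      have h1 : MapClusterPt (F.π p) (𝓝[e.int] v) (F.π ∘ f) :=
        hp.continuousAt_comp F.continuous_π.continuousAt
      have h2 : Tendsto (F.π ∘ f) (𝓝[e.int] v) (𝓝 (e.chr v)) := by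
        refine (((e.continuousOn_chr v hv).mono ball_subset_closedBall).tendsto).congr' ?_
        filter_upwards [self_mem_nhdsWithin] with w hw using (hπ w hw).symm
      have h3 : (𝓝 (F.π p) ⊓ 𝓝 (e.chr v)).NeBot := NeBot.mono h1 (inf_le_inf_left _ h2)
      exact eq_of_nhds_neBot h3
    refine ⟨p, ?_⟩
    intro V hV
    obtain ⟨V₁, hV₁, hinj⟩ := hi p hpc
    obtain ⟨C, hC, hCc, hCV⟩ := exists_mem_nhds_isClosed_subset (inter_mem hV hV₁)
    set O := interior C with hO
    have hOC : closure O ⊆ C := closure_minimal interior_subset hCc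
    have hpO : p ∈ O := mem_interior_iff_mem_nhds.2 hC
    have hk : IsCompact (F.π '' (c ∩ frontier O)) :=
      (hc.inter_right isClosed_frontier).image F.continuous_π
    have hx : e.chr v ∉ F.π '' (c ∩ frontier O) := by
      rintro ⟨t, ⟨htc, htO⟩, ht⟩
      have h1 : t = p := hinj ⟨htc, (hCV (hOC htO.1)).2⟩ ⟨hpc, mem_of_mem_nhds hV₁⟩
        (ht.trans hpπ.symm)
      rw [h1] at htO
      exact htO.2 (by rwa [isOpen_interior.interior_eq])
    have h2 : ∀ᶠ w in 𝓝[e.cube] v, e.chr w ∉ F.π '' (c ∩ frontier O) :=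
      (e.continuousOn_chr v hv).eventually (hk.isClosed.isOpen_compl.mem_nhds hx)
    obtain ⟨r, hr, hrb⟩ := Metric.mem_nhdsWithin_iff.1 h2
    -- The image of `A` is connected, meets `O` because `p` is a cluster point, and cannot cross the
    -- frontier of `O`, since the points of `c` on this frontier do not project close to `e.chr v`.
    -- Hence `p` is a limit.
    set A := Metric.ball v r ∩ e.int with hA
    have hAconn : IsPreconnected (f '' A) := by
      refine IsPreconnected.image ?_ _ (hf.mono inter_subset_right)
      exact ((convex_ball _ _).inter (convex_ball _ _)).isPreconnected
    have hAn : A ∈ 𝓝[e.int] v :=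
      inter_mem (mem_nhdsWithin_of_mem_nhds (Metric.ball_mem_nhds v hr)) self_mem_nhdsWithin
    have hAO : (f '' A ∩ O).Nonempty := by
      obtain ⟨w, hw, hw'⟩ := ((mapClusterPt_iff_frequently.1 hp O
        (isOpen_interior.mem_nhds hpO)).and_eventually hAn).exists
      exact ⟨f w, ⟨w, hw', rfl⟩, hw⟩
    have hsub : f '' A ⊆ O := by
      refine hAconn.subset_of_closure_inter_subset isOpen_interior hAO ?_
      rintro _ ⟨hcl, w, hw, rfl⟩
      by_contra hn
      refine hrb ⟨hw.1, ball_subset_closedBall hw.2⟩ ⟨f w, ⟨hfc hw.2, hcl, ?_⟩, hπ w hw.2⟩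
      rwa [isOpen_interior.interior_eq]
    exact Filter.mem_map.2 (mem_of_superset hAn fun w hw =>
      (hCV (interior_subset (hsub ⟨w, hw, rfl⟩))).1)
  have hlc : ContinuousOn (extendFrom e.int f) e.cube := continuousOn_extendFrom hcl hlim
  refine ⟨extendFrom e.int f, ⟨hlc, fun v hv => ?_, fun v hv => ?_⟩,
    extendFrom_extends hf⟩
  · have hne : (𝓝[e.int] v).NeBot := mem_closure_iff_nhdsWithin_neBot.1 (hcl hv)
    refine hc.isClosed.mem_of_tendsto (tendsto_extendFrom (hlim v hv)) ?_
    filter_upwards [self_mem_nhdsWithin] with w hw using hfc hw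
  · have hne : (𝓝[e.int] v).NeBot := mem_closure_iff_nhdsWithin_neBot.1 (hcl hv)
    have h1 := (F.continuous_π.tendsto _).comp (tendsto_extendFrom (hlim v hv))
    refine tendsto_nhds_unique h1 ?_
    refine (((e.continuousOn_chr v hv).mono ball_subset_closedBall).tendsto).congr' ?_
    filter_upwards [self_mem_nhdsWithin] with w hw using (hπ w hw).symm

lemma LocInj.exists_isLift_of_isCellOf {c : Set N} (hi : F.LocInj c) (hc : IsCompact c) {K : Set N}
    (h : F.IsCellOf c K) : ∃ e l, F.IsLift c e l ∧ K = l '' e.int := by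
  obtain ⟨n, i, σ, hσ, hσc, rfl⟩ := h
  let e : BCell B := ⟨n, i⟩
  obtain ⟨l, hl, h⟩ := hi.exists_extension hc (e := e) (f := fun v => σ (e.chr v))
    (hσ.comp (e.continuousOn_chr.mono ball_subset_closedBall) fun v hv => e.chr_mem_op hv)
    (fun v hv => (hσc _ (e.chr_mem_op hv)).2) (fun v hv => (hσc _ (e.chr_mem_op hv)).1)
  refine ⟨e, l, hl, ?_⟩
  rw [h.image_eq, ← image_image σ e.chr]
  rfl

variable (F) in
/-- A compact set, locally a section of `π`, which is a union of lifts of closed cells. -/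
structure IsCpx (c : Set N) : Prop where
  isCompact : IsCompact c
  locInj : F.LocInj c
  exists_lift : ∀ s ∈ c, ∃ e l, F.IsLift c e l ∧ ∃ v ∈ e.int, l v = s

lemma IsSplittingComplex.isCpx {c : Set N} (h : F.IsSplittingComplex c) : F.IsCpx c := by
  have hi : F.LocInj c := by
    intro s hs
    obtain ⟨D, hD | hD, -, V, hV, hDV⟩ := h.locally_in_surface s hs
    · exact ⟨V, hV, hD.injOn.mono hDV⟩
    · exact ⟨V, hV, hD.injOn.mono hDV⟩
  refine ⟨h.isCompact, hi, fun s hs => ?_⟩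
  obtain ⟨K, hK, hsK⟩ := h.cells s hs
  obtain ⟨e, l, hl, rfl⟩ := hi.exists_isLift_of_isCellOf h.isCompact hK
  exact ⟨e, l, hl, hsK⟩

namespace IsCpx

variable {c : Set N} (hc : F.IsCpx c)
include hc

lemma exists_lift_of_op {s : N} (hs : s ∈ c) {e : BCell B} (he : F.π s ∈ e.op) :
    ∃ l, F.IsLift c e l ∧ l (e.inv (F.π s)) = s := by
  obtain ⟨e', l, hl, v, hv, rfl⟩ := hc.exists_lift s hs
  rw [hl.π_eq v (ball_subset_closedBall hv)] at he ⊢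
  have := BCell.eq_of_mem_op he (e'.chr_mem_op hv)
  subst this
  exact ⟨l, hl, by rw [BCell.inv_chr _ hv]⟩

/-- There are only finitely many lifts of a given cell. -/
lemma exists_eventually_eqOn {A : Type*} (U : Ultrafilter A) {e : BCell B} {l : A → e.Par → N}
    (hl : ∀ᶠ a in (U : Filter A), F.IsLift c e (l a)) :
    ∃ l₀, F.IsLift c e l₀ ∧ ∀ᶠ a in (U : Filter A), EqOn (l a) l₀ e.cube := by
  have h0 : (0 : e.Par) ∈ e.cube := mem_closedBall_self zero_le_one
  obtain ⟨p, -, hp⟩ := U.exists_eventually_eq_of_finite (f := fun a => l a 0)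
    (hc.locInj.finite_fibre hc.isCompact (e.chr 0)) (by
      filter_upwards [hl] with a ha using ⟨ha.mem 0 h0, ha.π_eq 0 h0⟩)
  obtain ⟨a₀, ha₀, ha₀'⟩ := (hl.and hp).exists
  refine ⟨l a₀, ha₀, ?_⟩
  filter_upwards [hl, hp] with a ha ha'
  exact ha.eqOn hc.locInj ha₀ h0 (ha'.trans ha₀'.symm)

/-- Limits of points of `c` are on limits of cells of `c`. -/
lemma exists_lift_of_tendsto {A : Type*} (U : Ultrafilter A) {s : A → N} {p : N} {e : BCell B}
    (hs : ∀ᶠ a in (U : Filter A), s a ∈ c) (hsp : Tendsto s (U : Filter A) (𝓝 p)) {v : A → e.Par}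
    (hv : ∀ᶠ a in (U : Filter A), v a ∈ e.int ∧ F.π (s a) = e.chr (v a)) {v₀ : e.Par}
    (hv₀ : Tendsto v (U : Filter A) (𝓝 v₀)) :
    ∃ l, F.IsLift c e l ∧ l v₀ = p ∧ ∀ᶠ a in (U : Filter A), l (v a) = s a := by
  have h1 : ∀ a, ∃ l : e.Par → N, s a ∈ c → v a ∈ e.int ∧ F.π (s a) = e.chr (v a) →
      F.IsLift c e l ∧ l (v a) = s a := by
    intro a
    by_cases h : s a ∈ c ∧ v a ∈ e.int ∧ F.π (s a) = e.chr (v a)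
    · obtain ⟨l, hl, hla⟩ := hc.exists_lift_of_op h.1 (e := e) (by
        rw [h.2.2]; exact e.chr_mem_op h.2.1)
      rw [h.2.2, e.inv_chr h.2.1] at hla
      exact ⟨l, fun _ _ => ⟨hl, hla⟩⟩
    · exact ⟨fun _ => s a, fun h1 h2 => absurd ⟨h1, h2⟩ h⟩
  choose l hl using h1
  obtain ⟨l₀, hl₀, h⟩ := hc.exists_eventually_eqOn U (l := l) (by
    filter_upwards [hs, hv] with a ha hva using (hl a ha hva).1)
  have h2 : ∀ᶠ a in (U : Filter A), l₀ (v a) = s a := by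
    filter_upwards [hs, hv, h] with a ha hva h
    rw [← h (ball_subset_closedBall hva.1), (hl a ha hva).2]
  have hv₀' : v₀ ∈ e.cube := isClosed_closedBall.mem_of_tendsto hv₀ (by
    filter_upwards [hv] with a ha using ball_subset_closedBall ha.1)
  refine ⟨l₀, hl₀, ?_, h2⟩
  have h3 : Tendsto (fun a => l₀ (v a)) (U : Filter A) (𝓝 (l₀ v₀)) := by
    refine (hl₀.continuousOn v₀ hv₀').tendsto.comp (tendsto_nhdsWithin_iff.2 ⟨hv₀, ?_⟩)
    filter_upwards [hv] with a ha using ball_subset_closedBall ha.1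
  exact tendsto_nhds_unique h3 (hsp.congr' (h2.mono fun a ha => ha.symm))

omit [T2Space N] [CompactSpace N] hc in
lemma _root_.BranchedSurface.BCell.ultrafilter_param [CompactSpace B] {A : Type*}
    (U : Ultrafilter A) (x : A → B) :
    ∃ (e : BCell B) (v : A → e.Par) (v₀ : e.Par), (∀ᶠ a in (U : Filter A), x a ∈ e.op ∧
      v a ∈ e.int ∧ x a = e.chr (v a)) ∧ v₀ ∈ e.cube ∧ Tendsto v (U : Filter A) (𝓝 v₀) := by
  have := BCell.finite (B := B)
  choose e he using fun a => BCell.exists_mem_op (x a)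
  obtain ⟨e, -, h⟩ := U.exists_eventually_eq_of_finite (f := e) finite_univ (by simp)
  have h' : ∀ᶠ a in (U : Filter A), x a ∈ e.op := h.mono fun a ha => ha ▸ he a
  obtain ⟨v₀, hv₀, hU⟩ := (isCompact_closedBall (0 : e.Par) 1).ultrafilter_le_nhds
    (U.map fun a => e.inv (x a)) (by
      rw [le_principal_iff, Ultrafilter.coe_map]
      exact Filter.mem_map.2 (h'.mono fun a ha => ball_subset_closedBall (e.inv_mem ha)))
  exact ⟨e, fun a => e.inv (x a), v₀, h'.mono fun a ha => ⟨ha, e.inv_mem ha, (e.chr_inv ha).symm⟩,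
    hv₀, hU⟩

/-- No fullness at `p` is needed here: the points of `c` near `p` already lie on lifted cells of
`c`, and by finiteness of fibres a single lift serves along the ultrafilter. -/
lemma star_mem_nhdsWithin (p : N) :
    F.star c (fun _ => True) {p} ∈ 𝓝[c] p := by
  have := F.compactSpace_base
  rw [mem_iff_ultrafilter]
  intro U hU
  have hUS : c ∈ U := hU self_mem_nhdsWithin
  obtain ⟨e, v, v₀, h, hv₀, hv⟩ := BCell.ultrafilter_param U F.π
  obtain ⟨l, hl, hlp, hlU⟩ := hc.exists_lift_of_tendsto U (s := id) hUS
    (hU.trans nhdsWithin_le_nhds) (h.mono fun a ha => ha.2) hv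
  filter_upwards [hlU, h] with s hs hs'
  exact hl.image_subset_star trivial hv₀ hlp ⟨v s, ball_subset_closedBall hs'.2.1, hs⟩

/-- This passes from cells given by sections over open cells to lifts of characteristic maps, to
which unique lifting applies. -/
lemma ball_succ (k : ℕ) : F.ball c (k + 1) = F.star c (fun _ => True) (F.ball c k) := by
  ext s
  refine or_congr_right ⟨fun h => ?_, ?_⟩
  · simp only [mem_iUnion] at h
    obtain ⟨K, hK, ⟨t, htK, ht⟩, hs⟩ := h
    obtain ⟨e, l, hl, rfl⟩ := hc.locInj.exists_isLift_of_isCellOf hc.isCompact hK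
    rw [hl.closure_image] at htK hs
    obtain ⟨v, hv, rfl⟩ := htK
    exact ⟨e, l, hl, trivial, ⟨v, hv, ht⟩, hs⟩
  · rintro ⟨e, l, hl, -, ⟨v, hv, ht⟩, hs⟩
    simp only [mem_iUnion]
    refine ⟨_, hl.isCellOf, ?_⟩
    rw [hl.closure_image]
    exact ⟨⟨l v, ⟨v, hv, rfl⟩, ht⟩, hs⟩

/-- Lifts of cells exist through the points where `c` is full. -/
lemma hasLifts {A : Set N} (hA : ∀ p ∈ A, F.FullAt c p) : F.HasLifts c A := by
  intro e u p hup hp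
  obtain ⟨V, hV, r, hr, hrp, hrV⟩ := hA p hp
  obtain ⟨f, hf, hfn, hfe⟩ := exists_seq_of_mem_limFib hup
  let U := Ultrafilter.of f
  have hUf : (U : Filter _) ≤ f := Ultrafilter.of_le f
  have h1 : Tendsto (fun a : e.Par × N => a.1) (U : Filter _) (𝓝 u) :=
    (continuous_fst.tendsto (u, p)).mono_left (hUf.trans hfn)
  have h2 : Tendsto (fun a : e.Par × N => a.2) (U : Filter _) (𝓝 p) :=
    (continuous_snd.tendsto (u, p)).mono_left (hUf.trans hfn)
  have h3 : Tendsto (fun a : e.Par × N => r a.2) (U : Filter _) (𝓝 p) := by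
    have h4 : Tendsto r (𝓝 p) (𝓝 (r p)) := hr.continuousAt hV
    rw [hrp] at h4
    exact h4.comp h2
  obtain ⟨l, hl, hlp, -⟩ := hc.exists_lift_of_tendsto U (h2.eventually hV |>.mono fun a ha =>
    (hrV a.2 ha).1) h3 (v := fun a => a.1) (by
      filter_upwards [h2.eventually hV, hUf hfe] with a ha ha'
      exact ⟨ha'.1, (hrV a.2 ha).2.trans ha'.2⟩) h1
  exact ⟨l, hl, hlp⟩

end IsCpx
end FibredNbhd
end BranchedSurface

namespace BranchedSurface
namespace FibredNbhd

variable {N B : Type*} [TopologicalSpace N] [TopologicalSpace B] {F : FibredNbhd N B}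

/-! ### The combinatorial balls of a splitting complex consist of full points -/

lemma IsGraph.exists_section {φ : OpenPartialHomeomorph N modelN} {E : Set (ℝ × ℝ)}
    {g : ℝ × ℝ → ℝ} {D : Set N} (h : IsGraph φ E g D) (n₀ : N) :
    ∃ P : ℝ × ℝ → N, ContinuousOn P E ∧ (∀ q ∈ E, P q ∈ D ∧ (φ (P q) : (ℝ × ℝ) × ℝ) = (q, g q)) ∧
      ∀ n ∈ D, P (φ n).1.1 = n := by
  classical
  obtain ⟨hg, hm, rfl⟩ := h
  let P : ℝ × ℝ → N := fun q => if h : (q, g q) ∈ modelN then φ.symm ⟨(q, g q), h⟩ else n₀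
  have hP : ∀ q (h : (q, g q) ∈ modelN), P q = φ.symm ⟨(q, g q), h⟩ := fun q h => dif_pos h
  have hφP : ∀ q ∈ E, P q ∈ φ.source ∧ (φ (P q) : (ℝ × ℝ) × ℝ) = (q, g q) := by
    intro q hq
    obtain ⟨h, ht⟩ := hm q hq
    rw [hP q h]
    exact ⟨φ.map_target ht, by rw [φ.right_inv ht]⟩
  refine ⟨P, ?_, fun q hq => ⟨⟨(hφP q hq).1, ?_, ?_⟩, (hφP q hq).2⟩, ?_⟩
  · rw [continuousOn_iff_continuous_domRestrict]
    have h1 : Continuous fun q : E => (⟨(q.1, g q.1), (hm q q.2).1⟩ : modelN) :=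
      (continuous_subtype_val.prodMk (continuousOn_iff_continuous_domRestrict.1 hg)).subtype_mk _
    have h2 := φ.symm.continuousOn.comp_continuous h1 fun q => (hm q q.2).2
    convert! h2 using 1
    ext q
    exact hP q (hm q q.2).1
  · rw [(hφP q hq).2]; exact hq
  · rw [(hφP q hq).2]
  · rintro n ⟨hn, hnE, hng⟩
    obtain ⟨h1, h2⟩ := hφP _ hnE
    refine φ.injOn h1 hn (Subtype.ext (h2.trans ?_))
    rw [← hng]

variable [CWComplex (univ : Set B)] [T2Space B] [T2Space N] [CompactSpace N]

namespace IsSplittingComplex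

variable {c : Set N} (hc : F.IsSplittingComplex c)
include hc

lemma ball_subset : ∀ k, F.ball c k ⊆ c
  | 0 => by
    show F.core ⊆ c
    rw [← hc.bdry_inter_vert]; exact fun s hs => hs.1.1
  | k + 1 => by
    rw [hc.isCpx.ball_succ]
    exact star_subset (ball_subset k)

lemma fullAt_of_not_mem_core {j : ℕ} (hR : F.ball c j ∩ F.bdry c = F.core) {s : N}
    (hs : s ∈ F.ball c j) (h : s ∉ F.core) : F.FullAt c s := by
  have h1 : s ∈ F.surfaceInterior c := by
    by_contra h2
    exact h (hR ▸ ⟨hs, hc.ball_subset j hs, h2⟩)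
  obtain ⟨D, hD, hsD, hDc⟩ := h1
  exact (hD.fullAt hsD).mono hDc

/-- Near `s` the complex lies in a half plaque `D`, since a plaque would avoid the pared locus.
Parametrise `D` by `P` and let `H` be an open half disc. The part of `H` which `P` maps into `c` is
relatively closed as `c` is compact; it is open because its points are in the first ball and off the
pared locus, hence interior to `c`; and it is nonempty because `surfaceInterior c` accumulates at
`s`. So `P` maps all of `H` into `c`, and then also its edge. -/
lemma fullAt_core (hR : F.ball c 1 ∩ F.bdry c = F.core) {s : N} (hs : s ∈ F.core) :
    F.FullAt c s := by
  obtain ⟨D, hD, hsD, V, hV, hDV⟩ := hc.locally_in_surface s (hc.ball_subset 0 hs)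
  have hD : F.IsHalfPlaque D := hD.resolve_left fun h =>
    h.not_mem_vertInterior hsD (core_subset_vertInterior hs)
  have hfull := hD.fullAt hsD
  have hDi := hD.injOn
  obtain ⟨φ, hφ, R, g, hR', hgr, hg0⟩ := hD
  obtain ⟨P, hPc, hPD, hPn⟩ := hgr.exists_section s
  obtain ⟨hsφ, hsE, hsg⟩ := hgr.mem hsD
  set q₀ := (φ s).1.1 with hq₀
  -- `s` is on the first slit
  have hz : g q₀ = 3 / 2 := by
    rcases (hφ.core_iff s hsφ).1 hs with h | h
    · rw [← hsg]; exact h.2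
    -- On the second slit, the graph over `q.1 ≤ 0` would continue in the direction of positive
    -- `q.2` at heights inside the open slit.
    · exfalso
      let f : ℝ → ℝ × ℝ := fun t => (q₀.1, q₀.2 + t)
      have hf : Continuous f := by fun_prop
      have hf0 : f 0 = q₀ := by simp [f]
      have hfE : ∀ᶠ t in 𝓝[>] (0 : ℝ), f t ∈ R ∩ {q | q.1 ≤ 0} := by
        have h1 : ∀ᶠ t in 𝓝 (0 : ℝ), f t ∈ R :=
          hf.continuousAt.eventually (by rw [hf0]; exact hR'.mem_nhds hsE.1)
        filter_upwards [nhdsWithin_le_nhds h1] with t ht using ⟨ht, hsE.2⟩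
      have h2 : Tendsto (fun t => g (f t)) (𝓝[>] 0) (𝓝 (g q₀)) := by
        refine (hgr.1 q₀ hsE).tendsto.comp (tendsto_nhdsWithin_iff.2 ⟨?_, hfE⟩)
        have := hf.tendsto 0
        rw [hf0] at this
        exact this.mono_left nhdsWithin_le_nhds
      have h3 : g q₀ ∈ Ioo (-2 : ℝ) (-1) := by
        rw [← hsg, h.2]; constructor <;> norm_num
      obtain ⟨t, ht1, ht2, ht3⟩ := ((h2.eventually (isOpen_Ioo.mem_nhds h3)).and
        (hfE.and self_mem_nhdsWithin)).exists
      obtain ⟨hm, -⟩ := hgr.2.1 _ ht2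
      have h4 : q₀.2 = 0 := h.1
      have h5 : (f t).2 = t := by simp [f, h4]
      exact (mem_modelN.1 hm).2.2 ⟨by rw [h5]; exact ht3, ht1⟩
  have hq0 : q₀.1 = 0 := by
    rcases (hφ.core_iff s hsφ).1 hs with h | h
    · exact h.1
    · have h1 := h.2
      rw [hsg, hz] at h1
      norm_num at h1
  -- a neighbourhood in which `c` is in `D` and in the first ball
  have hstar := hc.isCpx.star_mem_nhdsWithin s
  rw [mem_nhdsWithin_iff_exists_mem_nhds_inter] at hstar
  obtain ⟨O, hO, hOs⟩ := hstar
  have hball : c ∩ O ⊆ F.ball c 1 := by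
    rw [hc.isCpx.ball_succ 0]
    rintro n ⟨hn, hn'⟩
    rcases hOs ⟨hn', hn⟩ with h | ⟨e, l, hl, -, ⟨v, hv, h⟩, h'⟩
    · exact Or.inl (by rw [mem_singleton_iff.1 h]; exact hs)
    · exact Or.inr ⟨e, l, hl, trivial, ⟨v, hv, by rw [mem_singleton_iff.1 h]; exact hs⟩, h'⟩
  have hZ : {n | (φ n : (ℝ × ℝ) × ℝ).2 ∈ Ioi 1} ∈ 𝓝 s := by
    refine (continuous_snd.continuousAt.comp (continuousAt_flowBox hsφ)) (Ioi_mem_nhds ?_)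
    show 1 < (φ s).1.2
    rw [hsg, hz]; norm_num
  obtain ⟨W, hWsub, hWo, hsW⟩ := mem_nhds_iff.1 (inter_mem (inter_mem hV hO)
    (inter_mem (φ.open_source.mem_nhds hsφ) hZ))
  have hPs : P q₀ = s := hPn s hsD
  obtain ⟨r, hr, hrW⟩ := Metric.mem_nhdsWithin_iff.1
    (inter_mem (mem_nhdsWithin_of_mem_nhds (hR'.mem_nhds hsE.1) : R ∈ 𝓝[R ∩ {q | q.1 ≤ 0}] q₀)
      (hPc q₀ hsE (by rw [hPs]; exact hWo.mem_nhds hsW)))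
  obtain ⟨r', hr', hrR⟩ := Metric.isOpen_iff.1 hR' q₀ hsE.1
  set ρ := min r r' with hρ
  have hρ0 : 0 < ρ := lt_min hr hr'
  have hρE : ∀ q ∈ Metric.ball q₀ ρ, q.1 ≤ 0 → q ∈ R ∩ {q | q.1 ≤ 0} ∧ P q ∈ W := by
    intro q hq hq1
    have h1 : q ∈ R ∩ {q | q.1 ≤ 0} := ⟨hrR (ball_subset_ball (min_le_right _ _) hq), hq1⟩
    exact ⟨h1, (hrW ⟨ball_subset_ball (min_le_left _ _) hq, h1⟩).2⟩
  set H : Set (ℝ × ℝ) := Metric.ball q₀ ρ ∩ {q | q.1 < 0} with hH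
  have hHo : IsOpen H := isOpen_ball.inter (isOpen_lt continuous_fst continuous_const)
  have hHc : IsPreconnected H := by
    refine ((convex_ball _ _).inter ?_).isPreconnected
    exact convex_halfSpace_lt (LinearMap.fst ℝ ℝ ℝ).isLinear 0
  have hHE : H ⊆ R ∩ {q | q.1 ≤ 0} := fun q hq => (hρE q hq.1 (le_of_lt hq.2)).1
  have hncore : ∀ n ∈ W, n ∈ F.core → (φ n).1.1.1 = 0 := by
    intro n hn hnc
    rcases (hφ.core_iff n (hWsub hn).2.1).1 hnc with h | h
    · exact h.1
    · have h1 : 1 < (φ n : (ℝ × ℝ) × ℝ).2 := (hWsub hn).2.2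
      rw [h.2] at h1
      norm_num at h1
  have hHsub : H ⊆ H ∩ P ⁻¹' c := by
    refine hHc.subset_of_closure_inter_subset ?_ ?_ ?_
    · rw [isOpen_iff_mem_nhds]
      rintro q ⟨hq, hqc⟩
      have hqW := (hρE q hq.1 (le_of_lt hq.2)).2
      have hqcore : P q ∉ F.core := fun h => by
        have h1 := hncore _ hqW h
        rw [(hPD q (hHE hq)).2] at h1
        exact absurd h1 (ne_of_lt hq.2)
      obtain ⟨V', hV', σ, hσ, hσq, hσV⟩ := hc.fullAt_of_not_mem_core hR
        (hball ⟨hqc, (hWsub hqW).1.2⟩) hqcore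
      have hPq : ContinuousAt P q := (hPc.mono hHE).continuousAt (hHo.mem_nhds hq)
      have hσc : ContinuousAt σ (P q) := hσ.continuousAt hV'
      have h1 : ∀ᶠ q' in 𝓝 q, σ (P q') ∈ W :=
        (ContinuousAt.comp (g := σ) hσc hPq) (by
          show W ∈ 𝓝 (σ (P q))
          rw [hσq]; exact hWo.mem_nhds hqW)
      filter_upwards [hHo.mem_nhds hq, hPq hV', h1] with q' hq' hqV' hqσ
      refine ⟨hq', ?_⟩
      obtain ⟨h2, h3⟩ := hσV _ hqV'
      have h4 : σ (P q') = P q' := hDi (hDV ⟨h2, (hWsub hqσ).1.1⟩) (hPD q' (hHE hq')).1 h3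
      show P q' ∈ c
      rw [← h4]; exact h2
    · have h1 := hc.core_subset hs
      have h2 : {n | (φ n : (ℝ × ℝ) × ℝ).1 ∈ Metric.ball q₀ ρ} ∈ 𝓝 s :=
        (continuous_fst.continuousAt.comp (continuousAt_flowBox hsφ)) (ball_mem_nhds _ hρ0)
      obtain ⟨n, ⟨hnW, hnq⟩, hni⟩ := mem_closure_iff_nhds.1 h1 _ (inter_mem (hWo.mem_nhds hsW) h2)
      have hnc : n ∈ c := by obtain ⟨D', -, h, h'⟩ := hni; exact h' h
      have hnD : n ∈ D := hDV ⟨hnc, (hWsub hnW).1.1⟩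
      obtain ⟨hn1, hn2, hn3⟩ := hgr.mem hnD
      have hlt : (φ n).1.1.1 < 0 := by
        refine lt_of_le_of_ne hn2.2 fun h => ?_
        refine core_disjoint_surfaceInterior (c := c) ((hφ.core_iff n hn1).2 (Or.inl ⟨h, ?_⟩)) hni
        rw [hn3]; exact hg0 _ hn2.1 h
      refine ⟨(φ n).1.1, ⟨hnq, hlt⟩, ⟨hnq, hlt⟩, ?_⟩
      show P (φ n).1.1 ∈ c
      rw [hPn n hnD]; exact hnc
    · rintro q ⟨hq, hqH⟩
      refine ⟨hqH, ?_⟩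
      have h1 : ContinuousWithinAt P (H ∩ P ⁻¹' c) q :=
        (hPc q (hHE hqH)).mono (inter_subset_left.trans hHE)
      have h2 := h1.mem_closure hq (t := c) fun a ha => ha.2
      rwa [hc.isCompact.isClosed.closure_eq] at h2
  have hmem : ∀ q ∈ Metric.ball q₀ ρ, q.1 ≤ 0 → P q ∈ c := by
    intro q hq hq1
    have hqH : q ∈ closure H := by
      let f : ℝ → ℝ × ℝ := fun t => (q.1 - t, q.2)
      have hf : Continuous f := by fun_prop
      have hf0 : f 0 = q := by simp [f]
      have h1 : Tendsto f (𝓝[>] 0) (𝓝 q) := by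
        have := hf.tendsto 0
        rw [hf0] at this
        exact this.mono_left nhdsWithin_le_nhds
      refine mem_closure_of_tendsto h1 ?_
      filter_upwards [h1 (isOpen_ball.mem_nhds hq), self_mem_nhdsWithin] with t ht ht'
      exact ⟨ht, by show q.1 - t < 0; have : 0 < t := ht'; linarith⟩
    have h1 : ContinuousWithinAt P H q := (hPc q (hρE q hq hq1).1).mono hHE
    have h2 := h1.mem_closure hqH (t := c) fun a ha => (hHsub ha).2
    rwa [hc.isCompact.isClosed.closure_eq] at h2
  obtain ⟨V₁, hV₁, σ, hσ, hσs, hσV⟩ := hfull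
  have h1 : {m | (φ (σ m) : (ℝ × ℝ) × ℝ).1 ∈ Metric.ball q₀ ρ} ∈ 𝓝 s := by
    have h2 : ContinuousAt (fun n => (φ n : (ℝ × ℝ) × ℝ).1) s :=
      continuous_fst.continuousAt.comp (continuousAt_flowBox hsφ)
    have h3 : ContinuousAt (fun m => (φ (σ m) : (ℝ × ℝ) × ℝ).1) s :=
      ContinuousAt.comp (g := fun n => (φ n : (ℝ × ℝ) × ℝ).1) (f := σ)
        (by rw [hσs]; exact h2) (hσ.continuousAt hV₁)
    refine h3 ?_
    show Metric.ball q₀ ρ ∈ 𝓝 (φ (σ s) : (ℝ × ℝ) × ℝ).1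
    rw [hσs]; exact ball_mem_nhds _ hρ0
  refine ⟨_, inter_mem hV₁ h1, σ, hσ.mono inter_subset_left, hσs, fun m hm => ⟨?_, (hσV m hm.1).2⟩⟩
  have h4 := (hσV m hm.1).1
  rw [← hPn _ h4]
  exact hmem _ hm.2 (hgr.mem h4).2.1.2

lemma hasLifts_ball {j : ℕ} (hj : 1 ≤ j) (hR : F.ball c j ∩ F.bdry c = F.core) :
    F.HasLifts c (F.ball c j) := by
  refine hc.isCpx.hasLifts fun p hp => ?_
  by_cases h : p ∈ F.core
  · refine hc.fullAt_core (Subset.antisymm ?_ ?_) h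
    · refine Subset.trans (inter_subset_inter_left _ ?_) hR.subset
      exact monotone_nat_of_le_succ (f := F.ball c) (fun _ => subset_union_left) hj
    · exact fun s hs => ⟨core_subset_ball _ hs, (hR ▸ hs : s ∈ F.ball c j ∩ F.bdry c).2⟩
  · exact hc.fullAt_of_not_mem_core hR hp h

omit hc in
/-- Complexes of large radius have lifts through the points of a large ball. -/
lemma eventually_hasLifts {c : ℕ → Set N} (hc : ∀ k, F.IsSplittingComplex (c k))
    (h : Tendsto (fun k => F.radius (c k)) atTop (𝓝 ⊤)) (j : ℕ) :
    ∀ᶠ k in atTop, F.HasLifts (c k) (F.ball (c k) j) := by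
  have h1 := ENat.tendsto_nhds_top_iff_natCast_lt.1 h (j + 1)
  filter_upwards [h1] with k hk
  obtain ⟨i, hi⟩ := lt_iSup_iff.1 hk
  obtain ⟨hR, hi⟩ := lt_iSup_iff.1 hi
  have hi' : j + 1 < i := by exact_mod_cast hi
  refine ((hc k).hasLifts_ball (by lia) hR).mono ?_
  exact monotone_nat_of_le_succ (f := F.ball (c k)) (fun _ => subset_union_left) (by lia)

end IsSplittingComplex
end FibredNbhd
end BranchedSurface

/-! ### Coherence: small sheets about a fibre, uniformly in the complex -/

namespace BranchedSurface

/-- Small caps of spheres are connected. -/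
lemma exists_preconnected_cap {E : Type*} [NormedAddCommGroup E] [NormedSpace ℝ E] {u : E}
    (hu : u ∈ sphere (0 : E) 1) {r : ℝ} (hr1 : r < 1) :
    ∃ A, IsPreconnected A ∧ A ⊆ sphere (0 : E) 1 ∧ sphere (0 : E) 1 ∩ Metric.ball u r ⊆ A ∧
      A ⊆ Metric.ball u (2 * r) := by
  have hu1 : ‖u‖ = 1 := by simpa using hu
  have hpos : ∀ w ∈ Metric.ball u r, 0 < ‖w‖ := by
    intro w hw
    have h1 : ‖w - u‖ < r := by rwa [← dist_eq_norm]
    have h2 := norm_sub_norm_le u w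
    rw [norm_sub_rev] at h2
    linarith
  refine ⟨(fun w : E => ‖w‖⁻¹ • w) '' Metric.ball u r, ?_, ?_, ?_, ?_⟩
  · refine (convex_ball u r).isPreconnected.image _ ?_
    exact (continuousOn_id.norm.inv₀ fun w hw => (hpos w hw).ne').smul continuousOn_id
  · rintro _ ⟨w, hw, rfl⟩
    rw [mem_sphere_zero_iff_norm, norm_smul, norm_inv, norm_norm, inv_mul_cancel₀ (hpos w hw).ne']
  · rintro w ⟨hw, hw'⟩
    refine ⟨w, hw', ?_⟩
    rw [mem_sphere_zero_iff_norm] at hw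
    simp [hw]
  · rintro _ ⟨w, hw, rfl⟩
    have h0 := hpos w hw
    have h1 : ‖w - u‖ < r := by rwa [← dist_eq_norm]
    have h2 : ‖‖w‖⁻¹ • w - w‖ = |‖u‖ - ‖w‖| := by
      have : ‖w‖⁻¹ • w - w = (‖w‖⁻¹ - 1) • w := by rw [sub_smul, one_smul]
      rw [this, norm_smul, Real.norm_eq_abs, ← abs_of_pos h0, ← abs_mul, abs_of_pos h0, sub_mul,
        inv_mul_cancel₀ h0.ne', one_mul, hu1]
    have h3 := abs_norm_sub_norm_le u w
    rw [norm_sub_rev] at h3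
    rw [Metric.mem_ball, dist_eq_norm]
    have h4 : ‖w‖⁻¹ • w - u = (‖w‖⁻¹ • w - w) + (w - u) := by abel
    simp only
    rw [h4]
    linarith [norm_add_le (‖w‖⁻¹ • w - w) (w - u)]

section Geometry

variable {B : Type*} [TopologicalSpace B] [CWComplex (univ : Set B)] [T2Space B] [CompactSpace B]

lemma BCell.isCompact_preimage (e : BCell B) (x : B) : IsCompact (e.cube ∩ e.chr ⁻¹' {x}) :=
  (isCompact_closedBall _ _).of_isClosed_subset
    (e.continuousOn_chr.preimage_isClosed_of_isClosed isClosed_closedBall isClosed_singleton)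
    inter_subset_left

/-- One `δ` serves for all preimages of `x`, as they form a compact set in each of finitely many
parameter cubes. -/
lemma BCell.eventually_chr_mem {x : B} {O : Set B} (hO : O ∈ 𝓝 x) :
    ∀ᶠ δ in 𝓝[>] (0 : ℝ), ∀ (e : BCell B), ∀ u ∈ e.cube, e.chr u = x → ∀ v ∈ e.cube,
      dist v u < δ → e.chr v ∈ O := by
  have := BCell.finite (B := B)
  refine eventually_all.2 fun e => ?_
  obtain ⟨U, hU, hUO⟩ := (continuousOn_iff'.1 e.continuousOn_chr) _ (isOpen_interior (s := O))
  have hsub : e.cube ∩ e.chr ⁻¹' {x} ⊆ U := by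
    rintro u ⟨hu, hux⟩
    have h1 : u ∈ e.chr ⁻¹' interior O ∩ e.cube :=
      ⟨by rw [mem_preimage, mem_singleton_iff.1 hux]; exact mem_interior_iff_mem_nhds.2 hO, hu⟩
    rw [hUO] at h1
    exact h1.1
  obtain ⟨δ, hδ, hδU⟩ := (e.isCompact_preimage x).exists_thickening_subset_open hU hsub
  filter_upwards [Ioo_mem_nhdsGT hδ] with δ' hδ' u hu hux v hv hvu
  have h1 : v ∈ U := hδU (mem_thickening_iff.2 ⟨u, ⟨hu, hux⟩, hvu.trans hδ'.2⟩)
  have h2 : v ∈ U ∩ e.cube := ⟨h1, hv⟩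
  rw [← hUO] at h2
  exact interior_subset h2.1

lemma BCell.eventually_exists_near (x : B) {δ : ℝ} (hδ : 0 < δ) :
    ∀ᶠ y in 𝓝 x, ∀ (e : BCell B), ∀ v ∈ e.cube, e.chr v = y →
      ∃ u ∈ e.cube, e.chr u = x ∧ dist v u < δ := by
  have := BCell.finite (B := B)
  refine eventually_all.2 fun e => ?_
  have hk : IsCompact (e.cube \ thickening δ (e.cube ∩ e.chr ⁻¹' {x})) :=
    (isCompact_closedBall _ _).diff isOpen_thickening
  have hk' := (hk.image_of_continuousOn (e.continuousOn_chr.mono sdiff_subset)).isClosed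
  have hx : x ∉ e.chr '' (e.cube \ thickening δ (e.cube ∩ e.chr ⁻¹' {x})) := by
    rintro ⟨u, ⟨hu, hu'⟩, hux⟩
    exact hu' (self_subset_thickening hδ _ ⟨hu, hux⟩)
  filter_upwards [hk'.isOpen_compl.mem_nhds hx] with y hy v hv hvy
  by_contra h
  refine hy ⟨v, ⟨hv, fun hv' => h ?_⟩, hvy⟩
  obtain ⟨u, ⟨hu, hux⟩, hvu⟩ := mem_thickening_iff.1 hv'
  exact ⟨u, hu, hux, hvu⟩

lemma BCell.eventually_mem_int (x : B) :
    ∀ᶠ δ in 𝓝[>] (0 : ℝ), ∀ (e : BCell B), ∀ u ∈ e.int, e.chr u = x → ∀ v,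
      dist v u < δ → v ∈ e.int := by
  obtain ⟨e, he⟩ := BCell.exists_mem_op x
  obtain ⟨δ, hδ, h⟩ := Metric.isOpen_iff.1 (isOpen_ball (x := (0 : e.Par)) (ε := 1)) _ (e.inv_mem he)
  filter_upwards [Ioo_mem_nhdsGT hδ] with δ' hδ' e' u hu hux v hvu
  have := BCell.eq_of_mem_op he (hux ▸ e'.chr_mem_op hu)
  subst this
  refine h ?_
  rw [← hux, e.inv_chr hu]
  exact hvu.trans hδ'.2

end Geometry

namespace FibredNbhd

variable {N B : Type*} [TopologicalSpace N] [TopologicalSpace B] {F : FibredNbhd N B}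
variable [CWComplex (univ : Set B)]

/-- The point `s` is on a closed cell of `c`, of dimension less than `n`, near the point `p` of this
cell. -/
def Near (F : FibredNbhd N B) (c : Set N) (n : ℕ) (δ : ℝ) (p s : N) : Prop :=
  ∃ (e : BCell B) (l : e.Par → N) (u v : e.Par), e.1 < n ∧ F.IsLift c e l ∧ u ∈ e.cube ∧
    v ∈ e.cube ∧ dist v u < δ ∧ l u = p ∧ l v = s

lemma Near.mono {c : Set N} {n n' : ℕ} {δ δ' : ℝ} {p s : N} (h : F.Near c n δ p s) (hn : n ≤ n')
    (hδ : δ ≤ δ') : F.Near c n' δ' p s := by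
  obtain ⟨e, l, u, v, h1, h2, h3, h4, h5, h6⟩ := h
  exact ⟨e, l, u, v, h1.trans_le hn, h2, h3, h4, h5.trans_le hδ, h6⟩

lemma Near.mem {c : Set N} {n : ℕ} {δ : ℝ} {p s : N} (h : F.Near c n δ p s) : s ∈ c := by
  obtain ⟨e, l, u, v, h1, h2, h3, h4, h5, h6, rfl⟩ := h
  exact h2.mem v h4

variable (F) in
/-- Points near a full point over `x` are determined by their projection. -/
def Coherent (x : B) (n : ℕ) (δ : ℝ) : Prop :=
  ∀ c, F.LocInj c → ∀ p, F.π p = x → F.HasLifts c {p} → ∀ s s', F.Near c n δ p s →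
    F.Near c n δ p s' → F.π s = F.π s' → s = s'

variable [T2Space B] [CompactSpace N] [T2Space N]

/-- Limits of points near `p` are near `p`. -/
lemma Coherent.tendsto {x : B} {n : ℕ} {δ δ' : ℝ} (h : F.Coherent x n δ) (hδ' : δ' < δ)
    {c : Set N} (hi : F.LocInj c) {p : N} (hp : F.π p = x) (hL : F.HasLifts c {p}) {A : Type*}
    (U : Ultrafilter A) {s : A → N} (hs : ∀ᶠ a in (U : Filter A), F.Near c n δ' p (s a)) {y : B}
    (hy : Tendsto (fun a => F.π (s a)) (U : Filter A) (𝓝 y)) :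
    ∃ t, F.Near c n δ p t ∧ F.π t = y ∧ Tendsto s (U : Filter A) (𝓝 t) := by
  have := F.compactSpace_base
  have := BCell.finite (B := B)
  obtain ⟨a₀, ha₀⟩ := hs.exists
  have hex : ∀ a, ∃ (e : BCell B) (l : e.Par → N) (u v : e.Par), F.Near c n δ' p (s a) →
      e.1 < n ∧ F.IsLift c e l ∧ u ∈ e.cube ∧ v ∈ e.cube ∧ dist v u < δ' ∧ l u = p ∧
        l v = s a := by
    intro a
    by_cases ha : F.Near c n δ' p (s a)
    · obtain ⟨e, l, u, v, h⟩ := ha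
      exact ⟨e, l, u, v, fun _ => h⟩
    · obtain ⟨e, l, u, v, -⟩ := ha₀
      exact ⟨e, l, u, v, fun h => absurd h ha⟩
  choose e l u v hlu using hex
  obtain ⟨e₀, -, he₀⟩ := U.exists_eventually_eq_of_finite (f := e) finite_univ (by simp)
  have hex : ∀ a, ∃ (l : e₀.Par → N) (u v : e₀.Par), F.Near c n δ' p (s a) → e a = e₀ →
      e₀.1 < n ∧ F.IsLift c e₀ l ∧ u ∈ e₀.cube ∧ v ∈ e₀.cube ∧ dist v u < δ' ∧ l u = p ∧
        l v = s a := by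
    intro a
    by_cases ha : F.Near c n δ' p (s a) ∧ e a = e₀
    · have h1 := hlu a ha.1
      obtain ⟨h2, h3⟩ := ha
      subst h3
      exact ⟨l a, u a, v a, fun _ _ => h1⟩
    · exact ⟨fun _ => p, 0, 0, fun h1 h2 => absurd ⟨h1, h2⟩ ha⟩
  choose l u v hlu using hex
  have hluv := (hs.and he₀).mono fun a ha => hlu a ha.1 ha.2
  obtain ⟨u₀, hu₀, hu⟩ := (isCompact_closedBall (0 : e₀.Par) 1).ultrafilter_le_nhds
    (U.map u) (by
      rw [le_principal_iff, Ultrafilter.coe_map]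
      exact Filter.mem_map.2 (hluv.mono fun a ha => ha.2.2.1))
  obtain ⟨v₀, hv₀, hv⟩ := (isCompact_closedBall (0 : e₀.Par) 1).ultrafilter_le_nhds
    (U.map v) (by
      rw [le_principal_iff, Ultrafilter.coe_map]
      exact Filter.mem_map.2 (hluv.mono fun a ha => ha.2.2.2.1))
  change Tendsto u (U : Filter A) (𝓝 u₀) at hu
  change Tendsto v (U : Filter A) (𝓝 v₀) at hv
  -- The point `p` is still in the limit fibre over the limit `u₀` of the base parameters, so there
  -- is a lift `l₀` through it. Coherence identifies `s` with the values of `l₀`, which converge.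
  have hu₀p : (u₀, p) ∈ F.limFib e₀ := by
    refine (isClosed_limFib e₀).mem_of_tendsto (hu.prodMk_nhds tendsto_const_nhds) ?_
    filter_upwards [hluv] with a ha
    have h1 := ha.2.1.mem_limFib ha.2.2.1
    rwa [ha.2.2.2.2.2.1] at h1
  obtain ⟨l₀, hl₀, hl₀p⟩ := hL e₀ u₀ p hu₀p rfl
  have hdist : dist v₀ u₀ ≤ δ' := le_of_tendsto (hv.dist hu) (hluv.mono fun a ha =>
    ha.2.2.2.2.1.le)
  have hn : e₀.1 < n := hluv.exists.choose_spec.1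
  have hlv : Tendsto (fun a => l₀ (v a)) (U : Filter A) (𝓝 (l₀ v₀)) := by
    refine (hl₀.continuousOn v₀ hv₀).tendsto.comp (tendsto_nhdsWithin_iff.2 ⟨hv, ?_⟩)
    exact hluv.mono fun a ha => ha.2.2.2.1
  have hls : ∀ᶠ a in (U : Filter A), l₀ (v a) = s a := by
    have h1 : ∀ᶠ a in (U : Filter A), dist (v a) u₀ < δ :=
      (hv.dist tendsto_const_nhds).eventually (gt_mem_nhds (hdist.trans_lt hδ'))
    filter_upwards [h1, hluv, hs] with a ha ha' hsa
    refine h c hi p hp hL _ _ ⟨e₀, l₀, u₀, v a, hn, hl₀, hu₀, ha'.2.2.2.1, ha, hl₀p, rfl⟩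
      (hsa.mono le_rfl hδ'.le) ?_
    rw [hl₀.π_eq _ ha'.2.2.2.1, ← ha'.2.1.π_eq _ ha'.2.2.2.1, ha'.2.2.2.2.2.2]
  refine ⟨l₀ v₀, ⟨e₀, l₀, u₀, v₀, hn, hl₀, hu₀, hv₀, hdist.trans_lt hδ', hl₀p, rfl⟩, ?_,
    hlv.congr' hls⟩
  have h1 := (F.continuous_π.tendsto _).comp hlv
  exact tendsto_nhds_unique h1 (hy.congr' (hls.mono fun a ha => by
    simp only [Function.comp_apply]; rw [ha]))

end FibredNbhd
end BranchedSurface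

namespace BranchedSurface
namespace FibredNbhd

variable {N B : Type*} [TopologicalSpace N] [TopologicalSpace B] {F : FibredNbhd N B}

/-- The box `b` is centred at the fibre over `x`. -/
def Box.IsCentre (b : F.Box) (x : B) : Prop := ∀ m, F.π m = x → m ∈ b.src ∧ b.q m = b.q₀

namespace Box.IsCentre

variable {b : F.Box} {x : B} (hb : b.IsCentre x)
include hb

lemma mem_base : x ∈ b.base := by
  obtain ⟨m, rfl⟩ := F.surjective_π x
  exact (b.mem_base_iff).2 (hb m rfl).1

lemma qB_eq : b.qB x = b.q₀ := by
  obtain ⟨m, rfl⟩ := F.surjective_π x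
  rw [b.qB_π (hb m rfl).1, (hb m rfl).2]

lemma pt_eq [Nonempty N] {p : N} (hp : F.π p = x) : b.pt (b.q₀, b.z p) = p := by
  rw [← (hb p hp).2, b.pt_qz (hb p hp).1]

end Box.IsCentre

variable [CWComplex (univ : Set B)] [T2Space B] [CompactSpace N] [T2Space N]

/-- `δ` is so small that cells over the `δ`-neighbourhood of preimages of `x` are in the box. -/
def Box.Small (b : F.Box) (x : B) (δ : ℝ) : Prop :=
  ∀ (e : BCell B), ∀ u ∈ e.cube, e.chr u = x → ∀ v ∈ e.cube, dist v u < δ → e.chr v ∈ b.base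

namespace Box.Small

variable {b : F.Box} {x : B} {δ : ℝ} (hs : b.Small x δ)
include hs

omit [T2Space B] [CompactSpace N] [T2Space N] in
lemma exists_convex {e : BCell B} {u : e.Par} (hu : u ∈ e.cube) (hux : e.chr u = x) {v : e.Par}
    (hv : v ∈ e.cube) (hvu : dist v u < δ) :
    ∃ U, Convex ℝ U ∧ U ⊆ e.cube ∧ MapsTo e.chr U b.base ∧ U ∈ 𝓝[e.cube] u ∧ u ∈ U ∧ v ∈ U ∧
      (U ∩ e.int).Nonempty := by
  have hδ : 0 < δ := dist_nonneg.trans_lt hvu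
  refine ⟨Metric.ball u δ ∩ e.cube, (convex_ball _ _).inter (convex_closedBall _ _),
    inter_subset_right, fun w hw => hs e u hu hux w hw.2 hw.1,
    inter_mem (mem_nhdsWithin_of_mem_nhds (ball_mem_nhds _ hδ)) self_mem_nhdsWithin,
    ⟨mem_ball_self hδ, hu⟩, ⟨hvu, hv⟩, ?_⟩
  have hu' : u ∈ closure e.int := by rwa [closure_ball _ one_ne_zero]
  obtain ⟨w, hw, hw'⟩ := mem_closure_iff_nhds.1 hu' _ (ball_mem_nhds u hδ)
  exact ⟨w, ⟨hw, ball_subset_closedBall hw'⟩, hw'⟩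

lemma J_of_limFib (hτ : F.IsAdapted) {e : BCell B} {u : e.Par} {p : N}
    (hup : (u, p) ∈ F.limFib e) (hp : F.π p = x) {v : e.Par} (hv : v ∈ e.cube)
    (hvu : dist v u < δ) : b.z p ∈ b.J (e.chr v) := by
  have : Nonempty N := ⟨p⟩
  obtain ⟨hu, hpu⟩ := limFib_subset hup
  obtain ⟨U, h1, h2, h3, h4, h5, h6, w, hw⟩ := hs.exists_convex hu (hpu.symm.trans hp) hv hvu
  have h7 := b.z_mem_J_of_limFib hτ h1 h2 h3 h4 hw hup
  obtain ⟨h8, h9⟩ := b.limFib_pt hτ h1 h2 h3 h6 hw h7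
  exact ⟨_, b.pt_mem h8, (limFib_subset h9).2, b.z_pt h8⟩

/-- With `J_of_limFib` this is a criterion: the cell `e` can be lifted at `u` to start from `p` as
soon as the height of `p` occurs over a nearby point of the open cell. -/
lemma limFib_of_J (hτ : F.IsAdapted) (hb : b.IsCentre x) {e : BCell B} {u : e.Par} {p : N}
    (hu : u ∈ e.cube) (hux : e.chr u = x) (hp : F.π p = x) {v : e.Par} (hv : v ∈ e.int)
    (hvu : dist v u < δ) (hJ : b.z p ∈ b.J (e.chr v)) : (u, p) ∈ F.limFib e := by
  have : Nonempty N := ⟨p⟩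
  obtain ⟨U, h1, h2, h3, h4, h5, h6, -⟩ :=
    hs.exists_convex hu hux (ball_subset_closedBall hv) hvu
  have h7 := (b.limFib_pt hτ h1 h2 h3 h5 ⟨h6, hv⟩ hJ).2
  rwa [hux, hb.qB_eq, hb.pt_eq hp] at h7

/-- Existence of points near a full point. -/
lemma exists_near (hτ : F.IsAdapted) (hb : b.IsCentre x) {c : Set N} {p : N} (hp : F.π p = x)
    (hL : F.HasLifts c {p}) {n : ℕ} {δ' : ℝ} (hδ : δ' ≤ δ) {y : B} (hyn : y ∈ skel B n)
    (hy : ∀ (e : BCell B), ∀ v ∈ e.cube, e.chr v = y → ∃ u ∈ e.cube, e.chr u = x ∧ dist v u < δ')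
    (hJ : b.z p ∈ b.J y) : ∃ s, F.Near c n δ' p s ∧ F.π s = y := by
  obtain ⟨e, hen, he⟩ := hyn
  have hv := e.inv_mem he
  have hvy := e.chr_inv he
  obtain ⟨u, hu, hux, hvu⟩ := hy e _ (ball_subset_closedBall hv) hvy
  obtain ⟨l, hl, hlp⟩ := hL e u p
    (hs.limFib_of_J hτ hb hu hux hp hv (hvu.trans_le hδ) (hvy.symm ▸ hJ)) rfl
  exact ⟨_, ⟨e, l, u, _, hen, hl, hu, ball_subset_closedBall hv, hvu, hlp, rfl⟩,
    (hl.π_eq _ (ball_subset_closedBall hv)).trans hvy⟩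

end Box.Small

omit [T2Space B] [CompactSpace N] [T2Space N] in
lemma HasLifts.near_self {c : Set N} {p : N} (hL : F.HasLifts c {p}) {n : ℕ} {δ : ℝ} (hδ : 0 < δ)
    (hn : F.π p ∈ skel B n) : F.Near c n δ p p := by
  obtain ⟨e, hen, he⟩ := hn
  have hv := e.inv_mem he
  obtain ⟨l, hl, hlp⟩ := hL e _ p (mem_limFib_of_int hv (e.chr_inv he).symm) rfl
  exact ⟨e, l, _, _, hen, hl, ball_subset_closedBall hv, ball_subset_closedBall hv, by simpa, hlp,
    hlp⟩

/-- Lifts of a cell, near points of its frontier over `x`, are near in lower dimensional cells. -/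
lemma Coherent.near_of_sphere (hτ : F.IsAdapted) {b : F.Box} {x : B} (hb : b.IsCentre x) {n : ℕ}
    {δ ε r : ℝ} (h : F.Coherent x n δ) (hδ : 0 < δ) (hs : b.Small x δ) (hεδ : ε ≤ δ)
    (hε : ∀ (e : BCell B), ∀ u ∈ e.cube, e.chr u = x → ∀ w ∈ e.cube, dist w u < ε →
      ∀ (e' : BCell B), ∀ v ∈ e'.cube, e'.chr v = e.chr w →
        ∃ u' ∈ e'.cube, e'.chr u' = x ∧ dist v u' < δ / 2) (hr : 0 < r) (hr1 : r < 1)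
    (hrε : 2 * r ≤ ε)
    {c : Set N} (hi : F.LocInj c) {p : N} (hp : F.π p = x) (hL : F.HasLifts c {p}) {e : BCell B}
    (hen : e.1 ≤ n) {l : e.Par → N} (hl : F.IsLift c e l) {u v : e.Par}
    (hu : u ∈ sphere (0 : e.Par) 1) (hup : l u = p) (hv : v ∈ sphere (0 : e.Par) 1)
    (hvu : dist v u < r) : F.Near c n δ p (l v) := by
  have hsc : sphere (0 : e.Par) 1 ⊆ e.cube := sphere_subset_closedBall
  have hδ2 : δ / 2 < δ := by linarith
  have hux : e.chr u = x := by rw [← hl.π_eq u (hsc hu), hup, hp]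
  obtain ⟨A, hA, hAs, hsA, hAb⟩ := exists_preconnected_cap hu hr1
  have hlim : (u, p) ∈ F.limFib e := hup ▸ hl.mem_limFib (hsc hu)
  -- Over the cap `A` of the sphere there is a second lift `Λ`, which starts at `p` and is made of
  -- cells of lower dimension. Coherence in dimension less than `n` makes it continuous, so it
  -- agrees with `l` on the connected cap.
  have hex : ∀ w, ∃ s, w ∈ A → F.Near c n (δ / 2) p s ∧ F.π s = e.chr w := by
    intro w
    by_cases hw : w ∈ A
    · have hwε : dist w u < ε := (hAb hw).trans_le hrε
      have hwc := hsc (hAs hw)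
      obtain ⟨s, hs⟩ := hs.exists_near hτ hb hp hL hδ2.le (skel_mono hen (e.chr_sphere (hAs hw)))
        (hε e u (hsc hu) hux w hwc hwε)
        (hs.J_of_limFib hτ hlim hp hwc (hwε.trans_le hεδ))
      exact ⟨s, fun _ => hs⟩
    · exact ⟨p, fun h => absurd h hw⟩
  choose Λ hΛ using hex
  have hΛc : ContinuousOn Λ A := by
    intro w hw
    have : Tendsto Λ (𝓝[A] w) (𝓝 (Λ w)) := by
      rw [tendsto_iff_ultrafilter]
      intro U hU
      have hUA : ∀ᶠ w' in (U : Filter e.Par), w' ∈ A := hU self_mem_nhdsWithin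
      obtain ⟨t, ht, htπ, hts⟩ := h.tendsto hδ2 hi hp hL U (s := Λ) (y := e.chr w)
        (hUA.mono fun w' hw' => (hΛ w' hw').1) (by
          have h1 : Tendsto e.chr (U : Filter e.Par) (𝓝 (e.chr w)) :=
            ((e.continuousOn_chr w (hsc (hAs hw))).mono (hAs.trans hsc)).tendsto.mono_left hU
          exact h1.congr' (hUA.mono fun w' hw' => (hΛ w' hw').2.symm))
      have h2 : t = Λ w := h c hi p hp hL _ _ ht ((hΛ w hw).1.mono le_rfl hδ2.le)
        (htπ.trans (hΛ w hw).2.symm)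
      rwa [h2] at hts
    exact this
  have huA : u ∈ A := hsA ⟨hu, mem_ball_self hr⟩
  have hvA : v ∈ A := hsA ⟨hv, hvu⟩
  have hΛu : l u = Λ u := by
    have h1 : F.Near c n δ p p := hL.near_self hδ (by
      rw [hp, ← hux]; exact skel_mono hen (e.chr_sphere hu))
    rw [hup]
    exact h c hi p hp hL _ _ h1 ((hΛ u huA).1.mono le_rfl hδ2.le)
      (by rw [(hΛ u huA).2, hp, hux])
  have heq : EqOn l Λ A := hi.eqOn hA (hl.continuousOn.mono (hAs.trans hsc)) hΛc
    (fun w hw => hl.mem w (hsc (hAs hw))) (fun w hw => (hΛ w hw).1.mem)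
    (fun w hw => by rw [hl.π_eq w (hsc (hAs hw)), (hΛ w hw).2]) huA hΛu
  rw [heq hvA]
  exact (hΛ v hvA).1.mono le_rfl hδ2.le

/-- Points of open `n`-cells are told from points of lower cells by their projection. The remaining
case is that of two lifts `l`, `l'` of the same `n`-cell, with `p = l u = l' u'` and `u`, `u'` both
close to one `v`. If `u` is interior, then `u = u'`. If `u` is on the sphere, so is `u'`, and
`near_of_sphere` places `l u'` near `p` in lower cells; coherence there gives `l u' = p`, so the
lifts agree. -/
lemma Coherent.succ (hτ : F.IsAdapted) {b : F.Box} {x : B} (hb : b.IsCentre x) {n : ℕ}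
    {δ : ℝ} (h : F.Coherent x n δ) (hδ : 0 < δ) (hs : b.Small x δ) :
    ∃ δ' > 0, δ' ≤ δ ∧ F.Coherent x (n + 1) δ' := by
  have := F.compactSpace_base
  obtain ⟨ε, hε, hεδ, hint, hε0⟩ := ((BCell.eventually_chr_mem
    (BCell.eventually_exists_near x (half_pos hδ))).and ((show ∀ᶠ ε in 𝓝[>] (0 : ℝ), ε ∈ Ioc 0 δ from
      Ioc_mem_nhdsGT hδ).and ((BCell.eventually_mem_int x).and self_mem_nhdsWithin))).exists
  have hε0 : 0 < ε := hε0
  -- The bound `r < 1` makes the cap connected and `2 * r ≤ ε` bounds its size. The final constant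
  -- is `r / 2`, so that two parameters close to a third are within `r` of each other.
  set r := min (1 / 2) (ε / 2) with hr
  have hr0 : 0 < r := lt_min (by norm_num) (by linarith)
  have hr1 : r < 1 := (min_le_left _ _).trans_lt (by norm_num)
  have hrε : 2 * r ≤ ε := by have := min_le_right (1 / 2 : ℝ) (ε / 2); linarith
  have hsph : ∀ {c : Set N}, F.LocInj c → ∀ {p}, F.π p = x → F.HasLifts c {p} → ∀ {e : BCell B},
      e.1 ≤ n → ∀ {l : e.Par → N}, F.IsLift c e l → ∀ {u v : e.Par}, u ∈ sphere (0 : e.Par) 1 →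
      l u = p → v ∈ sphere (0 : e.Par) 1 → dist v u < r → F.Near c n δ p (l v) :=
    fun hi _ hp hL _ hen _ hl _ _ hu hup hv hvu =>
      h.near_of_sphere hτ hb hδ hs hεδ.2 hε hr0 hr1 hrε hi hp hL hen hl hu hup hv hvu
  have hrδ : r / 2 ≤ δ := by linarith [hεδ.2]
  refine ⟨r / 2, half_pos hr0, hrδ, ?_⟩
  intro c hi p hp hL s s' hsn hsn' hss
  have key : ∀ s, F.Near c (n + 1) (r / 2) p s → F.Near c n δ p s ∨ ∃ (e : BCell B)
      (l : e.Par → N) (u v : e.Par), e.1 = n ∧ F.IsLift c e l ∧ u ∈ e.cube ∧ v ∈ e.int ∧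
        dist v u < r / 2 ∧ l u = p ∧ l v = s := by
    rintro s ⟨e, l, u, v, hen, hl, hu, hv, hvu, hlu, hlv⟩
    rcases (Nat.lt_succ_iff.1 hen).lt_or_eq with hlt | heq
    · exact Or.inl ⟨e, l, u, v, hlt, hl, hu, hv, hvu.trans_le hrδ, hlu, hlv⟩
    rcases BCell.mem_ball_or_sphere hv with hv' | hv'
    · exact Or.inr ⟨e, l, u, v, heq, hl, hu, hv', hvu, hlu, hlv⟩
    · left
      rcases BCell.mem_ball_or_sphere hu with hu' | hu'
      · have := hint e u hu' (by rw [← hl.π_eq u hu, hlu, hp]) v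
          (hvu.trans_le (by linarith))
        rw [mem_ball_zero_iff] at this
        rw [mem_sphere_zero_iff_norm] at hv'
        exact absurd hv' this.ne
      · rw [← hlv]
        exact hsph hi hp hL heq.le hl hu' hlu hv' (hvu.trans (by linarith))
  have hmix : ∀ s s', F.π s = F.π s' → F.Near c n δ p s → ∀ (e : BCell B)
      (l : e.Par → N) (v : e.Par), e.1 = n → F.IsLift c e l → v ∈ e.int → l v = s' → False := by
    rintro s s' hss ⟨e₁, l₁, u₁, v₁, hen₁, hl₁, -, hv₁, -, -, rfl⟩ e l v hen hl hv rfl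
    rw [hl.π_eq v (ball_subset_closedBall hv), hl₁.π_eq v₁ hv₁] at hss
    have h1 : e₁.chr v₁ ∈ skel B n := by
      rcases BCell.mem_ball_or_sphere hv₁ with h2 | h2
      · exact ⟨e₁, hen₁, e₁.chr_mem_op h2⟩
      · exact skel_mono hen₁.le (e₁.chr_sphere h2)
    rw [hss, ← hen] at h1
    exact BCell.not_mem_op_of_mem_skel h1 (e.chr_mem_op hv)
  rcases key s hsn with h1 | ⟨e, l, u, v, hen, hl, hu, hv, hvu, hlu, hlv⟩
  · rcases key s' hsn' with h2 | ⟨e', l', u', v', hen', hl', hu', hv', hvu', hlu', hlv'⟩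
    · exact h c hi p hp hL _ _ h1 h2 hss
    · exact (hmix s s' hss h1 e' l' v' hen' hl' hv' hlv').elim
  · rcases key s' hsn' with h2 | ⟨e', l', u', v', hen', hl', hu', hv', hvu', hlu', hlv'⟩
    · exact (hmix s' s hss.symm h2 e l v hen hl hv hlv).elim
    · have hvv : e.chr v = e'.chr v' := by
        rw [← hl.π_eq v (ball_subset_closedBall hv), hlv, hss, ← hlv',
          hl'.π_eq v' (ball_subset_closedBall hv')]
      have := BCell.eq_of_mem_op (e.chr_mem_op hv) (hvv ▸ e'.chr_mem_op hv')
      subst this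
      have := e.injOn_chr hv hv' hvv
      subst this
      have hux : e.chr u = x := by rw [← hl.π_eq u hu, hlu, hp]
      have hux' : e.chr u' = x := by rw [← hl'.π_eq u' hu', hlu', hp]
      have huu : dist u' u < r := by
        have := dist_triangle u' v u
        rw [dist_comm u' v] at this
        linarith
      suffices hlu'' : l u' = p by
        rw [← hlv, ← hlv']
        exact hl.eqOn hi hl' hu' (hlu''.trans hlu'.symm) (ball_subset_closedBall hv)
      rcases BCell.mem_ball_or_sphere hu with h3 | h3
      · have h4 := hint e u h3 hux u' (huu.trans_le (by linarith))
        rw [← e.injOn_chr h3 h4 (hux.trans hux'.symm)]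
        exact hlu
      · have h4 : u' ∈ sphere (0 : e.Par) 1 := by
          refine (BCell.mem_ball_or_sphere hu').resolve_left fun h4 => ?_
          have h5 := BCell.mem_ball_of_chr_mem_op hu (hux.trans hux'.symm ▸ e.chr_mem_op h4)
          rw [mem_ball_zero_iff] at h5
          rw [mem_sphere_zero_iff_norm] at h3
          exact h5.ne h3
        have h5 := hsph hi hp hL hen.le hl h3 hlu h4 huu
        have h6 := hsph hi hp hL hen.le hl h3 hlu h3 (by rwa [dist_self])
        rw [← hlu]
        refine h c hi p hp hL _ _ h5 h6 ?_
        rw [hl.π_eq u' hu', hl.π_eq u hu, hux, hux']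

lemma exists_coherent (hτ : F.IsAdapted) {b : F.Box} {x : B} (hb : b.IsCentre x) (n : ℕ) :
    ∃ δ > 0, b.Small x δ ∧ F.Coherent x n δ := by
  have := F.compactSpace_base
  induction n with
  | zero =>
    obtain ⟨δ, hδ, hδ0⟩ := ((BCell.eventually_chr_mem (b.isOpen_base.mem_nhds hb.mem_base)).and
      self_mem_nhdsWithin).exists
    refine ⟨δ, hδ0, hδ, ?_⟩
    rintro c - p - - s s' ⟨e, l, u, v, h, -⟩
    exact absurd h (Nat.not_lt_zero _)
  | succ n ih =>
    obtain ⟨δ, hδ, hs, h⟩ := ih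
    obtain ⟨δ', hδ', hδδ, h'⟩ := h.succ hτ hb hδ hs
    exact ⟨δ', hδ', fun e u hu hux v hv hvu => hs e u hu hux v hv (hvu.trans_le hδδ), h'⟩

end FibredNbhd
end BranchedSurface

namespace BranchedSurface
namespace FibredNbhd

variable {N B : Type*} [TopologicalSpace N] [TopologicalSpace B] {F : FibredNbhd N B}

/-! ### Charts -/

lemma Box.J_centre {b : F.Box} {x : B} (hb : b.IsCentre x) : b.J x = Icc b.zl b.zu := by
  apply Subset.antisymm
  · intro z hz
    exact (b.rng_of_J hz).2.2
  · intro z hz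
    obtain ⟨m, hm⟩ := F.surjective_π x
    have h1 : b.z m ∈ b.J x := hm ▸ b.z_mem_J (hb m hm).1
    refine b.J_of_same h1 ?_
    rw [hb.qB_eq]
    exact ⟨rfl, fun w hw => b.center w ((uIcc_subset_Icc (b.rng_of_J h1).2.2 hz) hw)⟩

/-- Points of the box over a smaller closed square which do not project into `O` are contained in a
compact set; its image in the plane of horizontal coordinates misses `b.q₀`, because the whole fibre
over `b.q₀` projects to `x`. -/
lemma Box.exists_subset_of_mem_nhds [CompactSpace N] [T2Space B] {b : F.Box} {x : B}
    (hb : b.IsCentre x) {O : Set B} (hO : O ∈ 𝓝 x) :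
    ∃ ρ > 0, ∀ y ∈ b.base, dist (b.qB y) b.q₀ < ρ → y ∈ O := by
  have : Nonempty N := ⟨(F.surjective_π x).choose⟩
  set K : Set ((ℝ × ℝ) × ℝ) := (closedBall b.q₀ (b.ε / 2) ×ˢ Icc b.zl b.zu) ∩ modelN with hK
  have hKc : IsCompact K :=
    ((isCompact_closedBall _ _).prod isCompact_Icc).inter_right isClosed_modelN
  have hKr : K ⊆ b.rng := fun t ht => ⟨ht.2, lt_of_le_of_lt ht.1.1 (half_lt_self b.ε_pos), ht.1.2⟩
  have hf : ContinuousOn (fun t => F.π (b.pt t)) K :=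
    F.continuous_π.comp_continuousOn (b.continuousOn_pt.mono hKr)
  obtain ⟨U, hU, hUO⟩ := continuousOn_iff'.1 hf _ (isOpen_interior (s := O))
  have hc : IsCompact (K \ U) := hKc.diff hU
  have himg : IsCompact (Prod.fst '' (K \ U)) := hc.image continuous_fst
  have hq : b.q₀ ∉ Prod.fst '' (K \ U) := by
    rintro ⟨⟨q, z⟩, ⟨htK, htU⟩, rfl⟩
    have h1 : F.π (b.pt (b.q₀, z)) = x := by
      rw [← hb.qB_eq]
      exact b.π_pt_of_J (by rw [Box.J_centre hb]; exact htK.1.2)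
    have h2 : (b.q₀, z) ∈ (fun t => F.π (b.pt t)) ⁻¹' interior O ∩ K :=
      ⟨by rw [mem_preimage, h1]; exact mem_interior_iff_mem_nhds.2 hO, htK⟩
    rw [hUO] at h2
    exact htU h2.1
  obtain ⟨ρ, hρ, hρK⟩ := Metric.isOpen_iff.1 himg.isClosed.isOpen_compl _ hq
  refine ⟨min ρ (b.ε / 2), lt_min hρ (half_pos b.ε_pos), ?_⟩
  rintro y ⟨m, hm, rfl⟩ hy
  rw [b.qB_π hm] at hy
  have h1 := b.mem_rng hm
  have htK : (b.q m, b.z m) ∈ K :=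
    ⟨⟨(hy.trans_le (min_le_right _ _)).le, h1.2.2⟩, h1.1⟩
  have htU : (b.q m, b.z m) ∈ U := by
    by_contra h
    exact hρK (hy.trans_le (min_le_left _ _)) ⟨_, ⟨htK, h⟩, rfl⟩
  have h2 : (b.q m, b.z m) ∈ U ∩ K := ⟨htU, htK⟩
  rw [← hUO] at h2
  have h3 := interior_subset h2.1
  change F.π (b.pt (b.q m, b.z m)) ∈ O at h3
  rwa [b.pt_qz hm] at h3

variable [CWComplex (univ : Set B)]

variable (F) in
/-- A box about a fibre, with the constants which control sheets of complexes in this box. -/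
structure Chart where
  b : F.Box
  x : B
  δ : ℝ
  ρ : ℝ
  centre : b.IsCentre x
  δ_pos : 0 < δ
  ρ_pos : 0 < ρ
  small : b.Small x δ
  coherent : F.Coherent x 3 δ
  near : ∀ y ∈ b.base, dist (b.qB y) b.q₀ < ρ → ∀ (e : BCell B), ∀ v ∈ e.cube, e.chr v = y →
    ∃ u ∈ e.cube, e.chr u = x ∧ dist v u < δ / 2
  slit₁ : ∀ y ∈ b.base, dist (b.qB y) b.q₀ < ρ → (b.qB y).1 = 0 → b.q₀.1 = 0
  slit₂ : ∀ y ∈ b.base, dist (b.qB y) b.q₀ < ρ → (b.qB y).2 = 0 → b.q₀.2 = 0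

/-- The neighbourhood of the centre of a chart where it controls sheets. -/
def Chart.O (C : F.Chart) : Set B := {y | y ∈ C.b.base ∧ dist (C.b.qB y) C.b.q₀ < C.ρ}

variable [T2Space B] [CompactSpace N] [T2Space N]

lemma exists_chart (hτ : F.IsAdapted) (x : B) : ∃ C : F.Chart, C.x = x := by
  have := F.compactSpace_base
  obtain ⟨b, hb⟩ := exists_box F x
  have hb : b.IsCentre x := hb
  -- Dimension less than 3 covers all cells of an adapted structure.
  obtain ⟨δ, hδ, hs, hco⟩ := exists_coherent hτ hb 3
  have hq : Tendsto b.qB (𝓝 x) (𝓝 b.q₀) := by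
    have := b.continuousOn_qB.continuousAt (b.isOpen_base.mem_nhds hb.mem_base)
    rwa [ContinuousAt, hb.qB_eq] at this
  have h1 : ∀ᶠ y in 𝓝 x, (b.qB y).1 = 0 → b.q₀.1 = 0 := by
    by_cases h : b.q₀.1 = 0
    · exact Eventually.of_forall fun _ _ => h
    · filter_upwards [((continuous_fst.tendsto _).comp hq).eventually_ne h] with y hy hy'
      exact absurd hy' hy
  have h2 : ∀ᶠ y in 𝓝 x, (b.qB y).2 = 0 → b.q₀.2 = 0 := by
    by_cases h : b.q₀.2 = 0
    · exact Eventually.of_forall fun _ _ => h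
    · filter_upwards [((continuous_snd.tendsto _).comp hq).eventually_ne h] with y hy hy'
      exact absurd hy' hy
  obtain ⟨ρ, hρ, h⟩ := Box.exists_subset_of_mem_nhds hb
    ((BCell.eventually_exists_near x (half_pos hδ)).and (h1.and h2))
  exact ⟨⟨b, x, δ, ρ, hb, hδ, hρ, hs, hco, fun y hy hy' => (h y hy hy').1,
    fun y hy hy' => (h y hy hy').2.1, fun y hy hy' => (h y hy hy').2.2⟩, rfl⟩

lemma IsAdapted.mem_skel_three (hτ : F.IsAdapted) (x : B) : x ∈ skel B 3 := by
  obtain ⟨e, he⟩ := BCell.exists_mem_op x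
  refine ⟨e, ?_, he⟩
  by_contra h
  exact (hτ.dim_le e.1 (by lia)).false e.2

lemma IsAdapted.dim_lt (hτ : F.IsAdapted) (e : BCell B) : e.1 < 3 := by
  by_contra h
  exact (hτ.dim_le e.1 (by lia)).false e.2

lemma IsCpx.ball_of_near {c : Set N} (hc : F.IsCpx c) {n : ℕ} {δ : ℝ} {p s : N}
    (h : F.Near c n δ p s) {j : ℕ} (hp : p ∈ F.ball c j) : s ∈ F.ball c (j + 1) := by
  obtain ⟨e, l, u, v, -, hl, hu, hv, -, rfl, rfl⟩ := h
  rw [hc.ball_succ]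
  exact hl.image_subset_star trivial hu hp ⟨v, hv, rfl⟩

lemma IsCpx.ball_of_near' {c : Set N} (hc : F.IsCpx c) {n : ℕ} {δ : ℝ} {p s : N}
    (h : F.Near c n δ p s) {j : ℕ} (hs : s ∈ F.ball c j) : p ∈ F.ball c (j + 1) := by
  obtain ⟨e, l, u, v, -, hl, hu, hv, -, rfl, rfl⟩ := h
  rw [hc.ball_succ]
  exact hl.image_subset_star trivial hv hs ⟨u, hu, rfl⟩

namespace Chart

variable (C : F.Chart)

lemma isOpen_O : IsOpen C.O :=
  C.b.continuousOn_qB.isOpen_inter_preimage C.b.isOpen_base (isOpen_ball (x := C.b.q₀) (ε := C.ρ))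

lemma mem_O : C.x ∈ C.O :=
  ⟨C.centre.mem_base, by rw [C.centre.qB_eq, dist_self]; exact C.ρ_pos⟩

variable {C}

lemma unique {c : Set N} (hi : F.LocInj c) {p : N} (hp : F.π p = C.x) (hL : F.HasLifts c {p})
    {s s' : N} (hs : F.Near c 3 C.δ p s) (hs' : F.Near c 3 C.δ p s') (h : F.π s = F.π s') :
    s = s' := C.coherent c hi p hp hL s s' hs hs' h

lemma exists_base (hτ : F.IsAdapted) {c : Set N} (hc : F.IsCpx c) {s : N} (hs : s ∈ c)
    (hx : F.π s ∈ C.O) : ∃ p, F.π p = C.x ∧ F.Near c 3 (C.δ / 2) p s := by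
  obtain ⟨e, l, hl, v, hv, rfl⟩ := hc.exists_lift s hs
  have hv' := ball_subset_closedBall hv
  rw [hl.π_eq v hv'] at hx
  obtain ⟨u, hu, hux, hvu⟩ := C.near _ hx.1 hx.2 e v hv' rfl
  exact ⟨l u, (hl.π_eq u hu).trans hux, e, l, u, v, hτ.dim_lt e, hl, hu, hv', hvu, rfl, rfl⟩

lemma exists_near (hτ : F.IsAdapted) {c : Set N} {p : N} (hp : F.π p = C.x)
    (hL : F.HasLifts c {p}) {y : B} (hy : y ∈ C.O) (hJ : C.b.z p ∈ C.b.J y) :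
    ∃ s, F.Near c 3 (C.δ / 2) p s ∧ F.π s = y :=
  C.small.exists_near hτ C.centre hp hL (by linarith [C.δ_pos]) (hτ.mem_skel_three y)
    (C.near y hy.1 hy.2) hJ

lemma J_of_near (hτ : F.IsAdapted) {c : Set N} {p s : N} (hp : F.π p = C.x)
    (h : F.Near c 3 C.δ p s) : C.b.z p ∈ C.b.J (F.π s) := by
  obtain ⟨e, l, u, v, -, hl, hu, hv, hvu, rfl, rfl⟩ := h
  rw [hl.π_eq v hv]
  exact C.small.J_of_limFib hτ (hl.mem_limFib hu) hp hv hvu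

lemma near_self (hτ : F.IsAdapted) {c : Set N} {p : N} (hL : F.HasLifts c {p}) {δ : ℝ}
    (hδ : 0 < δ) : F.Near c 3 δ p p := hL.near_self hδ (hτ.mem_skel_three _)

/-- A point near `p` is near `p` in its own open cell. -/
lemma exists_lifts (hτ : F.IsAdapted) {c : Set N} (hc : F.IsCpx c) {y : B} (hy : y ∈ C.O) :
    ∃ (e : BCell B) (u v : e.Par), u ∈ e.cube ∧ v ∈ e.int ∧ dist v u < C.δ ∧ e.chr v = y ∧
      e.chr u = C.x ∧ ∀ p s, F.π p = C.x → F.HasLifts c {p} → F.Near c 3 C.δ p s → F.π s = y →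
        ∃ l, F.IsLift c e l ∧ l u = p ∧ l v = s := by
  obtain ⟨e, he⟩ := BCell.exists_mem_op y
  have hv := e.inv_mem he
  have hvy := e.chr_inv he
  obtain ⟨u, hu, hux, hvu⟩ := C.near y hy.1 hy.2 e _ (ball_subset_closedBall hv) hvy
  have hvu : dist (e.inv y) u < C.δ := hvu.trans (by linarith [C.δ_pos])
  refine ⟨e, u, _, hu, hv, hvu, hvy, hux, fun p s hp hL hs hsy => ?_⟩
  obtain ⟨l, hl, hlp⟩ := hL e u p (C.small.limFib_of_J hτ C.centre hu hux hp hv hvu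
    (by rw [hvy, ← hsy]; exact J_of_near hτ hp hs)) rfl
  refine ⟨l, hl, hlp, unique hc.locInj hp hL ⟨e, l, u, _, hτ.dim_lt e, hl, hu,
    ball_subset_closedBall hv, hvu, hlp, rfl⟩ hs ?_⟩
  rw [hl.π_eq _ (ball_subset_closedBall hv), hvy, hsy]

/-- By `exists_lifts` both base points are values at the same parameter `u` of lifts of the same
cell, and these lifts agree at `v`. -/
lemma unique_base (hτ : F.IsAdapted) {c : Set N} (hc : F.IsCpx c) {p p' s : N}
    (hp : F.π p = C.x) (hL : F.HasLifts c {p}) (hp' : F.π p' = C.x) (hL' : F.HasLifts c {p'})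
    (hs : F.Near c 3 C.δ p s) (hs' : F.Near c 3 C.δ p' s) (hx : F.π s ∈ C.O) : p = p' := by
  obtain ⟨e, u, v, hu, hv, -, -, -, h⟩ := exists_lifts (C := C) hτ hc hx
  obtain ⟨l, hl, rfl, hlv⟩ := h p s hp hL hs rfl
  obtain ⟨l', hl', rfl, hlv'⟩ := h p' s hp' hL' hs' rfl
  exact hl.eqOn hc.locInj hl' (ball_subset_closedBall hv) (hlv.trans hlv'.symm) hu

/-- Sheets cannot cross: on a convex set of parameters the heights of the two lifts are continuous,
so a change of order would produce a common point, and the lifts would coincide. -/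
lemma z_lt (hτ : F.IsAdapted) {c : Set N} (hc : F.IsCpx c) {p p' s s' : N}
    (hp : F.π p = C.x) (hL : F.HasLifts c {p}) (hp' : F.π p' = C.x) (hL' : F.HasLifts c {p'})
    (hs : F.Near c 3 C.δ p s) (hs' : F.Near c 3 C.δ p' s') (hss : F.π s = F.π s')
    (hx : F.π s ∈ C.O) (h : C.b.z p < C.b.z p') : C.b.z s < C.b.z s' := by
  obtain ⟨e, u, v, hu, hv, hvu, hvy, hux, H⟩ := exists_lifts (C := C) hτ hc hx
  obtain ⟨l, hl, rfl, hlv⟩ := H p s hp hL hs rfl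
  obtain ⟨l', hl', rfl, hlv'⟩ := H p' s' hp' hL' hs' hss.symm
  obtain ⟨U, hU, hUc, hUb, -, huU, hvU, -⟩ := C.small.exists_convex hu hux
    (ball_subset_closedBall hv) hvu
  have hsrc : ∀ {l : e.Par → N}, F.IsLift c e l → MapsTo l U C.b.src := fun {l} hl w hw => by
    show l w ∈ C.b.src
    rw [← C.b.mem_base_iff, hl.π_eq w (hUc hw)]; exact hUb hw
  have hz : ∀ {l : e.Par → N}, F.IsLift c e l → ContinuousOn (fun w => C.b.z (l w)) U :=
    fun {l} hl => C.b.continuousOn_z.comp (hl.continuousOn.mono hUc) (hsrc hl)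
  by_contra hcon
  rw [← hlv, ← hlv'] at hcon
  obtain ⟨w, hw, hww⟩ := hU.isPreconnected.intermediate_value₂ huU hvU (hz hl) (hz hl') h.le
    (not_lt.1 hcon)
  have h1 : l w = l' w := C.b.injOn (hsrc hl hw) (hsrc hl' hw)
    (C.b.q_eq (hsrc hl hw) (by rw [hl.π_eq w (hUc hw), hl'.π_eq w (hUc hw)])) hww
  rw [hl.eqOn hc.locInj hl' (hUc hw) h1 hu] at h
  exact lt_irrefl _ h

/-- The cell carrying `s` and `s'` also passes over the centre of the chart, within `δ / 2` of the
parameter of `s`; the two halves of `δ` add up. -/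
lemma transport {c : Set N} {s s' : N} (hs : F.π s ∈ C.O) (h : F.Near c 3 (C.δ / 2) s s') :
    ∃ r, F.π r = C.x ∧ F.Near c 3 C.δ r s ∧ F.Near c 3 C.δ r s' := by
  obtain ⟨e, l, u, v, he, hl, hu, hv, hvu, rfl, rfl⟩ := h
  rw [hl.π_eq u hu] at hs
  obtain ⟨w, hw, hwx, huw⟩ := C.near _ hs.1 hs.2 e u hu rfl
  refine ⟨l w, (hl.π_eq w hw).trans hwx, ⟨e, l, w, u, he, hl, hw, hu, ?_, rfl, rfl⟩,
    ⟨e, l, w, v, he, hl, hw, hv, ?_, rfl, rfl⟩⟩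
  · linarith [C.δ_pos]
  · linarith [dist_triangle v u w]

/-- The points of the pared locus are on sheets through the pared locus. -/
lemma near_core (hτ : F.IsAdapted) {m' : N} (hm' : m' ∈ F.core) (hx : F.π m' ∈ C.O) :
    ∃ m ∈ F.core, F.π m = C.x ∧ C.b.z m = C.b.z m' ∧ ∀ c, F.LocInj c → F.core ⊆ c →
      F.HasLifts c {m} → F.Near c 3 C.δ m m' := by
  have : Nonempty N := ⟨m'⟩
  have hsrc : m' ∈ C.b.src := (C.b.mem_base_iff).1 hx.1
  set z := C.b.z m' with hz
  set q := C.b.q m' with hq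
  have hrng : (q, z) ∈ C.b.rng := C.b.mem_rng hsrc
  have hqρ : dist q C.b.q₀ < C.ρ := by rw [hq, ← C.b.qB_π hsrc]; exact hx.2
  -- In coordinates this is the straight path from the centre to `m'` at constant height. The fields
  -- `slit₁` and `slit₂` ensure that the line of the slit passes through the centre, so the path
  -- stays on the pared locus.
  let f : ℝ → (ℝ × ℝ) × ℝ := fun t => (C.b.q₀ + t • (q - C.b.q₀), z)
  have hf : Continuous f := by fun_prop
  have hf0 : f 0 = (C.b.q₀, z) := by simp [f]
  have hf1 : f 1 = (q, z) := by simp [f]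
  have hcore : ∀ t, f t ∈ modelCore ∧ f t ∈ modelN := by
    intro t
    rcases (C.b.isFlowBox.core_iff m' hsrc).1 hm' with h | h
    · have h1 : q.1 = 0 := h.1
      have h2 : z = 3 / 2 := h.2
      have h3 := C.slit₁ _ hx.1 hx.2 (by rw [C.b.qB_π hsrc]; exact h1)
      have h4 : (f t).1.1 = 0 := by simp [f, h1, h3]
      refine ⟨Or.inl ⟨h4, h2⟩, ?_, ?_, ?_⟩
      · show |z| ≤ 3
        rw [h2, abs_of_pos] <;> norm_num
      · rw [h4]; simp
      · show ¬ (_ ∧ -2 < z ∧ z < -1)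
        rw [h2]; norm_num
    · have h1 : q.2 = 0 := h.1
      have h2 : z = -3 / 2 := h.2
      have h3 := C.slit₂ _ hx.1 hx.2 (by rw [C.b.qB_π hsrc]; exact h1)
      have h4 : (f t).1.2 = 0 := by simp [f, h1, h3]
      refine ⟨Or.inr ⟨h4, h2⟩, ?_, ?_, ?_⟩
      · show |z| ≤ 3
        rw [h2, abs_le]; norm_num
      · show ¬ (_ ∧ 1 < z ∧ z < 2)
        rw [h2]; norm_num
      · rw [h4]; simp
  have hdist : ∀ t ∈ Icc (0 : ℝ) 1, dist (f t).1 C.b.q₀ ≤ dist q C.b.q₀ := by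
    intro t ht
    rw [dist_eq_norm, dist_eq_norm]
    simp only [f, add_sub_cancel_left]
    rw [norm_smul, Real.norm_eq_abs, abs_of_nonneg ht.1]
    exact mul_le_of_le_one_left (norm_nonneg _) ht.2
  have hfr : ∀ t ∈ Icc (0 : ℝ) 1, f t ∈ C.b.rng := fun t ht =>
    ⟨(hcore t).2, (hdist t ht).trans_lt hrng.2.1, hrng.2.2⟩
  have hO : ∀ t ∈ Icc (0 : ℝ) 1, F.π (C.b.pt (f t)) ∈ C.O := fun t ht => by
    have h1 := C.b.pt_mem (hfr t ht)
    refine ⟨(C.b.mem_base_iff).2 h1, ?_⟩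
    rw [C.b.qB_π h1, C.b.q_pt (hfr t ht)]
    exact (hdist t ht).trans_lt hqρ
  have hco : ∀ t ∈ Icc (0 : ℝ) 1, C.b.pt (f t) ∈ F.core := fun t ht => by
    rw [C.b.isFlowBox.core_iff _ (C.b.pt_mem (hfr t ht)), C.b.φ_pt (hfr t ht)]
    exact (hcore t).1
  have h0 : (0 : ℝ) ∈ Icc (0 : ℝ) 1 := ⟨le_rfl, zero_le_one⟩
  have h1 : (1 : ℝ) ∈ Icc (0 : ℝ) 1 := ⟨zero_le_one, le_rfl⟩
  have hz0 : ∀ t ∈ Icc (0 : ℝ) 1, C.b.z (C.b.pt (f t)) = z := fun t ht => by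
    rw [C.b.z_pt (hfr t ht)]
  have hpx : F.π (C.b.pt (f 0)) = C.x := by
    rw [hf0, ← C.centre.qB_eq]
    refine C.b.π_pt_of_J ?_
    rw [Box.J_centre C.centre]; exact hrng.2.2
  have hm1 : C.b.pt (f 1) = m' := by rw [hf1]; exact C.b.pt_qz hsrc
  refine ⟨C.b.pt (f 0), hco 0 h0, hpx, hz0 0 h0, fun c hi hcc hL => ?_⟩
  have hδ2 : C.δ / 2 < C.δ := by linarith [C.δ_pos]
  -- `Λ` lifts the projected path to the sheet of the core point over the centre. The path in the
  -- pared locus is another lift to `c` from the same point, so the two agree.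
  have hex : ∀ t, ∃ s, t ∈ Icc (0 : ℝ) 1 → F.Near c 3 (C.δ / 2) (C.b.pt (f 0)) s ∧
      F.π s = F.π (C.b.pt (f t)) := by
    intro t
    by_cases ht : t ∈ Icc (0 : ℝ) 1
    · obtain ⟨s, hs⟩ := exists_near (C := C) hτ hpx hL (hO t ht) (by
        rw [hz0 0 h0, ← hz0 t ht]; exact C.b.z_mem_J (C.b.pt_mem (hfr t ht)))
      exact ⟨s, fun _ => hs⟩
    · exact ⟨m', fun h => absurd h ht⟩
  choose Λ hΛ using hex
  have hfc : ContinuousOn (fun t => C.b.pt (f t)) (Icc 0 1) :=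
    C.b.continuousOn_pt.comp hf.continuousOn hfr
  have hΛc : ContinuousOn Λ (Icc 0 1) := by
    intro t ht
    have : Tendsto Λ (𝓝[Icc 0 1] t) (𝓝 (Λ t)) := by
      rw [tendsto_iff_ultrafilter]
      intro U hU
      have hUA : ∀ᶠ t' in (U : Filter ℝ), t' ∈ Icc (0 : ℝ) 1 := hU self_mem_nhdsWithin
      obtain ⟨t', ht', htπ, hts⟩ := C.coherent.tendsto hδ2 hi hpx hL U (s := Λ)
        (y := F.π (C.b.pt (f t))) (hUA.mono fun w' hw' => (hΛ w' hw').1) (by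
          have h2 : Tendsto (fun t => F.π (C.b.pt (f t))) (U : Filter ℝ)
              (𝓝 (F.π (C.b.pt (f t)))) :=
            ((F.continuous_π.comp_continuousOn hfc) t ht).tendsto.mono_left hU
          exact h2.congr' (hUA.mono fun w' hw' => (hΛ w' hw').2.symm))
      have h2 : t' = Λ t := unique hi hpx hL ht' ((hΛ t ht).1.mono le_rfl hδ2.le)
        (htπ.trans (hΛ t ht).2.symm)
      rwa [h2] at hts
    exact this
  have heq : EqOn Λ (fun t => C.b.pt (f t)) (Icc 0 1) := by
    refine hi.eqOn isPreconnected_Icc hΛc hfc (fun t ht => (hΛ t ht).1.mem)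
      (fun t ht => hcc (hco t ht)) (fun t ht => (hΛ t ht).2) h0 ?_
    exact unique hi hpx hL ((hΛ 0 h0).1.mono le_rfl hδ2.le) (near_self hτ hL C.δ_pos) (hΛ 0 h0).2
  have h2 := (hΛ 1 h1).1.mono le_rfl hδ2.le
  rw [heq h1] at h2
  simp only [hm1] at h2
  exact h2

end Chart

/-! ### Uniform local finiteness -/

/-- Cells which meet already agree at one of finitely many given places. -/
lemma exists_finite_pairs (hτ : F.IsAdapted) (e e' : BCell B) :
    ∃ Ψ : Set (e.Par × e'.Par), Ψ.Finite ∧ Ψ ⊆ e.cube ×ˢ e'.cube ∧ ∀ c A, F.IsCpx c →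
      F.HasLifts c A → ∀ l l', F.IsLift c e l → F.IsLift c e' l' → l '' e.cube ⊆ A →
      l' '' e'.cube ⊆ A → ∀ v ∈ e.cube, ∀ v' ∈ e'.cube, l v = l' v' → ∃ w ∈ Ψ, l w.1 = l' w.2 := by
  suffices H : ∃ Ψ : Set (e.Par × e'.Par), Ψ.Finite ∧ Ψ ⊆ e.cube ×ˢ e'.cube ∧ ∀ c A, F.IsCpx c →
      F.HasLifts c A → ∀ l l', F.IsLift c e l → F.IsLift c e' l' → l '' e.cube ⊆ A →
      l' '' e'.cube ⊆ A → ∀ v ∈ e.cube, ∀ v' ∈ e'.cube, (v, v') ∈ e.cube ×ˢ e'.cube → l v = l' v' →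
        ∃ w ∈ Ψ, l w.1 = l' w.2 by
    obtain ⟨Ψ, h1, h2, h3⟩ := H
    exact ⟨Ψ, h1, h2, fun c A hc hA l l' hl hl' h h' v hv v' hv' hvv =>
      h3 c A hc hA l l' hl hl' h h' v hv v' hv' ⟨hv, hv'⟩ hvv⟩
  have hk : IsCompact (e.cube ×ˢ e'.cube) :=
    (isCompact_closedBall _ _).prod (isCompact_closedBall _ _)
  refine hk.induction_on (p := fun T => ∃ Ψ : Set (e.Par × e'.Par), Ψ.Finite ∧
    Ψ ⊆ e.cube ×ˢ e'.cube ∧ ∀ c A, F.IsCpx c →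
      F.HasLifts c A → ∀ l l', F.IsLift c e l → F.IsLift c e' l' → l '' e.cube ⊆ A →
      l' '' e'.cube ⊆ A → ∀ v ∈ e.cube, ∀ v' ∈ e'.cube, (v, v') ∈ T → l v = l' v' →
        ∃ w ∈ Ψ, l w.1 = l' w.2) ?_ ?_ ?_ ?_
  · exact ⟨∅, finite_empty, empty_subset _, by simp⟩
  · rintro T T' hT ⟨Ψ, h1, h2, h3⟩
    exact ⟨Ψ, h1, h2, fun c A hc hA l l' hl hl' h h' v hv v' hv' hvT =>
      h3 c A hc hA l l' hl hl' h h' v hv v' hv' (hT hvT)⟩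
  · rintro T T' ⟨Ψ, h1, h2, h3⟩ ⟨Ψ', h1', h2', h3'⟩
    refine ⟨Ψ ∪ Ψ', h1.union h1', union_subset h2 h2', ?_⟩
    intro c A hc hA l l' hl hl' h h' v hv v' hv' hvT hvv
    rcases hvT with hvT | hvT
    · obtain ⟨w, hw, hww⟩ := h3 c A hc hA l l' hl hl' h h' v hv v' hv' hvT hvv
      exact ⟨w, Or.inl hw, hww⟩
    · obtain ⟨w, hw, hww⟩ := h3' c A hc hA l l' hl hl' h h' v hv v' hv' hvT hvv
      exact ⟨w, Or.inr hw, hww⟩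
  · rintro ⟨w, w'⟩ ⟨hw, hw'⟩
    have hct : ContinuousWithinAt (fun p : e.Par × e'.Par => e.chr p.1) (e.cube ×ˢ e'.cube)
        (w, w') := (e.continuousOn_chr w hw).comp continuousWithinAt_fst fun p hp => hp.1
    have hct' : ContinuousWithinAt (fun p : e.Par × e'.Par => e'.chr p.2) (e.cube ×ˢ e'.cube)
        (w, w') := (e'.continuousOn_chr w' hw').comp continuousWithinAt_snd fun p hp => hp.2
    -- Locally one pair suffices. If `w` and `w'` lie over the same point, cells which meet near
    -- `(w, w')` are on one sheet of a chart centred there and so meet at `(w, w')` itself.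
    -- Otherwise no cells meet near `(w, w')`. Neither case depends on the complex.
    by_cases hne : e.chr w = e'.chr w'
    · obtain ⟨C, hC⟩ := exists_chart hτ (e.chr w)
      have h1 : ∀ᶠ p in 𝓝[e.cube ×ˢ e'.cube] (w, w'), e.chr p.1 ∈ C.O :=
        hct (C.isOpen_O.mem_nhds (show e.chr w ∈ C.O from hC ▸ C.mem_O))
      have h2 : ∀ᶠ p : e.Par × e'.Par in 𝓝[e.cube ×ˢ e'.cube] (w, w'), dist p.1 w < C.δ :=
        (continuousWithinAt_fst (s := e.cube ×ˢ e'.cube) (p := (w, w'))).eventually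
          (ball_mem_nhds w C.δ_pos)
      have h3 : ∀ᶠ p : e.Par × e'.Par in 𝓝[e.cube ×ˢ e'.cube] (w, w'), dist p.2 w' < C.δ :=
        (continuousWithinAt_snd (s := e.cube ×ˢ e'.cube) (p := (w, w'))).eventually
          (ball_mem_nhds w' C.δ_pos)
      refine ⟨_, h1.and (h2.and h3), {(w, w')}, finite_singleton _,
        singleton_subset_iff.2 ⟨hw, hw'⟩, ?_⟩
      rintro c A hc hA l l' hl hl' hlA hlA' v hv v' hv' ⟨h1, h2, h3⟩ hvv
      refine ⟨_, rfl, ?_⟩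
      refine Chart.unique_base hτ hc (C := C) (by rw [hl.π_eq w hw, hC])
        (hA.mono (singleton_subset_iff.2 (hlA ⟨w, hw, rfl⟩)))
        (by rw [hl'.π_eq w' hw', hC, hne])
        (hA.mono (singleton_subset_iff.2 (hlA' ⟨w', hw', rfl⟩)))
        ⟨e, l, w, v, hτ.dim_lt e, hl, hw, hv, h2, rfl, rfl⟩
        ⟨e', l', w', v', hτ.dim_lt e', hl', hw', hv', h3, rfl, hvv.symm⟩ ?_
      rw [hl.π_eq v hv]; exact h1
    · obtain ⟨O, O', hO, hO', hxO, hxO', hd⟩ := t2_separation hne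
      refine ⟨_, inter_mem (hct (hO.mem_nhds hxO)) (hct' (hO'.mem_nhds hxO')), ∅, finite_empty,
        empty_subset _, ?_⟩
      rintro c A hc hA l l' hl hl' hlA hlA' v hv v' hv' ⟨h1, h2⟩ hvv
      have h3 : e.chr v = e'.chr v' := by rw [← hl.π_eq v hv, hvv, hl'.π_eq v' hv']
      have h1 : e.chr v ∈ O := h1
      have h2 : e'.chr v' ∈ O' := h2
      exact (disjoint_left.1 hd h1 (h3 ▸ h2)).elim

/-- Cells meeting the pared locus already do so at one of finitely many given places. -/
lemma exists_finite_core (hτ : F.IsAdapted) (e : BCell B) :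
    ∃ Ψ : Set (e.Par × N), Ψ.Finite ∧ (∀ w ∈ Ψ, w.1 ∈ e.cube) ∧ ∀ c A, F.IsCpx c →
      F.HasLifts c A → F.core ⊆ c → F.core ⊆ A → ∀ l, F.IsLift c e l → l '' e.cube ⊆ A →
      ∀ v ∈ e.cube, l v ∈ F.core → ∃ w ∈ Ψ, l w.1 = w.2 := by
  suffices H : ∃ Ψ : Set (e.Par × N), Ψ.Finite ∧ (∀ w ∈ Ψ, w.1 ∈ e.cube) ∧ ∀ c A, F.IsCpx c →
      F.HasLifts c A → F.core ⊆ c → F.core ⊆ A → ∀ l, F.IsLift c e l → l '' e.cube ⊆ A →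
      ∀ v ∈ e.cube, l v ∈ F.core → (v, l v) ∈ F.limFib e ∩ {p | p.2 ∈ F.core} → ∃ w ∈ Ψ, l w.1 = w.2 by
    obtain ⟨Ψ, h1, h2, h3⟩ := H
    exact ⟨Ψ, h1, h2, fun c A hc hA h h' l hl hlA v hv hvc =>
      h3 c A hc hA h h' l hl hlA v hv hvc ⟨hl.mem_limFib hv, hvc⟩⟩
  have hk : IsCompact (F.limFib e ∩ {p | p.2 ∈ F.core}) :=
    (isCompact_limFib e).inter_right (isClosed_core.preimage continuous_snd)
  refine hk.induction_on (p := fun T => ∃ Ψ : Set (e.Par × N), Ψ.Finite ∧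
    (∀ w ∈ Ψ, w.1 ∈ e.cube) ∧ ∀ c A, F.IsCpx c →
      F.HasLifts c A → F.core ⊆ c → F.core ⊆ A → ∀ l, F.IsLift c e l → l '' e.cube ⊆ A →
      ∀ v ∈ e.cube, l v ∈ F.core → (v, l v) ∈ T → ∃ w ∈ Ψ, l w.1 = w.2) ?_ ?_ ?_ ?_
  · exact ⟨∅, finite_empty, by simp, by simp⟩
  · rintro T T' hT ⟨Ψ, h1, h2, h3⟩
    exact ⟨Ψ, h1, h2, fun c A hc hA h h' l hl hlA v hv hvc hvT =>
      h3 c A hc hA h h' l hl hlA v hv hvc (hT hvT)⟩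
  · rintro T T' ⟨Ψ, h1, h2, h3⟩ ⟨Ψ', h1', h2', h3'⟩
    refine ⟨Ψ ∪ Ψ', h1.union h1', fun w hw => hw.elim (h2 w) (h2' w), ?_⟩
    intro c A hc hA h h' l hl hlA v hv hvc hvT
    rcases hvT with hvT | hvT
    · obtain ⟨w, hw, hww⟩ := h3 c A hc hA h h' l hl hlA v hv hvc hvT
      exact ⟨w, Or.inl hw, hww⟩
    · obtain ⟨w, hw, hww⟩ := h3' c A hc hA h h' l hl hlA v hv hvc hvT
      exact ⟨w, Or.inr hw, hww⟩
  · rintro ⟨w, m⟩ ⟨hwm, hm⟩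
    obtain ⟨hw, hmw⟩ := limFib_subset hwm
    obtain ⟨C, hC⟩ := exists_chart hτ (F.π m)
    have hsrc : m ∈ C.b.src := (C.centre m hC.symm).1
    have h1 : ∀ᶠ p : e.Par × N in 𝓝 (w, m), F.π p.2 ∈ C.O :=
      (F.continuous_π.comp continuous_snd).continuousAt
        (C.isOpen_O.mem_nhds (show F.π m ∈ C.O from hC ▸ C.mem_O))
    have h2 : ∀ᶠ p : e.Par × N in 𝓝 (w, m), dist p.1 w < C.δ :=
      (continuous_fst.tendsto (w, m)).eventually (ball_mem_nhds w C.δ_pos)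
    have h3 : ∀ᶠ p : e.Par × N in 𝓝 (w, m), dist (C.b.z p.2) (C.b.z m) < 1 := by
      have h4 : ContinuousAt C.b.z m := C.b.continuousOn_z.continuousAt (C.b.isOpen_src.mem_nhds hsrc)
      exact (continuous_snd.tendsto (w, m)).eventually (h4 (ball_mem_nhds _ one_pos))
    refine ⟨_, mem_nhdsWithin_of_mem_nhds (h1.and (h2.and h3)), {(w, m)}, finite_singleton _,
      by simpa using hw, ?_⟩
    rintro c A hc hA hcc hcA l hl hlA v hv hvc ⟨k1, k2, k3⟩
    refine ⟨_, rfl, ?_⟩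
    obtain ⟨m₀, hm₀, hm₀x, hm₀z, hnear⟩ := Chart.near_core (C := C) hτ hvc k1
    have hz : ∀ n ∈ F.core, n ∈ C.b.src → C.b.z n = 3 / 2 ∨ C.b.z n = -3 / 2 := by
      intro n hn hns
      exact ((C.b.isFlowBox.core_iff n hns).1 hn).imp (fun h => h.2) (fun h => h.2)
    -- In a box the pared locus has heights `±3 / 2` only, so two core points of the same fibre at
    -- height distance less than 1 coincide.
    have hmm : m₀ = m := by
      have hm₀s := (C.centre m₀ hm₀x).1
      refine C.b.injOn hm₀s hsrc (C.b.q_eq hm₀s (hm₀x.trans hC)) ?_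
      rw [Real.dist_eq] at k3
      simp only at k3
      rw [← hm₀z] at k3
      rcases hz _ hm₀ hm₀s with h5 | h5 <;> rcases hz _ hm hsrc with h6 | h6 <;>
        rw [h5, h6] at k3 ⊢ <;> norm_num at k3
    subst hmm
    refine Chart.unique_base hτ hc (C := C) (by rw [hl.π_eq w hw, hC, hmw])
      (hA.mono (singleton_subset_iff.2 (hlA ⟨w, hw, rfl⟩))) hm₀x
      (hA.mono (singleton_subset_iff.2 (hcA hm₀)))
      ⟨e, l, w, v, hτ.dim_lt e, hl, hw, hv, k2, rfl, rfl⟩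
      (hnear c hc.locInj hcc (hA.mono (singleton_subset_iff.2 (hcA hm₀)))) k1

end FibredNbhd
end BranchedSurface

namespace BranchedSurface

/-! ### Germs along a sequence of complexes -/

/-- Sequences in `N`, up to equality on a large set of indices. -/
abbrev Gm (N : Type*) := Germ (hyperfilter ℕ : Filter ℕ) N

/-- A sequence representing a germ. -/
noncomputable def Gm.rep {N : Type*} (s : Gm N) : ℕ → N := Quotient.out s

lemma Gm.coe_rep {N : Type*} (s : Gm N) : (s.rep : Gm N) = s := Quotient.out_eq _

lemma Gm.rep_coe {N : Type*} (f : ℕ → N) :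
    ∀ᶠ k in (hyperfilter ℕ : Filter ℕ), Gm.rep (f : Gm N) k = f k :=
  Germ.coe_eq.1 (Gm.coe_rep (f : Gm N))

lemma Gm.ext {N : Type*} {s t : Gm N}
    (h : ∀ᶠ k in (hyperfilter ℕ : Filter ℕ), s.rep k = t.rep k) : s = t := by
  rw [← s.coe_rep, ← t.coe_rep]; exact Germ.coe_eq.2 h

lemma _root_.Ultrafilter.exists_eventually_of_finite {A Y : Type*} (U : Ultrafilter A)
    {P : A → Y → Prop} {T : Set Y} (hT : T.Finite) (h : ∀ᶠ a in (U : Filter A), ∃ y ∈ T, P a y) :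
    ∃ y ∈ T, ∀ᶠ a in (U : Filter A), P a y := by
  have h1 : (⋃ y ∈ T, {a | P a y}) ∈ U := by
    refine mem_of_superset h fun a ha => ?_
    simp only [mem_iUnion]
    obtain ⟨y, hy, hay⟩ := ha
    exact ⟨y, hy, hay⟩
  rw [Ultrafilter.finite_biUnion_mem_iff hT] at h1
  exact h1

/-- The representative height of the part of the standard block containing height `z`. -/
noncomputable def band (z : ℝ) : ℝ :=
  if 2 ≤ z then 5 / 2 else if 1 < z then 3 / 2 else if -1 ≤ z then 0 else
    if -2 < z then -3 / 2 else -5 / 2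

/-- The representative heights. -/
def bands : Set ℝ := {5 / 2, 3 / 2, 0, -3 / 2, -5 / 2}

lemma band_mem (z : ℝ) : band z ∈ bands := by
  unfold band bands
  split_ifs <;> simp

lemma finite_bands : bands.Finite := by
  unfold bands; exact toFinite _

lemma band_mono {z z' : ℝ} (h : z ≤ z') : band z ≤ band z' := by
  unfold band
  split_ifs <;> linarith

/-- The heights at which the slits begin and end cut `[-3, 3]` into five pieces. Over a given base
point each piece is entirely in the block or entirely missing, so only the piece containing a height
matters. -/
lemma same_band {q : ℝ × ℝ} {z : ℝ} (hz : |z| ≤ 3) (h : (q, z) ∈ modelN ∨ (q, band z) ∈ modelN) :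
    SameModelFiber (q, z) (q, band z) := by
  refine ⟨rfl, fun w hw => ?_⟩
  rw [mem_modelN, mem_modelN] at h
  rw [mem_modelN]
  simp only [mem_uIcc] at hw
  rw [abs_le] at hz ⊢
  unfold band at hw h
  split_ifs at hw h with h1 h2 h3 h4
  · refine ⟨?_, ?_, ?_⟩
    · rcases hw with hw | hw <;> constructor <;> linarith
    · rintro ⟨-, -, h5⟩; rcases hw with hw | hw <;> linarith
    · rintro ⟨-, -, h5⟩; rcases hw with hw | hw <;> linarith
  · have hq : ¬ 0 < q.1 := by
      intro hq
      rcases h with h | h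
      · exact h.2.1 ⟨hq, h2, not_le.1 h1⟩
      · exact h.2.1 ⟨hq, by norm_num, by norm_num⟩
    refine ⟨?_, fun h => hq h.1, ?_⟩
    · rcases hw with hw | hw <;> constructor <;> linarith
    · rintro ⟨-, -, h5⟩; rcases hw with hw | hw <;> linarith
  · refine ⟨?_, ?_, ?_⟩
    · rcases hw with hw | hw <;> constructor <;> linarith
    · rintro ⟨-, h5, -⟩; rcases hw with hw | hw <;> linarith
    · rintro ⟨-, -, h5⟩; rcases hw with hw | hw <;> linarith
  · have hq : ¬ 0 < q.2 := by
      intro hq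
      rcases h with h | h
      · exact h.2.2 ⟨hq, h4, not_le.1 h3⟩
      · exact h.2.2 ⟨hq, by norm_num, by norm_num⟩
    refine ⟨?_, ?_, fun h => hq h.1⟩
    · rcases hw with hw | hw <;> constructor <;> linarith
    · rintro ⟨-, h5, -⟩; rcases hw with hw | hw <;> linarith
  · refine ⟨?_, ?_, ?_⟩
    · rcases hw with hw | hw <;> constructor <;> linarith
    · rintro ⟨-, h5, -⟩; rcases hw with hw | hw <;> linarith
    · rintro ⟨-, h5, -⟩; rcases hw with hw | hw <;> linarith

namespace FibredNbhd

variable {N B : Type*} [TopologicalSpace N] [TopologicalSpace B] {F : FibredNbhd N B}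

lemma Box.band_mem_J_iff (b : F.Box) {x : B} {z : ℝ} (hz : |z| ≤ 3) :
    band z ∈ b.J x ↔ z ∈ b.J x :=
  ⟨fun h => b.J_of_same h (same_band hz (Or.inr (b.rng_of_J h).1)).symm,
    fun h => b.J_of_same h (same_band hz (Or.inl (b.rng_of_J h).1))⟩

/-- The boxes induce the same order on the fibre over `x`. -/
def Box.Same (b b' : F.Box) (x : B) : Prop :=
  ∀ m n, F.π m = x → F.π n = x → (b.z m < b.z n ↔ b'.z m < b'.z n)

/-- The boxes induce opposite orders on the fibre over `x`. -/
def Box.Opp (b b' : F.Box) (x : B) : Prop :=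
  ∀ m n, F.π m = x → F.π n = x → (b.z m < b.z n ↔ b'.z n < b'.z m)

variable [CWComplex (univ : Set B)]

/-- A family of ordered sets `L x` indexed by the points `x` of `B`, with local transition maps
`τ i` to a fixed set in each chart: the combinatorial structure of the intersections of a splitting
surface with the fibres. -/
structure Leaves (F : FibredNbhd N B) (ι G : Type*) where
  C : ι → F.Chart
  cover : ∀ x, ∃ i, x ∈ (C i).O
  L : B → Set G
  τ : ι → G → G
  lt : ι → G → G → Prop
  β : ι → G → ℝ
  κ : N → G
  countable : ∀ i, (L (C i).x).Countable
  lt_irrefl : ∀ i p, ¬ lt i p p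
  lt_trans : ∀ i p p' p'', lt i p p' → lt i p' p'' → lt i p p''
  lt_total : ∀ i, ∀ p ∈ L (C i).x, ∀ p' ∈ L (C i).x, p ≠ p' → lt i p p' ∨ lt i p' p
  β_mem : ∀ i p, β i p ∈ bands
  β_mono : ∀ i p p', lt i p p' → β i p ≤ β i p'
  τ_bij : ∀ i, ∀ x ∈ (C i).O, BijOn (τ i) (L x) {p | p ∈ L (C i).x ∧ β i p ∈ (C i).b.J x}
  τ_same : ∀ i j, ∀ x ∈ (C i).O, x ∈ (C j).O → (C i).b.Same (C j).b x → ∀ s ∈ L x, ∀ s' ∈ L x,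
    lt i (τ i s) (τ i s') → lt j (τ j s) (τ j s')
  τ_opp : ∀ i j, ∀ x ∈ (C i).O, x ∈ (C j).O → (C i).b.Opp (C j).b x → ∀ s ∈ L x, ∀ s' ∈ L x,
    lt i (τ i s) (τ i s') → lt j (τ j s') (τ j s)
  τ_loc : ∀ i j, ∀ x ∈ (C i).O, x ∈ (C j).O → ∀ᶠ x' in 𝓝 x, ∀ s ∈ L x, ∀ s' ∈ L x',
    τ i s = τ i s' → τ j s = τ j s'
  κ_mem : ∀ m ∈ F.core, κ m ∈ L (F.π m)
  β_κ : ∀ i, ∀ m ∈ F.core, F.π m ∈ (C i).O → β i (τ i (κ m)) = (C i).b.z m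
  κ_unique : ∀ i, ∀ m ∈ F.core, F.π m ∈ (C i).O → ∀ p ∈ L (C i).x, β i p = (C i).b.z m →
    p = τ i (κ m)

variable [T2Space B] [CompactSpace N] [T2Space N]

variable (F) in
/-- The germs over `x` of points of a sequence of complexes, in balls of bounded radius. -/
def leaf (c : ℕ → Set N) (x : B) : Set (Gm N) :=
  {s | ∃ j, ∀ᶠ k in (hyperfilter ℕ : Filter ℕ), s.rep k ∈ F.ball (c k) j ∧ F.π (s.rep k) = x}

lemma coe_mem_leaf {c : ℕ → Set N} {x : B} {f : ℕ → N} {j : ℕ}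
    (h : ∀ᶠ k in (hyperfilter ℕ : Filter ℕ), f k ∈ F.ball (c k) j ∧ F.π (f k) = x) :
    (f : Gm N) ∈ F.leaf c x := by
  refine ⟨j, ?_⟩
  filter_upwards [h, Gm.rep_coe f] with k hk hk'
  rwa [hk']

variable (F) in
/-- The germ `s` is on the sheet of the germ `p` in the chart `C`. -/
def GNear (c : ℕ → Set N) (C : F.Chart) (p s : Gm N) : Prop :=
  ∀ᶠ k in (hyperfilter ℕ : Filter ℕ), F.Near (c k) 3 C.δ (p.rep k) (s.rep k)

section Germs

variable (hτ : F.IsAdapted) {c : ℕ → Set N} (hc : ∀ k, F.IsSplittingComplex (c k))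
  (hR : Tendsto (fun k => F.radius (c k)) atTop (𝓝 ⊤))
include hc hR

/-- This is where the growth of the radius enters: a germ at bounded combinatorial distance is, for
almost all indices, a point through which cells can be lifted. -/
lemma leaf_deep {x : B} {s : Gm N} (hs : s ∈ F.leaf c x) :
    ∀ᶠ k in (hyperfilter ℕ : Filter ℕ), F.HasLifts (c k) {s.rep k} ∧ s.rep k ∈ c k ∧
      F.π (s.rep k) = x := by
  obtain ⟨j, hj⟩ := hs
  have h1 := Nat.hyperfilter_le_atTop (IsSplittingComplex.eventually_hasLifts hc hR j)
  filter_upwards [hj, h1] with k hk hk'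
  exact ⟨HasLifts.mono hk' (singleton_subset_iff.2 hk.1), (hc k).ball_subset j hk.1, hk.2⟩

include hτ

lemma exists_gNear {C : F.Chart} {x : B} (hx : x ∈ C.O) {s : Gm N} (hs : s ∈ F.leaf c x) :
    ∃ p ∈ F.leaf c C.x, F.GNear c C p s := by
  obtain ⟨j, hj⟩ := hs
  have h1 : ∀ᶠ k in (hyperfilter ℕ : Filter ℕ), ∃ p, F.π p = C.x ∧
      F.Near (c k) 3 C.δ p (s.rep k) := by
    filter_upwards [hj] with k hk
    obtain ⟨p, hp, hn⟩ := Chart.exists_base (C := C) hτ (hc k).isCpx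
      ((hc k).ball_subset j hk.1) (by rwa [hk.2])
    exact ⟨p, hp, hn.mono le_rfl (by linarith [C.δ_pos])⟩
  obtain ⟨f, hf⟩ := h1.choice
  refine ⟨(f : Gm N), coe_mem_leaf (j := j + 1) ?_, ?_⟩
  · filter_upwards [hf, hj] with k hk hk'
    exact ⟨(hc k).isCpx.ball_of_near' hk.2 hk'.1, hk.1⟩
  · filter_upwards [hf, Gm.rep_coe f] with k hk hk'
    rw [hk']; exact hk.2

lemma gNear_unique {C : F.Chart} {x : B} (hx : x ∈ C.O) {p p' s : Gm N}
    (hs : s ∈ F.leaf c x) (hp : p ∈ F.leaf c C.x) (hp' : p' ∈ F.leaf c C.x) (h : F.GNear c C p s)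
    (h' : F.GNear c C p' s) : p = p' := by
  refine Gm.ext ?_
  filter_upwards [h, h', leaf_deep hc hR hp, leaf_deep hc hR hp', leaf_deep hc hR hs]
    with k h1 h2 h3 h4 h5
  exact Chart.unique_base hτ (hc k).isCpx h3.2.2 h3.1 h4.2.2 h4.1 h1 h2 (by rwa [h5.2.2])

omit hτ in
lemma gNear_inj {C : F.Chart} {x : B} {p s s' : Gm N} (hs : s ∈ F.leaf c x)
    (hs' : s' ∈ F.leaf c x) (hp : p ∈ F.leaf c C.x) (h : F.GNear c C p s)
    (h' : F.GNear c C p s') : s = s' := by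
  refine Gm.ext ?_
  filter_upwards [h, h', leaf_deep hc hR hp, leaf_deep hc hR hs', leaf_deep hc hR hs]
    with k h1 h2 h3 h4 h5
  exact Chart.unique (hc k).isCpx.locInj h3.2.2 h3.1 h1 h2 (h5.2.2.trans h4.2.2.symm)

lemma exists_gNear' {C : F.Chart} {x : B} (hx : x ∈ C.O) {p : Gm N} (hp : p ∈ F.leaf c C.x)
    (h : ∀ᶠ k in (hyperfilter ℕ : Filter ℕ), C.b.z (p.rep k) ∈ C.b.J x) :
    ∃ s ∈ F.leaf c x, F.GNear c C p s := by
  obtain ⟨j, hj⟩ := id hp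
  have h1 : ∀ᶠ k in (hyperfilter ℕ : Filter ℕ), ∃ s, F.Near (c k) 3 C.δ (p.rep k) s ∧
      F.π s = x := by
    filter_upwards [h, leaf_deep hc hR hp] with k hk hk'
    obtain ⟨s, hs, hsx⟩ := Chart.exists_near (C := C) hτ hk'.2.2 hk'.1 hx hk
    exact ⟨s, hs.mono le_rfl (by linarith [C.δ_pos]), hsx⟩
  obtain ⟨f, hf⟩ := h1.choice
  refine ⟨(f : Gm N), coe_mem_leaf (j := j + 1) ?_, ?_⟩
  · filter_upwards [hf, hj] with k hk hk'
    exact ⟨(hc k).isCpx.ball_of_near hk.1 hk'.1, hk.2⟩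
  · filter_upwards [hf, Gm.rep_coe f] with k hk hk'
    rw [hk']; exact hk.1

/-- Over nearby points, germs on common sheets of a chart are on common sheets in other charts. -/
lemma gNear_loc {C C' : F.Chart} {x : B} (hx : x ∈ C.O) (hx' : x ∈ C'.O) :
    ∀ᶠ y in 𝓝 x, ∀ s ∈ F.leaf c x, ∀ t ∈ F.leaf c y, ∀ p ∈ F.leaf c C.x, F.GNear c C p s →
      F.GNear c C p t → ∀ p' ∈ F.leaf c C'.x, F.GNear c C' p' s → F.GNear c C' p' t := by
  have := F.compactSpace_base
  set η := min (C.δ / 2) (C'.δ / 2) with hη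
  have hη0 : 0 < η := lt_min (half_pos C.δ_pos) (half_pos C'.δ_pos)
  filter_upwards [BCell.eventually_exists_near x hη0, C.isOpen_O.mem_nhds hx,
    C'.isOpen_O.mem_nhds hx'] with y hy hyO hyO' s hs t ht p hp hps hpt p' hp' hps'
  obtain ⟨j, hj⟩ := id ht
  have h1 : ∀ᶠ k in (hyperfilter ℕ : Filter ℕ), ∃ r, F.π r = x ∧
      F.Near (c k) 3 η r (t.rep k) := by
    filter_upwards [leaf_deep hc hR ht] with k hk
    obtain ⟨e, l, hl, v, hv, hvt⟩ := (hc k).isCpx.exists_lift _ hk.2.1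
    have hv' := ball_subset_closedBall hv
    obtain ⟨u, hu, hux, hvu⟩ := hy e v hv' (by rw [← hl.π_eq v hv', hvt, hk.2.2])
    exact ⟨l u, (hl.π_eq u hu).trans hux, e, l, u, v, hτ.dim_lt e, hl, hu, hv', hvu, rfl, hvt⟩
  obtain ⟨f, hf⟩ := h1.choice
  have hfl : (f : Gm N) ∈ F.leaf c x := by
    refine coe_mem_leaf (j := j + 1) ?_
    filter_upwards [hf, hj] with k hk hk'
    exact ⟨(hc k).isCpx.ball_of_near' hk.2 hk'.1, hk.1⟩
  -- The germ `f` over `x` and the germ `t` over `y` are close on common cells, so in every chart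
  -- fine enough they lie on the same sheet.
  have key : ∀ D : F.Chart, x ∈ D.O → y ∈ D.O → η ≤ D.δ / 2 → ∀ r ∈ F.leaf c D.x,
      (F.GNear c D r (f : Gm N) ↔ F.GNear c D r t) := by
    intro D hxD hyD hηD
    have h2 : ∀ᶠ k in (hyperfilter ℕ : Filter ℕ), ∃ r, F.π r = D.x ∧
        F.Near (c k) 3 D.δ r (f k) ∧ F.Near (c k) 3 D.δ r (t.rep k) := by
      filter_upwards [hf] with k hk
      exact Chart.transport (C := D) (by rwa [hk.1]) (hk.2.mono le_rfl hηD)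
    obtain ⟨g, hg⟩ := h2.choice
    have hgl : (g : Gm N) ∈ F.leaf c D.x := by
      refine coe_mem_leaf (j := j + 1) ?_
      filter_upwards [hg, hj] with k hk hk'
      exact ⟨(hc k).isCpx.ball_of_near' hk.2.2 hk'.1, hk.1⟩
    have hgf : F.GNear c D (g : Gm N) (f : Gm N) := by
      filter_upwards [hg, Gm.rep_coe f, Gm.rep_coe g] with k hk hk' hk''
      rw [hk', hk'']; exact hk.2.1
    have hgt : F.GNear c D (g : Gm N) t := by
      filter_upwards [hg, Gm.rep_coe g] with k hk hk''
      rw [hk'']; exact hk.2.2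
    intro r hr
    constructor
    · intro h; rw [gNear_unique hτ hc hR hxD hfl hr hgl h hgf]; exact hgt
    · intro h; rw [gNear_unique hτ hc hR hyD ht hr hgl h hgt]; exact hgf
  have hsf : s = (f : Gm N) := gNear_inj hc hR hs hfl hp hps
    ((key C hx hyO (min_le_left _ _) p hp).2 hpt)
  rw [hsf] at hps'
  exact (key C' hx' hyO' (min_le_right _ _) p' hp').1 hps'

omit hτ hR in
lemma mem_core_of_mem_vertInterior {k : ℕ} {s : N} (hs : s ∈ c k) (hv : s ∈ F.vertInterior) :
    s ∈ F.core := by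
  rw [← (hc k).bdry_inter_vert]
  exact ⟨⟨hs, fun ⟨D, hD, hsD, _⟩ => hD.not_mem_vertInterior hsD hv⟩, vertInterior_subset_vert hv⟩

end Germs
end FibredNbhd
end BranchedSurface

/-! ### Countability of leaves and the limiting combinatorial structure -/

namespace BranchedSurface
namespace FibredNbhd

variable {N B : Type*} [TopologicalSpace N] [TopologicalSpace B] {F : FibredNbhd N B}
variable [CWComplex (univ : Set B)] [T2Space B] [CompactSpace N] [T2Space N]

section Germs

variable (hτ : F.IsAdapted) {c : ℕ → Set N} (hc : ∀ k, F.IsSplittingComplex (c k))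
  (hR : Tendsto (fun k => F.radius (c k)) atTop (𝓝 ⊤))

variable (F) in
/-- The germs of lifts of `e` meeting the balls of radius `j`, represented by the images of the
centre of `e`. -/
def liftGerms (c : ℕ → Set N) (e : BCell B) (j : ℕ) : Set (Gm N) :=
  {t | ∀ᶠ k in (hyperfilter ℕ : Filter ℕ), ∃ l, F.IsLift (c k) e l ∧ l 0 = t.rep k ∧
    ∃ v ∈ e.cube, l v ∈ F.ball (c k) j}

include hτ hc hR

/-- A lift is determined by its value at one point. A cell meeting the ball of radius `j + 1` meets
a cell which meets the ball of radius `j`, and by `exists_finite_pairs` it does so at one of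
finitely many places given in advance; the ultrafilter selects one place. So finiteness passes from
`j` to `j + 1`, and `exists_finite_core` starts the induction. -/
lemma finite_liftGerms (j : ℕ) (e : BCell B) : (F.liftGerms c e j).Finite := by
  have := F.compactSpace_base
  have := BCell.finite (B := B)
  have hdeep : ∀ j, ∀ᶠ k in (hyperfilter ℕ : Filter ℕ), F.HasLifts (c k) (F.ball (c k) j) :=
    fun j => Nat.hyperfilter_le_atTop (IsSplittingComplex.eventually_hasLifts hc hR j)
  have h0 : ∀ e : BCell B, (0 : e.Par) ∈ e.cube := fun e => mem_closedBall_self zero_le_one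
  have hstar : ∀ {k j} {e : BCell B} {l : e.Par → N}, F.IsLift (c k) e l → ∀ {v}, v ∈ e.cube →
      l v ∈ F.ball (c k) j → l '' e.cube ⊆ F.ball (c k) (j + 1) := by
    intro k j e l hl v hv h
    rw [(hc k).isCpx.ball_succ]
    exact hl.image_subset_star trivial hv h
  induction j generalizing e with
  | zero =>
    obtain ⟨Ψ, hΨ, hΨc, H⟩ := exists_finite_core hτ e
    have hsub : F.liftGerms c e 0 ⊆ ⋃ w ∈ Ψ, {t | ∀ᶠ k in (hyperfilter ℕ : Filter ℕ),
        ∃ l, F.IsLift (c k) e l ∧ l 0 = t.rep k ∧ l w.1 = w.2} := by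
      intro t ht
      simp only [mem_iUnion, exists_prop]
      refine Ultrafilter.exists_eventually_of_finite _ hΨ ?_
      filter_upwards [ht, hdeep 1] with k ⟨l, hl, hlt, v, hv, hlv⟩ hk
      obtain ⟨w, hw, hww⟩ := H (c k) _ (hc k).isCpx hk ((hc k).ball_subset 0) (core_subset_ball 1) l
        hl (hstar hl hv hlv) v hv hlv
      exact ⟨w, hw, l, hl, hlt, hww⟩
    refine (hΨ.biUnion fun w hw => ?_).subset hsub
    refine Set.Subsingleton.finite fun t ht t' ht' => Gm.ext ?_
    filter_upwards [ht, ht'] with k ⟨l, hl, hlt, hlw⟩ ⟨l', hl', hlt', hlw'⟩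
    rw [← hlt, ← hlt']
    exact hl.eqOn (hc k).isCpx.locInj hl' (hΨc w hw) (hlw.trans hlw'.symm) (h0 e)
  | succ j ih =>
    choose Ψ hΨ hΨc H using exists_finite_pairs (F := F) hτ e
    have hsub : F.liftGerms c e (j + 1) ⊆ F.liftGerms c e j ∪
        ⋃ e' : BCell B, ⋃ t' ∈ F.liftGerms c e' j, ⋃ w ∈ Ψ e',
          {t | ∀ᶠ k in (hyperfilter ℕ : Filter ℕ), ∃ l l', F.IsLift (c k) e l ∧
            F.IsLift (c k) e' l' ∧ l 0 = t.rep k ∧ l' 0 = t'.rep k ∧ l w.1 = l' w.2} := by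
      intro t ht
      by_cases htj : t ∈ F.liftGerms c e j
      · exact Or.inl htj
      right
      have h1 : ∀ᶠ k in (hyperfilter ℕ : Filter ℕ), ∃ e' ∈ (univ : Set (BCell B)), ∃ s l l',
          F.IsLift (c k) e l ∧ F.IsLift (c k) e' l' ∧ l 0 = t.rep k ∧ l' 0 = s ∧
            (∃ v ∈ e'.cube, l' v ∈ F.ball (c k) j) ∧ ∃ w ∈ Ψ e', l w.1 = l' w.2 := by
        have htj' := Ultrafilter.eventually_not.2 htj
        filter_upwards [ht, htj', hdeep (j + 2)] with k ⟨l, hl, hlt, v, hv, hlv⟩ hk hd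
        rw [(hc k).isCpx.ball_succ] at hlv
        rcases hlv with hlv | ⟨e', l', hl', -, ⟨v', hv', hlv'⟩, u, hu, hlu⟩
        · exact (hk ⟨l, hl, hlt, v, hv, hlv⟩).elim
        · have h2 := hstar hl' hv' hlv'
          have h3 : l v ∈ F.ball (c k) (j + 1) := hlu ▸ h2 ⟨u, hu, rfl⟩
          obtain ⟨w, hw, hww⟩ := H e' (c k) _ (hc k).isCpx hd l l' hl hl' (hstar hl hv h3)
            (h2.trans subset_union_left) v hv u hu hlu.symm
          exact ⟨e', mem_univ _, l' 0, l, l', hl, hl', hlt, rfl, ⟨v', hv', hlv'⟩, w, hw, hww⟩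
      obtain ⟨e', -, h2⟩ := Ultrafilter.exists_eventually_of_finite _ finite_univ h1
      obtain ⟨f, hf⟩ := h2.choice
      have h3 : ∀ᶠ k in (hyperfilter ℕ : Filter ℕ), ∃ w ∈ Ψ e', ∃ l l', F.IsLift (c k) e l ∧
            F.IsLift (c k) e' l' ∧ l 0 = t.rep k ∧ l' 0 = Gm.rep (f : Gm N) k ∧
              l w.1 = l' w.2 := by
        filter_upwards [hf, Gm.rep_coe f] with k ⟨l, l', h1, h2, h3, h4, _, w, h5, h6⟩ hk
        exact ⟨w, h5, l, l', h1, h2, h3, hk ▸ h4, h6⟩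
      obtain ⟨w, hw, h4⟩ := Ultrafilter.exists_eventually_of_finite _ (hΨ e') h3
      simp only [mem_iUnion, exists_prop]
      refine ⟨e', (f : Gm N), ?_, w, hw, h4⟩
      filter_upwards [hf, Gm.rep_coe f] with k ⟨l, l', h1, h2, h3, h4, h5, _⟩ hk
      exact ⟨l', h2, hk ▸ h4, h5⟩
    refine ((ih e).union (finite_iUnion fun e' => (ih e').biUnion fun t' ht' =>
      (hΨ e').biUnion fun w hw => ?_)).subset hsub
    refine Set.Subsingleton.finite fun t ht t₂ ht₂ => Gm.ext ?_
    filter_upwards [ht, ht₂] with k ⟨l, l', h1, h2, h3, h4, h5⟩ ⟨m, m', k1, k2, k3, k4, k5⟩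
    rw [← h3, ← k3]
    have h6 := h2.eqOn (hc k).isCpx.locInj k2 (h0 e') (h4.trans k4.symm) (hΨc e' hw).2
    exact h1.eqOn (hc k).isCpx.locInj k1 (hΨc e' hw).1 (by rw [h5, k5, h6]) (h0 e)

/-- A germ over `x` is the value at a fixed parameter of a germ of lifts of the open cell containing
`x`, and there are finitely many of these at each distance. -/
lemma countable_leaf (x : B) : (F.leaf c x).Countable := by
  obtain ⟨e, he⟩ := BCell.exists_mem_op x
  have hsub : F.leaf c x ⊆ ⋃ j, ⋃ t ∈ F.liftGerms c e j,
      {s | ∀ᶠ k in (hyperfilter ℕ : Filter ℕ), ∃ l, F.IsLift (c k) e l ∧ l 0 = t.rep k ∧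
        l (e.inv x) = s.rep k} := by
    rintro s ⟨j, hj⟩
    have h1 : ∀ᶠ k in (hyperfilter ℕ : Filter ℕ), ∃ r l, F.IsLift (c k) e l ∧ l 0 = r ∧
        l (e.inv x) = s.rep k := by
      filter_upwards [hj] with k hk
      obtain ⟨l, hl, hls⟩ := (hc k).isCpx.exists_lift_of_op ((hc k).ball_subset j hk.1)
        (e := e) (hk.2.symm ▸ he)
      rw [hk.2] at hls
      exact ⟨_, l, hl, rfl, hls⟩
    obtain ⟨f, hf⟩ := h1.choice
    simp only [mem_iUnion, exists_prop]
    refine ⟨j, (f : Gm N), ?_, ?_⟩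
    · filter_upwards [hf, Gm.rep_coe f, hj] with k ⟨l, h1, h2, h3⟩ hk hk'
      exact ⟨l, h1, hk ▸ h2, _, ball_subset_closedBall (e.inv_mem he), h3 ▸ hk'.1⟩
    · filter_upwards [hf, Gm.rep_coe f] with k ⟨l, h1, h2, h3⟩ hk
      exact ⟨l, h1, hk ▸ h2, h3⟩
  refine (countable_iUnion fun j => ((finite_liftGerms hτ hc hR j e).countable.biUnion
    fun t _ => ?_)).mono hsub
  refine Set.Subsingleton.countable fun s hs s' hs' => Gm.ext ?_
  filter_upwards [hs, hs'] with k ⟨l, h1, h2, h3⟩ ⟨l', k1, k2, k3⟩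
  rw [← h3, ← k3]
  exact h1.eqOn (hc k).isCpx.locInj k1 (mem_closedBall_self zero_le_one) (h2.trans k2.symm)
    (ball_subset_closedBall (e.inv_mem he))

omit hc hR hτ [CWComplex (univ : Set B)] [T2Space B] [CompactSpace N] [T2Space N] in
lemma Box.exists_band (b : F.Box) (p : Gm N) :
    ∃ β ∈ bands, ∀ᶠ k in (hyperfilter ℕ : Filter ℕ), band (b.z (p.rep k)) = β :=
  Ultrafilter.exists_eventually_eq_of_finite _ finite_bands
    (Eventually.of_forall fun _ => band_mem _)

/-- The combinatorial structure carried by a sequence of complexes of growing radius. -/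
theorem exists_leaves : ∃ T : Finset B, Nonempty (F.Leaves T (Gm N)) := by
  classical
  have := F.compactSpace_base
  choose C hC using exists_chart (F := F) hτ
  obtain ⟨T, hT⟩ := CompactSpace.elim_nhds_subcover (fun x => (C x).O)
    (fun x => (C x).isOpen_O.mem_nhds (by have := (C x).mem_O; rwa [hC] at this))
  let Ci : T → F.Chart := fun i => C i
  choose β hβ hβp using fun (i : T) (p : Gm N) => (Ci i).b.exists_band p
  have hex : ∀ (i : T) (s : Gm N), ∃ p, ∀ x ∈ (Ci i).O, s ∈ F.leaf c x →
      p ∈ F.leaf c (Ci i).x ∧ F.GNear c (Ci i) p s := by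
    intro i s
    by_cases h : ∃ x ∈ (Ci i).O, s ∈ F.leaf c x
    · obtain ⟨x, hx, hs⟩ := h
      obtain ⟨p, hp, hps⟩ := exists_gNear hτ hc hR hx hs
      exact ⟨p, fun _ _ _ => ⟨hp, hps⟩⟩
    · exact ⟨s, fun x hx hs => absurd ⟨x, hx, hs⟩ h⟩
  choose τ hτp using hex
  have hτu : ∀ (i : T) {x}, x ∈ (Ci i).O → ∀ {s}, s ∈ F.leaf c x → ∀ {p},
      p ∈ F.leaf c (Ci i).x → F.GNear c (Ci i) p s → τ i s = p := fun i x hx s hs p hp hps =>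
    gNear_unique hτ hc hR hx hs (hτp i s x hx hs).1 hp (hτp i s x hx hs).2 hps
  have hz3 : ∀ (i : T) (m : N), |(Ci i).b.z m| ≤ 3 := fun i m => ((Ci i).b.mem_modelN m).1
  have hβJ : ∀ (i : T) (p : Gm N) (x : B), β i p ∈ (Ci i).b.J x ↔
      ∀ᶠ k in (hyperfilter ℕ : Filter ℕ), (Ci i).b.z (p.rep k) ∈ (Ci i).b.J x := by
    intro i p x
    constructor
    · intro h
      filter_upwards [hβp i p] with k hk
      rwa [← (Ci i).b.band_mem_J_iff (hz3 i _), hk]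
    · intro h
      obtain ⟨k, hk, hk'⟩ := (h.and (hβp i p)).exists
      rwa [← hk', (Ci i).b.band_mem_J_iff (hz3 i _)]
  let lt : T → Gm N → Gm N → Prop := fun i p p' =>
    ∀ᶠ k in (hyperfilter ℕ : Filter ℕ), (Ci i).b.z (p.rep k) < (Ci i).b.z (p'.rep k)
  have hlt_total : ∀ (i : T), ∀ p ∈ F.leaf c (Ci i).x, ∀ p' ∈ F.leaf c (Ci i).x, p ≠ p' →
      lt i p p' ∨ lt i p' p := by
    intro i p hp p' hp' hne
    rw [← Ultrafilter.eventually_or]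
    by_contra h
    refine hne (Gm.ext ?_)
    filter_upwards [Ultrafilter.eventually_not.2 h, leaf_deep hc hR hp, leaf_deep hc hR hp']
      with k hk h1 h2
    push Not at hk
    obtain ⟨h3, h4⟩ := (Ci i).centre _ h1.2.2
    obtain ⟨h5, h6⟩ := (Ci i).centre _ h2.2.2
    exact (Ci i).b.injOn h3 h5 (h4.trans h6.symm) (le_antisymm hk.2 hk.1)
  -- the maps `τ i` preserve and reflect the order
  have hlt_τ : ∀ (i : T), ∀ x ∈ (Ci i).O, ∀ s ∈ F.leaf c x, ∀ s' ∈ F.leaf c x,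
      lt i (τ i s) (τ i s') → lt i s s' := by
    intro i x hx s hs s' hs' h
    obtain ⟨h1, h2⟩ := hτp i s x hx hs
    obtain ⟨h1', h2'⟩ := hτp i s' x hx hs'
    filter_upwards [h, h2, h2', leaf_deep hc hR h1, leaf_deep hc hR h1', leaf_deep hc hR hs,
      leaf_deep hc hR hs'] with k h hn hn' hd hd' hds hds'
    exact Chart.z_lt hτ (hc k).isCpx hd.2.2 hd.1 hd'.2.2 hd'.1 hn hn'
      (hds.2.2.trans hds'.2.2.symm) (by rwa [hds.2.2]) h
  have hlt_irr : ∀ (i : T) s, ¬ lt i s s := fun i s h => by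
    obtain ⟨k, hk⟩ := h.exists
    exact lt_irrefl _ hk
  have hlt_asymm : ∀ (i : T) s s', lt i s s' → ¬ lt i s' s := fun i s s' h h' => by
    obtain ⟨k, hk⟩ := (h.and h').exists
    exact lt_asymm hk.1 hk.2
  have hlt_τ' : ∀ (i : T), ∀ x ∈ (Ci i).O, ∀ s ∈ F.leaf c x, ∀ s' ∈ F.leaf c x,
      lt i s s' → lt i (τ i s) (τ i s') := by
    intro i x hx s hs s' hs' h
    have hne : τ i s ≠ τ i s' := by
      intro heq
      have h1 := (hτp i s' x hx hs').2
      rw [← heq] at h1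
      have h2 := gNear_inj hc hR hs hs' (hτp i s x hx hs).1 (hτp i s x hx hs).2 h1
      exact hlt_irr i s (by rwa [← h2] at h)
    rcases hlt_total i _ (hτp i s x hx hs).1 _ (hτp i s' x hx hs').1 hne with h1 | h1
    · exact h1
    · exact (hlt_asymm i _ _ h (hlt_τ i x hx s' hs' s hs h1)).elim
  have hcore : ∀ m ∈ F.core, ((fun _ => m : ℕ → N) : Gm N) ∈ F.leaf c (F.π m) := fun m hm =>
    coe_mem_leaf (j := 0) (Eventually.of_forall fun k => ⟨hm, rfl⟩)
  -- the pared locus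
  have hκ : ∀ (i : T), ∀ m ∈ F.core, F.π m ∈ (Ci i).O → ∃ m₀ ∈ F.core, F.π m₀ = (Ci i).x ∧
      (Ci i).b.z m₀ = (Ci i).b.z m ∧
        τ i ((fun _ => m : ℕ → N) : Gm N) = ((fun _ => m₀ : ℕ → N) : Gm N) := by
    intro i m hm hx
    obtain ⟨m₀, h1, h2, h3, h4⟩ := Chart.near_core (C := Ci i) hτ hm hx
    have h5 := hcore m₀ h1
    rw [h2] at h5
    refine ⟨m₀, h1, h2, h3, hτu i hx (hcore m hm) h5 ?_⟩
    filter_upwards [Gm.rep_coe (fun _ => m), Gm.rep_coe (fun _ => m₀), leaf_deep hc hR h5]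
      with k hk hk' hd
    rw [hk, hk']
    rw [hk'] at hd
    exact h4 (c k) (hc k).isCpx.locInj ((hc k).ball_subset 0) hd.1
  have hz_core : ∀ (i : T) (m : N), m ∈ F.core → m ∈ (Ci i).b.src →
      ((Ci i).b.q m).1 = 0 ∧ (Ci i).b.z m = 3 / 2 ∨
        ((Ci i).b.q m).2 = 0 ∧ (Ci i).b.z m = -3 / 2 := fun i m hm hs =>
    ((Ci i).b.isFlowBox.core_iff m hs).1 hm
  have hband : ∀ (i : T) (m : N), m ∈ F.core → m ∈ (Ci i).b.src →
      band ((Ci i).b.z m) = (Ci i).b.z m := by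
    intro i m hm hs
    rcases hz_core i m hm hs with h | h <;> rw [h.2] <;> norm_num [band]
  refine ⟨T, ⟨{
    C := Ci
    cover := fun x => ?_
    L := F.leaf c
    τ := τ
    lt := lt
    β := β
    κ := fun m => ((fun _ => m : ℕ → N) : Gm N)
    countable := fun i => countable_leaf hτ hc hR _
    lt_irrefl := hlt_irr
    lt_trans := fun i p p' p'' h h' => by
      filter_upwards [h, h'] with k hk hk' using hk.trans hk'
    lt_total := hlt_total
    β_mem := hβ
    β_mono := fun i p p' h => ?_
    τ_bij := fun i x hx => ⟨fun s hs => ?_, fun s hs s' hs' h => ?_, fun p hp => ?_⟩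
    τ_same := fun i j x hx hx' hS s hs s' hs' h => ?_
    τ_opp := fun i j x hx hx' hS s hs s' hs' h => ?_
    τ_loc := fun i j x hx hx' => ?_
    κ_mem := hcore
    β_κ := fun i m hm hx => ?_
    κ_unique := fun i m hm hx p hp h => ?_ }⟩⟩
  · have hx : x ∈ ⋃ y ∈ T, (C y).O := hT ▸ mem_univ x
    simp only [mem_iUnion] at hx
    obtain ⟨y, hy, hxy⟩ := hx
    exact ⟨⟨y, hy⟩, hxy⟩
  · obtain ⟨k, h1, h2, h3⟩ := (h.and ((hβp i p).and (hβp i p'))).exists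
    rw [← h2, ← h3]
    exact band_mono h1.le
  · obtain ⟨h1, h2⟩ := hτp i s x hx hs
    refine ⟨h1, (hβJ i _ x).2 ?_⟩
    filter_upwards [h2, leaf_deep hc hR h1, leaf_deep hc hR hs] with k hk hd hd'
    have := Chart.J_of_near hτ hd.2.2 hk
    rwa [hd'.2.2] at this
  · have h1 := (hτp i s' x hx hs').2
    rw [← h] at h1
    exact gNear_inj hc hR hs hs' (hτp i s x hx hs).1 (hτp i s x hx hs).2 h1
  · obtain ⟨s, hs, hps⟩ := exists_gNear' hτ hc hR hx hp.1 ((hβJ i p x).1 hp.2)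
    exact ⟨s, hs, hτu i hx hs hp.1 hps⟩
  · refine hlt_τ' j x hx' s hs s' hs' ?_
    filter_upwards [hlt_τ i x hx s hs s' hs' h, leaf_deep hc hR hs, leaf_deep hc hR hs']
      with k hk hd hd'
    exact (hS _ _ hd.2.2 hd'.2.2).1 hk
  · refine hlt_τ' j x hx' s' hs' s hs ?_
    filter_upwards [hlt_τ i x hx s hs s' hs' h, leaf_deep hc hR hs, leaf_deep hc hR hs']
      with k hk hd hd'
    exact (hS _ _ hd.2.2 hd'.2.2).1 hk
  · filter_upwards [gNear_loc hτ hc hR hx hx', (Ci i).isOpen_O.mem_nhds hx,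
      (Ci j).isOpen_O.mem_nhds hx'] with y hy hyi hyj s hs s' hs' h
    obtain ⟨h1, h2⟩ := hτp i s x hx hs
    obtain ⟨h3, h4⟩ := hτp j s x hx' hs
    have h5 := (hτp i s' y hyi hs').2
    rw [← h] at h5
    exact (hτu j hyj hs' h3 (hy s hs s' hs' _ h1 h2 h5 _ h3 h4)).symm
  · obtain ⟨m₀, h1, h2, h3, h4⟩ := hκ i m hm hx
    rw [h4, ← h3]
    obtain ⟨k, hk, hk'⟩ := ((hβp i ((fun _ => m₀ : ℕ → N) : Gm N)).and
      (Gm.rep_coe (fun _ => m₀))).exists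
    rw [← hk, hk', hband i m₀ h1 ((Ci i).centre m₀ h2).1]
  · obtain ⟨m₀, h1, h2, h3, h4⟩ := hκ i m hm hx
    rw [h4]
    refine Gm.ext ?_
    filter_upwards [hβp i p, Gm.rep_coe (fun _ => m₀), leaf_deep hc hR hp] with k hk hk' hd
    rw [hk']
    obtain ⟨k1, k2⟩ := (Ci i).centre _ hd.2.2
    obtain ⟨k3, k4⟩ := (Ci i).centre _ h2
    rw [h, ← h3] at hk
    -- A germ whose band is that of a core point over the centre lies in the interior of the
    -- vertical boundary, where `c k` has no points other than the pared locus. This gives the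
    -- uniqueness of core germs.
    have hv : p.rep k ∈ F.vertInterior := by
      rw [mem_vertInterior_iff (Ci i).b.isFlowBox k1]
      have hq : (Ci i).b.q (p.rep k) = (Ci i).b.q m₀ := k2.trans k4.symm
      rcases hz_core i m₀ h1 k3 with h5 | h5
      · left
        rw [h5.2] at hk
        refine ⟨?_, ?_⟩
        · show ((Ci i).b.q (p.rep k)).1 = 0
          rw [hq]; exact h5.1
        · show 1 < (Ci i).b.z (p.rep k) ∧ (Ci i).b.z (p.rep k) < 2
          unfold band at hk
          split_ifs at hk with a1 a2 a3 a4 <;> norm_num at hk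
          exact ⟨a2, not_le.1 a1⟩
      · right
        rw [h5.2] at hk
        refine ⟨?_, ?_⟩
        · show ((Ci i).b.q (p.rep k)).2 = 0
          rw [hq]; exact h5.1
        · show -2 < (Ci i).b.z (p.rep k) ∧ (Ci i).b.z (p.rep k) < -1
          unfold band at hk
          split_ifs at hk with a1 a2 a3 a4 <;> norm_num at hk
          exact ⟨a4, not_le.1 a3⟩
    have hco := mem_core_of_mem_vertInterior hc hd.2.1 hv
    refine (Ci i).b.injOn k1 k3 (k2.trans k4.symm) ?_
    rw [← hband i _ hco k1, hk]

end Germs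
end FibredNbhd
end BranchedSurface

namespace BranchedSurface

/-! ### Placing a countable ordered set in the bands of the standard block -/

/-- The radius of the part of the standard block with representative height `β`. -/
noncomputable def bandRadius (β : ℝ) : ℝ := if β = 0 then 1 else 1 / 2

lemma bandRadius_pos (β : ℝ) : 0 < bandRadius β := by
  unfold bandRadius; split_ifs <;> norm_num

lemma same_of_bands {q : ℝ × ℝ} {β z : ℝ} (hβ : β ∈ bands) (h : (q, β) ∈ modelN)
    (hz : |z - β| ≤ bandRadius β) : SameModelFiber (q, β) (q, z) := by
  refine ⟨rfl, fun w hw => ?_⟩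
  have hw' : |w - β| ≤ bandRadius β := (abs_sub_left_of_mem_uIcc hw).trans hz
  rw [mem_modelN] at h ⊢
  simp only [bands, mem_insert_iff, mem_singleton_iff] at hβ
  rw [abs_le] at hw' ⊢
  obtain ⟨h1, h2⟩ := hw'
  have hq1 : β = 3 / 2 → ¬ 0 < q.1 := by
    rintro rfl h3; exact h.2.1 ⟨h3, by norm_num, by norm_num⟩
  have hq2 : β = -3 / 2 → ¬ 0 < q.2 := by
    rintro rfl h3; exact h.2.2 ⟨h3, by norm_num, by norm_num⟩
  refine ⟨?_, fun ⟨h3, h4, h5⟩ => ?_, fun ⟨h3, h4, h5⟩ => ?_⟩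
  · rcases hβ with rfl | rfl | rfl | rfl | rfl <;> norm_num [bandRadius] at h1 h2 <;>
      constructor <;> linarith
  · rcases hβ with rfl | rfl | rfl | rfl | rfl <;> norm_num [bandRadius] at h1 h2 <;>
      first | linarith | exact hq1 rfl h3
  · rcases hβ with rfl | rfl | rfl | rfl | rfl <;> norm_num [bandRadius] at h1 h2 <;>
      first | linarith | exact hq2 rfl h3

lemma bands_sep {β β' : ℝ} (hβ : β ∈ bands) (hβ' : β' ∈ bands) (h : β < β') :
    β + bandRadius β ≤ β' - bandRadius β' := by
  simp only [bands, mem_insert_iff, mem_singleton_iff] at hβ hβ'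
  rcases hβ with rfl | rfl | rfl | rfl | rfl <;> rcases hβ' with rfl | rfl | rfl | rfl | rfl <;>
    first | (norm_num [bandRadius]; done) | norm_num at h

/-- Choose summable positive weights `w`. Within a band of total weight `T p`, the interval of `p`
starts after the total weight `A p` of the predecessors of `p` and has length proportional to `w p`;
order and disjointness follow from additivity of `μ`. Dividing by `T p` makes a sole occupant fill
its band, as is needed for the pared locus. -/
lemma exists_placement {G : Type*} {P : Set G} (hP : P.Countable) (lt : G → G → Prop)
    (hirr : ∀ p, ¬ lt p p) (htrans : ∀ p p' p'', lt p p' → lt p' p'' → lt p p'')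
    (β : G → ℝ) (hβ : ∀ p, β p ∈ bands) (hmono : ∀ p p', lt p p' → β p ≤ β p') :
    ∃ mid half : G → ℝ, (∀ p ∈ P, 0 < half p) ∧ (∀ p ∈ P, |mid p - β p| + half p ≤ bandRadius (β p)) ∧
      (∀ p ∈ P, ∀ p' ∈ P, lt p p' → mid p + half p ≤ mid p' - half p') ∧
      ∀ p ∈ P, (∀ p' ∈ P, β p' = β p → p' = p) → mid p = β p ∧ half p = bandRadius (β p) := by
  classical
  obtain ⟨w, hw, c, hc, -⟩ := hP.exists_pos_hasSum_le one_pos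
  set μ : Set G → ℝ := fun X => ∑' u : P, X.indicator w u with hμ
  have hs : ∀ X : Set G, Summable fun u : P => X.indicator w u := fun X =>
    Summable.of_nonneg_of_le (fun u => indicator_nonneg (fun a _ => (hw a).le) _)
      (fun u => indicator_le_self' (fun a _ => (hw a).le) _) hc.summable
  have hmon : ∀ X Y : Set G, (X ∩ P) ⊆ Y → μ X ≤ μ Y := fun X Y h =>
    Summable.tsum_le_tsum (fun u => by
      by_cases hu : (u : G) ∈ X
      · rw [indicator_of_mem hu, indicator_of_mem (h ⟨hu, u.2⟩)]
      · rw [indicator_of_notMem hu]; exact indicator_nonneg (fun a _ => (hw a).le) _) (hs X) (hs Y)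
  have hins : ∀ (X : Set G), ∀ p ∈ P, p ∉ X → μ (insert p X) = w p + μ X := by
    intro X p hp hpX
    have h1 : ∀ u : P, (insert p X).indicator w u = (if u = ⟨p, hp⟩ then w p else 0) +
        X.indicator w u := by
      rintro ⟨u, hu⟩
      by_cases h : u = p
      · subst h; simp [hpX]
      · simp [h, indicator_apply, Subtype.ext_iff]
    simp only [hμ, h1]
    rw [Summable.tsum_add (hasSum_ite_eq _ _).summable (hs X), tsum_ite_eq]
  have hnn : ∀ X, 0 ≤ μ X := fun X =>
    tsum_nonneg fun u => indicator_nonneg (fun a _ => (hw a).le) _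
  set T : G → ℝ := fun p => μ {u | β u = β p} with hT
  set A : G → ℝ := fun p => μ {u | β u = β p ∧ lt u p} with hA
  have hAT : ∀ p ∈ P, w p + A p ≤ T p := by
    intro p hp
    rw [hA, ← hins _ p hp fun h => hirr p h.2]
    refine hmon _ _ ?_
    rintro u ⟨rfl | hu, -⟩
    exacts [rfl, hu.1]
  have hTp : ∀ p ∈ P, 0 < T p := fun p hp => by
    have := hnn {u | β u = β p ∧ lt u p}
    linarith [hAT p hp, hw p]
  refine ⟨fun p => β p - bandRadius (β p) + bandRadius (β p) * ((2 * A p + w p) / T p),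
    fun p => bandRadius (β p) * (w p / T p), ?_, ?_, ?_, ?_⟩
  · intro p hp
    exact mul_pos (bandRadius_pos _) (div_pos (hw p) (hTp p hp))
  · intro p hp
    have h0 : bandRadius (β p) = bandRadius (β p) * (T p / T p) := by
      rw [div_self (hTp p hp).ne', mul_one]
    have h1 : |(-1 + (2 * A p + w p) / T p)| + w p / T p ≤ 1 := by
      have e1 : -1 + (2 * A p + w p) / T p + w p / T p ≤ 1 := by
        have : -1 + (2 * A p + w p) / T p + w p / T p = -1 + 2 * ((w p + A p) / T p) := by ring
        rw [this]
        linarith [(div_le_one (hTp p hp)).2 (hAT p hp)]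
      have e2 : -(-1 + (2 * A p + w p) / T p) + w p / T p ≤ 1 := by
        have : -(-1 + (2 * A p + w p) / T p) + w p / T p = 1 - 2 * (A p / T p) := by ring
        rw [this]
        linarith [div_nonneg (hnn {u | β u = β p ∧ lt u p}) (hTp p hp).le]
      rcases abs_cases (-1 + (2 * A p + w p) / T p) with h | h <;> rw [h.1] <;> assumption
    calc _ = bandRadius (β p) * (|(-1 + (2 * A p + w p) / T p)| + w p / T p) := by
          rw [mul_add]
          congr 1
          conv_rhs => rw [← abs_of_pos (bandRadius_pos (β p)), ← abs_mul]
          congr 1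
          ring
      _ ≤ _ := mul_le_of_le_one_right (bandRadius_pos _).le h1
  · intro p hp p' hp' h
    have e1 : β p - bandRadius (β p) + bandRadius (β p) * ((2 * A p + w p) / T p) +
        bandRadius (β p) * (w p / T p) =
        β p - bandRadius (β p) + bandRadius (β p) * 2 * ((w p + A p) / T p) := by ring
    have e2 : β p' - bandRadius (β p') + bandRadius (β p') * ((2 * A p' + w p') / T p') -
        bandRadius (β p') * (w p' / T p') =
        β p' - bandRadius (β p') + bandRadius (β p') * 2 * (A p' / T p') := by ring
    simp only
    rw [e1, e2]
    rcases (hmono _ _ h).lt_or_eq with hlt | heq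
    · have h1 := bands_sep (hβ p) (hβ p') hlt
      have h2 := (div_le_one (hTp p hp)).2 (hAT p hp)
      have h3 := div_nonneg (hnn {u | β u = β p' ∧ lt u p'}) (hTp p' hp').le
      have h4 := mul_le_mul_of_nonneg_left h2 (mul_pos (bandRadius_pos (β p)) two_pos).le
      have h5 := mul_nonneg (mul_pos (bandRadius_pos (β p')) two_pos).le h3
      change 0 ≤ bandRadius (β p') * 2 * (A p' / T p') at h5
      linarith
    · have h1 : T p = T p' := by simp only [hT, heq]
      have h2 : w p + A p ≤ A p' := by
        rw [hA, ← hins _ p hp fun h => hirr p h.2]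
        refine hmon _ _ ?_
        rintro u ⟨rfl | hu, -⟩
        exacts [⟨heq, h⟩, ⟨hu.1.trans heq, htrans _ _ _ hu.2 h⟩]
      rw [heq, h1]
      have h3 : (w p + A p) / T p' ≤ A p' / T p' := div_le_div_of_nonneg_right h2 (hTp p' hp').le
      have h4 := mul_le_mul_of_nonneg_left h3 (mul_pos (bandRadius_pos (β p')) two_pos).le
      linarith
  · intro p hp hu
    have hA0 : A p = 0 := by
      refine le_antisymm ?_ (hnn _)
      have : μ ∅ = 0 := by simp [hμ]
      rw [← this]
      refine hmon _ _ ?_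
      rintro u ⟨⟨h1, h2⟩, h3⟩
      rw [hu u h3 h1] at h2
      exact (hirr p h2).elim
    have hT0 : T p = w p := by
      refine le_antisymm ?_ (by linarith [hAT p hp])
      have : μ {p} = w p := by
        rw [← insert_empty_eq, hins ∅ p hp (notMem_empty _)]; simp [hμ]
      rw [← this]
      exact hmon _ _ fun u hu' => hu u hu'.2 hu'.1
    have := (hw p).ne'
    simp only
    rw [hA0, hT0, mul_zero, zero_add, div_self this]
    constructor <;> ring

/-! ### Relative orientation of boxes along fibres -/

namespace FibredNbhd

variable {N B : Type*} [TopologicalSpace N] [TopologicalSpace B] {F : FibredNbhd N B}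

lemma Box.J_of_bands (b : F.Box) {x : B} {β z : ℝ} (hβ : β ∈ bands) (h : β ∈ b.J x)
    (hz : |z - β| ≤ bandRadius β) : z ∈ b.J x :=
  b.J_of_same h (same_of_bands hβ (b.rng_of_J h).1 hz)

lemma Box.ordConnected_J (b : F.Box) (x : B) : (b.J x).OrdConnected := by
  rw [ordConnected_iff_uIcc_subset]
  intro z hz z' hz' w hw
  exact b.J_of_same hz ⟨rfl, fun t ht =>
    (b.same_of_J hz hz').2 t (uIcc_subset_uIcc left_mem_uIcc hw ht)⟩

/-- Every fibre contains one of three test segments. -/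
lemma Box.exists_test (b : F.Box) {x : B} (hx : x ∈ b.base) :
    ∃ w ∈ ({5 / 2, 0, -5 / 2} : Set ℝ), w ∈ b.J x ∧ w + 1 / 4 ∈ b.J x := by
  suffices h : ∃ w ∈ ({5 / 2, 0, -5 / 2} : Set ℝ), w ∈ b.J x by
    obtain ⟨w, hw, hwJ⟩ := h
    refine ⟨w, hw, hwJ, b.J_of_bands (β := w) ?_ hwJ ?_⟩
    · simp only [mem_insert_iff, mem_singleton_iff, bands] at hw ⊢; tauto
    · rw [add_sub_cancel_left]; unfold bandRadius; split_ifs <;> norm_num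
  obtain ⟨m, hm, rfl⟩ := hx
  have h1 := (b.band_mem_J_iff (b.mem_modelN m).1).2 (b.z_mem_J hm)
  have h2 := band_mem (b.z m)
  generalize band (b.z m) = β at h1 h2
  simp only [bands, mem_insert_iff, mem_singleton_iff] at h2
  rcases h2 with rfl | rfl | rfl | rfl | rfl
  · exact ⟨_, by simp, h1⟩
  · have h3 := b.J_of_bands (z := 2) (by simp [bands]) h1 (by norm_num [bandRadius])
    refine ⟨5 / 2, by simp, ?_⟩
    have := (b.band_mem_J_iff (x := F.π m) (z := 2) (by norm_num)).2 h3
    norm_num [band] at this ⊢; exact this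
  · exact ⟨_, by simp, h1⟩
  · have h3 := b.J_of_bands (z := -2) (by simp [bands]) h1 (by norm_num [bandRadius])
    refine ⟨-5 / 2, by simp, ?_⟩
    have := (b.band_mem_J_iff (x := F.π m) (z := -2) (by norm_num)).2 h3
    norm_num [band] at this ⊢; exact this
  · exact ⟨_, by simp, h1⟩

lemma Box.exists_lt (b : F.Box) {x : B} (hx : x ∈ b.base) :
    ∃ m n, F.π m = x ∧ F.π n = x ∧ b.z m < b.z n := by
  obtain ⟨w, -, ⟨m, -, h1, h2⟩, ⟨n, -, h3, h4⟩⟩ := b.exists_test hx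
  exact ⟨m, n, h1, h3, by linarith⟩

lemma Box.fibre_eq [Nonempty N] (b : F.Box) {x : B} (hx : x ∈ b.base) :
    F.π ⁻¹' {x} = (fun z => b.pt (b.qB x, z)) '' b.J x := by
  ext m
  constructor
  · rintro rfl
    have hm := b.mem_base_iff.1 hx
    refine ⟨b.z m, b.z_mem_J hm, ?_⟩
    simp only
    rw [b.qB_π hm, b.pt_qz hm]
  · rintro ⟨z, hz, rfl⟩
    exact b.π_pt_of_J hz

lemma Box.continuousOn_pt_fibre [Nonempty N] (b : F.Box) (x : B) :
    ContinuousOn (fun z => b.pt (b.qB x, z)) (b.J x) :=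
  b.continuousOn_pt.comp (by fun_prop) fun _ hz => b.rng_of_J hz

lemma Box.isPreconnected_image_pt [Nonempty N] (b : F.Box) {x : B} {A : Set ℝ}
    (hA : A.OrdConnected) (hAJ : A ⊆ b.J x) :
    IsPreconnected ((fun z => b.pt (b.qB x, z)) '' A) :=
  hA.isPreconnected.image _ ((b.continuousOn_pt_fibre x).mono hAJ)

lemma Box.Same.not_opp {b b' : F.Box} {x : B} (h : b.Same b' x) (hx : x ∈ b.base) :
    ¬ b.Opp b' x := fun h' => by
  obtain ⟨m, n, hm, hn, hmn⟩ := b.exists_lt hx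
  exact lt_asymm ((h m n hm hn).1 hmn) ((h' m n hm hn).1 hmn)

/-- The change of height coordinate is a continuous injection of the compact interval `b.J x`, hence
strictly monotone. -/
lemma Box.same_or_opp [CompactSpace N] [T2Space B] {b b' : F.Box} {x : B} (hx : x ∈ b.base)
    (hx' : x ∈ b'.base) : b.Same b' x ∨ b.Opp b' x := by
  have : Nonempty N := ⟨(F.surjective_π x).choose⟩
  have hpt : ∀ z ∈ b.J x, b.pt (b.qB x, z) ∈ b'.src := fun z hz => by
    rw [← b'.mem_base_iff, b.π_pt_of_J hz]; exact hx'
  have hc : ContinuousOn (fun z => b'.z (b.pt (b.qB x, z))) (b.J x) :=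
    b'.continuousOn_z.comp (b.continuousOn_pt_fibre x) hpt
  have hi : InjOn (fun z => b'.z (b.pt (b.qB x, z))) (b.J x) := by
    intro z hz z' hz' h
    have h1 : F.π (b.pt (b.qB x, z)) = F.π (b.pt (b.qB x, z')) := by
      rw [b.π_pt_of_J hz, b.π_pt_of_J hz']
    have h2 := b'.injOn (hpt z hz) (hpt z' hz') (b'.q_eq (hpt z hz) h1) h
    have h3 := b.z_pt (b.rng_of_J hz)
    rwa [h2, b.z_pt (b.rng_of_J hz'), eq_comm] at h3
  have hz : ∀ m, F.π m = x → b.z m ∈ b.J x ∧ b.pt (b.qB x, b.z m) = m := by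
    rintro m rfl
    have hm := b.mem_base_iff.1 hx
    exact ⟨b.z_mem_J hm, by rw [b.qB_π hm, b.pt_qz hm]⟩
  have hJ : ∃ u v, b.J x = Icc u v ∧ u ≤ v := by
    have hk : IsCompact (b.J x) := isCompact_Icc.of_isClosed_subset (b.J_isClosed hx)
      fun z hz => (b.rng_of_J hz).2.2
    refine ⟨sInf (b.J x), sSup (b.J x), Subset.antisymm (fun z hz =>
      ⟨csInf_le hk.bddBelow hz, le_csSup hk.bddAbove hz⟩) ?_, ?_⟩
    · exact (b.ordConnected_J x).out (hk.sInf_mem (b.J_nonempty hx)) (hk.sSup_mem (b.J_nonempty hx))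
    · exact csInf_le hk.bddBelow (hk.sSup_mem (b.J_nonempty hx))
  obtain ⟨u, v, hJ, huv⟩ := hJ
  rw [hJ] at hc hi hz
  rcases hc.strictMonoOn_of_injOn_Icc' huv hi with h | h
  · left
    intro m n hm hn
    have := h.lt_iff_lt (hz m hm).1 (hz n hn).1
    rw [(hz m hm).2, (hz n hn).2] at this
    exact this.symm
  · right
    intro m n hm hn
    have := h.lt_iff_gt (hz n hn).1 (hz m hm).1
    rw [(hz m hm).2, (hz n hn).2] at this
    exact this.symm

open Classical in
/-- The relative orientation of two boxes along the fibre over `x`. -/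
noncomputable def Box.sgn (b b' : F.Box) (x : B) : ℝ := if b.Same b' x then 1 else -1

lemma Box.sgn_cases (b b' : F.Box) (x : B) : b.sgn b' x = 1 ∨ b.sgn b' x = -1 := by
  unfold Box.sgn; split_ifs <;> simp

lemma Box.sgn_mul_lt [CompactSpace N] [T2Space B] {b b' : F.Box} {m n : N} (hx : F.π m ∈ b.base)
    (hx' : F.π m ∈ b'.base) (hn : F.π n = F.π m) (h : b.z m < b.z n) :
    b.sgn b' (F.π m) * b'.z m < b.sgn b' (F.π m) * b'.z n := by
  unfold Box.sgn
  split_ifs with hS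
  · have := (hS m n rfl hn).1 h
    linarith
  · have := ((Box.same_or_opp hx hx').resolve_left hS m n rfl hn).1 h
    linarith

lemma Box.sgn_mul [CompactSpace N] [T2Space B] {b b' b'' : F.Box} {x : B} (hx : x ∈ b.base)
    (hx' : x ∈ b'.base) (hx'' : x ∈ b''.base) :
    b.sgn b'' x = b.sgn b' x * b'.sgn b'' x := by
  have h1 : b.Same b'' x → ¬ b.Opp b'' x := fun h => h.not_opp hx
  unfold Box.sgn
  rcases Box.same_or_opp hx hx' with h | h <;> rcases Box.same_or_opp hx' hx'' with h' | h'
  · have : b.Same b'' x := fun m n hm hn => (h m n hm hn).trans (h' m n hm hn)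
    simp [this, h, h']
  · have : b.Opp b'' x := fun m n hm hn => (h m n hm hn).trans (h' m n hm hn)
    have h3 : ¬ b'.Same b'' x := fun h4 => h4.not_opp hx' h'
    have h4 : ¬ b.Same b'' x := fun h4 => h1 h4 this
    simp [h4, h, h3]
  · have : b.Opp b'' x := fun m n hm hn => (h m n hm hn).trans (h' n m hn hm)
    have h3 : ¬ b.Same b' x := fun h4 => h4.not_opp hx h
    have h4 : ¬ b.Same b'' x := fun h4 => h1 h4 this
    simp [h4, h', h3]
  · have : b.Same b'' x := fun m n hm hn => (h m n hm hn).trans (h' n m hn hm)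
    have h3 : ¬ b.Same b' x := fun h4 => h4.not_opp hx h
    have h4 : ¬ b'.Same b'' x := fun h4 => h4.not_opp hx' h'
    simp [this, h4, h3]

/-- Orientation is tested on segments from `w` to `w + 1 / 4`. Since fibres jump, no single segment
need persist, but every nearby fibre contains one of three, by `exists_test`. A test present over
points near `x` is also present over `x`, where its strict inequality is stable. -/
lemma Box.sgn_eventuallyEq [CompactSpace N] [T2Space B] {b b' : F.Box} {x : B} (hx : x ∈ b.base)
    (hx' : x ∈ b'.base) : ∀ᶠ y in 𝓝 x, b.sgn b' y = b.sgn b' x := by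
  have : Nonempty N := ⟨(F.surjective_π x).choose⟩
  have hlim : ∀ w, ContinuousWithinAt (fun y => b'.z (b.pt (b.qB y, w))) {y | w ∈ b.J y} x ∨
      w ∉ b.J x := by
    intro w
    by_cases hw : w ∈ b.J x
    · left
      have h1 : ContinuousWithinAt (fun y => b.pt (b.qB y, w)) {y | w ∈ b.J y} x :=
        (b.continuousOn_pt _ (b.rng_of_J hw)).comp (f := fun y => (b.qB y, w))
          (((b.continuousOn_qB.continuousAt (b.isOpen_base.mem_nhds hx)).prodMk
            continuousAt_const).continuousWithinAt) fun y hy => b.rng_of_J hy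
      refine ContinuousAt.comp_continuousWithinAt (g := b'.z) (f := fun y => b.pt (b.qB y, w)) ?_ h1
      refine b'.continuousOn_z.continuousAt (b'.isOpen_src.mem_nhds ?_)
      rw [← b'.mem_base_iff, b.π_pt_of_J hw]; exact hx'
    · exact Or.inr hw
  have key : ∀ w ∈ ({5 / 2, 0, -5 / 2} : Set ℝ), ∀ᶠ y in 𝓝 x, w ∈ b.J y → w + 1 / 4 ∈ b.J y →
      b.sgn b' y = b.sgn b' x := by
    intro w _
    by_cases hw : w ∈ b.J x ∧ w + 1 / 4 ∈ b.J x
    swap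
    · filter_upwards [b.J_stable hx] with y hy h1 h2
      exact (hw ⟨hy.2.1 h1, hy.2.1 h2⟩).elim
    have hz := (hlim w).resolve_right (not_not.2 hw.1)
    have hz' := (hlim (w + 1 / 4)).resolve_right (not_not.2 hw.2)
    have hlt : ∀ y, w ∈ b.J y → w + 1 / 4 ∈ b.J y → y ∈ b'.base →
        b.sgn b' y * b'.z (b.pt (b.qB y, w)) < b.sgn b' y * b'.z (b.pt (b.qB y, w + 1 / 4)) := by
      intro y h1 h2 h3
      have h4 := b.π_pt_of_J h1
      have := Box.sgn_mul_lt (b := b) (b' := b') (m := b.pt (b.qB y, w))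
        (n := b.pt (b.qB y, w + 1 / 4)) (by rw [h4]; exact b.mem_base_of_J h1) (by rwa [h4])
        (by rw [h4, b.π_pt_of_J h2]) (by rw [b.z_pt (b.rng_of_J h1), b.z_pt (b.rng_of_J h2)]; linarith)
      rwa [h4] at this
    have hx0 := hlt x hw.1 hw.2 hx'
    have hev : ∀ᶠ y in 𝓝[{y | w ∈ b.J y} ∩ {y | w + 1 / 4 ∈ b.J y}] x,
        b.sgn b' x * b'.z (b.pt (b.qB y, w)) < b.sgn b' x * b'.z (b.pt (b.qB y, w + 1 / 4)) :=
      ((hz.mono inter_subset_left).tendsto.const_mul _).eventually_lt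
        ((hz'.mono inter_subset_right).tendsto.const_mul _) hx0
    filter_upwards [eventually_nhdsWithin_iff.1 hev, b'.isOpen_base.mem_nhds hx'] with y hy hy' h1 h2
    have h3 := hy ⟨h1, h2⟩
    have h4 := hlt y h1 h2 hy'
    rcases b.sgn_cases b' x with h5 | h5 <;> rcases b.sgn_cases b' y with h6 | h6 <;>
      rw [h5] at h3 <;> rw [h6] at h4 <;> rw [h5, h6] <;> linarith
  have h5 := key (5 / 2) (by simp)
  have h0 := key 0 (by simp)
  have h5' := key (-5 / 2) (by simp)
  filter_upwards [h5, h0, h5', b.isOpen_base.mem_nhds hx] with y h1 h2 h3 hy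
  obtain ⟨w, hw, hw1, hw2⟩ := b.exists_test hy
  simp only [mem_insert_iff, mem_singleton_iff] at hw
  rcases hw with rfl | rfl | rfl
  exacts [h1 hw1 hw2, h2 hw1 hw2, h3 hw1 hw2]

/-! ### Slits -/

lemma Box.core_cases (b : F.Box) {m : N} (hm : m ∈ b.src) (hc : m ∈ F.core) :
    (b.q m).1 = 0 ∧ b.z m = 3 / 2 ∨ (b.q m).2 = 0 ∧ b.z m = -3 / 2 :=
  (b.isFlowBox.core_iff m hm).1 hc

/-- The component of the vertical boundary of a fibre containing a point of the pared locus is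
the same in all boxes. -/
lemma Box.slit_le {b b' : F.Box} {m n : N} (hm : m ∈ b.src) (hm' : m ∈ b'.src) (hc : m ∈ F.core)
    (hn : F.π n = F.π m) (h : |b.z n - b.z m| ≤ 1 / 2) : |b'.z n - b'.z m| ≤ 1 / 2 := by
  have : Nonempty N := ⟨m⟩
  set x := F.π m with hx
  have hnb := b.mem_src hm hn
  have hA : uIcc (b.z m) (b.z n) ⊆ b.J x :=
    ordConnected_iff_uIcc_subset.1 (b.ordConnected_J x) (b.z_mem_J hm) (hn ▸ b.z_mem_J hnb)
  have hsrc : ∀ z ∈ uIcc (b.z m) (b.z n), b.pt (b.qB x, z) ∈ b'.src := fun z hz => by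
    rw [← b'.mem_base_iff, b.π_pt_of_J (hA hz)]; exact b'.mem_base_iff.2 hm'
  have hvert : ∀ z ∈ uIcc (b.z m) (b.z n), b.pt (b.qB x, z) ∈ F.vert := by
    intro z hz
    have hr := b.rng_of_J (hA hz)
    rw [b.isFlowBox.vert_iff _ (b.pt_mem hr), b.φ_pt hr]
    have h1 := abs_le.1 ((abs_sub_left_of_mem_uIcc hz).trans h)
    have hq : b.qB x = b.q m := b.qB_π hm
    change (b.qB x, z) ∈ modelVert
    rw [hq]
    rcases b.core_cases hm hc with h2 | h2
    · left; exact ⟨h2.1, by simp only; linarith, by simp only; linarith⟩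
    · right; exact ⟨h2.1, by simp only; linarith, by simp only; linarith⟩
  have hpre := (ordConnected_uIcc.isPreconnected.image (fun z => b'.z (b.pt (b.qB x, z)))
    (b'.continuousOn_z.comp ((b.continuousOn_pt_fibre x).mono hA) hsrc)).ordConnected
  have hzm : b'.z m ∈ (fun z => b'.z (b.pt (b.qB x, z))) '' uIcc (b.z m) (b.z n) :=
    ⟨b.z m, left_mem_uIcc, by simp only; rw [b.qB_π hm, b.pt_qz hm]⟩
  have hzn : b'.z n ∈ (fun z => b'.z (b.pt (b.qB x, z))) '' uIcc (b.z m) (b.z n) :=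
    ⟨b.z n, right_mem_uIcc, by simp only; rw [← hn, b.qB_π hnb, b.pt_qz hnb]⟩
  -- The segment between `m` and `n` lies in the vertical boundary. Its heights in `b'` form an
  -- interval which avoids 0, so they stay in the slit containing `m`.
  have hT : ∀ t ∈ (fun z => b'.z (b.pt (b.qB x, z))) '' uIcc (b.z m) (b.z n),
      t ∈ Icc 1 2 ∨ t ∈ Icc (-2 : ℝ) (-1) := by
    rintro _ ⟨z, hz, rfl⟩
    have := (b'.isFlowBox.vert_iff _ (hsrc z hz)).1 (hvert z hz)
    exact this.imp And.right And.right
  have h0 : (0 : ℝ) ∉ (fun z => b'.z (b.pt (b.qB x, z))) '' uIcc (b.z m) (b.z n) := fun h => by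
    rcases hT 0 h with h | h <;> norm_num at h
  have hsub := ordConnected_iff_uIcc_subset.1 hpre hzm hzn
  have h0' : ¬ (0 ∈ uIcc (b'.z m) (b'.z n)) := fun h => h0 (hsub h)
  rw [mem_uIcc] at h0'
  push Not at h0'
  rw [abs_le]
  rcases b'.core_cases hm' hc with h2 | h2 <;> rcases hT _ hzn with h3 | h3
  · constructor <;> linarith [h3.1, h3.2]
  · exact absurd (h0'.2 (by linarith [h3.2])) (by linarith)
  · exact absurd (h0'.1 (by linarith)) (by linarith [h3.1])
  · constructor <;> linarith [h3.1, h3.2]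

/-- The strict version holds because the interior of the vertical boundary is described by open
slits in every box. -/
lemma Box.slit_lt {b b' : F.Box} {m n : N} (hm : m ∈ b.src) (hm' : m ∈ b'.src) (hc : m ∈ F.core)
    (hn : F.π n = F.π m) (h : |b.z n - b.z m| < 1 / 2) : |b'.z n - b'.z m| < 1 / 2 := by
  have h1 := Box.slit_le hm hm' hc hn h.le
  have hnb := b.mem_src hm hn
  have hnb' := b'.mem_src hm' hn
  have hv : n ∈ F.vertInterior := by
    rw [mem_vertInterior_iff b.isFlowBox hnb]
    rw [abs_lt] at h
    rcases b.core_cases hm hc with h2 | h2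
    · left
      exact ⟨by rw [← h2.1, b.q_eq hm hn.symm]; rfl, by change 1 < b.z n; linarith,
        by change b.z n < 2; linarith⟩
    · right
      exact ⟨by rw [← h2.1, b.q_eq hm hn.symm]; rfl, by change -2 < b.z n; linarith,
        by change b.z n < -1; linarith⟩
  rw [mem_vertInterior_iff b'.isFlowBox hnb'] at hv
  rw [abs_le] at h1
  rw [abs_lt]
  rcases b'.core_cases hm' hc with h2 | h2 <;> rcases hv with ⟨-, h3, h4⟩ | ⟨-, h3, h4⟩ <;>
    change _ < b'.z n at h3 <;> change b'.z n < _ at h4 <;> constructor <;> linarith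

end FibredNbhd
end BranchedSurface

/-! ### Averaging the placements with a partition of unity -/

namespace BranchedSurface
namespace FibredNbhd

variable {N B : Type*} [TopologicalSpace N] [TopologicalSpace B] {F : FibredNbhd N B}
variable [CWComplex (univ : Set B)]

/-- Leaves with a placement in each chart and a partition of unity. -/
structure FramedLeaves (F : FibredNbhd N B) (ι G : Type*) [Fintype ι] extends F.Leaves ι G where
  ρ : ι → B → ℝ
  continuous_ρ : ∀ i, Continuous (ρ i)
  ρ_nonneg : ∀ i x, 0 ≤ ρ i x
  sum_ρ : ∀ x, ∑ i, ρ i x = 1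
  ρ_eq : ∀ i, ∀ x, x ∉ (C i).O → ∀ᶠ y in 𝓝 x, ρ i y = 0
  mid : ι → G → ℝ
  half : ι → G → ℝ
  half_pos : ∀ i, ∀ p ∈ L (C i).x, 0 < half i p
  mid_le : ∀ i, ∀ p ∈ L (C i).x, |mid i p - β i p| + half i p ≤ bandRadius (β i p)
  mid_lt : ∀ i, ∀ p ∈ L (C i).x, ∀ p' ∈ L (C i).x, lt i p p' →
    mid i p + half i p ≤ mid i p' - half i p'
  mid_eq : ∀ i, ∀ p ∈ L (C i).x, (∀ p' ∈ L (C i).x, β i p' = β i p → p' = p) →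
    mid i p = β i p ∧ half i p = bandRadius (β i p)

variable [T2Space B] [CompactSpace N] [T2Space N]

lemma Leaves.exists_framed {ι G : Type*} [Fintype ι] (Λ : F.Leaves ι G) :
    Nonempty (F.FramedLeaves ι G) := by
  have := F.compactSpace_base
  obtain ⟨f, hf⟩ := PartitionOfUnity.exists_isSubordinate_of_locallyFinite isClosed_univ
    (fun i => (Λ.C i).O) (fun i => (Λ.C i).isOpen_O) (locallyFinite_of_finite _)
    (fun x _ => mem_iUnion.2 (Λ.cover x))
  choose mid half h1 h2 h3 h4 using fun i => exists_placement (Λ.countable i) (Λ.lt i)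
    (Λ.lt_irrefl i) (Λ.lt_trans i) (Λ.β i) (Λ.β_mem i) (Λ.β_mono i)
  exact ⟨{ Λ with
    ρ := fun i => f i
    continuous_ρ := fun i => (f i).continuous
    ρ_nonneg := fun i x => f.nonneg i x
    sum_ρ := fun x => by
      rw [← finsum_eq_sum_of_fintype]; exact f.sum_eq_one (mem_univ x)
    ρ_eq := fun i x hx => notMem_tsupport_iff_eventuallyEq.1 fun h => hx (hf i h)
    mid := mid
    half := half
    half_pos := h1
    mid_le := h2
    mid_lt := h3
    mid_eq := h4 }⟩

namespace FramedLeaves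

variable {ι G : Type*} [Fintype ι] (Λ : F.FramedLeaves ι G)

lemma ρ_zero {j : ι} {x : B} (hx : x ∉ (Λ.C j).O) : Λ.ρ j x = 0 := (Λ.ρ_eq j x hx).self_of_nhds

/-- The averaged signed distance of `m` to the middles of the germs `t`, in the orientation of the
chart `i`. -/
noncomputable def E (i : ι) (m : N) (t : ι → G) : ℝ :=
  ∑ j, Λ.ρ j (F.π m) *
    ((Λ.C i).b.sgn (Λ.C j).b (F.π m) * ((Λ.C j).b.z m - Λ.mid j (t j)))

/-- The averaged half width of the germs `t`. -/
noncomputable def η (x : B) (t : ι → G) : ℝ := ∑ j, Λ.ρ j x * Λ.half j (t j)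

/-- The images of a germ in all charts. -/
def tr (s : G) : ι → G := fun j => Λ.τ j s

lemma continuous_η (t : ι → G) : Continuous fun x => Λ.η x t :=
  continuous_finsetSum _ fun j _ => (Λ.continuous_ρ j).mul continuous_const

/-- The tuple `t` is held fixed. In the charts containing `F.π m` the signs are locally constant,
and the other charts have weight zero near `F.π m`. -/
lemma continuousAt_E {i : ι} {m : N} (hm : F.π m ∈ (Λ.C i).O) (t : ι → G) :
    ContinuousAt (fun n => Λ.E i n t) m := by
  refine tendsto_finsetSum _ fun j _ => ?_
  have hπ := F.continuous_π.continuousAt (x := m)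
  by_cases hj : F.π m ∈ (Λ.C j).O
  · refine ((Λ.continuous_ρ j).continuousAt.comp hπ).mul (ContinuousAt.mul ?_ ?_)
    · exact continuousAt_const.congr
        ((hπ.eventually (Box.sgn_eventuallyEq hm.1 hj.1)).mono fun _ h => h.symm)
    · exact ((Λ.C j).b.continuousOn_z.continuousAt
        ((Λ.C j).b.isOpen_src.mem_nhds ((Λ.C j).b.mem_base_iff.1 hj.1))).sub continuousAt_const
  · refine (continuousAt_const (y := (0 : ℝ))).congr ?_ |>.tendsto
    filter_upwards [hπ.eventually (Λ.ρ_eq j _ hj)] with n hn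
    rw [hn, zero_mul]

lemma E_congr (i : ι) {m : N} {t t' : ι → G} (h : ∀ j, Λ.ρ j (F.π m) ≠ 0 → t j = t' j) :
    Λ.E i m t = Λ.E i m t' := by
  refine Finset.sum_congr rfl fun j _ => ?_
  by_cases hj : Λ.ρ j (F.π m) = 0
  · rw [hj, zero_mul, zero_mul]
  · rw [h j hj]

lemma η_congr {x : B} {t t' : ι → G} (h : ∀ j, Λ.ρ j x ≠ 0 → t j = t' j) :
    Λ.η x t = Λ.η x t' := by
  refine Finset.sum_congr rfl fun j _ => ?_
  by_cases hj : Λ.ρ j x = 0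
  · rw [hj, zero_mul, zero_mul]
  · rw [h j hj]

/-- The signs satisfy a cocycle relation, so a change of reference chart multiplies every term by
one common sign. Consequently `|E|` and the zero set of `E` do not depend on the chart. -/
lemma E_chart {i k : ι} {m : N} (hi : F.π m ∈ (Λ.C i).O) (hk : F.π m ∈ (Λ.C k).O) (t : ι → G) :
    Λ.E i m t = (Λ.C i).b.sgn (Λ.C k).b (F.π m) * Λ.E k m t := by
  rw [E, E, Finset.mul_sum]
  refine Finset.sum_congr rfl fun j _ => ?_
  by_cases hj : F.π m ∈ (Λ.C j).O
  · rw [Box.sgn_mul (b' := (Λ.C k).b) hi.1 hk.1 hj.1]; ring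
  · rw [Λ.ρ_zero hj]; ring

lemma abs_E {i k : ι} {m : N} (hi : F.π m ∈ (Λ.C i).O) (hk : F.π m ∈ (Λ.C k).O) (t : ι → G) :
    |Λ.E i m t| = |Λ.E k m t| := by
  rw [Λ.E_chart hi hk, abs_mul]
  rcases (Λ.C i).b.sgn_cases (Λ.C k).b (F.π m) with h | h <;> rw [h] <;> simp

lemma exists_ρ_pos (x : B) : ∃ j, x ∈ (Λ.C j).O ∧ 0 < Λ.ρ j x := by
  by_contra h
  push Not at h
  have := Λ.sum_ρ x
  rw [Finset.sum_eq_zero fun j _ => ?_] at this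
  · norm_num at this
  · by_cases hj : x ∈ (Λ.C j).O
    · exact le_antisymm (h j hj) (Λ.ρ_nonneg j x)
    · exact Λ.ρ_zero hj

/-- Weighted sums over the charts at `x` are strictly monotone. -/
lemma sum_lt_sum {x : B} {f g : ι → ℝ} (h : ∀ j, x ∈ (Λ.C j).O → f j < g j) :
    ∑ j, Λ.ρ j x * f j < ∑ j, Λ.ρ j x * g j := by
  obtain ⟨k, hk, hk'⟩ := Λ.exists_ρ_pos x
  refine Finset.sum_lt_sum (fun j _ => ?_) ⟨k, Finset.mem_univ _, mul_lt_mul_of_pos_left (h k hk) hk'⟩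
  by_cases hj : x ∈ (Λ.C j).O
  · exact mul_le_mul_of_nonneg_left (h j hj).le (Λ.ρ_nonneg j x)
  · rw [Λ.ρ_zero hj, zero_mul, zero_mul]

lemma sum_le_sum {x : B} {f g : ι → ℝ} (h : ∀ j, x ∈ (Λ.C j).O → f j ≤ g j) :
    ∑ j, Λ.ρ j x * f j ≤ ∑ j, Λ.ρ j x * g j := by
  refine Finset.sum_le_sum (fun j _ => ?_)
  by_cases hj : x ∈ (Λ.C j).O
  · exact mul_le_mul_of_nonneg_left (h j hj) (Λ.ρ_nonneg j x)
  · rw [Λ.ρ_zero hj, zero_mul, zero_mul]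

lemma E_lt {i : ι} {m n : N} (hi : F.π m ∈ (Λ.C i).O) (hn : F.π n = F.π m)
    (h : (Λ.C i).b.z m < (Λ.C i).b.z n) (t : ι → G) : Λ.E i m t < Λ.E i n t := by
  rw [E, E, hn]
  refine Λ.sum_lt_sum fun j hj => ?_
  rw [mul_sub, mul_sub]
  exact sub_lt_sub_right (Box.sgn_mul_lt hi.1 hj.1 hn h) _

lemma E_lt_iff {i : ι} {m n : N} (hi : F.π m ∈ (Λ.C i).O) (hn : F.π n = F.π m) (t : ι → G) :
    Λ.E i m t < Λ.E i n t ↔ (Λ.C i).b.z m < (Λ.C i).b.z n := by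
  refine ⟨fun h => ?_, fun h => Λ.E_lt hi hn h t⟩
  by_contra h'
  rcases (not_lt.1 h').lt_or_eq with h' | h'
  · exact lt_asymm h (Λ.E_lt (hn ▸ hi) hn.symm h' t)
  · have hms := (Λ.C i).b.mem_base_iff.1 hi.1
    have := (Λ.C i).b.injOn hms ((Λ.C i).b.mem_src hms hn) ((Λ.C i).b.q_eq hms hn.symm) h'.symm
    rw [this] at h
    exact lt_irrefl _ h

lemma E_inj {i : ι} {m n : N} (hi : F.π m ∈ (Λ.C i).O) (hn : F.π n = F.π m) {t : ι → G}
    (h : Λ.E i m t = Λ.E i n t) : m = n := by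
  have hms := (Λ.C i).b.mem_base_iff.1 hi.1
  refine (Λ.C i).b.injOn hms ((Λ.C i).b.mem_src hms hn) ((Λ.C i).b.q_eq hms hn.symm) ?_
  rcases lt_trichotomy ((Λ.C i).b.z m) ((Λ.C i).b.z n) with h' | h' | h'
  · exact ((Λ.E_lt hi hn h' t).ne h).elim
  · exact h'
  · exact ((Λ.E_lt (hn ▸ hi) hn.symm h' t).ne h.symm).elim

lemma τ_mem {j : ι} {x : B} (hx : x ∈ (Λ.C j).O) {s : G} (hs : s ∈ Λ.L x) :
    Λ.τ j s ∈ Λ.L (Λ.C j).x := ((Λ.τ_bij j x hx).mapsTo hs).1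

lemma β_mem_J {j : ι} {x : B} (hx : x ∈ (Λ.C j).O) {s : G} (hs : s ∈ Λ.L x) :
    Λ.β j (Λ.τ j s) ∈ (Λ.C j).b.J x := ((Λ.τ_bij j x hx).mapsTo hs).2

lemma η_pos {x : B} {s : G} (hs : s ∈ Λ.L x) : 0 < Λ.η x (Λ.tr s) := by
  have := Λ.sum_lt_sum (x := x) (f := fun _ => 0) (g := fun j => Λ.half j (Λ.tr s j))
    fun j hj => Λ.half_pos j _ (Λ.τ_mem hj hs)
  rw [η]
  simpa using this

/-- In each chart the intervals of `s` and `s'` are disjoint and in the order of the leaf, up to an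
orientation which `sgn` corrects. The inequality is linear in the chart data, so it survives
averaging. -/
lemma E_sep {i : ι} {m : N} (hi : F.π m ∈ (Λ.C i).O) {s s' : G} (hs : s ∈ Λ.L (F.π m))
    (hs' : s' ∈ Λ.L (F.π m)) (h : Λ.lt i (Λ.τ i s) (Λ.τ i s')) :
    Λ.E i m (Λ.tr s') + Λ.η (F.π m) (Λ.tr s') ≤ Λ.E i m (Λ.tr s) - Λ.η (F.π m) (Λ.tr s) := by
  simp only [E, η, ← Finset.sum_add_distrib, ← Finset.sum_sub_distrib, ← mul_add, ← mul_sub]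
  refine Λ.sum_le_sum fun j hj => ?_
  unfold Box.sgn
  split_ifs with hS
  · have := Λ.mid_lt j _ (Λ.τ_mem hj hs) _ (Λ.τ_mem hj hs')
      (Λ.τ_same i j _ hi hj hS s hs s' hs' h)
    simp only [tr]
    linarith
  · have := Λ.mid_lt j _ (Λ.τ_mem hj hs') _ (Λ.τ_mem hj hs)
      (Λ.τ_opp i j _ hi hj ((Box.same_or_opp hi.1 hj.1).resolve_left hS) s hs s' hs' h)
    simp only [tr]
    linarith

lemma eq_of_not_lt {i : ι} {x : B} (hi : x ∈ (Λ.C i).O) {s s' : G} (hs : s ∈ Λ.L x)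
    (hs' : s' ∈ Λ.L x) (h : ¬ Λ.lt i (Λ.τ i s) (Λ.τ i s')) (h' : ¬ Λ.lt i (Λ.τ i s') (Λ.τ i s)) :
    s = s' := by
  refine (Λ.τ_bij i x hi).injOn hs hs' ?_
  by_contra hne
  exact (Λ.lt_total i _ (Λ.τ_mem hi hs) _ (Λ.τ_mem hi hs') hne).elim h h'

/-- The intervals of different germs are disjoint. -/
lemma unique {i : ι} {m : N} (hi : F.π m ∈ (Λ.C i).O) {s s' : G} (hs : s ∈ Λ.L (F.π m))
    (hs' : s' ∈ Λ.L (F.π m)) (h : |Λ.E i m (Λ.tr s)| < Λ.η (F.π m) (Λ.tr s))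
    (h' : |Λ.E i m (Λ.tr s')| < Λ.η (F.π m) (Λ.tr s')) : s = s' := by
  rw [abs_lt] at h h'
  refine Λ.eq_of_not_lt hi hs hs' (fun hlt => ?_) fun hlt => ?_
  · linarith [Λ.E_sep hi hs hs' hlt]
  · linarith [Λ.E_sep hi hs' hs hlt]

lemma mid_mem_J {j : ι} {x : B} (hx : x ∈ (Λ.C j).O) {s : G} (hs : s ∈ Λ.L x) {θ : ℝ}
    (hθ : |θ| ≤ 1) : Λ.mid j (Λ.τ j s) + θ * Λ.half j (Λ.τ j s) ∈ (Λ.C j).b.J x := by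
  refine (Λ.C j).b.J_of_bands (Λ.β_mem j _) (Λ.β_mem_J hx hs) ?_
  have h1 := Λ.mid_le j _ (Λ.τ_mem hx hs)
  have h2 := Λ.half_pos j _ (Λ.τ_mem hx hs)
  calc _ = |(Λ.mid j (Λ.τ j s) - Λ.β j (Λ.τ j s)) + θ * Λ.half j (Λ.τ j s)| := by congr 1; ring
    _ ≤ _ := abs_add_le _ _
    _ ≤ |Λ.mid j (Λ.τ j s) - Λ.β j (Λ.τ j s)| + 1 * Λ.half j (Λ.τ j s) := by
        rw [abs_mul, abs_of_pos h2]
        gcongr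
    _ ≤ _ := by linarith

/-- Every position within the width of a germ is taken. -/
lemma exists_E_eq {i : ι} {x : B} (hi : x ∈ (Λ.C i).O) {s : G} (hs : s ∈ Λ.L x) {θ : ℝ}
    (hθ : |θ| ≤ 1) : ∃ m, F.π m = x ∧ Λ.E i m (Λ.tr s) = θ * Λ.η x (Λ.tr s) := by
  classical
  have : Nonempty N := ⟨(F.surjective_π x).choose⟩
  have hpre : IsPreconnected (F.π ⁻¹' {x}) := by
    rw [(Λ.C i).b.fibre_eq hi.1]
    exact (Λ.C i).b.isPreconnected_image_pt ((Λ.C i).b.ordConnected_J x) subset_rfl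
  have hcont : ContinuousOn (fun m => Λ.E i m (Λ.tr s)) (F.π ⁻¹' {x}) := fun m hm =>
    (Λ.continuousAt_E (by rw [show F.π m = x from hm]; exact hi) _).continuousWithinAt
  -- Here `f j` will be the point in relative position `θ` according to chart `j` alone. The
  -- averaged position takes the value `θ` between the lowest and the highest of these points.
  have hpt : ∀ j, ∃ m, x ∈ (Λ.C j).O → F.π m = x ∧ (Λ.C i).b.sgn (Λ.C j).b x *
      ((Λ.C j).b.z m - Λ.mid j (Λ.τ j s)) = θ * Λ.half j (Λ.τ j s) := by
    intro j
    by_cases hj : x ∈ (Λ.C j).O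
    · obtain ⟨m, hm, hmx, hmz⟩ := Λ.mid_mem_J hj hs
        (θ := (Λ.C i).b.sgn (Λ.C j).b x * θ) (by
          rw [abs_mul]
          rcases (Λ.C i).b.sgn_cases (Λ.C j).b x with h | h <;> rw [h] <;> simpa using hθ)
      refine ⟨m, fun _ => ⟨hmx, ?_⟩⟩
      rw [hmz]
      rcases (Λ.C i).b.sgn_cases (Λ.C j).b x with h | h <;> rw [h] <;> ring
    · exact ⟨Classical.arbitrary N, fun h => (hj h).elim⟩
  choose f hf using hpt
  have hfin : (Finset.univ.filter fun j => x ∈ (Λ.C j).O).Nonempty :=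
    ⟨i, by simpa using hi⟩
  obtain ⟨k, hk, hkmin⟩ := Finset.exists_min_image _ (fun j => (Λ.C i).b.z (f j)) hfin
  obtain ⟨k', hk', hkmax⟩ := Finset.exists_max_image _ (fun j => (Λ.C i).b.z (f j)) hfin
  simp only [Finset.mem_filter, Finset.mem_univ, true_and] at hk hk' hkmin hkmax
  have hmono : ∀ j m n, x ∈ (Λ.C j).O → F.π m = x → F.π n = x → (Λ.C i).b.z m ≤ (Λ.C i).b.z n →
      (Λ.C i).b.sgn (Λ.C j).b x * (Λ.C j).b.z m ≤ (Λ.C i).b.sgn (Λ.C j).b x * (Λ.C j).b.z n := by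
    intro j m n hj hm hn h
    rcases h.lt_or_eq with h | h
    · have := Box.sgn_mul_lt (b := (Λ.C i).b) (b' := (Λ.C j).b) (m := m) (n := n)
        (by rw [hm]; exact hi.1) (by rw [hm]; exact hj.1) (hn.trans hm.symm) h
      rw [hm] at this
      exact this.le
    · have hms : m ∈ (Λ.C i).b.src := by rw [← (Λ.C i).b.mem_base_iff, hm]; exact hi.1
      have hns : n ∈ (Λ.C i).b.src := by rw [← (Λ.C i).b.mem_base_iff, hn]; exact hi.1
      rw [(Λ.C i).b.injOn hms hns ((Λ.C i).b.q_eq hms (hm.trans hn.symm)) h]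
  have hE : ∀ m, F.π m = x → Λ.E i m (Λ.tr s) = ∑ j, Λ.ρ j x *
      ((Λ.C i).b.sgn (Λ.C j).b x * ((Λ.C j).b.z m - Λ.mid j (Λ.τ j s))) := by
    rintro m rfl; rfl
  have hη : θ * Λ.η x (Λ.tr s) = ∑ j, Λ.ρ j x * (θ * Λ.half j (Λ.τ j s)) := by
    rw [η, Finset.mul_sum]
    exact Finset.sum_congr rfl fun j _ => by simp only [tr]; ring
  have hlow : Λ.E i (f k) (Λ.tr s) ≤ θ * Λ.η x (Λ.tr s) := by
    rw [hE _ (hf k hk).1, hη]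
    refine Λ.sum_le_sum fun j hj => ?_
    rw [← (hf j hj).2, mul_sub, mul_sub]
    exact sub_le_sub_right (hmono j _ _ hj (hf k hk).1 (hf j hj).1 (hkmin j hj)) _
  have hupp : θ * Λ.η x (Λ.tr s) ≤ Λ.E i (f k') (Λ.tr s) := by
    rw [hE _ (hf k' hk').1, hη]
    refine Λ.sum_le_sum fun j hj => ?_
    rw [← (hf j hj).2, mul_sub, mul_sub]
    exact sub_le_sub_right (hmono j _ _ hj (hf j hj).1 (hf k' hk').1 (hkmax j hj)) _
  obtain ⟨m, hm, hmE⟩ := hpre.intermediate_value (hf k hk).1 (hf k' hk').1 hcont ⟨hlow, hupp⟩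
  exact ⟨m, hm, hmE⟩

end FramedLeaves
end FibredNbhd
end BranchedSurface

namespace BranchedSurface
namespace FibredNbhd

variable {N B : Type*} [TopologicalSpace N] [TopologicalSpace B] {F : FibredNbhd N B}
variable [CWComplex (univ : Set B)] [T2Space B] [CompactSpace N] [T2Space N]

namespace FramedLeaves

variable {ι G : Type*} [Fintype ι] (Λ : F.FramedLeaves ι G)

/-! ### Germs of the pared locus -/

lemma core_mid {j : ι} {m : N} (hm : m ∈ F.core) (hj : F.π m ∈ (Λ.C j).O) :
    Λ.mid j (Λ.τ j (Λ.κ m)) = (Λ.C j).b.z m ∧ Λ.half j (Λ.τ j (Λ.κ m)) = 1 / 2 := by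
  have h1 := Λ.β_κ j m hm hj
  have h2 := Λ.mid_eq j _ (Λ.τ_mem hj (Λ.κ_mem m hm)) fun p hp h =>
    Λ.κ_unique j m hm hj p hp (h.trans h1)
  rw [h1] at h2
  refine ⟨h2.1, h2.2.trans ?_⟩
  rcases (Λ.C j).b.core_cases ((Λ.C j).b.mem_base_iff.1 hj.1) hm with h | h <;> rw [h.2] <;>
    norm_num [bandRadius]

lemma η_core {m : N} (hm : m ∈ F.core) : Λ.η (F.π m) (Λ.tr (Λ.κ m)) = 1 / 2 := by
  have h : ∑ j, Λ.ρ j (F.π m) * (1 / 2 : ℝ) = 1 / 2 := by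
    rw [← Finset.sum_mul, Λ.sum_ρ, one_mul]
  rw [← h]
  exact le_antisymm (Λ.sum_le_sum fun j hj => (Λ.core_mid hm hj).2.le)
    (Λ.sum_le_sum fun j hj => (Λ.core_mid hm hj).2.ge)

/-- For a core germ the middle in each chart is the height of `m`. After orientation all charts
agree on the side of `m` on which `n` lies, so the terms have a common sign and the absolute value
passes into the sum. -/
lemma abs_E_core {i : ι} {m n : N} (hm : m ∈ F.core) (hi : F.π m ∈ (Λ.C i).O)
    (hn : F.π n = F.π m) : |Λ.E i n (Λ.tr (Λ.κ m))| =
      ∑ j, Λ.ρ j (F.π m) * |(Λ.C j).b.z n - (Λ.C j).b.z m| := by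
  have h1 : Λ.E i n (Λ.tr (Λ.κ m)) = ∑ j, Λ.ρ j (F.π m) *
      ((Λ.C i).b.sgn (Λ.C j).b (F.π m) * ((Λ.C j).b.z n - (Λ.C j).b.z m)) := by
    rw [E, hn]
    exact le_antisymm (Λ.sum_le_sum fun j hj => by rw [tr, (Λ.core_mid hm hj).1])
      (Λ.sum_le_sum fun j hj => by rw [tr, (Λ.core_mid hm hj).1])
  have hnn : 0 ≤ ∑ j, Λ.ρ j (F.π m) * |(Λ.C j).b.z n - (Λ.C j).b.z m| :=
    Finset.sum_nonneg fun j _ => mul_nonneg (Λ.ρ_nonneg j _) (abs_nonneg _)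
  have habs : ∀ (σ t : ℝ), (σ = 1 ∨ σ = -1) → 0 ≤ σ * t → σ * t = |t| := by
    rintro σ t h h'
    rw [← abs_of_nonneg h', abs_mul]
    rcases h with rfl | rfl <;> simp
  rcases lt_trichotomy ((Λ.C i).b.z m) ((Λ.C i).b.z n) with h | h | h
  · have h2 : Λ.E i n (Λ.tr (Λ.κ m)) = ∑ j, Λ.ρ j (F.π m) * |(Λ.C j).b.z n - (Λ.C j).b.z m| := by
      have h3 : ∀ j, F.π m ∈ (Λ.C j).O → (Λ.C i).b.sgn (Λ.C j).b (F.π m) *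
          ((Λ.C j).b.z n - (Λ.C j).b.z m) = |(Λ.C j).b.z n - (Λ.C j).b.z m| := fun j hj =>
        habs _ _ (Box.sgn_cases _ _ _) (by linarith [Box.sgn_mul_lt hi.1 hj.1 hn h])
      rw [h1]
      exact le_antisymm (Λ.sum_le_sum fun j hj => (h3 j hj).le)
        (Λ.sum_le_sum fun j hj => (h3 j hj).ge)
    rw [h2, abs_of_nonneg hnn]
  · have hms := (Λ.C i).b.mem_base_iff.1 hi.1
    have := (Λ.C i).b.injOn hms ((Λ.C i).b.mem_src hms hn) ((Λ.C i).b.q_eq hms hn.symm) h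
    subst this
    rw [h1]
    simp
  · have h2 : -Λ.E i n (Λ.tr (Λ.κ m)) = ∑ j, Λ.ρ j (F.π m) * |(Λ.C j).b.z n - (Λ.C j).b.z m| := by
      have h3 : ∀ j, F.π m ∈ (Λ.C j).O → -((Λ.C i).b.sgn (Λ.C j).b (F.π m) *
          ((Λ.C j).b.z n - (Λ.C j).b.z m)) = |(Λ.C j).b.z n - (Λ.C j).b.z m| := fun j hj => by
        have h4 := Box.sgn_mul_lt (b := (Λ.C i).b) (b' := (Λ.C j).b) (by rw [hn]; exact hi.1)
          (by rw [hn]; exact hj.1) hn.symm h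
        rw [hn] at h4
        rw [← mul_neg, neg_sub, abs_sub_comm]
        exact habs _ _ (Box.sgn_cases _ _ _) (by linarith)
      rw [h1, ← Finset.sum_neg_distrib]
      simp only [← mul_neg] at h3 ⊢
      exact le_antisymm (Λ.sum_le_sum fun j hj => (h3 j hj).le)
        (Λ.sum_le_sum fun j hj => (h3 j hj).ge)
    rw [← abs_neg, h2, abs_of_nonneg hnn]

lemma sum_ρ_half (x : B) : ∑ j, Λ.ρ j x * (1 / 2 : ℝ) = 1 / 2 := by
  rw [← Finset.sum_mul, Λ.sum_ρ, one_mul]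

/-- By `slit_lt` all charts agree on whether `n` is within the open slit of `m`, so the averaged
condition is equivalent to the condition in any one of them. -/
lemma core_lt_iff {i : ι} {m n : N} (hm : m ∈ F.core) (hi : F.π m ∈ (Λ.C i).O)
    (hn : F.π n = F.π m) : |Λ.E i n (Λ.tr (Λ.κ m))| < 1 / 2 ↔
      |(Λ.C i).b.z n - (Λ.C i).b.z m| < 1 / 2 := by
  rw [Λ.abs_E_core hm hi hn, ← Λ.sum_ρ_half (F.π m)]
  have hs : ∀ {j}, F.π m ∈ (Λ.C j).O → m ∈ (Λ.C j).b.src := fun hj =>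
    (Λ.C _).b.mem_base_iff.1 hj.1
  constructor
  · intro h
    by_contra h'
    refine not_le.2 h (Λ.sum_le_sum fun j hj => ?_)
    by_contra h''
    exact h' (by rw [Λ.sum_ρ_half]; exact Box.slit_lt (hs hj) (hs hi) hm hn (not_le.1 h''))
  · intro h
    rw [Λ.sum_ρ_half] at h
    exact Λ.sum_lt_sum fun j hj => Box.slit_lt (hs hi) (hs hj) hm hn h

lemma core_le {i : ι} {m n : N} (hm : m ∈ F.core) (hi : F.π m ∈ (Λ.C i).O)
    (hn : F.π n = F.π m) (h : |(Λ.C i).b.z n - (Λ.C i).b.z m| ≤ 1 / 2) :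
    |Λ.E i n (Λ.tr (Λ.κ m))| ≤ 1 / 2 := by
  rw [Λ.abs_E_core hm hi hn, ← Λ.sum_ρ_half (F.π m)]
  exact Λ.sum_le_sum fun j hj => Box.slit_le ((Λ.C i).b.mem_base_iff.1 hi.1)
    ((Λ.C j).b.mem_base_iff.1 hj.1) hm hn h

lemma E_core_self {i : ι} {m : N} (hm : m ∈ F.core) (hi : F.π m ∈ (Λ.C i).O) :
    Λ.E i m (Λ.tr (Λ.κ m)) = 0 := by
  rw [← abs_eq_zero, Λ.abs_E_core hm hi rfl]
  simp

/-- Relative to a point of the pared locus on the same fibre, the interval of a germ is on the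
same side as the germ. -/
lemma sides {i : ι} {m n : N} (hm : m ∈ F.core) (hi : F.π m ∈ (Λ.C i).O) (hn : F.π n = F.π m)
    {s : G} (hs : s ∈ Λ.L (F.π m)) (h : |Λ.E i n (Λ.tr s)| < Λ.η (F.π m) (Λ.tr s)) :
    (s = Λ.κ m ∧ |(Λ.C i).b.z n - (Λ.C i).b.z m| < 1 / 2) ∨
    ((Λ.C i).b.z m < Λ.β i (Λ.τ i s) ∧ (Λ.C i).b.z m + 1 / 2 < (Λ.C i).b.z n) ∨
    (Λ.β i (Λ.τ i s) < (Λ.C i).b.z m ∧ (Λ.C i).b.z n < (Λ.C i).b.z m - 1 / 2) := by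
  have hκ := Λ.κ_mem m hm
  have hηκ := Λ.η_core hm
  have hin : F.π n ∈ (Λ.C i).O := by rwa [hn]
  have hsn : s ∈ Λ.L (F.π n) := by rwa [hn]
  have hκn : Λ.κ m ∈ Λ.L (F.π n) := by rwa [hn]
  have hβ : s ≠ Λ.κ m → Λ.β i (Λ.τ i s) ≠ (Λ.C i).b.z m := fun hne h =>
    hne ((Λ.τ_bij i _ hi).injOn hs hκ (Λ.κ_unique i m hm hi _ (Λ.τ_mem hi hs) h))
  have habs := abs_lt.1 h
  have hle := mt (Λ.core_le hm hi hn)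
  by_cases h1 : Λ.lt i (Λ.τ i (Λ.κ m)) (Λ.τ i s)
  · have hne : s ≠ Λ.κ m := fun h => by rw [h] at h1; exact Λ.lt_irrefl _ _ h1
    right; left
    have h2 := Λ.E_sep hin hκn hsn h1
    rw [hn, hηκ] at h2
    have h3 : 1 / 2 < Λ.E i n (Λ.tr (Λ.κ m)) := by linarith
    have h4 : (Λ.C i).b.z m < (Λ.C i).b.z n := by
      rw [← Λ.E_lt_iff hi hn (Λ.tr (Λ.κ m)), Λ.E_core_self hm hi]; linarith
    have h5 := Λ.β_mono i _ _ h1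
    rw [Λ.β_κ i m hm hi] at h5
    refine ⟨h5.lt_of_ne (hβ hne).symm, ?_⟩
    have h6 := hle (not_le.2 (h3.trans_le (le_abs_self _)))
    rw [not_le, abs_of_pos (sub_pos.2 h4)] at h6
    linarith
  by_cases h1' : Λ.lt i (Λ.τ i s) (Λ.τ i (Λ.κ m))
  · have hne : s ≠ Λ.κ m := fun h => by rw [h] at h1'; exact Λ.lt_irrefl _ _ h1'
    right; right
    have h2 := Λ.E_sep hin hsn hκn h1'
    rw [hn, hηκ] at h2
    have h3 : 1 / 2 < -Λ.E i n (Λ.tr (Λ.κ m)) := by linarith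
    have h4 : (Λ.C i).b.z n < (Λ.C i).b.z m := by
      rw [← Λ.E_lt_iff hin hn.symm (Λ.tr (Λ.κ m)), Λ.E_core_self hm hi]; linarith
    have h5 := Λ.β_mono i _ _ h1'
    rw [Λ.β_κ i m hm hi] at h5
    refine ⟨h5.lt_of_ne (hβ hne), ?_⟩
    have h6 := hle (not_le.2 (h3.trans_le (neg_le_abs _)))
    rw [not_le, abs_of_neg (sub_neg.2 h4)] at h6
    linarith
  · left
    have := Λ.eq_of_not_lt hi hκ hs h1 h1'
    subst this
    rw [hηκ] at h
    exact ⟨rfl, (Λ.core_lt_iff hm hi hn).1 h⟩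

/-- Points in the interval of a germ only have nearby points over the domain of the sheet of
the germ. -/
lemma eventually_β_mem {i : ι} {n : N} (hi : F.π n ∈ (Λ.C i).O) {s : G} (hs : s ∈ Λ.L (F.π n))
    (h : |Λ.E i n (Λ.tr s)| < Λ.η (F.π n) (Λ.tr s)) :
    ∀ᶠ n' in 𝓝 n, Λ.β i (Λ.τ i s) ∈ (Λ.C i).b.J (F.π n') := by
  have : Nonempty N := ⟨n⟩
  set b := (Λ.C i).b with hb
  set β := Λ.β i (Λ.τ i s) with hβ
  have hβb : β ∈ bands := Λ.β_mem i _
  simp only [bands, mem_insert_iff, mem_singleton_iff] at hβb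
  have hβJ : β ∈ b.J (F.π n) := Λ.β_mem_J hi hs
  have hns : n ∈ b.src := b.mem_base_iff.1 hi.1
  have hq : ContinuousAt b.q n := b.continuousOn_q.continuousAt (b.isOpen_src.mem_nhds hns)
  have hz : ContinuousAt b.z n := b.continuousOn_z.continuousAt (b.isOpen_src.mem_nhds hns)
  have ev1 : ∀ {f : N → ℝ} (c : ℝ), ContinuousAt f n → ∀ᶠ n' in 𝓝 n, f n < c → f n' < c := by
    intro f c hf
    by_cases hc : f n < c
    · exact (hf.eventually_lt_const hc).mono fun _ h _ => h
    · exact Eventually.of_forall fun _ h => (hc h).elim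
  have ev2 : ∀ {f : N → ℝ} (c : ℝ), ContinuousAt f n → ∀ᶠ n' in 𝓝 n, c < f n → c < f n' := by
    intro f c hf
    by_cases hc : c < f n
    · exact (hf.eventually_const_lt hc).mono fun _ h _ => h
    · exact Eventually.of_forall fun _ h => (hc h).elim
  have hsub : ∀ᶠ n' in 𝓝 n, b.J (F.π n') ⊆ b.J (F.π n) :=
    (F.continuous_π.continuousAt.eventually (b.J_stable hi.1)).mono fun _ h => h.2.1
  -- A height can be lost near `n` only where a slit opens at whose edge `F.π n` lies. The core
  -- point in this slit then separates the fibre, and `sides` puts `n` in the slit itself or on the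
  -- same side as `β`, so the segment from `b.z n'` to `β` avoids the opened slit.
  have hcore : ∀ z₀ : ℝ, z₀ ∈ b.J (F.π n) → ((b.qB (F.π n), z₀) ∈ modelCore) →
      (|b.z n - z₀| < 1 / 2) ∨ (z₀ < β ∧ z₀ + 1 / 2 < b.z n) ∨ (β < z₀ ∧ b.z n < z₀ - 1 / 2) := by
    intro z₀ h1 h2
    have hr := b.rng_of_J h1
    have hm : b.pt (b.qB (F.π n), z₀) ∈ F.core := by
      rw [b.isFlowBox.core_iff _ (b.pt_mem hr), b.φ_pt hr]; exact h2
    have hπ := b.π_pt_of_J h1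
    have := Λ.sides (i := i) (n := n) hm (by rwa [hπ]) hπ.symm (by rwa [hπ]) (by rwa [hπ])
    rw [← hb, b.z_pt hr] at this
    exact this.imp_left And.right
  filter_upwards [b.isOpen_src.mem_nhds hns, hsub, ev1 0 (continuous_fst.continuousAt.comp hq),
    ev1 0 (continuous_snd.continuousAt.comp hq), ev1 1 hz, ev1 2 hz, ev1 (-1) hz, ev1 (-2) hz,
    ev2 1 hz, ev2 2 hz, ev2 (-1) hz, ev2 (-2) hz] with n' hn' hsub hq1 hq2 a1 a2 a3 a4 b1 b2 b3 b4
  have hzJ := b.z_mem_J hn'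
  refine b.J_of_same hzJ ⟨rfl, fun w hw => ?_⟩
  have hwJ : w ∈ b.J (F.π n) :=
    ordConnected_iff_uIcc_subset.1 (b.ordConnected_J _) (hsub hzJ) hβJ hw
  have hwm := (b.rng_of_J hwJ).1
  have hn'm := b.mem_modelN n'
  rw [BranchedSurface.mem_modelN] at hwm hn'm ⊢
  rw [b.qB_π hns] at hwm hcore
  rw [b.qB_π hn']
  simp only [mem_uIcc] at hw
  simp only [Function.comp_apply] at hq1 hq2
  refine ⟨hwm.1, fun ⟨h1, h2, h3⟩ => ?_, fun ⟨h1, h2, h3⟩ => ?_⟩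
  · have h4 : (b.q n).1 = 0 := by
      rcases lt_trichotomy (b.q n).1 0 with h4 | h4 | h4
      · exact (lt_asymm h1 (hq1 h4)).elim
      · exact h4
      · exact (hwm.2.1 ⟨h4, h2, h3⟩).elim
    have h5 : (3 / 2 : ℝ) ∈ b.J (F.π n) := by
      have := (b.band_mem_J_iff hwm.1).2 hwJ
      rwa [band, if_neg (not_le.2 h3), if_pos h2] at this
    rcases hcore _ h5 (Or.inl ⟨h4, rfl⟩) with h6 | ⟨h6, h7⟩ | ⟨h6, h7⟩
    · rw [abs_lt] at h6
      exact hn'm.2.1 ⟨h1, b1 (by linarith), a2 (by linarith)⟩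
    · have h8 := b2 (by linarith)
      have h9 : 2 ≤ β := by rcases hβb with h | h | h | h | h <;> rw [h] at h6 ⊢ <;> linarith
      rcases hw with hw | hw <;> linarith
    · have h8 := a1 (by linarith)
      have h9 : β ≤ 1 := by rcases hβb with h | h | h | h | h <;> rw [h] at h6 ⊢ <;> linarith
      rcases hw with hw | hw <;> linarith
  · have h4 : (b.q n).2 = 0 := by
      rcases lt_trichotomy (b.q n).2 0 with h4 | h4 | h4
      · exact (lt_asymm h1 (hq2 h4)).elim
      · exact h4
      · exact (hwm.2.2 ⟨h4, h2, h3⟩).elim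
    have h5 : (-3 / 2 : ℝ) ∈ b.J (F.π n) := by
      have := (b.band_mem_J_iff hwm.1).2 hwJ
      rwa [band, if_neg (by linarith), if_neg (by linarith), if_neg (by linarith), if_pos h2]
        at this
    rcases hcore _ h5 (Or.inr ⟨h4, rfl⟩) with h6 | ⟨h6, h7⟩ | ⟨h6, h7⟩
    · rw [abs_lt] at h6
      exact hn'm.2.2 ⟨h1, b4 (by linarith), a3 (by linarith)⟩
    · have h8 := b3 (by linarith)
      have h9 : -1 ≤ β := by rcases hβb with h | h | h | h | h <;> rw [h] at h6 ⊢ <;> linarith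
      rcases hw with hw | hw <;> linarith
    · have h8 := a4 (by linarith)
      have h9 : β ≤ -2 := by rcases hβb with h | h | h | h | h <;> rw [h] at h6 ⊢ <;> linarith
      rcases hw with hw | hw <;> linarith

/-- Transition maps are locally constant along sheets, and charts not containing `x` have weight
zero nearby. So germs on one sheet have the same middles and widths in all charts that count. -/
lemma eventually_congr {i : ι} {x : B} (hi : x ∈ (Λ.C i).O) {s : G} (hs : s ∈ Λ.L x) :
    ∀ᶠ y in 𝓝 x, ∀ s' ∈ Λ.L y, Λ.τ i s' = Λ.τ i s →
      (∀ n, F.π n = y → Λ.E i n (Λ.tr s') = Λ.E i n (Λ.tr s)) ∧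
        Λ.η y (Λ.tr s') = Λ.η y (Λ.tr s) := by
  have h : ∀ᶠ y in 𝓝 x, ∀ j, Λ.ρ j y ≠ 0 → ∀ s' ∈ Λ.L y, Λ.τ i s' = Λ.τ i s →
      Λ.τ j s' = Λ.τ j s := by
    rw [eventually_all]
    intro j
    by_cases hj : x ∈ (Λ.C j).O
    · filter_upwards [Λ.τ_loc i j x hi hj] with y hy _ s' hs' h
      exact (hy s hs s' hs' h.symm).symm
    · filter_upwards [Λ.ρ_eq j x hj] with y hy h
      exact (h hy).elim
  filter_upwards [h] with y hy s' hs' hss'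
  refine ⟨?_, Λ.η_congr fun j hj => hy j hj s' hs' hss'⟩
  rintro n rfl
  exact Λ.E_congr i fun j hj => hy j hj s' hs' hss'

/-- The intervals of the germs of a sheet form an open set. -/
lemma eventually_mem {i : ι} {n : N} (hi : F.π n ∈ (Λ.C i).O) {s : G} (hs : s ∈ Λ.L (F.π n))
    (h : |Λ.E i n (Λ.tr s)| < Λ.η (F.π n) (Λ.tr s)) :
    ∀ᶠ n' in 𝓝 n, F.π n' ∈ (Λ.C i).O ∧ ∃ s' ∈ Λ.L (F.π n'), Λ.τ i s' = Λ.τ i s ∧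
      |Λ.E i n' (Λ.tr s')| < Λ.η (F.π n') (Λ.tr s') := by
  have hπ := F.continuous_π.continuousAt (x := n)
  have h1 : ∀ᶠ n' in 𝓝 n, |Λ.E i n' (Λ.tr s)| < Λ.η (F.π n') (Λ.tr s) :=
    (Λ.continuousAt_E hi (Λ.tr s)).abs.eventually_lt
      ((Λ.continuous_η (Λ.tr s)).continuousAt.comp hπ) h
  filter_upwards [h1, hπ.eventually (Λ.eventually_congr hi hs), Λ.eventually_β_mem hi hs h,
    hπ.eventually ((Λ.C i).isOpen_O.mem_nhds hi)] with n' h1 h2 h3 h4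
  obtain ⟨s', hs', hss'⟩ := (Λ.τ_bij i _ h4).surjOn ⟨Λ.τ_mem hi hs, h3⟩
  obtain ⟨h5, h6⟩ := h2 s' hs' hss'
  exact ⟨h4, s', hs', hss', by rwa [h5 n' rfl, h6]⟩

/-! ### Positions -/

/-- The point `m` is in relative position `θ` in the interval of the germ `p` of the chart `i`. -/
def IsPos (i : ι) (θ : ℝ) (p : G) (m : N) : Prop :=
  F.π m ∈ (Λ.C i).O ∧ ∃ s ∈ Λ.L (F.π m), Λ.τ i s = p ∧
    Λ.E i m (Λ.tr s) = θ * Λ.η (F.π m) (Λ.tr s)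

/-- The domain of the sheet of `p`. -/
def dom (i : ι) (p : G) : Set B := {x | x ∈ (Λ.C i).O ∧ Λ.β i p ∈ (Λ.C i).b.J x}

open Classical in
/-- The point over `x` in relative position `θ` in the interval of `p`. -/
noncomputable def pos (i : ι) (θ : ℝ) (p : G) (x : B) : N :=
  if h : ∃ m, F.π m = x ∧ Λ.IsPos i θ p m then h.choose else F.sec x

variable {Λ} {i : ι} {θ : ℝ} {p : G} {m : N}

lemma IsPos.mem_dom (h : Λ.IsPos i θ p m) : F.π m ∈ Λ.dom i p := by
  obtain ⟨hi, s, hs, rfl, -⟩ := h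
  exact ⟨hi, Λ.β_mem_J hi hs⟩

lemma IsPos.eq {n : N} (h : Λ.IsPos i θ p m) (h' : Λ.IsPos i θ p n) (hn : F.π n = F.π m) :
    m = n := by
  obtain ⟨hi, s, hs, rfl, h1⟩ := h
  obtain ⟨-, s', hs', h2, h3⟩ := h'
  rw [hn] at hs' h3
  have := (Λ.τ_bij i _ hi).injOn hs' hs h2
  subst this
  exact Λ.E_inj hi hn (h1.trans h3.symm)

lemma exists_isPos (hp : p ∈ Λ.L (Λ.C i).x) {x : B} (hx : x ∈ Λ.dom i p) (hθ : |θ| ≤ 1) :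
    ∃ m, F.π m = x ∧ Λ.IsPos i θ p m := by
  obtain ⟨s, hs, rfl⟩ := (Λ.τ_bij i _ hx.1).surjOn ⟨hp, hx.2⟩
  obtain ⟨m, rfl, hm⟩ := Λ.exists_E_eq hx.1 hs hθ
  exact ⟨m, rfl, hx.1, s, hs, rfl, hm⟩

lemma pos_spec (hp : p ∈ Λ.L (Λ.C i).x) {x : B} (hx : x ∈ Λ.dom i p) (hθ : |θ| ≤ 1) :
    F.π (Λ.pos i θ p x) = x ∧ Λ.IsPos i θ p (Λ.pos i θ p x) := by
  have h := exists_isPos hp hx hθ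
  rw [pos, dif_pos h]
  exact h.choose_spec

lemma IsPos.pos_eq (h : Λ.IsPos i θ p m) : Λ.pos i θ p (F.π m) = m := by
  have h' : ∃ n, F.π n = F.π m ∧ Λ.IsPos i θ p n := ⟨m, rfl, h⟩
  rw [pos, dif_pos h']
  exact (h.eq h'.choose_spec.2 h'.choose_spec.1).symm

/-- On the fibre through `m` the equation `E = θ * η` has `m` as its only solution, and not being a
solution is an open condition. Since `π` is closed, solutions on nearby fibres are confined to `V`.
-/
lemma IsPos.eventually (h : Λ.IsPos i θ p m) {V : Set N} (hV : V ∈ 𝓝 m) :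
    ∀ᶠ y in 𝓝 (F.π m), ∀ n ∈ F.π ⁻¹' {y}, Λ.IsPos i θ p n → n ∈ V := by
  obtain ⟨hi, s, hs, hsp, hE⟩ := h
  have h1 : ∀ᶠ y in 𝓝 (F.π m), ∀ n ∈ F.π ⁻¹' {y},
      Λ.E i n (Λ.tr s) = θ * Λ.η (F.π n) (Λ.tr s) → n ∈ V := by
    refine F.continuous_π.isClosedMap.eventually_nhds_fiber _ fun n hn => ?_
    have hn : F.π n = F.π m := hn
    by_cases hnm : n = m
    · subst hnm
      filter_upwards [hV] with n' hn' _ using hn'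
    · have hne : Λ.E i n (Λ.tr s) ≠ θ * Λ.η (F.π n) (Λ.tr s) := by
        rw [hn, ← hE]
        exact fun h => hnm (Λ.E_inj hi hn h.symm).symm
      have hc : ContinuousAt (fun n => θ * Λ.η (F.π n) (Λ.tr s)) n :=
        (continuous_const.mul ((Λ.continuous_η _).comp F.continuous_π)).continuousAt
      filter_upwards [((Λ.continuousAt_E (i := i) (hn ▸ hi) (Λ.tr s)).sub hc).eventually_ne
        (sub_ne_zero.2 hne)] with n' h1 h2 using (h1 (sub_eq_zero.2 h2)).elim
  filter_upwards [h1, Λ.eventually_congr hi hs] with y h1 h2 n hn ⟨_, s', hs', hsp', hE'⟩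
  have hn : F.π n = y := hn
  subst hn
  obtain ⟨h3, h4⟩ := h2 s' hs' (hsp'.trans hsp.symm)
  exact h1 n rfl (by rw [← h3 n rfl, ← h4]; exact hE')

lemma continuousOn_pos (hp : p ∈ Λ.L (Λ.C i).x) (hθ : |θ| ≤ 1) :
    ContinuousOn (Λ.pos i θ p) (Λ.dom i p) := by
  intro x hx V hV
  obtain ⟨h1, h2⟩ := pos_spec hp hx hθ
  have := h2.eventually hV
  rw [h1] at this
  rw [mem_map, mem_nhdsWithin_iff_eventually]
  filter_upwards [this] with y hy hyd
  obtain ⟨h3, h4⟩ := pos_spec hp hyd hθ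
  exact hy _ h3 h4

end FramedLeaves
end FibredNbhd
end BranchedSurface

namespace BranchedSurface

/-! ### The symmetry exchanging the slits -/

/-- The symmetry of the standard block exchanging its slits. -/
def swapFun (t : (ℝ × ℝ) × ℝ) : (ℝ × ℝ) × ℝ := (t.1.swap, -t.2)

lemma swapFun_swapFun (t : (ℝ × ℝ) × ℝ) : swapFun (swapFun t) = t := by simp [swapFun]

lemma swapFun_mem {t : (ℝ × ℝ) × ℝ} (ht : t ∈ modelN) : swapFun t ∈ modelN := by
  refine ⟨by simpa [swapFun] using ht.1, fun ⟨h1, h2, h3⟩ => ht.2.2 ⟨h1, ?_, ?_⟩,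
    fun ⟨h1, h2, h3⟩ => ht.2.1 ⟨h1, ?_, ?_⟩⟩ <;> simp only [swapFun] at h2 h3 <;> linarith

lemma continuous_swapFun : Continuous swapFun := by unfold swapFun; fun_prop

lemma swapFun_mem_modelVert {t : (ℝ × ℝ) × ℝ} : swapFun t ∈ modelVert ↔ t ∈ modelVert := by
  suffices h : ∀ t, t ∈ modelVert → swapFun t ∈ modelVert from
    ⟨fun h' => swapFun_swapFun t ▸ h _ h', h t⟩
  rintro t (⟨h1, h2, h3⟩ | ⟨h1, h2, h3⟩)
  · right; exact ⟨h1, by simp only [swapFun]; linarith, by simp only [swapFun]; linarith⟩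
  · left; exact ⟨h1, by simp only [swapFun]; linarith, by simp only [swapFun]; linarith⟩

lemma swapFun_mem_modelCore {t : (ℝ × ℝ) × ℝ} : swapFun t ∈ modelCore ↔ t ∈ modelCore := by
  suffices h : ∀ t, t ∈ modelCore → swapFun t ∈ modelCore from
    ⟨fun h' => swapFun_swapFun t ▸ h _ h', h t⟩
  rintro t (⟨h1, h2⟩ | ⟨h1, h2⟩)
  · right; exact ⟨h1, by simp only [swapFun]; linarith⟩
  · left; exact ⟨h1, by simp only [swapFun]; linarith⟩

lemma SameModelFiber.swapFun {t u : (ℝ × ℝ) × ℝ} (h : SameModelFiber t u) :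
    SameModelFiber (swapFun t) (swapFun u) := by
  refine ⟨congrArg Prod.swap h.1, fun z hz => ?_⟩
  have h1 : -z ∈ uIcc t.2 u.2 := by
    simp only [BranchedSurface.swapFun, mem_uIcc] at hz ⊢
    rcases hz with hz | hz
    · right; constructor <;> linarith
    · left; constructor <;> linarith
  have := swapFun_mem (h.2 _ h1)
  simpa [BranchedSurface.swapFun] using this

/-- The symmetry of the standard block exchanging its slits. -/
def swapN : modelN ≃ₜ modelN where
  toFun t := ⟨swapFun t, swapFun_mem t.2⟩
  invFun t := ⟨swapFun t, swapFun_mem t.2⟩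
  left_inv t := Subtype.ext (swapFun_swapFun t)
  right_inv t := Subtype.ext (swapFun_swapFun t)
  continuous_toFun := (continuous_swapFun.comp continuous_subtype_val).subtype_mk _
  continuous_invFun := (continuous_swapFun.comp continuous_subtype_val).subtype_mk _

namespace FibredNbhd

variable {N B : Type*} [TopologicalSpace N] [TopologicalSpace B] {F : FibredNbhd N B}

lemma IsFlowBox.swap {φ : OpenPartialHomeomorph N modelN} (hφ : F.IsFlowBox φ) :
    F.IsFlowBox (φ.transHomeomorph swapN) where
  source_saturated := hφ.source_saturated
  target_saturated t ht u h := hφ.target_saturated _ ht (swapN.symm u) h.swapFun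
  fiber_iff m hm n hn := (hφ.fiber_iff m hm n hn).trans ⟨fun h => h.swapFun, fun h => by
    have := h.swapFun
    change SameModelFiber (swapFun (swapFun _)) (swapFun (swapFun _)) at this
    rwa [swapFun_swapFun, swapFun_swapFun] at this⟩
  vert_iff n hn := (hφ.vert_iff n hn).trans swapFun_mem_modelVert.symm
  core_iff n hn := (hφ.core_iff n hn).trans swapFun_mem_modelCore.symm

lemma IsGraph.swap {φ : OpenPartialHomeomorph N modelN} {E : Set (ℝ × ℝ)} {g : ℝ × ℝ → ℝ}
    {D : Set N} (h : IsGraph φ E g D) :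
    IsGraph (φ.transHomeomorph swapN) (Prod.swap ⁻¹' E) (fun q => -g q.swap) D := by
  obtain ⟨h1, h2, rfl⟩ := h
  refine ⟨(h1.comp continuous_swap.continuousOn fun q hq => hq).neg, fun q hq => ?_, ?_⟩
  · obtain ⟨h3, h4⟩ := h2 _ hq
    have h5 := swapFun_mem h3
    refine ⟨h5, ?_⟩
    change swapN.symm _ ∈ φ.target
    convert! h4 using 1
    exact Subtype.ext (swapFun_swapFun (q.swap, g q.swap))
  · ext n
    change (n ∈ φ.source ∧ (φ n).1.1 ∈ E ∧ (φ n).1.2 = g (φ n).1.1) ↔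
      (n ∈ φ.source ∧ (φ n).1.1.swap.swap ∈ E ∧ -(φ n).1.2 = -g (φ n).1.1.swap.swap)
    rw [Prod.swap_swap, neg_inj]

lemma Box.exists_core_of_vertInterior (b : F.Box) {n : N} (hn : n ∈ b.src)
    (h : n ∈ F.vertInterior) : ∃ m ∈ F.core, F.π n = F.π m ∧ |b.z n - b.z m| < 1 / 2 := by
  have : Nonempty N := ⟨n⟩
  rw [mem_vertInterior_iff b.isFlowBox hn] at h
  have key : ∀ z₀, |b.z n - z₀| < 1 / 2 → (b.q n, z₀) ∈ modelCore → (b.q n, z₀) ∈ modelN →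
      ∃ m ∈ F.core, F.π n = F.π m ∧ |b.z n - b.z m| < 1 / 2 := by
    intro z₀ h1 h2 h3
    have hJ : z₀ ∈ b.J (F.π n) :=
      b.J_of_near (b.z_mem_J hn) (by rwa [b.qB_π hn]) (by linarith)
    have hr := b.rng_of_J hJ
    refine ⟨_, ?_, (b.π_pt_of_J hJ).symm, by rwa [b.z_pt hr]⟩
    rw [b.isFlowBox.core_iff _ (b.pt_mem hr), b.φ_pt hr]
    change (b.qB (F.π n), z₀) ∈ modelCore
    rwa [b.qB_π hn]
  rcases h with ⟨h1, h2, h3⟩ | ⟨h1, h2, h3⟩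
  · change (b.q n).1 = 0 at h1
    change 1 < b.z n at h2
    change b.z n < 2 at h3
    refine key (3 / 2) (by rw [abs_lt]; constructor <;> linarith) (Or.inl ⟨h1, rfl⟩) ?_
    rw [BranchedSurface.mem_modelN]
    refine ⟨by norm_num [abs_le], fun h => h.1.ne' h1, fun h => by linarith [h.2.2]⟩
  · change (b.q n).2 = 0 at h1
    change -2 < b.z n at h2
    change b.z n < -1 at h3
    refine key (-3 / 2) (by rw [abs_lt]; constructor <;> linarith) (Or.inr ⟨h1, rfl⟩) ?_
    rw [BranchedSurface.mem_modelN]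
    refine ⟨by norm_num [abs_le], fun h => by linarith [h.2.1], fun h => h.1.ne' h1⟩

lemma Box.exists_core_of_vert (b : F.Box) {n : N} (hn : n ∈ b.src)
    (h : n ∈ F.vert) : ∃ m ∈ F.core, F.π n = F.π m ∧ |b.z n - b.z m| ≤ 1 / 2 := by
  have : Nonempty N := ⟨n⟩
  rw [b.isFlowBox.vert_iff n hn] at h
  have key : ∀ z₀, |b.z n - z₀| ≤ 1 / 2 → (b.q n, z₀) ∈ modelCore → (b.q n, z₀) ∈ modelN →
      ∃ m ∈ F.core, F.π n = F.π m ∧ |b.z n - b.z m| ≤ 1 / 2 := by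
    intro z₀ h1 h2 h3
    have hJ : z₀ ∈ b.J (F.π n) :=
      b.J_of_near (b.z_mem_J hn) (by rwa [b.qB_π hn]) (by linarith)
    have hr := b.rng_of_J hJ
    refine ⟨_, ?_, (b.π_pt_of_J hJ).symm, by rwa [b.z_pt hr]⟩
    rw [b.isFlowBox.core_iff _ (b.pt_mem hr), b.φ_pt hr]
    change (b.qB (F.π n), z₀) ∈ modelCore
    rwa [b.qB_π hn]
  rcases h with ⟨h1, h2, h3⟩ | ⟨h1, h2, h3⟩
  · change (b.q n).1 = 0 at h1
    change 1 ≤ b.z n at h2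
    change b.z n ≤ 2 at h3
    refine key (3 / 2) (by rw [abs_le]; constructor <;> linarith) (Or.inl ⟨h1, rfl⟩) ?_
    rw [BranchedSurface.mem_modelN]
    refine ⟨by norm_num [abs_le], fun h => h.1.ne' h1, fun h => by linarith [h.2.2]⟩
  · change (b.q n).2 = 0 at h1
    change -2 ≤ b.z n at h2
    change b.z n ≤ -1 at h3
    refine key (-3 / 2) (by rw [abs_le]; constructor <;> linarith) (Or.inr ⟨h1, rfl⟩) ?_
    rw [BranchedSurface.mem_modelN]
    refine ⟨by norm_num [abs_le], fun h => by linarith [h.2.1], fun h => h.1.ne' h1⟩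

variable [CWComplex (univ : Set B)] [T2Space B] [CompactSpace N] [T2Space N]

namespace FramedLeaves

variable {ι G : Type*} [Fintype ι] (Λ : F.FramedLeaves ι G)

/-! ### The surface and its neighbourhood -/

/-- The surface traced out by the middles of the germs. -/
def surf : Set N := {m | ∃ i p, Λ.IsPos i 0 p m}

/-- The neighbourhood swept out by the intervals of the germs. -/
def nbd : Set N := {m | ∃ i, F.π m ∈ (Λ.C i).O ∧ ∃ s ∈ Λ.L (F.π m),
  |Λ.E i m (Λ.tr s)| < Λ.η (F.π m) (Λ.tr s)}

variable {Λ} {i : ι} {θ : ℝ} {p : G} {m : N}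

lemma IsPos.germ_mem (h : Λ.IsPos i θ p m) : p ∈ Λ.L (Λ.C i).x := by
  obtain ⟨hi, s, hs, rfl, -⟩ := h
  exact Λ.τ_mem hi hs

lemma mem_surf_iff (hi : F.π m ∈ (Λ.C i).O) : m ∈ Λ.surf ↔
    ∃ s ∈ Λ.L (F.π m), Λ.E i m (Λ.tr s) = 0 := by
  constructor
  · rintro ⟨j, p, hj, s, hs, -, h⟩
    refine ⟨s, hs, ?_⟩
    rw [zero_mul] at h
    rw [← abs_eq_zero, Λ.abs_E hi hj, h, abs_zero]
  · rintro ⟨s, hs, h⟩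
    exact ⟨i, _, hi, s, hs, rfl, by rw [h, zero_mul]⟩

lemma exists_isPos_of_mem_surf (hm : m ∈ Λ.surf) (hi : F.π m ∈ (Λ.C i).O) :
    ∃ p, Λ.IsPos i 0 p m := by
  obtain ⟨s, hs, h⟩ := (mem_surf_iff hi).1 hm
  exact ⟨_, hi, s, hs, rfl, by rw [h, zero_mul]⟩

lemma mem_nbd_iff (hi : F.π m ∈ (Λ.C i).O) : m ∈ Λ.nbd ↔
    ∃ s ∈ Λ.L (F.π m), |Λ.E i m (Λ.tr s)| < Λ.η (F.π m) (Λ.tr s) := by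
  constructor
  · rintro ⟨j, hj, s, hs, h⟩
    exact ⟨s, hs, by rwa [Λ.abs_E hi hj]⟩
  · rintro ⟨s, hs, h⟩
    exact ⟨i, hi, s, hs, h⟩

lemma surf_subset_nbd : Λ.surf ⊆ Λ.nbd := by
  rintro m ⟨i, p, hi, s, hs, -, h⟩
  exact ⟨i, hi, s, hs, by rw [h, zero_mul, abs_zero]; exact Λ.η_pos hs⟩

lemma isOpen_nbd : IsOpen Λ.nbd := by
  rw [isOpen_iff_mem_nhds]
  rintro n ⟨i, hi, s, hs, h⟩
  filter_upwards [Λ.eventually_mem hi hs h] with n' ⟨h1, s', h2, _, h3⟩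
  exact ⟨i, h1, s', h2, h3⟩

lemma IsPos.germ_unique {p' : G} (h : Λ.IsPos i 0 p m) (h' : Λ.IsPos i 0 p' m) : p = p' := by
  obtain ⟨hi, s, hs, rfl, h1⟩ := h
  obtain ⟨-, s', hs', rfl, h2⟩ := h'
  rw [zero_mul] at h1 h2
  rw [Λ.unique hi hs hs' (by rw [h1, abs_zero]; exact Λ.η_pos hs)
    (by rw [h2, abs_zero]; exact Λ.η_pos hs')]

/-- Near a point of the surface, the surface consists of one sheet. -/
lemma IsPos.eventually_surf (h : Λ.IsPos i 0 p m) : ∀ᶠ n in 𝓝 m, n ∈ Λ.surf → Λ.IsPos i 0 p n := by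
  obtain ⟨hi, s, hs, rfl, h1⟩ := h
  rw [zero_mul] at h1
  filter_upwards [Λ.eventually_mem hi hs (by rw [h1, abs_zero]; exact Λ.η_pos hs)]
    with n ⟨h2, s', h3, h4, h5⟩ hn
  obtain ⟨s'', h6, h7⟩ := (mem_surf_iff h2).1 hn
  have := Λ.unique h2 h6 h3 (by rw [h7, abs_zero]; exact Λ.η_pos h6) h5
  subst this
  exact ⟨h2, s'', h6, h4, by rw [h7, zero_mul]⟩

lemma isPos_core (hm : m ∈ F.core) (hi : F.π m ∈ (Λ.C i).O) :
    Λ.IsPos i 0 (Λ.τ i (Λ.κ m)) m :=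
  ⟨hi, _, Λ.κ_mem m hm, rfl, by rw [Λ.E_core_self hm hi, zero_mul]⟩

lemma core_subset_surf : F.core ⊆ Λ.surf := fun m hm => by
  obtain ⟨i, hi⟩ := Λ.cover (F.π m)
  exact ⟨i, _, isPos_core hm hi⟩

/-- The interval of the core germ of `m'` contains the whole open slit, so disjointness identifies
the germ of `m` with it; the middle of this germ is `m'`. -/
lemma mem_core_of_mem_surf (hm : m ∈ Λ.surf) (hv : m ∈ F.vertInterior) : m ∈ F.core := by
  obtain ⟨i, hi⟩ := Λ.cover (F.π m)
  obtain ⟨m', hm', hmm', hz⟩ := (Λ.C i).b.exists_core_of_vertInterior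
    ((Λ.C i).b.mem_base_iff.1 hi.1) hv
  have hi' : F.π m' ∈ (Λ.C i).O := hmm' ▸ hi
  obtain ⟨s, hs, hE⟩ := (mem_surf_iff hi).1 hm
  have h1 := (Λ.core_lt_iff hm' hi' hmm').2 hz
  have hκ := Λ.κ_mem m' hm'
  rw [← Λ.η_core hm', ← hmm'] at h1
  rw [← hmm'] at hκ
  have := Λ.unique hi hs hκ (by rw [hE, abs_zero]; exact Λ.η_pos hs) h1
  subst this
  have := Λ.E_inj hi hmm'.symm (hE.trans (Λ.E_core_self hm' hi').symm)
  rwa [this]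

/-- The core germ fills exactly the open slit, and by `sides` the interval of any other germ of the
fibre avoids the closed slit. -/
lemma nbd_inter_vert : Λ.nbd ∩ F.vert = F.vertInterior := by
  ext n
  obtain ⟨i, hi⟩ := Λ.cover (F.π n)
  have hn := (Λ.C i).b.mem_base_iff.1 hi.1
  constructor
  · rintro ⟨h1, h2⟩
    obtain ⟨m, hm, hnm, hz⟩ := (Λ.C i).b.exists_core_of_vert hn h2
    obtain ⟨s, hs, hE⟩ := (mem_nbd_iff hi).1 h1
    rw [hnm] at hs hE hi
    rw [abs_le] at hz
    rcases Λ.sides hm hi hnm hs hE with ⟨-, h3⟩ | ⟨-, h3⟩ | ⟨-, h3⟩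
    · rw [mem_vertInterior_iff (Λ.C i).b.isFlowBox hn]
      have hms := (Λ.C i).b.mem_src hn hnm.symm
      have hq := (Λ.C i).b.q_eq hn hnm
      rw [abs_lt] at h3
      rcases (Λ.C i).b.core_cases hms hm with h4 | h4
      · left
        exact ⟨by rw [← h4.1, ← hq]; rfl, by change 1 < (Λ.C i).b.z n; linarith,
          by change (Λ.C i).b.z n < 2; linarith⟩
      · right
        exact ⟨by rw [← h4.1, ← hq]; rfl, by change -2 < (Λ.C i).b.z n; linarith,
          by change (Λ.C i).b.z n < -1; linarith⟩
    · linarith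
    · linarith
  · intro h
    refine ⟨?_, vertInterior_subset_vert h⟩
    obtain ⟨m, hm, hnm, hz⟩ := (Λ.C i).b.exists_core_of_vertInterior hn h
    rw [mem_nbd_iff hi, hnm]
    refine ⟨_, Λ.κ_mem m hm, ?_⟩
    rw [Λ.η_core hm]
    rw [hnm] at hi
    exact (Λ.core_lt_iff hm hi hnm).2 hz

/-! ### The local structure of the surface -/

/-- The set `A` describes the horizontal coordinates available near `m`: the plane for a plaque, a
half plane for a half plaque. Over `A` the sheet is parametrised by moving horizontally from `m`,
projecting to `B`, and taking the point of the sheet. -/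
lemma IsPos.exists_graph [Nonempty N] (h : Λ.IsPos i 0 p m) {A : Set (ℝ × ℝ)}
    (hmA : (Λ.C i).b.q m ∈ A)
    (hA : ∀ᶠ q in 𝓝[A] ((Λ.C i).b.q m), (q, (Λ.C i).b.z m) ∈ modelN)
    (hA' : ∀ᶠ n in 𝓝 m, (Λ.C i).b.q n ∈ A) :
    ∃ (R : Set (ℝ × ℝ)) (g : ℝ × ℝ → ℝ) (D : Set N), IsOpen R ∧
      IsGraph (Λ.C i).b.φ (R ∩ A) g D ∧ m ∈ D ∧ D ⊆ Λ.surf ∧ (∃ V ∈ 𝓝 m, Λ.surf ∩ V ⊆ D) ∧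
      ∀ q ∈ R ∩ A, (q, (Λ.C i).b.z m) ∈ (Λ.C i).b.rng ∧ ∃ n, Λ.IsPos i 0 p n ∧
        F.π n = F.π ((Λ.C i).b.pt (q, (Λ.C i).b.z m)) ∧ g q = (Λ.C i).b.z n := by
  set b := (Λ.C i).b with hb
  have hi := h.1
  have hp := h.germ_mem
  have hms : m ∈ b.src := b.mem_base_iff.1 hi.1
  have hrng : ∀ᶠ q in 𝓝[A] (b.q m), (q, b.z m) ∈ b.rng := by
    have h1 : ∀ᶠ q in 𝓝[A] (b.q m), dist q b.q₀ < b.ε :=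
      nhdsWithin_le_nhds ((continuous_id.dist continuous_const).continuousAt.eventually_lt_const
        (b.dist_q_lt hms))
    filter_upwards [hA, h1] with q h2 h3 using ⟨h2, h3, (b.mem_rng hms).2.2⟩
  have htend : Tendsto (fun q => b.pt (q, b.z m)) (𝓝[A] (b.q m)) (𝓝 m) := by
    have h1 : Tendsto (fun q => (q, b.z m)) (𝓝[A] (b.q m)) (𝓝[b.rng] (b.q m, b.z m)) :=
      tendsto_nhdsWithin_iff.2 ⟨(tendsto_id.mono_left nhdsWithin_le_nhds).prodMk_nhds
        tendsto_const_nhds, hrng⟩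
    have h2 := (b.continuousOn_pt _ (b.mem_rng hms)).tendsto.comp h1
    rwa [b.pt_qz hms] at h2
  have hdom : ∀ᶠ q in 𝓝[A] (b.q m), F.π (b.pt (q, b.z m)) ∈ Λ.dom i p := by
    obtain ⟨-, s, hs, rfl, hE⟩ := h
    have h1 := Λ.eventually_β_mem hi hs (by rw [hE, zero_mul, abs_zero]; exact Λ.η_pos hs)
    have h2 := F.continuous_π.continuousAt.eventually ((Λ.C i).isOpen_O.mem_nhds hi)
    exact (htend.eventually (h2.and h1))
  obtain ⟨R, hR, hmR, hRA⟩ := mem_nhdsWithin.1 (hrng.and hdom)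
  have hθ : |(0 : ℝ)| ≤ 1 := by simp
  set P : ℝ × ℝ → N := fun q => Λ.pos i 0 p (F.π (b.pt (q, b.z m))) with hP
  have hPs : ∀ q ∈ R ∩ A, F.π (P q) = F.π (b.pt (q, b.z m)) ∧ Λ.IsPos i 0 p (P q) ∧
      P q ∈ b.src ∧ b.q (P q) = q := by
    intro q hq
    obtain ⟨h1, h2⟩ := hRA hq
    obtain ⟨h3, h4⟩ := pos_spec hp h2 hθ
    have h5 := b.mem_src (b.pt_mem h1) h3
    exact ⟨h3, h4, h5, (b.q_eq h5 h3).trans (b.q_pt h1)⟩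
  have hPc : ContinuousOn P (R ∩ A) := by
    refine (continuousOn_pos hp hθ).comp (F.continuous_π.comp_continuousOn
      (b.continuousOn_pt.comp (by fun_prop) fun q hq => (hRA hq).1)) fun q hq => (hRA hq).2
  have hzm : b.pt (b.q m, b.z m) = m := b.pt_qz hms
  refine ⟨R, fun q => b.z (P q), {n | n ∈ b.src ∧ b.q n ∈ R ∩ A ∧ b.z n = b.z (P (b.q n))}, hR,
    ⟨b.continuousOn_z.comp hPc fun q hq => (hPs q hq).2.2.1, fun q hq => ?_, rfl⟩, ?_, ?_, ?_, ?_⟩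
  · obtain ⟨-, -, h3, h4⟩ := hPs q hq
    have h5 : ((q, b.z (P q)) : (ℝ × ℝ) × ℝ) = (b.φ (P q) : (ℝ × ℝ) × ℝ) := Prod.ext h4.symm rfl
    refine ⟨by rw [h5]; exact (b.φ (P q)).2, ?_⟩
    convert! b.φ.map_source h3 using 1
    exact Subtype.ext h5
  · refine ⟨hms, ⟨hmR, hmA⟩, ?_⟩
    simp only [hP]
    rw [hzm, h.pos_eq]
  · rintro n ⟨h1, h2, h3⟩
    obtain ⟨-, h4, h5, h6⟩ := hPs _ h2
    rw [b.injOn h1 h5 h6.symm h3]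
    exact ⟨i, p, h4⟩
  · have hz : ∀ᶠ n in 𝓝 m, |b.z n - b.z m| < 1 :=
      (b.continuousOn_z.continuousAt (b.isOpen_src.mem_nhds hms)).eventually
        (ball_mem_nhds _ one_pos)
    have hq : ∀ᶠ n in 𝓝 m, b.q n ∈ R :=
      (b.continuousOn_q.continuousAt (b.isOpen_src.mem_nhds hms)).eventually (hR.mem_nhds hmR)
    refine ⟨_, h.eventually_surf.and (hz.and (hq.and (hA'.and (b.isOpen_src.mem_nhds hms)))), ?_⟩
    rintro n ⟨h1, h2, h3, h4, h5, h6⟩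
    refine ⟨h6, ⟨h4, h5⟩, ?_⟩
    have h7 := hRA ⟨h4, h5⟩
    have h8 : F.π (b.pt (b.q n, b.z m)) = F.π n := by
      rw [b.π_eq_iff (b.pt_mem h7.1) h6, b.q_pt h7.1, b.z_pt h7.1]
      exact (sameModelFiber_of_near (b.mem_modelN n) h7.1.1 h3).symm
    simp only [hP]
    rw [h8, (h2 h1).pos_eq]
  · intro q hq
    obtain ⟨h1, h2, -, -⟩ := hPs q hq
    exact ⟨(hRA hq).1, _, h2, h1, rfl⟩

/-- Off the pared locus a point of the surface is not interior to the vertical boundary, so the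
block contains all points close to it at the same height. -/
lemma exists_plaque (hm : m ∈ Λ.surf) (hc : m ∉ F.core) :
    ∃ D, F.IsPlaque D ∧ m ∈ D ∧ D ⊆ Λ.surf ∧ ∃ V ∈ 𝓝 m, Λ.surf ∩ V ⊆ D := by
  have : Nonempty N := ⟨m⟩
  obtain ⟨i, hi⟩ := Λ.cover (F.π m)
  obtain ⟨p, hp⟩ := exists_isPos_of_mem_surf hm hi
  set b := (Λ.C i).b
  have hms : m ∈ b.src := b.mem_base_iff.1 hi.1
  have hv : (b.q m, b.z m) ∉ modelVertInt := fun h =>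
    hc (mem_core_of_mem_surf hm ((mem_vertInterior_iff b.isFlowBox hms).2 h))
  have hmod := b.mem_modelN m
  have hev : ∀ {f : ℝ × ℝ → ℝ}, Continuous f → ∀ {Q : Prop}, ¬ (0 < f (b.q m) ∧ Q) →
      ¬ (f (b.q m) = 0 ∧ Q) → ∀ᶠ q in 𝓝 (b.q m), ¬ (0 < f q ∧ Q) := by
    intro f hf Q h1 h2
    by_cases hQ : Q
    · have : f (b.q m) < 0 := lt_of_le_of_ne (not_lt.1 fun h => h1 ⟨h, hQ⟩) fun h => h2 ⟨h, hQ⟩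
      filter_upwards [hf.continuousAt.eventually_lt_const this] with q hq h
      exact lt_asymm hq h.1
    · exact Eventually.of_forall fun q h => hQ h.2
  have hA : ∀ᶠ q in 𝓝[univ] (b.q m), (q, b.z m) ∈ modelN := by
    rw [nhdsWithin_univ]
    filter_upwards [hev continuous_fst hmod.2.1 fun h => hv (Or.inl h),
      hev continuous_snd hmod.2.2 fun h => hv (Or.inr h)] with q h1 h2
    exact ⟨hmod.1, h1, h2⟩
  obtain ⟨R, g, D, hR, hg, h1, h2, h3, -⟩ := hp.exists_graph (mem_univ _) hA
    (Eventually.of_forall fun _ => mem_univ _)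
  rw [inter_univ] at hg
  exact ⟨D, ⟨b.φ, b.isFlowBox, R, g, hR, hg⟩, h1, h2, h3⟩

/-- Along a core curve in the chart, core points at one height have the same germ, by `κ_unique`. So
the sheet of the core germ passes through the pared locus there, which gives the half plaque its
prescribed boundary height. -/
lemma core_graph_eq (hm : m ∈ F.core) (hi : F.π m ∈ (Λ.C i).O) {n n' : N}
    (hn : Λ.IsPos i 0 (Λ.τ i (Λ.κ m)) n) (hn' : n' ∈ F.core) (hnn' : F.π n = F.π n')
    (hz : (Λ.C i).b.z n' = (Λ.C i).b.z m) : n = n' := by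
  have hi' : F.π n' ∈ (Λ.C i).O := hnn' ▸ hn.1
  have h1 := Λ.κ_unique i n' hn' hi' _ (Λ.τ_mem hi (Λ.κ_mem m hm))
    ((Λ.β_κ i m hm hi).trans hz.symm)
  have h2 := isPos_core hn' hi'
  rw [← h1] at h2
  exact hn.eq h2 hnn'.symm

lemma exists_halfPlaque (hm : m ∈ F.core) :
    ∃ D, F.IsHalfPlaque D ∧ m ∈ D ∧ D ⊆ Λ.surf ∧ ∃ V ∈ 𝓝 m, Λ.surf ∩ V ⊆ D := by
  have : Nonempty N := ⟨m⟩
  obtain ⟨i, hi⟩ := Λ.cover (F.π m)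
  have hp := isPos_core hm hi
  set b := (Λ.C i).b with hb
  have hms : m ∈ b.src := b.mem_base_iff.1 hi.1
  have hz : ContinuousAt b.z m := b.continuousOn_z.continuousAt (b.isOpen_src.mem_nhds hms)
  rcases b.core_cases hms hm with ⟨hq0, hz0⟩ | ⟨hq0, hz0⟩
  · have hA : ∀ᶠ q in 𝓝[{q : ℝ × ℝ | q.1 ≤ 0}] (b.q m), (q, b.z m) ∈ modelN := by
      filter_upwards [self_mem_nhdsWithin] with q hq
      rw [hz0, BranchedSurface.mem_modelN]
      exact ⟨by norm_num [abs_le], fun h => absurd h.1 (not_lt.2 hq), fun h => by linarith [h.2.2]⟩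
    have hA' : ∀ᶠ n in 𝓝 m, b.q n ∈ {q : ℝ × ℝ | q.1 ≤ 0} := by
      filter_upwards [hz.eventually_lt_const (show b.z m < 2 by rw [hz0]; norm_num),
        hz.eventually_const_lt (show 1 < b.z m by rw [hz0]; norm_num)] with n h1 h2
      exact not_lt.1 fun h => (b.mem_modelN n).2.1 ⟨h, h2, h1⟩
    obtain ⟨R, g, D, hR, hg, h1, h2, h3, h4⟩ := hp.exists_graph hq0.le hA hA'
    refine ⟨D, ⟨b.φ, b.isFlowBox, R, g, hR, hg, fun q hq hq1 => ?_⟩, h1, h2, h3⟩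
    obtain ⟨h5, n, h6, h7, h8⟩ := h4 q ⟨hq, hq1.le⟩
    have h9 : b.pt (q, b.z m) ∈ F.core := by
      rw [b.isFlowBox.core_iff _ (b.pt_mem h5), b.φ_pt h5]
      exact Or.inl ⟨hq1, hz0⟩
    rw [h8, core_graph_eq hm hi h6 h9 h7 (b.z_pt h5), b.z_pt h5]
    exact hz0
  · have hA : ∀ᶠ q in 𝓝[{q : ℝ × ℝ | q.2 ≤ 0}] (b.q m), (q, b.z m) ∈ modelN := by
      filter_upwards [self_mem_nhdsWithin] with q hq
      rw [hz0, BranchedSurface.mem_modelN]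
      exact ⟨by norm_num [abs_le], fun h => by linarith [h.2.1], fun h => absurd h.1 (not_lt.2 hq)⟩
    have hA' : ∀ᶠ n in 𝓝 m, b.q n ∈ {q : ℝ × ℝ | q.2 ≤ 0} := by
      filter_upwards [hz.eventually_lt_const (show b.z m < -1 by rw [hz0]; norm_num),
        hz.eventually_const_lt (show -2 < b.z m by rw [hz0]; norm_num)] with n h1 h2
      exact not_lt.1 fun h => (b.mem_modelN n).2.2 ⟨h, h2, h1⟩
    obtain ⟨R, g, D, hR, hg, h1, h2, h3, h4⟩ := hp.exists_graph hq0.le hA hA'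
    -- Half plaques are defined on the first slit only, so the box is composed with the symmetry of
    -- the block.
    refine ⟨D, ⟨_, IsFlowBox.swap b.isFlowBox, Prod.swap ⁻¹' R, _, hR.preimage continuous_swap,
      hg.swap, fun q hq hq1 => ?_⟩, h1, h2, h3⟩
    obtain ⟨h5, n, h6, h7, h8⟩ := h4 q.swap ⟨hq, hq1.le⟩
    have h9 : b.pt (q.swap, b.z m) ∈ F.core := by
      rw [b.isFlowBox.core_iff _ (b.pt_mem h5), b.φ_pt h5]
      exact Or.inr ⟨hq1, hz0⟩
    rw [h8, core_graph_eq hm hi h6 h9 h7 (b.z_pt h5), b.z_pt h5]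
    change -b.z m = _
    rw [hz0]; norm_num

lemma discreteTopology_surf (x : B) : DiscreteTopology ↥(Λ.surf ∩ F.π ⁻¹' {x}) := by
  rw [discreteTopology_subtype_iff']
  rintro m ⟨hm, rfl⟩
  obtain ⟨i, p, hp⟩ := id hm
  obtain ⟨V, hV, hVo, hmV⟩ := mem_nhds_iff.1 hp.eventually_surf
  refine ⟨V, hVo, Subset.antisymm ?_ ?_⟩
  · rintro n ⟨h1, h2, h3⟩
    exact (hp.eq (hV h1 h2) h3).symm
  · rintro _ rfl
    exact ⟨hmV, hm, rfl⟩

/-- In a chart at the limit point the germ of the sheet through `γ t` is locally constant, hence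
constant near the end of the path. The limit is in the domain of this sheet because fibres are upper
semicontinuous, and continuity of `pos` gives the limit of `γ`. -/
lemma surf_complete {γ : ℝ → N} (hγ : ContinuousOn γ (Ico 0 1)) (hS : MapsTo γ (Ico 0 1) Λ.surf)
    {x : B} (hx : Tendsto (fun t => F.π (γ t)) (𝓝[<] 1) (𝓝 x)) :
    ∃ s ∈ Λ.surf, Tendsto γ (𝓝[<] 1) (𝓝 s) := by
  obtain ⟨i, hi⟩ := Λ.cover x
  have h1 : ∀ᶠ t in 𝓝[<] (1 : ℝ), F.π (γ t) ∈ (Λ.C i).O ∧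
      (Λ.C i).b.J (F.π (γ t)) ⊆ (Λ.C i).b.J x := by
    filter_upwards [hx.eventually ((Λ.C i).isOpen_O.mem_nhds hi),
      hx.eventually ((Λ.C i).b.J_stable hi.1)] with t h1 h2 using ⟨h1, h2.2.1⟩
  obtain ⟨a, ha, h2⟩ := (mem_nhdsLT_iff_exists_Ioo_subset (a := (1 : ℝ))).1
    (h1.and (Ioo_mem_nhdsLT (show (0 : ℝ) < 1 by norm_num)))
  have ha : a < 1 := ha
  have hex : ∀ t, ∃ p, t ∈ Ioo a 1 → Λ.IsPos i 0 p (γ t) := by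
    intro t
    by_cases ht : t ∈ Ioo a 1
    · obtain ⟨p, hp⟩ := exists_isPos_of_mem_surf (hS ⟨(h2 ht).2.1.le, ht.2⟩) (h2 ht).1.1
      exact ⟨p, fun _ => hp⟩
    · exact ⟨Λ.κ (γ t), fun h => (ht h).elim⟩
  choose P hP using hex
  have hconst : ∀ t ∈ Ioo a 1, ∀ᶠ t' in 𝓝[Ioo a 1] t, P t' = P t := by
    intro t ht
    have hsub : Ioo a 1 ⊆ Ico 0 1 := fun t ht => ⟨(h2 ht).2.1.le, ht.2⟩
    have hc : Tendsto γ (𝓝[Ioo a 1] t) (𝓝 (γ t)) := (hγ.mono hsub) t ht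
    filter_upwards [hc.eventually (hP t ht).eventually_surf, self_mem_nhdsWithin] with t' h3 h4
    exact (hP t' h4).germ_unique (h3 (hS (hsub h4)))
  set t₀ := (a + 1) / 2 with ht₀
  have ht₀m : t₀ ∈ Ioo a 1 := ⟨by linarith, by linarith⟩
  have hpos : ∀ t ∈ Ioo a 1, Λ.IsPos i 0 (P t₀) (γ t) := fun t ht => by
    rw [← eq_of_eventuallyEq_of_isPreconnected isPreconnected_Ioo hconst ht ht₀m]
    exact hP t ht
  have hp := (hpos t₀ ht₀m).germ_mem
  have hxd : x ∈ Λ.dom i (P t₀) := ⟨hi, (h2 ht₀m).1.2 (hpos t₀ ht₀m).mem_dom.2⟩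
  have hθ : |(0 : ℝ)| ≤ 1 := by simp
  refine ⟨_, ⟨i, _, (pos_spec hp hxd hθ).2⟩, ?_⟩
  have hI : ∀ᶠ t in 𝓝[<] (1 : ℝ), t ∈ Ioo a 1 := Ioo_mem_nhdsLT ha
  have h3 : Tendsto (fun t => F.π (γ t)) (𝓝[<] 1) (𝓝[Λ.dom i (P t₀)] x) :=
    tendsto_nhdsWithin_iff.2 ⟨hx, hI.mono fun t ht => (hpos t ht).mem_dom⟩
  refine ((continuousOn_pos hp hθ x hxd).tendsto.comp h3).congr' ?_
  filter_upwards [hI] with t ht using (hpos t ht).pos_eq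

end FramedLeaves
end FibredNbhd
end BranchedSurface

namespace BranchedSurface
namespace FibredNbhd

variable {N B : Type*} [TopologicalSpace N] [TopologicalSpace B] {F : FibredNbhd N B}
variable [CWComplex (univ : Set B)] [T2Space B] [CompactSpace N] [T2Space N]

namespace FramedLeaves

variable {ι G : Type*} [Fintype ι] {Λ : F.FramedLeaves ι G} {i : ι} {θ : ℝ} {p : G} {m : N}

/-! ### The fibres of the neighbourhood -/

/-- An end of an interval is excluded from its own open interval by `|E| = η`, and from all others
by `E_sep`. -/
lemma IsPos.not_mem_nbd (h : Λ.IsPos i θ p m) (hθ : |θ| = 1) : m ∉ Λ.nbd := by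
  intro hn
  obtain ⟨hi, s, hs, -, hE⟩ := h
  obtain ⟨s', hs', hE'⟩ := (mem_nbd_iff hi).1 hn
  have hη := Λ.η_pos hs
  have hη' := Λ.η_pos hs'
  have h1 : |Λ.E i m (Λ.tr s)| = Λ.η (F.π m) (Λ.tr s) := by
    rw [hE, abs_mul, hθ, one_mul, abs_of_pos hη]
  have h2 := abs_le.1 h1.le
  have h3 := abs_lt.1 hE'
  have := Λ.eq_of_not_lt hi hs hs' (fun hlt => by linarith [Λ.E_sep hi hs hs' hlt])
    fun hlt => by linarith [Λ.E_sep hi hs' hs hlt]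
  subst this
  exact hE'.ne h1

/-- The fibre of the neighbourhood through a point of the surface. -/
lemma IsPos.nbhdFiber_eq (h : Λ.IsPos i 0 p m) {l u : N} (hl : Λ.IsPos i (-1) p l)
    (hu : Λ.IsPos i 1 p u) (hlm : F.π l = F.π m) (hum : F.π u = F.π m) :
    (Λ.C i).b.z l < (Λ.C i).b.z m ∧ (Λ.C i).b.z m < (Λ.C i).b.z u ∧
    F.nbhdFiber Λ.nbd m = {n | F.π n = F.π m ∧ (Λ.C i).b.z l < (Λ.C i).b.z n ∧
      (Λ.C i).b.z n < (Λ.C i).b.z u} ∧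
    ∀ s ∈ Λ.L (F.π m), Λ.τ i s = p → F.nbhdFiber Λ.nbd m =
      {n | F.π n = F.π m ∧ |Λ.E i n (Λ.tr s)| < Λ.η (F.π m) (Λ.tr s)} := by
  have : Nonempty N := ⟨m⟩
  set b := (Λ.C i).b
  have hlN := hl.not_mem_nbd (by simp)
  have huN := hu.not_mem_nbd (by simp)
  have hmN : m ∈ Λ.nbd := surf_subset_nbd ⟨i, p, h⟩
  obtain ⟨hi, s, hs, rfl, hE⟩ := h
  obtain ⟨-, sl, hsl, hsl', hEl⟩ := hl
  obtain ⟨-, su, hsu, hsu', hEu⟩ := hu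
  rw [hlm] at hsl hEl
  rw [hum] at hsu hEu
  have hinj := (Λ.τ_bij i _ hi).injOn
  have e1 := hinj hsl hs hsl'
  have e2 := hinj hsu hs hsu'
  subst e1
  subst e2
  have hη := Λ.η_pos hs
  have hms : m ∈ b.src := b.mem_base_iff.1 hi.1
  have hT : ∀ n, F.π n = F.π m → (|Λ.E i n (Λ.tr su)| < Λ.η (F.π m) (Λ.tr su) ↔
      b.z l < b.z n ∧ b.z n < b.z u) := by
    intro n hn
    rw [abs_lt, ← Λ.E_lt_iff (hlm ▸ hi) (hn.trans hlm.symm) (Λ.tr su),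
      ← Λ.E_lt_iff (hn ▸ hi) (hum.trans hn.symm) (Λ.tr su), hEl, hEu, neg_one_mul, one_mul]
  have hTm := (hT m rfl).1 (by rw [hE, zero_mul, abs_zero]; exact hη)
  have hJ : ∀ n, F.π n = F.π m → b.z n ∈ b.J (F.π m) := fun n hn =>
    hn ▸ b.z_mem_J (b.mem_src hms hn)
  have hsub : Ioo (b.z l) (b.z u) ⊆ b.J (F.π m) := Ioo_subset_Icc_self.trans
    ((b.ordConnected_J _).out (hJ l hlm) (hJ u hum))
  have hpt : ∀ n, F.π n = F.π m → b.pt (b.qB (F.π m), b.z n) = n := by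
    intro n hn
    rw [← hn, b.qB_π (b.mem_src hms hn), b.pt_qz (b.mem_src hms hn)]
  have hTeq : {n | F.π n = F.π m ∧ b.z l < b.z n ∧ b.z n < b.z u} =
      (fun z => b.pt (b.qB (F.π m), z)) '' Ioo (b.z l) (b.z u) := by
    ext n
    constructor
    · rintro ⟨h1, h2⟩
      exact ⟨b.z n, h2, hpt n h1⟩
    · rintro ⟨z, hz, rfl⟩
      refine ⟨b.π_pt_of_J (hsub hz), ?_⟩
      simp only
      rw [b.z_pt (b.rng_of_J (hsub hz))]
      exact hz
  have hfib : F.nbhdFiber Λ.nbd m = {n | F.π n = F.π m ∧ b.z l < b.z n ∧ b.z n < b.z u} := by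
    have hmC : m ∈ Λ.nbd ∩ F.π ⁻¹' {F.π m} := ⟨hmN, rfl⟩
    apply Subset.antisymm
    · intro n hn
      have hCsub := connectedComponentIn_subset (Λ.nbd ∩ F.π ⁻¹' {F.π m}) m
      have hnx : F.π n = F.π m := (hCsub hn).2
      have hoc : (b.z '' connectedComponentIn (Λ.nbd ∩ F.π ⁻¹' {F.π m}) m).OrdConnected :=
        (isPreconnected_connectedComponentIn.image _ (b.continuousOn_z.mono fun r hr =>
          b.mem_src hms (hCsub hr).2)).ordConnected
      have hmz := mem_image_of_mem b.z (mem_connectedComponentIn hmC)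
      have hnz := mem_image_of_mem b.z hn
      -- The heights of the component form an interval containing `b.z m`. It cannot pass a point of
      -- the fibre outside `nbd`, in particular neither `l` nor `u`.
      have key : ∀ r, F.π r = F.π m → r ∉ Λ.nbd → b.z r ∉ uIcc (b.z m) (b.z n) := by
        intro r hr hrN h
        obtain ⟨r', hr', hz⟩ := ordConnected_iff_uIcc_subset.1 hoc hmz hnz h
        have hr'x : F.π r' = F.π m := (hCsub hr').2
        have := b.injOn (b.mem_src hms hr'x) (b.mem_src hms hr)
          (b.q_eq (b.mem_src hms hr'x) (hr'x.trans hr.symm)) hz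
        subst this
        exact hrN (hCsub hr').1
      refine ⟨hnx, ?_, ?_⟩
      · by_contra h
        exact key l hlm hlN (mem_uIcc.2 (Or.inr ⟨not_lt.1 h, hTm.1.le⟩))
      · by_contra h
        exact key u hum huN (mem_uIcc.2 (Or.inl ⟨hTm.2.le, not_lt.1 h⟩))
    · refine IsPreconnected.subset_connectedComponentIn ?_ ⟨rfl, hTm⟩ ?_
      · rw [hTeq]
        exact b.isPreconnected_image_pt ordConnected_Ioo hsub
      · rintro n ⟨h1, h2⟩
        refine ⟨(mem_nbd_iff (h1 ▸ hi)).2 ⟨su, h1 ▸ hs, ?_⟩, h1⟩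
        rw [h1]
        exact (hT n h1).2 h2
  refine ⟨hTm.1, hTm.2, hfib, fun s hs' hss => ?_⟩
  have := hinj hs' hs hss
  subst this
  rw [hfib]
  ext n
  exact and_congr_right fun hn => (hT n hn).symm

lemma IsPos.exists_ends (h : Λ.IsPos i 0 p m) : ∃ l u, Λ.IsPos i (-1) p l ∧ Λ.IsPos i 1 p u ∧
    F.π l = F.π m ∧ F.π u = F.π m := by
  obtain ⟨l, hl, hl'⟩ := exists_isPos (θ := -1) h.germ_mem h.mem_dom (by simp)
  obtain ⟨u, hu, hu'⟩ := exists_isPos (θ := 1) h.germ_mem h.mem_dom (by simp)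
  exact ⟨l, u, hl', hu', hl, hu⟩

lemma IsPos.mem_nbhdFiber_iff {s : G} (hs : s ∈ Λ.L (F.π m))
    (h : Λ.IsPos i 0 (Λ.τ i s) m) {n : N} : n ∈ F.nbhdFiber Λ.nbd m ↔
      F.π n = F.π m ∧ |Λ.E i n (Λ.tr s)| < Λ.η (F.π m) (Λ.tr s) := by
  obtain ⟨l, u, hl, hu, hlm, hum⟩ := h.exists_ends
  rw [(h.nbhdFiber_eq hl hu hlm hum).2.2.2 s hs rfl]
  rfl

lemma existsUnique_fibre {w : N} (hw : w ∈ Λ.nbd) :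
    ∃! s, s ∈ Λ.surf ∧ w ∈ F.nbhdFiber Λ.nbd s := by
  obtain ⟨i, hi, s, hs, hE⟩ := hw
  obtain ⟨m, hm, hm'⟩ := exists_isPos (θ := 0) (Λ.τ_mem hi hs) ⟨hi, Λ.β_mem_J hi hs⟩ (by simp)
  refine ⟨m, ⟨⟨i, _, hm'⟩, ?_⟩, ?_⟩
  · rw [hm'.mem_nbhdFiber_iff (hm ▸ hs), hm]
    exact ⟨rfl, hE⟩
  · rintro m₂ ⟨h1, h2⟩
    have hm₂ : F.π w = F.π m₂ := (connectedComponentIn_subset _ _ h2).2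
    have hi₂ : F.π m₂ ∈ (Λ.C i).O := hm₂ ▸ hi
    obtain ⟨p, hp⟩ := exists_isPos_of_mem_surf h1 hi₂
    obtain ⟨-, s₂, hs₂, rfl, -⟩ := id hp
    rw [hp.mem_nbhdFiber_iff hs₂] at h2
    rw [← hm₂] at hs₂ h2
    have := Λ.unique hi hs₂ hs h2.2 hE
    subst this
    exact hp.eq hm' (hm.trans hm₂)

lemma isFibredNbhdOf : F.IsFibredNbhdOf Λ.nbd Λ.surf where
  isOpen := isOpen_nbd
  subset := surf_subset_nbd
  inter_vert := nbd_inter_vert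
  fibres _ hw := existsUnique_fibre hw
  boundary m hm := by
    obtain ⟨i, p, hp⟩ := hm
    have hi := hp.1
    set b := (Λ.C i).b with hb
    have hms : m ∈ b.src := b.mem_base_iff.1 hi.1
    -- The ends of the fibres are the points in relative position `-1` and `1`, which vary
    -- continuously along the sheet by `continuousOn_pos`.
    have hpos : ∀ θ : ℝ, |θ| ≤ 1 → ∀ V ⊆ {n | (n ∈ Λ.surf → Λ.IsPos i 0 p n) ∧ n ∈ b.src},
        ContinuousOn (fun n => b.z (Λ.pos i θ p (F.π n))) (Λ.surf ∩ V) := by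
      intro θ hθ V hV
      have hd : ∀ n ∈ Λ.surf ∩ V, F.π n ∈ Λ.dom i p := fun n hn => ((hV hn.2).1 hn.1).mem_dom
      refine b.continuousOn_z.comp ((continuousOn_pos hp.germ_mem hθ).comp
        F.continuous_π.continuousOn hd) fun n hn => ?_
      exact b.mem_src (hV hn.2).2 (pos_spec hp.germ_mem (hd n hn) hθ).1
    refine ⟨b.φ, b.isFlowBox, hms, _, hp.eventually_surf.and (b.isOpen_src.mem_nhds hms),
      fun n hn => hn.2, _, _, hpos (-1) (by simp) _ subset_rfl, hpos 1 (by simp) _ subset_rfl, ?_⟩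
    rintro n ⟨h1, h2, h3⟩
    have hn := h2 h1
    obtain ⟨l, u, hl, hu, hln, hun⟩ := hn.exists_ends
    have hl' := hl.pos_eq
    have hu' := hu.pos_eq
    rw [hln] at hl'
    rw [hun] at hu'
    obtain ⟨h4, h5, h6, -⟩ := hn.nbhdFiber_eq hl hu hln hun
    simp only [hl', hu']
    refine ⟨h4.trans h5, ?_⟩
    have : Nonempty N := ⟨m⟩
    have hJ : ∀ r, F.π r = F.π n → b.z r ∈ b.J (F.π n) := fun r hr =>
      hr ▸ b.z_mem_J (b.mem_src h3 hr)
    rw [h6]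
    ext ⟨q, z⟩
    constructor
    · rintro ⟨r, ⟨hr1, hr2⟩, hr3⟩
      have hq : b.q r = q := congrArg Prod.fst hr3
      have hz : b.z r = z := congrArg Prod.snd hr3
      refine ⟨?_, by rw [← hz]; exact hr2⟩
      change q = b.q n
      rw [← hq]
      exact (b.q_eq h3 hr1.symm).symm
    · rintro ⟨hq, hz⟩
      have hq : q = b.q n := hq
      subst hq
      have hzJ : z ∈ b.J (F.π n) := (b.ordConnected_J _).out (hJ l hln) (hJ u hun)
        (Ioo_subset_Icc_self hz)
      have hr := b.rng_of_J hzJ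
      refine ⟨b.pt (b.qB (F.π n), z), ⟨b.π_pt_of_J hzJ, ?_⟩, ?_⟩
      · rw [← hb, b.z_pt hr]; exact hz
      · simp only
        rw [b.φ_pt hr]
        exact congrArg (·, z) (b.qB_π h3)

theorem isSplittingSurface_surf : F.IsSplittingSurface Λ.surf where
  core_subset := core_subset_surf
  plaque _ hs hc := exists_plaque hs hc
  halfPlaque _ hs := exists_halfPlaque hs
  complete _ hγ hS hx := surf_complete hγ hS hx.choose_spec
  discrete := discreteTopology_surf
  exists_nbhd := ⟨_, isFibredNbhdOf⟩

end FramedLeaves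

/-- A sequence of splitting complexes of growing radius gives rise to a splitting surface. -/
theorem exists_isSplittingSurface (hτ : F.IsAdapted) {c : ℕ → Set N}
    (hc : ∀ k, F.IsSplittingComplex (c k))
    (hR : Tendsto (fun k => F.radius (c k)) atTop (𝓝 ⊤)) : ∃ S, F.IsSplittingSurface S := by
  obtain ⟨T, ⟨Λ⟩⟩ := exists_leaves hτ hc hR
  obtain ⟨Λ'⟩ := Λ.exists_framed
  exact ⟨_, Λ'.isSplittingSurface_surf⟩

end FibredNbhd
end BranchedSurface

theorem mainTheorem7 {N B : Type*} [TopologicalSpace N] [TopologicalSpace B]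
    [CompactSpace N] [T2Space N] [T2Space B]
    (F : BranchedSurface.FibredNbhd N B)
    [Topology.CWComplex (Set.univ : Set B)] (hτ : F.IsAdapted) :
    (∃ c : ℕ → Set N, (∀ k, F.IsSplittingComplex (c k)) ∧
      Filter.Tendsto (fun k => F.radius (c k)) Filter.atTop (nhds ⊤)) ↔
    ∃ S : Set N, F.IsSplittingSurface S :=
  ⟨fun ⟨_, hc, hR⟩ => BranchedSurface.FibredNbhd.exists_isSplittingSurface hτ hc hR,
    fun ⟨_, hS⟩ => hS.exists_splittingComplexes hτ⟩
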